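/- **Setting.** Let $n\ge 2$, let $(M^{n+1},g)$ be a smooth Riemannian manifold without boundary and $K$ a symmetric $(0,2)$-tensor field of class $C^1$ on $M$. On $M\times\mathbb{R}$ use the metric $g+dz^2$ and the trivial extension of $K$. For a vector field $\nu$ put $P_\nu=(g^{ij}-\nu^i\nu^j)K_{ij}$. For a set $E$, $|\partial^*E\cap A|$ is the value on $A$ of the total variation measure of the distributional derivative of $\chi_E$, and $|\partial E|:=|\partial^*E|$; $E$ is a Caccioppoli set in $\Omega$ if it is measurable and $|\partial^*E\cap A|<\infty$ for all compact $A\subset\Omega$. A Caccioppoli set $E$ in $\Omega$ minimizes $\mathcal{J}_{u,\nu}$ in $\Omega$ if $$|\partial^*E\cap A|-\int_{E\cap A}\sqrt{|\nabla u|^2+P_\nu^2}\;\le\;|\partial^*F\cap A|-\int_{F\cap A}\sqrt{|\nabla u|^2+P_\nu^2}$$ for all compact $A\subset\Omega$ and measurable $F$ with $E\triangle F\subset A$. **Weak solutions.** Let $E_0\subset M$ be open and precompact with $C^2$ boundary. A pair $(U,\nu)$ of a locally Lipschitz function $U$ on $M\times\mathbb{R}$ and a measurable unit vector field $\nu$ (on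 $(M\setminus E_0)\times\mathbb{R}$) is a *weak solution of inverse space-time mean curvature flow with initial condition $E_0$* if 1. $U(y,z)=u(y)$, where $u\ge 0$ on $M\setminus E_0$, $u=0$ on $\partial E_0$, $u<0$ in $E_0$, and $u(x)\to+\infty$ as $\mathrm{dist}(x,E_0)\to\infty$; 2. for every $t>0$ the set $\{U<t\}$ minimizes $\mathcal{J}_{U,\nu}$ in $(M\setminus E_0)\times\mathbb{R}$, and $\nu$ is its outward unit normal at each point of $\partial\{U<t\}$ (in particular this boundary is $C^1$); 3. $\nu$ is translation invariant in $z$ on $(M\setminus E_0)\times\mathbb{R}$, and continuous on the set of points of $(M\setminus E_0)\times\mathbb{R}$ at which the value of $U$ is not a jump time, a jump time being a $t_0$ for which $\widetilde{\mathcal K}_{t_0}:=\mathrm{int}\{U=t_0\}$ is nonempty; 4. for every jump time $t_0\ge 0$ there is $\alpha\in(0,1)$ such that $\nu\in C^{1,\alpha}_{loc}(\widetilde{\mathcal K}_{t_0})$ and each $X_0\in\widetilde{\mathcal K}_{t_0}$ lies on the boundary of a set which minimizes $\mathcal{J}_{U,\nu}$ in $\widetilde{\mathcal K}_{t_0}$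 and whose boundary is, inside $\widetilde{\mathcal K}_{t_0}$, a $C^{1,\alpha}$ hypersurface with outward unit normal $\nu$. Let $\nu_M$ be the projection of $\nu$ to $TM$, $E_t=\{u<t\}$ and $E_t^+=\{u\le t\}$. **Outward optimizing sets.** Let $\Omega\subset M$ be open. A Caccioppoli set $E$ in $\Omega$ is *outward optimizing in $\Omega$ with respect to $\nu_M$* if $$|\partial^*E\cap A|\le|\partial^*F\cap A|-\int_{F\setminus E}|P_{\nu_M}|$$ for all measurable $F\supset E$ with $F\setminus E\subset A$, where $A\subset\Omega$ is compact. It is *strictly* outward optimizing in $\Omega$ if moreover equality implies that $F\cap\Omega=E\cap\Omega$ up to a null set. The hull $E'_\Omega$ is the intersection of the sets of points of density one of all strictly outward optimizing sets in $\Omega$ that contain $E$. **Theorem.** Suppose that $M$ has no compact components and that $(U,\nu)$ is a weak solution of inverse space-time mean curvature flow with initial condition $E_0$ such that $E_t$ is precompact for every $t>0$. Then $E_t$ is outward optimizing in $M$ with respect to $\nu_M$ for every $t>0$, and $E_t^+$ is outward optimizing in $M$ with respect to $\nu_M$ for every $t\ge 0$. Furthermore: (i) For every $t\ge0$ and every open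 set $\Omega\supset E_t^+$ that is disjoint from $\mathrm{int}\{u=t'\}$ for all $t'>t$, the set $E_t^+$ is strictly outward optimizing in $\Omega$ with respect to $\nu_M$. (ii) For such $t$ and $\Omega$, $(E_t)'_\Omega=E_t^+$ up to a null set. (iii) $|\partial E_t^+|<\infty$ for all $t\ge 0$, and for all $t>0$ $$|\partial E_t^+|=|\partial E_t|+\int_{E_t^+\setminus E_t}|P_{\nu_M}| .$$ This identity holds for $t=0$ if and only if $E_0$ is outward optimizing in $M$ with respect to $\nu_M$. -/

import Mathlib

open Set Filter Topology MeasureTheory Manifold Bundle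
open scoped ENNReal NNReal ContDiff

-- Without this, the charted space structure of `ℝ` is found through the category `TopCat`.
attribute [-instance] TopCat.of.chartedSpace

noncomputable section

namespace STIMCF

/-! ## Riemannian notions on a manifold carrying a metric tensor

`N` is a manifold without boundary modelled on the finite-dimensional space `V`. Tensors of type
`(0,2)` are given by their values on pairs of tangent vectors, so that the definitions apply both to
a Riemannian manifold `M` and to the cylinder `M × ℝ`. -/

section Riemannian

variable {V : Type*} [NormedAddCommGroup V] [NormedSpace ℝ V]
  {H : Type*} [TopologicalSpace H] (I : ModelWithCorners ℝ V H)
  {N : Type*} [TopologicalSpace N] [ChartedSpace H N]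

/-- The values of a `(0,2)`-tensor field on pairs of tangent vectors. -/
abbrev TensorField (N : Type*) [TopologicalSpace N] [ChartedSpace H N] :=
  ∀ x : N, TangentSpace I x → TangentSpace I x → ℝ

/-- The vector in the model space that represents the tangent vector `v` at `p` in the preferred
chart at `x₀`. -/
def coord (x₀ p : N) (v : TangentSpace I p) : V :=
  mfderiv I 𝓘(ℝ, V) (extChartAt I x₀) p v

/-- The tangent vector at the point with coordinates `y` in the preferred chart at `x₀` whose
components in that chart are those of `w`. -/
def coordVec (x₀ : N) (y w : V) : TangentSpace I ((extChartAt I x₀).symm y) :=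
  mfderiv 𝓘(ℝ, V) I (extChartAt I x₀).symm y w

/-- A vector field is measurable on `S` if its components are measurable in every chart. -/
def MeasurableFieldOn [MeasurableSpace N] [MeasurableSpace V] (S : Set N)
    (ν : ∀ x : N, TangentSpace I x) : Prop :=
  ∀ x₀ : N, Measurable fun p : ↥(S ∩ (chartAt H x₀).source) ↦ coord I x₀ p.1 (ν p.1)

/-- The value `df(v)` of the differential of `f` on a tangent vector. -/
def differential (f : N → ℝ) (x : N) (v : TangentSpace I x) : ℝ :=
  mfderiv I 𝓘(ℝ, ℝ) f x v

/-- The norm `|∇f|` of the gradient of `f`, that is, of the covector `df`, with respect to `g`. -/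
def gradNorm (g : TensorField I N) (f : N → ℝ) (x : N) : ℝ :=
  sSup {d : ℝ | ∃ v : TangentSpace I x, g x v v ≤ 1 ∧ differential I f x v = d}

section FiniteDimensional

variable [FiniteDimensional ℝ V]

/-- The trace `g^{ij} K_{ij}` of a bilinear form with respect to `g`. -/
def trace (g K : TensorField I N) (x : N) : ℝ :=
  let b : Module.Basis _ ℝ (TangentSpace I x) := Module.finBasis ℝ V
  ∑ i, ∑ j, (Matrix.of fun k l ↦ g x (b k) (b l))⁻¹ i j * K x (b i) (b j)

/-- `P_ν = (g^{ij} - ν^i ν^j) K_{ij}`. -/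
def expansion (g K : TensorField I N) (ν : ∀ x : N, TangentSpace I x) (x : N) : ℝ :=
  trace I g K x - K x (ν x) (ν x)

/-- The density `√(det g_{ij})` in the preferred chart at `x₀`, as a function of the coordinates;
components are taken with respect to a fixed basis of the model space. -/
def sqrtDet (g : TensorField I N) (x₀ : N) (y : V) : ℝ :=
  Real.sqrt (Matrix.of fun i j ↦
    g ((extChartAt I x₀).symm y) (coordVec I x₀ y (Module.finBasis ℝ V i))
      (coordVec I x₀ y (Module.finBasis ℝ V j))).det

/-- The Riemannian volume: the smallest measure which on every chart domain dominates
`√(det g_{ij}) dx`, where `dx` gives measure one to the parallelepiped spanned by the basis used in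
`sqrtDet`. As these measures agree where charts overlap, on a second countable manifold it
equals `√(det g_{ij}) dx` on every chart domain. -/
def vol [MeasurableSpace V] [BorelSpace V] [MeasurableSpace N] (g : TensorField I N) : Measure N :=
  ⨆ x₀ : N, Measure.map (extChartAt I x₀).symm
    (((Module.finBasis ℝ V).addHaar.restrict (extChartAt I x₀).target).withDensity
      fun y ↦ ENNReal.ofReal (sqrtDet I g x₀ y))

/-- The divergence `(√(det g))⁻¹ ∂_i (√(det g) X^i)` at `x`, computed in the preferred chart
at `x`. -/
def divergence (g : TensorField I N) (X : ∀ x : N, TangentSpace I x) (x : N) : ℝ :=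
  (sqrtDet I g x (extChartAt I x x))⁻¹ *
    LinearMap.trace ℝ V (fderiv ℝ (fun y : V ↦ sqrtDet I g x y •
      coord I x ((extChartAt I x).symm y) (X ((extChartAt I x).symm y))) (extChartAt I x x))

variable [IsManifold I 1 N]

/-- `X` is a `C¹` vector field with `|X| ≤ 1` and compact support in `U`. -/
def IsTestField (g : TensorField I N) (U : Set N) (X : ∀ x : N, TangentSpace I x) : Prop :=
  ContMDiff I I.tangent 1 (fun x ↦ (⟨x, X x⟩ : TangentBundle I N)) ∧
  (∀ x, g x (X x) (X x) ≤ 1) ∧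
  ∃ C : Set N, IsCompact C ∧ C ⊆ U ∧ ∀ x ∉ C, X x = 0

variable [MeasurableSpace V] [BorelSpace V] [MeasurableSpace N]

/-- The total variation in the open set `U` of the distributional derivative of the characteristic
function of `E`. -/
def variation (g : TensorField I N) (E U : Set N) : ℝ≥0∞ :=
  ⨆ (X : ∀ x : N, TangentSpace I x) (_ : IsTestField I g U X),
    ENNReal.ofReal (∫ x in E, divergence I g X x ∂(vol I g))

/-- `|∂* E ∩ A|`: the value on `A` of the total variation measure of the derivative of the
characteristic function of `E`, extended from open sets by outer regularity. -/
def perimeter (g : TensorField I N) (E A : Set N) : ℝ≥0∞ :=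
  ⨅ (U : Set N) (_ : IsOpen U) (_ : A ⊆ U), variation I g E U

/-- `E` is a Caccioppoli set in `Ω`, that is, a set of locally finite perimeter. -/
def IsCaccioppoli (g : TensorField I N) (Ω E : Set N) : Prop :=
  MeasurableSet E ∧ ∀ A : Set N, IsCompact A → A ⊆ Ω → perimeter I g E A < ⊤

/-- The bulk energy `∫_S √(|∇u|² + P_ν²)`. -/
def bulk (g K : TensorField I N) (u : N → ℝ) (ν : ∀ x : N, TangentSpace I x) (S : Set N) : ℝ≥0∞ :=
  ∫⁻ x in S, ENNReal.ofReal (Real.sqrt (gradNorm I g u x ^ 2 + expansion I g K ν x ^ 2)) ∂(vol I g)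

/-- The energy `∫_S |P_ν|`. -/
def bulkP (g K : TensorField I N) (ν : ∀ x : N, TangentSpace I x) (S : Set N) : ℝ≥0∞ :=
  ∫⁻ x in S, ENNReal.ofReal |expansion I g K ν x| ∂(vol I g)

/-- `E` minimizes `J(F) = |∂* F ∩ A| - ∫_{F ∩ A} √(|∇u|² + P_ν²)` in `Ω` among all `F` with
`E △ F ⊆ A`, for every compact `A ⊆ Ω`. The finite integrals are moved to the other sides of the
inequality `J(E) ≤ J(F)`. -/
def Minimizes (g K : TensorField I N) (u : N → ℝ) (ν : ∀ x : N, TangentSpace I x)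
    (Ω E : Set N) : Prop :=
  IsCaccioppoli I g Ω E ∧
  ∀ F A : Set N, MeasurableSet F → IsCompact A → A ⊆ Ω → symmDiff E F ⊆ A →
    perimeter I g E A + bulk I g K u ν (F ∩ A) ≤ perimeter I g F A + bulk I g K u ν (E ∩ A)

/-- `E` is outward optimizing in `Ω` with respect to `ν`:
`|∂* E ∩ A| ≤ |∂* F ∩ A| - ∫_{F \ E} |P_ν|` whenever `E ⊆ F` and `F \ E ⊆ A` with `A ⊆ Ω`
compact. -/
def OutwardOptimizing (g K : TensorField I N) (ν : ∀ x : N, TangentSpace I x)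
    (Ω E : Set N) : Prop :=
  IsCaccioppoli I g Ω E ∧
  ∀ F A : Set N, MeasurableSet F → E ⊆ F → IsCompact A → A ⊆ Ω → F \ E ⊆ A →
    perimeter I g E A + bulkP I g K ν (F \ E) ≤ perimeter I g F A

/-- `E` is strictly outward optimizing in `Ω`: moreover, equality forces `F ∩ Ω = E ∩ Ω` up to a
null set. -/
def StrictlyOutwardOptimizing (g K : TensorField I N) (ν : ∀ x : N, TangentSpace I x)
    (Ω E : Set N) : Prop :=
  OutwardOptimizing I g K ν Ω E ∧
  ∀ F A : Set N, MeasurableSet F → E ⊆ F → IsCompact A → A ⊆ Ω → F \ E ⊆ A →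
    perimeter I g E A + bulkP I g K ν (F \ E) = perimeter I g F A →
      (F ∩ Ω : Set N) =ᵐ[vol I g] (E ∩ Ω : Set N)

end FiniteDimensional

/-! ### Regularity of sets and vector fields -/

/-- Near `y₀` the map `f` is `C¹` with `α`-Hölder continuous derivative. -/
def C1AlphaNear {F : Type*} [NormedAddCommGroup F] [NormedSpace ℝ F] (α : ℝ≥0) (f : V → F)
    (y₀ : V) : Prop :=
  ∃ W : Set V, IsOpen W ∧ y₀ ∈ W ∧ ContDiffOn ℝ 1 f W ∧ ∃ C : ℝ≥0, HolderOnWith C α (fderiv ℝ f) W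

/-- The vector field `ν` is of class `C^{1,α}_loc` on the open set `S`. -/
def FieldC1AlphaOn (α : ℝ≥0) (ν : ∀ x : N, TangentSpace I x) (S : Set N) : Prop :=
  ∀ p ∈ S, C1AlphaNear α
    (fun y : V ↦ coord I p ((extChartAt I p).symm y) (ν ((extChartAt I p).symm y)))
    (extChartAt I p p)

/-- Near `p` the set `E` lies on the side `{ψ < 0}` of its boundary `{ψ = 0}`, and
`dψ ≠ 0` at `p`. -/
def IsDefiningFunction (E : Set N) (p : N) (ψ : N → ℝ) : Prop :=
  (∀ᶠ x in 𝓝 p, (x ∈ interior E ↔ ψ x < 0) ∧ (x ∈ frontier E ↔ ψ x = 0)) ∧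
  ∃ v : TangentSpace I p, differential I ψ p v ≠ 0

/-- `∂E` is a hypersurface of class `C²`. -/
def HasC2Boundary (E : Set N) : Prop :=
  ∀ p ∈ frontier E, ∃ ψ : N → ℝ, IsDefiningFunction I E p ψ ∧ ContMDiffAt I 𝓘(ℝ, ℝ) 2 ψ p

/-- Inside the open set `S`, `∂E` is a hypersurface of class `C^{1,α}`. -/
def HasC1AlphaBoundaryIn (α : ℝ≥0) (S E : Set N) : Prop :=
  ∀ p ∈ frontier E ∩ S, ∃ ψ : N → ℝ, IsDefiningFunction I E p ψ ∧
    C1AlphaNear α (fun y : V ↦ ψ ((extChartAt I p).symm y)) (extChartAt I p p)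

/-- `∂E` is of class `C¹` near `p ∈ ∂E` and `v` is its unit normal at `p` pointing out of `E`. -/
def IsUnitNormal (g : TensorField I N) (E : Set N) (p : N) (v : TangentSpace I p) : Prop :=
  ∃ ψ : N → ℝ, IsDefiningFunction I E p ψ ∧ ContMDiffAt I 𝓘(ℝ, ℝ) 1 ψ p ∧ g p v v = 1 ∧
    ∃ c : ℝ, 0 < c ∧ ∀ w : TangentSpace I p, g p v w = c * differential I ψ p w

end Riemannian

/-! ## The cylinder over a Riemannian manifold and weak solutions -/

section Flow

variable {V : Type*} [NormedAddCommGroup V] [NormedSpace ℝ V]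
  {H : Type*} [TopologicalSpace H] (I : ModelWithCorners ℝ V H)
  {M : Type*}

/-- The tensor `g + dz²` on `M × ℝ`. -/
def cylMetric [TopologicalSpace M] [ChartedSpace H M] (g : TensorField I M) :
    TensorField (I.prod 𝓘(ℝ, ℝ)) (M × ℝ) :=
  fun X v w ↦ g X.1 v.1 w.1 + v.2 * w.2

/-- The trivial extension of the tensor `K` to `M × ℝ`. -/
def cylExtend [TopologicalSpace M] [ChartedSpace H M] (K : TensorField I M) :
    TensorField (I.prod 𝓘(ℝ, ℝ)) (M × ℝ) :=
  fun X v w ↦ K X.1 v.1 w.1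

/-- The restriction of a function on `M × ℝ` to the slice `M`. -/
def slice (U : M × ℝ → ℝ) : M → ℝ := fun y ↦ U (y, 0)

/-- The projection to `TM` of a vector field on `M × ℝ`, along the slice `M`. -/
def projField [TopologicalSpace M] [ChartedSpace H M]
    (ν : ∀ X : M × ℝ, TangentSpace (I.prod 𝓘(ℝ, ℝ)) X) : ∀ y : M, TangentSpace I y :=
  fun y ↦ (ν (y, 0)).1

/-- The metric tensor of a Riemannian manifold. -/
def metricTensor [TopologicalSpace M] [ChartedSpace H M]
    [RiemannianBundle (fun x : M ↦ TangentSpace I x)] : TensorField I M :=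
  fun _ v w ↦ inner ℝ v w

/-- The jump region `K_t`: the interior of the level set `{f = t}`. -/
def jumpRegion {N : Type*} [TopologicalSpace N] (f : N → ℝ) (t : ℝ) : Set N :=
  interior {x | f x = t}

/-- The points of density one of `E` (its Lebesgue points) with respect to `μ`. -/
def lebesguePoints {N : Type*} [EMetricSpace N] [MeasurableSpace N] (μ : Measure N) (E : Set N) :
    Set N :=
  {x | Tendsto (fun r : ℝ ↦ μ (E ∩ Metric.eball x (ENNReal.ofReal r)) /
    μ (Metric.eball x (ENNReal.ofReal r))) (𝓝[>] 0) (𝓝 1)}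

variable [FiniteDimensional ℝ V] [MeasurableSpace V] [BorelSpace V]

/-- The strictly outward optimizing hull `E'_Ω`: the intersection of the sets of Lebesgue points of
all strictly outward optimizing sets in `Ω` that contain `E`. -/
def hull [EMetricSpace M] [ChartedSpace H M] [IsManifold I 1 M] [MeasurableSpace M] (g K : TensorField I M)
    (ν : ∀ x : M, TangentSpace I x) (Ω E : Set M) : Set M :=
  ⋂ (G : Set M) (_ : E ⊆ G) (_ : StrictlyOutwardOptimizing I g K ν Ω G), lebesguePoints (vol I g) G

/-- `(U, ν)` is a weak solution of inverse space-time mean curvature flow on the initial data set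
`(M, g, K)` with initial condition `E₀`, where `g` is the Riemannian metric of `M`. -/
structure IsWeakSolution [EMetricSpace M] [ChartedSpace H M] [IsManifold I 1 M] [MeasurableSpace M]
    [RiemannianBundle (fun x : M ↦ TangentSpace I x)]
    (K : TensorField I M) (E₀ : Set M) (U : M × ℝ → ℝ)
    (ν : ∀ X : M × ℝ, TangentSpace (I.prod 𝓘(ℝ, ℝ)) X) : Prop where
  /-- the initial set is open, precompact and of class `C²` -/
  isOpen : IsOpen E₀
  isCompact_closure : IsCompact (closure E₀)
  boundary : HasC2Boundary I E₀
  /-- `U ∈ C^{0,1}_loc(M × ℝ)` -/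
  locallyLipschitz : LocallyLipschitz U
  /-- `ν` is a measurable unit vector field -/
  measurable : MeasurableFieldOn (I.prod 𝓘(ℝ, ℝ)) (E₀ᶜ ×ˢ univ) ν
  unit : ∀ X ∈ E₀ᶜ ×ˢ (univ : Set ℝ), cylMetric I (metricTensor I) X (ν X) (ν X) = 1
  /-- `U(y, z) = u(y)`, with the prescribed behaviour of `u` -/
  invariant : ∀ (y : M) (z : ℝ), U (y, z) = slice U y
  nonneg : ∀ y ∉ E₀, 0 ≤ slice U y
  zero : ∀ y ∈ frontier E₀, slice U y = 0
  neg : ∀ y ∈ E₀, slice U y < 0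
  proper : ∀ L : ℝ, ∃ R : ℝ, ∀ y : M, ENNReal.ofReal R ≤ Metric.infEDist y E₀ → L ≤ slice U y
  /-- the sublevel sets minimize -/
  minimizes : ∀ t : ℝ, 0 < t →
    Minimizes (I.prod 𝓘(ℝ, ℝ)) (cylMetric I (metricTensor I)) (cylExtend I K) U ν
      (E₀ᶜ ×ˢ univ) {X | U X < t}
  /-- `ν` is translation invariant -/
  field_invariant : ∀ (y : M) (z a : ℝ), y ∉ E₀ →
    ((ν (y, z + a) : V × ℝ)) = (ν (y, z) : V × ℝ)
  /-- `ν` is continuous away from jump times -/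
  field_continuous : ContinuousOn
    (fun X ↦ (⟨X, ν X⟩ : TangentBundle (I.prod 𝓘(ℝ, ℝ)) (M × ℝ)))
    {X ∈ E₀ᶜ ×ˢ univ | jumpRegion U (U X) = ∅}
  /-- `ν` is the unit normal of the boundaries of the sublevel sets -/
  field_normal : ∀ t : ℝ, 0 < t → ∀ X ∈ frontier {X | U X < t},
    IsUnitNormal (I.prod 𝓘(ℝ, ℝ)) (cylMetric I (metricTensor I)) {X | U X < t} X (ν X)
  /-- on a jump region `ν` is of class `C^{1,α}`, and through each of its points there passes the
  `C^{1,α}` boundary of a minimizing Caccioppoli set with unit normal `ν` -/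
  jump : ∀ t : ℝ, 0 ≤ t → ∃ α : ℝ≥0, 0 < α ∧ α < 1 ∧
    FieldC1AlphaOn (I.prod 𝓘(ℝ, ℝ)) α ν (jumpRegion U t) ∧
    ∀ X₀ ∈ jumpRegion U t, ∃ E : Set (M × ℝ), X₀ ∈ frontier E ∧
      HasC1AlphaBoundaryIn (I.prod 𝓘(ℝ, ℝ)) α (jumpRegion U t) E ∧
      Minimizes (I.prod 𝓘(ℝ, ℝ)) (cylMetric I (metricTensor I)) (cylExtend I K) U ν
        (jumpRegion U t) E ∧
      ∀ X ∈ frontier E ∩ jumpRegion U t,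
        IsUnitNormal (I.prod 𝓘(ℝ, ℝ)) (cylMetric I (metricTensor I)) E X (ν X)

end Flow

end STIMCF

end

noncomputable section
namespace STIMCF

section DetCalculus

variable {V : Type*} [NormedAddCommGroup V] [NormedSpace ℝ V] [FiniteDimensional ℝ V]

lemma contDiff_clm_det {n : WithTop ℕ∞} : ContDiff ℝ n (fun C : V →L[ℝ] V ↦ C.det) := by
  let b := Module.finBasis ℝ V
  have h : (fun C : V →L[ℝ] V ↦ C.det) =
      fun C : V →L[ℝ] V ↦ ∑ σ : Equiv.Perm (Fin (Module.finrank ℝ V)),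
        (Equiv.Perm.sign σ : ℝ) * ∏ i, LinearMap.toMatrix b b (C : V →ₗ[ℝ] V) (σ i) i := by
    funext C
    rw [ContinuousLinearMap.det, ← LinearMap.det_toMatrix b, Matrix.det_apply']
  rw [h]
  refine ContDiff.sum fun σ _ ↦ contDiff_const.mul (contDiff_prod fun i _ ↦ ?_)
  simp only [LinearMap.toMatrix_apply]
  have : (fun C : V →L[ℝ] V ↦ b.repr ((C : V →ₗ[ℝ] V) (b i)) (σ i)) =
      fun C ↦ LinearMap.toContinuousLinearMap (b.coord (σ i)) (C (b i)) := by
    funext C; simp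
  rw [this]
  exact (ContinuousLinearMap.contDiff _).comp
    ((ContinuousLinearMap.apply ℝ V (b i)).contDiff)

omit [FiniteDimensional ℝ V] in
lemma clm_det_comp (A B : V →L[ℝ] V) : (A ∘L B).det = A.det * B.det := by
  simp [ContinuousLinearMap.det, ContinuousLinearMap.toLinearMap_comp, LinearMap.det_comp]

omit [FiniteDimensional ℝ V] in
lemma clm_det_id : (ContinuousLinearMap.id ℝ V).det = 1 := by
  simp [ContinuousLinearMap.det]

lemma fderiv_clm_det_id (C : V →L[ℝ] V) :
    fderiv ℝ (fun C : V →L[ℝ] V ↦ C.det) (ContinuousLinearMap.id ℝ V) C =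
      LinearMap.trace ℝ V C := by
  have hd : DifferentiableAt ℝ (fun C : V →L[ℝ] V ↦ C.det) (ContinuousLinearMap.id ℝ V) :=
    (contDiff_clm_det (n := 1)).differentiable one_ne_zero _
  let b := Module.finBasis ℝ V
  have h1 : HasDerivAt (fun t : ℝ ↦ (ContinuousLinearMap.id ℝ V + t • C).det)
      (fderiv ℝ (fun C : V →L[ℝ] V ↦ C.det) (ContinuousLinearMap.id ℝ V) C) 0 := by
    have h0 : HasDerivAt (fun t : ℝ ↦ ContinuousLinearMap.id ℝ V + t • C) C 0 := by
      simpa using ((hasDerivAt_id (0 : ℝ)).smul_const C).const_add (ContinuousLinearMap.id ℝ V)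
    have h2 : HasFDerivAt (fun C : V →L[ℝ] V ↦ C.det)
      (fderiv ℝ (fun C : V →L[ℝ] V ↦ C.det) (ContinuousLinearMap.id ℝ V))
      (ContinuousLinearMap.id ℝ V + (0 : ℝ) • C) := by
      simpa using hd.hasFDerivAt
    exact h2.comp_hasDerivAt 0 h0
  obtain ⟨p, hp⟩ : ∃ p : Polynomial ℝ, ∀ t : ℝ, (ContinuousLinearMap.id ℝ V + t • C).det =
      1 + LinearMap.trace ℝ V C * t + p.eval t * t ^ 2 := by
    have e : ∀ t : ℝ, (ContinuousLinearMap.id ℝ V + t • C).det =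
        (1 + t • LinearMap.toMatrix b b (C : V →ₗ[ℝ] V)).det := by
      intro t
      rw [ContinuousLinearMap.det, ← LinearMap.det_toMatrix b]
      congr 1
      rw [ContinuousLinearMap.toLinearMap_add, ContinuousLinearMap.toLinearMap_smul, map_add,
          map_smul]
      congr 1
      exact LinearMap.toMatrix_id b
    have e' := fun t : ℝ ↦ (e t).trans (Matrix.det_one_add_smul t _)
    rw [← LinearMap.trace_eq_matrix_trace] at e'
    exact ⟨_, e'⟩
  have h3 : HasDerivAt (fun t : ℝ ↦ (ContinuousLinearMap.id ℝ V + t • C).det)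
      (LinearMap.trace ℝ V C) 0 := by
    simp only [hp]
    have := (((hasDerivAt_id (0 : ℝ)).const_mul (LinearMap.trace ℝ V C)).const_add 1).add
      ((p.hasDerivAt 0).mul ((hasDerivAt_id (0 : ℝ)).pow 2))
    convert! this using 1
    simp
  exact h1.unique h3

lemma hasFDerivAt_abs_det {A : V → V →L[ℝ] V} {A' : V →L[ℝ] V →L[ℝ] V} {y : V}
    (hA : HasFDerivAt A A' y) {B : V →L[ℝ] V} (hB : B ∘L A y = ContinuousLinearMap.id ℝ V) :
    ∃ D : V →L[ℝ] ℝ, HasFDerivAt (fun z ↦ |(A z).det|) D y ∧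
      ∀ v, D v = |(A y).det| * LinearMap.trace ℝ V ((B ∘L A' v : V →L[ℝ] V) : V →ₗ[ℝ] V) := by
  have h1 : ∀ z, (A z).det = (A y).det * (B ∘L A z).det := by
    intro z
    have e : (A y).det * B.det = 1 := by
      rw [mul_comm, ← clm_det_comp, hB, clm_det_id]
    rw [clm_det_comp, ← mul_assoc, e, one_mul]
  have h2 : (fun z ↦ |(A z).det|) = fun z ↦ |(A y).det| * |(B ∘L A z).det| := by
    funext z; rw [h1, abs_mul]
  have hc : HasFDerivAt (fun z ↦ B ∘L A z)
      ((ContinuousLinearMap.compL ℝ V V V B) ∘L A') y :=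
    (ContinuousLinearMap.compL ℝ V V V B).hasFDerivAt.comp y hA
  have hd : HasFDerivAt (fun C : V →L[ℝ] V ↦ C.det)
      (fderiv ℝ (fun C : V →L[ℝ] V ↦ C.det) (ContinuousLinearMap.id ℝ V)) (B ∘L A y) := by
    rw [hB]
    exact ((contDiff_clm_det (n := 1)).differentiable one_ne_zero _).hasFDerivAt
  have h3 := hd.comp y hc
  have h4 : HasFDerivAt (fun z ↦ |(B ∘L A z).det|)
      ((fderiv ℝ (fun C : V →L[ℝ] V ↦ C.det) (ContinuousLinearMap.id ℝ V)) ∘L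
        ((ContinuousLinearMap.compL ℝ V V V B) ∘L A')) y := by
    refine h3.congr_of_eventuallyEq ?_
    have hcont : ContinuousAt (fun z ↦ (B ∘L A z).det) y := h3.continuousAt
    have hpos : 0 < (B ∘L A y).det := by
      rw [hB]; simp [ContinuousLinearMap.det]
    filter_upwards [hcont.eventually (lt_mem_nhds hpos)] with z hz
    exact abs_of_pos hz
  refine ⟨_, h2 ▸ h4.const_mul _, fun v ↦ ?_⟩
  simp [fderiv_clm_det_id]

/-- The invariance of `div (ρ W)` under a change of coordinates. -/
lemma trace_fderiv_density_transition {τ : V → V} {y : V} (hτ : ContDiffAt ℝ 2 τ y)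
    {B : V →L[ℝ] V} (hB : B ∘L fderiv ℝ τ y = ContinuousLinearMap.id ℝ V)
    {ρ ρ' : V → ℝ} {W W' : V → V}
    (hρ : ∀ᶠ z in 𝓝 y, ρ z = |(fderiv ℝ τ z).det| * ρ' (τ z))
    (hW : ∀ᶠ z in 𝓝 y, W' (τ z) = fderiv ℝ τ z (W z))
    (hd : DifferentiableAt ℝ (fun z ↦ ρ z • W z) y)
    (hd' : DifferentiableAt ℝ (fun z ↦ ρ' z • W' z) (τ y)) :
    LinearMap.trace ℝ V (fderiv ℝ (fun z ↦ ρ z • W z) y) =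
      |(fderiv ℝ τ y).det| * LinearMap.trace ℝ V (fderiv ℝ (fun z ↦ ρ' z • W' z) (τ y)) := by
  set A := fderiv ℝ τ
  have hA : DifferentiableAt ℝ A y :=
    (hτ.fderiv_right (m := 1) (by norm_num)).differentiableAt one_ne_zero
  have hsymm : ∀ v w, fderiv ℝ A y v w = fderiv ℝ A y w v := by
    intro v w
    exact (hτ.isSymmSndFDerivAt (by simp)) v w
  have hAB : A y ∘L B = ContinuousLinearMap.id ℝ V := by
    have h : (B : V →ₗ[ℝ] V) ∘ₗ (A y : V →ₗ[ℝ] V) = LinearMap.id := by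
      have := congrArg (fun C : V →L[ℝ] V ↦ (C : V →ₗ[ℝ] V)) hB
      simpa using this
    have h' := (LinearMap.comp_eq_id_comm ℝ V).1 h
    ext v
    exact LinearMap.congr_fun h' v
  obtain ⟨D, hD, hDv⟩ := hasFDerivAt_abs_det hA.hasFDerivAt hB
  set S := fun z ↦ ρ z • W z
  set Q := fun z ↦ ρ' z • W' z
  have hkey : (fun z ↦ A z (S z)) =ᶠ[𝓝 y] fun z ↦ |(A z).det| • Q (τ z) := by
    filter_upwards [hρ, hW] with z h1 h2
    simp only [S, Q, map_smul, ← h2, h1, smul_smul]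
  have hl : HasFDerivAt (fun z ↦ A z (S z))
      ((A y) ∘L fderiv ℝ S y + (fderiv ℝ A y).flip (S y)) y :=
    hA.hasFDerivAt.clm_apply hd.hasFDerivAt
  have hτd : HasFDerivAt τ (A y) y := (hτ.differentiableAt two_ne_zero).hasFDerivAt
  have hQ : HasFDerivAt (fun z ↦ Q (τ z)) (fderiv ℝ Q (τ y) ∘L A y) y :=
    hd'.hasFDerivAt.comp y hτd
  have hr := hD.smul hQ
  have heq := (hl.congr_of_eventuallyEq hkey.symm).unique hr
  have hS : S y = |(A y).det| • B (Q (τ y)) := by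
    have := hkey.eq_of_nhds
    have h2 := congrArg B this
    simp only [map_smul] at h2
    rw [← h2]
    exact (congrArg (fun C : V →L[ℝ] V ↦ C (S y)) hB).symm
  have hmain : fderiv ℝ S y = D.smulRight (B (Q (τ y))) +
      |(A y).det| • (B ∘L fderiv ℝ Q (τ y) ∘L A y) - B ∘L (fderiv ℝ A y (S y)) := by
    ext v
    have h1 := congrArg (fun C : V →L[ℝ] V ↦ B (C v)) heq
    have h2 : B (A y (fderiv ℝ S y v)) = fderiv ℝ S y v :=
      congrArg (fun C : V →L[ℝ] V ↦ C (fderiv ℝ S y v)) hB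
    simp only [_root_.add_apply, ContinuousLinearMap.comp_apply, map_add, h2,
      ContinuousLinearMap.flip_apply, _root_.smul_apply, map_smul,
      ContinuousLinearMap.smulRight_apply] at h1
    simp only [_root_.sub_apply, _root_.add_apply,
      ContinuousLinearMap.comp_apply,
      _root_.smul_apply, ContinuousLinearMap.smulRight_apply]
    rw [hsymm v] at h1
    rw [eq_sub_iff_add_eq, h1, add_comm]
  rw [hmain]
  have t1 : LinearMap.trace ℝ V
      ((D.smulRight (B (Q (τ y))) : V →L[ℝ] V) : V →ₗ[ℝ] V) = D (B (Q (τ y))) := by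
    simp
  have t2 : LinearMap.trace ℝ V
      ((B ∘L fderiv ℝ Q (τ y) ∘L A y : V →L[ℝ] V) : V →ₗ[ℝ] V) =
      LinearMap.trace ℝ V (fderiv ℝ Q (τ y)) := by
    rw [ContinuousLinearMap.toLinearMap_comp, LinearMap.trace_comp_comm',
      ContinuousLinearMap.toLinearMap_comp, LinearMap.comp_assoc,
      ← ContinuousLinearMap.toLinearMap_comp, hAB]
    simp
  simp only [ContinuousLinearMap.toLinearMap_sub, ContinuousLinearMap.toLinearMap_add,
    ContinuousLinearMap.toLinearMap_smul, map_sub, map_add, map_smul, t1, t2, hDv, hS,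
    ContinuousLinearMap.comp_smul, smul_eq_mul]
  ring

end DetCalculus

end STIMCF
end

noncomputable section
namespace STIMCF
set_option linter.unusedSectionVars false

section ChartCalculus

variable {V : Type*} [NormedAddCommGroup V] [NormedSpace ℝ V]
  {M : Type*} [TopologicalSpace M] [ChartedSpace V M] [IsManifold 𝓘(ℝ, V) ∞ M]

lemma isManifold_two : IsManifold 𝓘(ℝ, V) (1 + 1) M :=
  IsManifold.of_le (n := ∞) (by norm_cast)

lemma coord_add (c p : M) (v w : TangentSpace 𝓘(ℝ, V) p) :
    coord 𝓘(ℝ, V) c p (v + w) = coord 𝓘(ℝ, V) c p v + coord 𝓘(ℝ, V) c p w :=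
  map_add (mfderiv 𝓘(ℝ, V) 𝓘(ℝ, V) (extChartAt 𝓘(ℝ, V) c) p) v w

lemma coord_smul (c p : M) (a : ℝ) (v : TangentSpace 𝓘(ℝ, V) p) :
    coord 𝓘(ℝ, V) c p (a • v) = a • coord 𝓘(ℝ, V) c p v :=
  map_smul (mfderiv 𝓘(ℝ, V) 𝓘(ℝ, V) (extChartAt 𝓘(ℝ, V) c) p) a v

lemma coord_zero (c p : M) : coord 𝓘(ℝ, V) c p (0 : TangentSpace 𝓘(ℝ, V) p) = 0 :=
  map_zero (mfderiv 𝓘(ℝ, V) 𝓘(ℝ, V) (extChartAt 𝓘(ℝ, V) c) p)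

lemma coordVec_add (c : M) (y v w : V) :
    coordVec 𝓘(ℝ, V) c y (v + w) = coordVec 𝓘(ℝ, V) c y v + coordVec 𝓘(ℝ, V) c y w :=
  map_add (mfderiv 𝓘(ℝ, V) 𝓘(ℝ, V) (extChartAt 𝓘(ℝ, V) c).symm y) v w

lemma coordVec_smul (c : M) (y : V) (a : ℝ) (v : V) :
    coordVec 𝓘(ℝ, V) c y (a • v) = a • coordVec 𝓘(ℝ, V) c y v :=
  map_smul (mfderiv 𝓘(ℝ, V) 𝓘(ℝ, V) (extChartAt 𝓘(ℝ, V) c).symm y) a v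

lemma coord_coordVec {c : M} {y : V} (hy : y ∈ (extChartAt 𝓘(ℝ, V) c).target) (w : V) :
    coord 𝓘(ℝ, V) c _ (coordVec 𝓘(ℝ, V) c y w) = w := by
  have : IsManifold 𝓘(ℝ, V) 1 M := inferInstance
  have h := mfderiv_extChartAt_comp_mfderivWithin_extChartAt_symm (I := 𝓘(ℝ, V)) hy
  have hr : range (𝓘(ℝ, V) : V → V) = univ := by simp
  rw [hr, mfderivWithin_univ] at h
  exact congrArg (fun C ↦ C w) h

lemma coordVec_coord {c p : M} (hp : p ∈ (extChartAt 𝓘(ℝ, V) c).source)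
    (v : TangentSpace 𝓘(ℝ, V) p) :
    coordVec 𝓘(ℝ, V) c (extChartAt 𝓘(ℝ, V) c p) (coord 𝓘(ℝ, V) c p v) = v := by
  have h := mfderivWithin_extChartAt_symm_comp_mfderiv_extChartAt' (I := 𝓘(ℝ, V)) hp
  have hr : range (𝓘(ℝ, V) : V → V) = univ := by simp
  rw [hr, mfderivWithin_univ] at h
  exact congrArg (fun C ↦ C v) h

lemma coord_coordVec' {c p : M} (hp : p ∈ (extChartAt 𝓘(ℝ, V) c).source) (w : V) :
    coord 𝓘(ℝ, V) c p (coordVec 𝓘(ℝ, V) c (extChartAt 𝓘(ℝ, V) c p) w) = w := by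
  have h := coord_coordVec ((extChartAt 𝓘(ℝ, V) c).map_source hp) w
  have e := (extChartAt 𝓘(ℝ, V) c).left_inv hp
  unfold coord at h ⊢
  rw [e] at h
  exact h

/-- The transition map from the chart at `c` to the chart at `c'`. -/
def transition (c c' : M) : V → V := extChartAt 𝓘(ℝ, V) c' ∘ (extChartAt 𝓘(ℝ, V) c).symm

lemma isOpen_transition_domain (c c' : M) :
    IsOpen ((extChartAt 𝓘(ℝ, V) c).target ∩
      (extChartAt 𝓘(ℝ, V) c).symm ⁻¹' (extChartAt 𝓘(ℝ, V) c').source) :=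
  (continuousOn_extChartAt_symm c).isOpen_inter_preimage (isOpen_extChartAt_target c)
    (isOpen_extChartAt_source c')

lemma contDiffAt_transition {c c' : M} {y : V} (hy : y ∈ (extChartAt 𝓘(ℝ, V) c).target)
    (hy' : (extChartAt 𝓘(ℝ, V) c).symm y ∈ (extChartAt 𝓘(ℝ, V) c').source) :
    ContDiffAt ℝ ∞ (transition (V := V) c c') y := by
  rw [← contMDiffAt_iff_contDiffAt]
  have h1 : ContMDiffAt 𝓘(ℝ, V) 𝓘(ℝ, V) ∞ (extChartAt 𝓘(ℝ, V) c').toFun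
      ((extChartAt 𝓘(ℝ, V) c).symm y) :=
    contMDiffAt_extChartAt' (by simpa using hy')
  have h2 : ContMDiffAt 𝓘(ℝ, V) 𝓘(ℝ, V) ∞ (extChartAt 𝓘(ℝ, V) c).symm y :=
    (contMDiffOn_extChartAt_symm c).contMDiffAt ((isOpen_extChartAt_target c).mem_nhds hy)
  exact h1.comp y h2

lemma mdifferentiableAt_symm {c : M} {y : V} (hy : y ∈ (extChartAt 𝓘(ℝ, V) c).target) :
    MDifferentiableAt 𝓘(ℝ, V) 𝓘(ℝ, V) (extChartAt 𝓘(ℝ, V) c).symm y :=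
  ((contMDiffOn_extChartAt_symm (I := 𝓘(ℝ, V)) (n := ∞) c).contMDiffAt
    ((isOpen_extChartAt_target c).mem_nhds hy)).mdifferentiableAt (by simp)

lemma fderiv_transition {c c' : M} {y : V} (hy : y ∈ (extChartAt 𝓘(ℝ, V) c).target)
    (hy' : (extChartAt 𝓘(ℝ, V) c).symm y ∈ (extChartAt 𝓘(ℝ, V) c').source) (w : V) :
    fderiv ℝ (transition (V := V) c c') y w =
      coord 𝓘(ℝ, V) c' _ (coordVec 𝓘(ℝ, V) c y w) := by
  have h1 : MDifferentiableAt 𝓘(ℝ, V) 𝓘(ℝ, V) (extChartAt 𝓘(ℝ, V) c').toFun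
      ((extChartAt 𝓘(ℝ, V) c).symm y) :=
    mdifferentiableAt_extChartAt (by simpa using hy')
  have h := mfderiv_comp y h1 (mdifferentiableAt_symm hy)
  have h2 : mfderiv 𝓘(ℝ, V) 𝓘(ℝ, V) (transition (V := V) c c') y = fderiv ℝ (transition c c') y :=
    mfderiv_eq_fderiv
  rw [← h2]
  exact congrArg (fun C ↦ C w) h

/-- The inverse of the derivative of the transition map. -/
lemma fderiv_transition_inverse {c c' : M} {y : V} (hy : y ∈ (extChartAt 𝓘(ℝ, V) c).target)
    (hy' : (extChartAt 𝓘(ℝ, V) c).symm y ∈ (extChartAt 𝓘(ℝ, V) c').source) :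
    fderiv ℝ (transition (V := V) c' c) (transition (V := V) c c' y) ∘L
      fderiv ℝ (transition (V := V) c c') y = ContinuousLinearMap.id ℝ V := by
  ext w
  have e : (extChartAt 𝓘(ℝ, V) c').symm (transition (V := V) c c' y) =
      (extChartAt 𝓘(ℝ, V) c).symm y := (extChartAt 𝓘(ℝ, V) c').left_inv hy'
  have hm : transition (V := V) c c' y ∈ (extChartAt 𝓘(ℝ, V) c').target :=
    (extChartAt 𝓘(ℝ, V) c').map_source hy'
  rw [ContinuousLinearMap.comp_apply, fderiv_transition hm
    (by rw [e]; exact (extChartAt 𝓘(ℝ, V) c).map_target hy), fderiv_transition hy hy']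
  have h := coordVec_coord hy' (coordVec 𝓘(ℝ, V) c y w)
  unfold transition at e ⊢
  have h2 := coord_coordVec hy w
  simp only [Function.comp_apply] at e ⊢
  unfold coord at h h2 ⊢
  rw [e]
  rw [ContinuousLinearMap.id_apply]
  refine Eq.trans ?_ h2
  congr 1

lemma coordVec_transition {c c' : M} {y : V} (hy : y ∈ (extChartAt 𝓘(ℝ, V) c).target)
    (hy' : (extChartAt 𝓘(ℝ, V) c).symm y ∈ (extChartAt 𝓘(ℝ, V) c').source) (w : V) :
    (coordVec 𝓘(ℝ, V) c y w : V) = coordVec 𝓘(ℝ, V) c' (transition (V := V) c c' y)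
      (fderiv ℝ (transition (V := V) c c') y w) := by
  rw [fderiv_transition hy hy']
  exact (coordVec_coord hy' (coordVec 𝓘(ℝ, V) c y w)).symm

lemma coord_transition {c c' p : M} (hp : p ∈ (extChartAt 𝓘(ℝ, V) c).source)
    (hp' : p ∈ (extChartAt 𝓘(ℝ, V) c').source) (v : TangentSpace 𝓘(ℝ, V) p) :
    coord 𝓘(ℝ, V) c' p v =
      fderiv ℝ (transition (V := V) c c') (extChartAt 𝓘(ℝ, V) c p) (coord 𝓘(ℝ, V) c p v) := by
  have e := (extChartAt 𝓘(ℝ, V) c).left_inv hp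
  rw [fderiv_transition ((extChartAt 𝓘(ℝ, V) c).map_source hp) (by rwa [e])]
  have h := coordVec_coord hp v
  unfold coord at h ⊢
  rw [e]
  congr 1
  exact h.symm

lemma trivializationAt_snd {c p : M} (hp : p ∈ (extChartAt 𝓘(ℝ, V) c).source)
    (v : TangentSpace 𝓘(ℝ, V) p) :
    (trivializationAt V (TangentSpace 𝓘(ℝ, V)) c ⟨p, v⟩).2 = coord 𝓘(ℝ, V) c p v := by
  have hp' : p ∈ (chartAt V c).source := by simpa using hp
  have h := TangentBundle.continuousLinearMapAt_trivializationAt (I := 𝓘(ℝ, V)) hp'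
  have h2 := congrArg (fun C ↦ C v) h
  refine Eq.trans ?_ h2
  rw [Trivialization.continuousLinearMapAt_apply, Trivialization.linearMapAt_apply,
    if_pos (by simpa using hp')]

lemma contMDiffAt_field_iff {X : ∀ x : M, TangentSpace 𝓘(ℝ, V) x} {c p : M}
    (hp : p ∈ (extChartAt 𝓘(ℝ, V) c).source) :
    ContMDiffAt 𝓘(ℝ, V) 𝓘(ℝ, V).tangent 1 (fun x ↦ (⟨x, X x⟩ : TangentBundle 𝓘(ℝ, V) M)) p ↔
      ContMDiffAt 𝓘(ℝ, V) 𝓘(ℝ, V) 1 (fun x ↦ coord 𝓘(ℝ, V) c x (X x)) p := by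
  have := isManifold_two (V := V) (M := M)
  have hp' : p ∈ (trivializationAt V (TangentSpace 𝓘(ℝ, V)) c).baseSet := by simpa using hp
  rw [show (fun x ↦ (⟨x, X x⟩ : TangentBundle 𝓘(ℝ, V) M)) =
    fun x ↦ TotalSpace.mk' V x (X x) from rfl]
  refine (Trivialization.contMDiffAt_section_iff _ hp').trans ?_
  refine Filter.EventuallyEq.contMDiffAt_iff ?_
  filter_upwards [(isOpen_extChartAt_source c).mem_nhds hp] with x hx
  exact trivializationAt_snd hx _

/-- The components of a vector field in the chart at `c`, as a function of the coordinates. -/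
def rep (c : M) (X : ∀ x : M, TangentSpace 𝓘(ℝ, V) x) (y : V) : V :=
  coord 𝓘(ℝ, V) c ((extChartAt 𝓘(ℝ, V) c).symm y) (X ((extChartAt 𝓘(ℝ, V) c).symm y))

lemma contMDiffAt_comp_chart_iff {F : Type*} [NormedAddCommGroup F] [NormedSpace ℝ F]
    {f : M → F} {c : M} {y : V} {n : ℕ}
    (hy : y ∈ (extChartAt 𝓘(ℝ, V) c).target) :
    ContDiffAt ℝ n (f ∘ (extChartAt 𝓘(ℝ, V) c).symm) y ↔
      ContMDiffAt 𝓘(ℝ, V) 𝓘(ℝ, F) n f ((extChartAt 𝓘(ℝ, V) c).symm y) := by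
  have hn : IsManifold 𝓘(ℝ, V) n M := IsManifold.of_le (n := ∞) (by
    norm_cast; exact le_top)
  have hp := (extChartAt 𝓘(ℝ, V) c).map_target hy
  have h2 : ContMDiffAt 𝓘(ℝ, V) 𝓘(ℝ, V) n (extChartAt 𝓘(ℝ, V) c).symm y :=
    (contMDiffOn_extChartAt_symm c).contMDiffAt ((isOpen_extChartAt_target c).mem_nhds hy)
  have h1 : ContMDiffAt 𝓘(ℝ, V) 𝓘(ℝ, V) n (extChartAt 𝓘(ℝ, V) c)
      ((extChartAt 𝓘(ℝ, V) c).symm y) :=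
    contMDiffAt_extChartAt' (by simpa using hp)
  rw [← contMDiffAt_iff_contDiffAt]
  refine ⟨fun h ↦ ?_, fun h ↦ h.comp y h2⟩
  have e : y = extChartAt 𝓘(ℝ, V) c ((extChartAt 𝓘(ℝ, V) c).symm y) :=
    ((extChartAt 𝓘(ℝ, V) c).right_inv hy).symm
  rw [e] at h
  refine (h.comp _ h1).congr_of_eventuallyEq ?_
  filter_upwards [(isOpen_extChartAt_source c).mem_nhds hp] with x hx
  simp only [Function.comp_apply, (extChartAt 𝓘(ℝ, V) c).left_inv hx]

lemma contDiffAt_rep_iff {X : ∀ x : M, TangentSpace 𝓘(ℝ, V) x} {c : M} {y : V}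
    (hy : y ∈ (extChartAt 𝓘(ℝ, V) c).target) :
    ContDiffAt ℝ 1 (rep c X) y ↔ ContMDiffAt 𝓘(ℝ, V) 𝓘(ℝ, V).tangent 1
      (fun x ↦ (⟨x, X x⟩ : TangentBundle 𝓘(ℝ, V) M)) ((extChartAt 𝓘(ℝ, V) c).symm y) := by
  rw [contMDiffAt_field_iff ((extChartAt 𝓘(ℝ, V) c).map_target hy)]
  exact contMDiffAt_comp_chart_iff (F := V) (n := 1) (f := fun x ↦ coord 𝓘(ℝ, V) c x (X x)) hy

/-- A Riemannian metric of class `C¹`, given by its values on pairs of tangent vectors. -/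
structure C1Metric (g : TensorField 𝓘(ℝ, V) M) : Prop where
  add_left : ∀ x v v' w, g x (v + v') w = g x v w + g x v' w
  smul_left : ∀ x (a : ℝ) v w, g x (a • v) w = a * g x v w
  symm : ∀ x v w, g x v w = g x w v
  pos : ∀ x v, v ≠ 0 → 0 < g x v v
  contDiffOn : ∀ c v w, ContDiffOn ℝ 1
    (fun y ↦ g ((extChartAt 𝓘(ℝ, V) c).symm y) (coordVec 𝓘(ℝ, V) c y v) (coordVec 𝓘(ℝ, V) c y w))
    (extChartAt 𝓘(ℝ, V) c).target

variable {g : TensorField 𝓘(ℝ, V) M}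

lemma C1Metric.add_right (hg : C1Metric g) (x v w w') : g x v (w + w') = g x v w + g x v w' := by
  rw [hg.symm, hg.add_left, hg.symm x w, hg.symm x w']

lemma C1Metric.smul_right (hg : C1Metric g) (x) (a : ℝ) (v w) : g x v (a • w) = a * g x v w := by
  rw [hg.symm, hg.smul_left, hg.symm x w]

lemma C1Metric.zero (hg : C1Metric g) (x w) : g x 0 w = 0 := by
  have := hg.smul_left x 0 0 w
  simpa using this

/-- The metric in the chart at `c`, as a bilinear form depending on the coordinates. -/
def gramForm (hg : C1Metric g) (c : M) (y : V) : LinearMap.BilinForm ℝ V :=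
  LinearMap.mk₂ ℝ (fun v w ↦ g ((extChartAt 𝓘(ℝ, V) c).symm y) (coordVec 𝓘(ℝ, V) c y v)
      (coordVec 𝓘(ℝ, V) c y w))
    (fun v v' w ↦ by rw [coordVec_add, hg.add_left])
    (fun a v w ↦ by rw [coordVec_smul, hg.smul_left]; rfl)
    (fun v w w' ↦ by rw [coordVec_add, hg.add_right])
    (fun a v w ↦ by rw [coordVec_smul, hg.smul_right]; rfl)

lemma gramForm_apply (hg : C1Metric g) (c : M) (y v w : V) :
    gramForm hg c y v w = g ((extChartAt 𝓘(ℝ, V) c).symm y) (coordVec 𝓘(ℝ, V) c y v)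
      (coordVec 𝓘(ℝ, V) c y w) := rfl

lemma gramForm_pos (hg : C1Metric g) {c : M} {y : V} (hy : y ∈ (extChartAt 𝓘(ℝ, V) c).target)
    {v : V} (hv : v ≠ 0) : 0 < gramForm hg c y v v := by
  refine hg.pos _ _ fun h ↦ hv ?_
  rw [← coord_coordVec hy v, h, coord_zero]

lemma gramForm_rep (hg : C1Metric g) {c : M} {y : V} (hy : y ∈ (extChartAt 𝓘(ℝ, V) c).target)
    (X Y : ∀ x : M, TangentSpace 𝓘(ℝ, V) x) :
    gramForm hg c y (rep c X y) (rep c Y y) =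
      g ((extChartAt 𝓘(ℝ, V) c).symm y) (X ((extChartAt 𝓘(ℝ, V) c).symm y))
        (Y ((extChartAt 𝓘(ℝ, V) c).symm y)) := by
  rw [gramForm_apply]
  have h := fun v ↦ coordVec_coord ((extChartAt 𝓘(ℝ, V) c).map_target hy) v
  rw [(extChartAt 𝓘(ℝ, V) c).right_inv hy] at h
  unfold rep
  congr 1 <;> exact h _

lemma gramForm_transition (hg : C1Metric g) {c c' : M} {y : V}
    (hy : y ∈ (extChartAt 𝓘(ℝ, V) c).target)
    (hy' : (extChartAt 𝓘(ℝ, V) c).symm y ∈ (extChartAt 𝓘(ℝ, V) c').source) :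
    gramForm hg c y = (gramForm hg c' (transition (V := V) c c' y)).comp
      (fderiv ℝ (transition (V := V) c c') y : V →ₗ[ℝ] V)
      (fderiv ℝ (transition (V := V) c c') y : V →ₗ[ℝ] V) := by
  ext v w
  rw [LinearMap.BilinForm.comp_apply, gramForm_apply, gramForm_apply]
  have e : (extChartAt 𝓘(ℝ, V) c').symm (transition (V := V) c c' y) =
      (extChartAt 𝓘(ℝ, V) c).symm y := (extChartAt 𝓘(ℝ, V) c').left_inv hy'
  have hv := coordVec_transition hy hy' v
  have hw := coordVec_transition hy hy' w
  rw [e]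
  congr 1

variable [FiniteDimensional ℝ V]

lemma sqrtDet_eq (hg : C1Metric g) (c : M) (y : V) : sqrtDet 𝓘(ℝ, V) g c y =
    Real.sqrt (LinearMap.BilinForm.toMatrix (Module.finBasis ℝ V) (gramForm hg c y)).det := by
  unfold sqrtDet
  congr 2
  ext i j
  simp [LinearMap.BilinForm.toMatrix_apply, gramForm_apply]

lemma det_gramForm_pos (hg : C1Metric g) {c : M} {y : V}
    (hy : y ∈ (extChartAt 𝓘(ℝ, V) c).target) {ι : Type*} [Fintype ι] [DecidableEq ι]
    (b : Module.Basis ι ℝ V) :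
    0 < (LinearMap.BilinForm.toMatrix b (gramForm hg c y)).det := by
  refine Matrix.PosDef.det_pos (Matrix.PosDef.of_dotProduct_mulVec_pos ?_ fun x hx ↦ ?_)
  · ext i j
    simp only [Matrix.conjTranspose_apply, LinearMap.BilinForm.toMatrix_apply, star_trivial]
    rw [gramForm_apply, hg.symm, gramForm_apply]
  · have hv : b.equivFun.symm x ≠ 0 := by
      rwa [Ne, LinearEquiv.map_eq_zero_iff]
    have := gramForm_pos hg hy hv
    rw [Module.Basis.equivFun_symm_apply] at this
    refine this.trans_eq ?_
    simp only [dotProduct, Matrix.mulVec, map_sum, map_smul, LinearMap.sum_apply,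
      LinearMap.smul_apply, LinearMap.BilinForm.toMatrix_apply, smul_eq_mul, star_trivial,
      Finset.mul_sum]
    refine Finset.sum_congr rfl fun i _ ↦ Finset.sum_congr rfl fun j _ ↦ ?_
    rw [gramForm_apply, gramForm_apply, hg.symm]
    ring

lemma sqrtDet_pos (hg : C1Metric g) {c : M} {y : V}
    (hy : y ∈ (extChartAt 𝓘(ℝ, V) c).target) : 0 < sqrtDet 𝓘(ℝ, V) g c y := by
  rw [sqrtDet_eq hg]
  exact Real.sqrt_pos.2 (det_gramForm_pos hg hy _)

lemma contDiffOn_sqrtDet (hg : C1Metric g) (c : M) :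
    ContDiffOn ℝ 1 (sqrtDet 𝓘(ℝ, V) g c) (extChartAt 𝓘(ℝ, V) c).target := by
  have h : ContDiffOn ℝ 1 (fun y ↦
      (LinearMap.BilinForm.toMatrix (Module.finBasis ℝ V) (gramForm hg c y)).det)
      (extChartAt 𝓘(ℝ, V) c).target := by
    simp only [Matrix.det_apply']
    exact ContDiffOn.sum fun σ _ ↦ contDiffOn_const.mul
      (contDiffOn_prod fun i _ ↦ hg.contDiffOn c _ _)
  exact (h.sqrt fun y hy ↦ (det_gramForm_pos hg hy _).ne').congr fun y _ ↦ sqrtDet_eq hg c y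

lemma sqrtDet_transition (hg : C1Metric g) {c c' : M} {y : V}
    (hy : y ∈ (extChartAt 𝓘(ℝ, V) c).target)
    (hy' : (extChartAt 𝓘(ℝ, V) c).symm y ∈ (extChartAt 𝓘(ℝ, V) c').source) :
    sqrtDet 𝓘(ℝ, V) g c y = |(fderiv ℝ (transition (V := V) c c') y).det| *
      sqrtDet 𝓘(ℝ, V) g c' (transition (V := V) c c' y) := by
  rw [sqrtDet_eq hg, sqrtDet_eq hg, gramForm_transition hg hy hy',
    LinearMap.BilinForm.toMatrix_comp (Module.finBasis ℝ V) (Module.finBasis ℝ V), Matrix.det_mul,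
    Matrix.det_mul, Matrix.det_transpose, LinearMap.det_toMatrix, mul_right_comm,
    Real.sqrt_mul (mul_self_nonneg _), Real.sqrt_mul_self_eq_abs]

end ChartCalculus

end STIMCF
end

noncomputable section
namespace STIMCF
set_option linter.unusedSectionVars false

section VolumeGeneral

lemma iSup_measure_eq_sum {α ι : Type*} [MeasurableSpace α] (μ : ι → Measure α) (D : ℕ → Set α)
    (k : ℕ → ι) (hm : ∀ n, MeasurableSet (D n)) (hd : Pairwise fun i j ↦ Disjoint (D i) (D j))
    (hu : ⋃ n, D n = univ)
    (h : ∀ i n, (μ i).restrict (D n) ≤ (μ (k n)).restrict (D n)) :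
    ⨆ i, μ i = Measure.sum fun n ↦ (μ (k n)).restrict (D n) := by
  have key : ∀ m : Measure α, m = Measure.sum fun n ↦ m.restrict (D n) := fun m ↦ by
    rw [← Measure.restrict_iUnion hd hm, hu, Measure.restrict_univ]
  apply le_antisymm
  · refine iSup_le fun i ↦ ?_
    rw [key (μ i)]
    refine Measure.le_iff.2 fun s hs ↦ ?_
    rw [Measure.sum_apply _ hs, Measure.sum_apply _ hs]
    exact ENNReal.tsum_le_tsum fun n ↦ h i n s
  · rw [key (⨆ i, μ i)]
    refine Measure.le_iff.2 fun s hs ↦ ?_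
    rw [Measure.sum_apply _ hs, Measure.sum_apply _ hs]
    exact ENNReal.tsum_le_tsum fun n ↦
      Measure.restrict_mono_measure (le_iSup μ (k n)) _ s

end VolumeGeneral

section Volume

variable {V : Type*} [NormedAddCommGroup V] [NormedSpace ℝ V] [FiniteDimensional ℝ V]
  [MeasurableSpace V] [BorelSpace V]
  {M : Type*} [TopologicalSpace M] [ChartedSpace V M]
  [MeasurableSpace M] [BorelSpace M]
  {g : TensorField 𝓘(ℝ, V) M}

/-- The Riemannian volume of the chart domain at `c`. -/
def chartMeasure (g : TensorField 𝓘(ℝ, V) M) (c : M) : Measure M :=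
  Measure.map (extChartAt 𝓘(ℝ, V) c).symm
    (((Module.finBasis ℝ V).addHaar.restrict (extChartAt 𝓘(ℝ, V) c).target).withDensity
      fun y ↦ ENNReal.ofReal (sqrtDet 𝓘(ℝ, V) g c y))

lemma measurableSet_target_inter_preimage (c : M) {s : Set M} (hs : MeasurableSet s) :
    MeasurableSet ((extChartAt 𝓘(ℝ, V) c).target ∩ (extChartAt 𝓘(ℝ, V) c).symm ⁻¹' s) := by
  have h := (continuousOn_iff_continuous_domRestrict.1
    (continuousOn_extChartAt_symm (I := 𝓘(ℝ, V)) c)).measurable hs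
  have := (isOpen_extChartAt_target (I := 𝓘(ℝ, V)) c).measurableSet.subtype_image h
  convert this using 1
  ext y; simp [and_comm]

lemma measurableSet_source_inter_preimage (c : M) {s : Set V} (hs : MeasurableSet s) :
    MeasurableSet ((extChartAt 𝓘(ℝ, V) c).source ∩ (extChartAt 𝓘(ℝ, V) c) ⁻¹' s) := by
  have h := (continuousOn_iff_continuous_domRestrict.1
    (continuousOn_extChartAt (I := 𝓘(ℝ, V)) c)).measurable hs
  have := (isOpen_extChartAt_source (I := 𝓘(ℝ, V)) c).measurableSet.subtype_image h
  convert this using 1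
  ext y; simp [and_comm]

lemma aemeasurable_chart_symm (c : M) : AEMeasurable (extChartAt 𝓘(ℝ, V) c).symm
    ((Module.finBasis ℝ V).addHaar.restrict (extChartAt 𝓘(ℝ, V) c).target) :=
  (continuousOn_extChartAt_symm (I := 𝓘(ℝ, V)) c).aemeasurable
    (isOpen_extChartAt_target c).measurableSet

lemma aemeasurable_chart_symm' (c : M) : AEMeasurable (extChartAt 𝓘(ℝ, V) c).symm
    (((Module.finBasis ℝ V).addHaar.restrict (extChartAt 𝓘(ℝ, V) c).target).withDensity
      fun y ↦ ENNReal.ofReal (sqrtDet 𝓘(ℝ, V) g c y)) :=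
  (aemeasurable_chart_symm c).mono_ac (withDensity_absolutelyContinuous _ _)

lemma chartMeasure_apply (c : M) {s : Set M} (hs : MeasurableSet s) :
    chartMeasure g c s = ∫⁻ y in (extChartAt 𝓘(ℝ, V) c).target ∩
      (extChartAt 𝓘(ℝ, V) c).symm ⁻¹' s, ENNReal.ofReal (sqrtDet 𝓘(ℝ, V) g c y)
        ∂(Module.finBasis ℝ V).addHaar := by
  rw [chartMeasure, Measure.map_apply_of_aemeasurable (aemeasurable_chart_symm' c) hs,
    withDensity_apply', Measure.restrict_restrict' (isOpen_extChartAt_target c).measurableSet,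
    inter_comm]

variable [IsManifold 𝓘(ℝ, V) ∞ M]

lemma chartMeasure_le (hg : C1Metric g) (c c' : M) {s : Set M} (hs : MeasurableSet s)
    (hsub : s ⊆ (extChartAt 𝓘(ℝ, V) c').source) : chartMeasure g c s ≤ chartMeasure g c' s := by
  rw [chartMeasure_apply c hs, chartMeasure_apply c' hs]
  set T := (extChartAt 𝓘(ℝ, V) c).target ∩ (extChartAt 𝓘(ℝ, V) c).symm ⁻¹' s with hT
  have hTm : MeasurableSet T := measurableSet_target_inter_preimage c hs
  have hinj : InjOn (transition (V := V) c c') T := by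
    intro y hy z hz h
    have := (extChartAt 𝓘(ℝ, V) c').injOn (hsub hy.2) (hsub hz.2) h
    exact (extChartAt 𝓘(ℝ, V) c).symm.injOn hy.1 hz.1 this
  have h1 : ∫⁻ y in T, ENNReal.ofReal (sqrtDet 𝓘(ℝ, V) g c y) ∂(Module.finBasis ℝ V).addHaar =
      ∫⁻ y in T, ENNReal.ofReal |(fderiv ℝ (transition (V := V) c c') y).det| *
        ENNReal.ofReal (sqrtDet 𝓘(ℝ, V) g c' (transition (V := V) c c' y))
          ∂(Module.finBasis ℝ V).addHaar := by
    refine setLIntegral_congr_fun hTm fun y hy ↦ ?_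
    rw [sqrtDet_transition hg hy.1 (hsub hy.2), ENNReal.ofReal_mul (abs_nonneg _)]
  rw [h1, ← lintegral_image_eq_lintegral_abs_det_fderiv_mul (Module.finBasis ℝ V).addHaar hTm
    (fun y hy ↦ ((contDiffAt_transition hy.1 (hsub hy.2)).differentiableAt
      (by simp)).hasFDerivAt.hasFDerivWithinAt) hinj
      (fun z ↦ ENNReal.ofReal (sqrtDet 𝓘(ℝ, V) g c' z))]
  refine lintegral_mono_set ?_
  rintro _ ⟨y, hy, rfl⟩
  refine ⟨(extChartAt 𝓘(ℝ, V) c').map_source (hsub hy.2), ?_⟩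
  simp only [transition, mem_preimage, Function.comp_apply,
    (extChartAt 𝓘(ℝ, V) c').left_inv (hsub hy.2)]
  exact hy.2

variable [SecondCountableTopology M]

lemma exists_chart_partition [Nonempty M] : ∃ (x : ℕ → M) (D : ℕ → Set M),
    (∀ n, MeasurableSet (D n)) ∧ (∀ n, D n ⊆ (extChartAt 𝓘(ℝ, V) (x n)).source) ∧
    (Pairwise fun i j ↦ Disjoint (D i) (D j)) ∧ ⋃ n, D n = univ := by
  obtain ⟨s, hs, hsu⟩ := TopologicalSpace.countable_cover_nhds
    (fun x : M ↦ extChartAt_source_mem_nhds (I := 𝓘(ℝ, V)) x)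
  have hne : s.Nonempty := by
    by_contra h
    rw [not_nonempty_iff_eq_empty] at h
    subst h
    simp only [mem_empty_iff_false, iUnion_of_empty, iUnion_empty] at hsu
    exact (empty_ne_univ hsu)
  obtain ⟨x, hx⟩ := hs.exists_eq_range hne
  refine ⟨x, disjointed fun n ↦ (extChartAt 𝓘(ℝ, V) (x n)).source,
    fun n ↦ MeasurableSet.disjointed (fun n ↦ (isOpen_extChartAt_source _).measurableSet) n,
    fun n ↦ disjointed_le _ n, disjoint_disjointed _, ?_⟩
  rw [iUnion_disjointed, ← hsu, hx, biUnion_range]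

lemma vol_eq_sum (hg : C1Metric g) {x : ℕ → M} {D : ℕ → Set M}
    (hm : ∀ n, MeasurableSet (D n)) (hs : ∀ n, D n ⊆ (extChartAt 𝓘(ℝ, V) (x n)).source)
    (hd : Pairwise fun i j ↦ Disjoint (D i) (D j)) (hu : ⋃ n, D n = univ) :
    vol 𝓘(ℝ, V) g = Measure.sum fun n ↦ (chartMeasure g (x n)).restrict (D n) := by
  refine iSup_measure_eq_sum _ D x hm hd hu fun c n ↦ Measure.le_iff.2 fun s hs' ↦ ?_
  rw [Measure.restrict_apply hs', Measure.restrict_apply hs']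
  exact chartMeasure_le hg _ _ (hs'.inter (hm n)) (inter_subset_right.trans (hs n))

lemma vol_apply_of_subset (hg : C1Metric g) (c : M) {s : Set M} (hs : MeasurableSet s)
    (hsub : s ⊆ (extChartAt 𝓘(ℝ, V) c).source) : vol 𝓘(ℝ, V) g s = chartMeasure g c s := by
  have : Nonempty M := ⟨c⟩
  apply le_antisymm
  · obtain ⟨x, D, hm, hD, hd, hu⟩ := exists_chart_partition (V := V) (M := M)
    rw [vol_eq_sum hg hm hD hd hu, Measure.sum_apply _ hs]
    have h2 : chartMeasure g c s = ∑' n, chartMeasure g c (s ∩ D n) := by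
      rw [← measure_iUnion (fun i j hij ↦ (hd hij).mono inter_subset_right inter_subset_right)
        (fun n ↦ hs.inter (hm n)), ← inter_iUnion, hu, inter_univ]
    rw [h2]
    refine ENNReal.tsum_le_tsum fun n ↦ ?_
    rw [Measure.restrict_apply hs]
    exact chartMeasure_le hg _ _ (hs.inter (hm n)) (inter_subset_left.trans hsub)
  · exact le_iSup (chartMeasure g) c s

lemma vol_restrict_source (hg : C1Metric g) (c : M) :
    (vol 𝓘(ℝ, V) g).restrict (extChartAt 𝓘(ℝ, V) c).source = chartMeasure g c := by
  ext s hs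
  rw [Measure.restrict_apply hs, vol_apply_of_subset hg c
    (hs.inter (isOpen_extChartAt_source c).measurableSet) inter_subset_right,
    chartMeasure_apply c hs, chartMeasure_apply c
      (hs.inter (isOpen_extChartAt_source c).measurableSet)]
  congr 2
  ext y
  simp only [mem_inter_iff, mem_preimage]
  exact ⟨fun h ↦ ⟨h.1, h.2.1⟩, fun h ↦ ⟨h.1, h.2, (extChartAt 𝓘(ℝ, V) c).map_target h.1⟩⟩

lemma aemeasurable_sqrtDet (hg : C1Metric g) (c : M) :
    AEMeasurable (fun y ↦ sqrtDet 𝓘(ℝ, V) g c y)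
    ((Module.finBasis ℝ V).addHaar.restrict (extChartAt 𝓘(ℝ, V) c).target) :=
  ((contDiffOn_sqrtDet hg c).continuousOn).aemeasurable (isOpen_extChartAt_target c).measurableSet

lemma integral_chartMeasure (hg : C1Metric g) (c : M) {f : M → ℝ}
    (hf : AEStronglyMeasurable f (chartMeasure g c)) :
    ∫ x, f x ∂(chartMeasure g c) = ∫ y in (extChartAt 𝓘(ℝ, V) c).target,
      sqrtDet 𝓘(ℝ, V) g c y * f ((extChartAt 𝓘(ℝ, V) c).symm y)
        ∂(Module.finBasis ℝ V).addHaar := by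
  rw [chartMeasure, integral_map (aemeasurable_chart_symm' c) hf]
  rw [integral_withDensity_eq_integral_toReal_smul₀ (aemeasurable_sqrtDet hg c).ennreal_ofReal
    (Eventually.of_forall fun _ ↦ ENNReal.ofReal_lt_top)]
  refine setIntegral_congr_fun (isOpen_extChartAt_target c).measurableSet fun y hy ↦ ?_
  simp only [smul_eq_mul, ENNReal.toReal_ofReal (sqrtDet_pos hg hy).le]

/-- The integral of a function that vanishes off a chart domain. -/
lemma integral_vol_eq (hg : C1Metric g) (c : M) {f : M → ℝ}
    (hf : AEStronglyMeasurable f (vol 𝓘(ℝ, V) g))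
    (h0 : ∀ x ∉ (extChartAt 𝓘(ℝ, V) c).source, f x = 0) :
    ∫ x, f x ∂(vol 𝓘(ℝ, V) g) = ∫ y in (extChartAt 𝓘(ℝ, V) c).target,
      sqrtDet 𝓘(ℝ, V) g c y * f ((extChartAt 𝓘(ℝ, V) c).symm y)
        ∂(Module.finBasis ℝ V).addHaar := by
  rw [← setIntegral_eq_integral_of_forall_compl_eq_zero h0, vol_restrict_source hg,
    integral_chartMeasure hg]
  rw [← vol_restrict_source hg]
  exact hf.restrict

/-- The volume of a compact set inside a chart domain is comparable to Lebesgue measure. -/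
lemma isLocallyFiniteMeasure_vol (hg : C1Metric g) : IsLocallyFiniteMeasure (vol 𝓘(ℝ, V) g) := by
  refine ⟨fun p ↦ ?_⟩
  have ht := extChartAt_target_mem_nhds (I := 𝓘(ℝ, V)) p
  obtain ⟨r, hr, hsub⟩ := Metric.nhds_basis_closedBall.mem_iff.1 ht
  set B := Metric.closedBall (extChartAt 𝓘(ℝ, V) p p) r
  have hc : IsCompact B := isCompact_closedBall _ _
  set S := (extChartAt 𝓘(ℝ, V) p).source ∩ (extChartAt 𝓘(ℝ, V) p) ⁻¹' B
  have hSm : MeasurableSet S := measurableSet_source_inter_preimage p Metric.isClosed_closedBall.measurableSet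
  refine ⟨S, ?_, ?_⟩
  · exact inter_mem (extChartAt_source_mem_nhds p)
      ((continuousAt_extChartAt p).preimage_mem_nhds (Metric.closedBall_mem_nhds _ hr))
  · rw [vol_apply_of_subset hg p hSm inter_subset_left, chartMeasure_apply p hSm]
    obtain ⟨C, hC⟩ := hc.bddAbove_image ((contDiffOn_sqrtDet hg p).continuousOn.mono hsub)
    have hle : (extChartAt 𝓘(ℝ, V) p).target ∩ (extChartAt 𝓘(ℝ, V) p).symm ⁻¹' S ⊆ B := by
      rintro y ⟨hy, hy'⟩
      have := hy'.2
      rwa [mem_preimage, (extChartAt 𝓘(ℝ, V) p).right_inv hy] at this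
    refine (lintegral_mono_set hle).trans_lt ?_
    refine (setLIntegral_mono' Metric.isClosed_closedBall.measurableSet (g := fun _ ↦ ENNReal.ofReal C)
      fun y hy ↦ ENNReal.ofReal_le_ofReal (hC (mem_image_of_mem _ hy))).trans_lt ?_
    rw [setLIntegral_const]
    exact ENNReal.mul_lt_top ENNReal.ofReal_lt_top hc.measure_lt_top

end Volume

end STIMCF
end

noncomputable section
namespace STIMCF
set_option linter.unusedSectionVars false

section Trace

variable {V : Type*} [NormedAddCommGroup V] [NormedSpace ℝ V] [FiniteDimensional ℝ V]

/-- The Euclidean divergence of a map `F : V → V`. -/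
def tdiv (F : V → V) (y : V) : ℝ := LinearMap.trace ℝ V (fderiv ℝ F y)

/-- The trace as a continuous linear map. -/
def traceL : (V →L[ℝ] V) →L[ℝ] ℝ :=
  LinearMap.toContinuousLinearMap
    { toFun := fun C ↦ LinearMap.trace ℝ V (C : V →ₗ[ℝ] V)
      map_add' := fun A B ↦ by simp
      map_smul' := fun a B ↦ by simp }

lemma traceL_apply (C : V →L[ℝ] V) : traceL C = LinearMap.trace ℝ V (C : V →ₗ[ℝ] V) := rfl

lemma tdiv_eq (F : V → V) (y : V) : tdiv F y = traceL (fderiv ℝ F y) := rfl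

lemma tdiv_eq_sum {ι : Type*} [Fintype ι] (b : Module.Basis ι ℝ V) (F : V → V) (y : V) :
    tdiv F y = ∑ i, b.coord i (fderiv ℝ F y (b i)) := by
  classical
  rw [tdiv, LinearMap.trace_eq_matrix_trace ℝ b, Matrix.trace]
  simp [LinearMap.toMatrix_apply]

lemma tdiv_smul {η : V → ℝ} {F : V → V} {y : V} (hη : DifferentiableAt ℝ η y)
    (hF : DifferentiableAt ℝ F y) :
    tdiv (fun z ↦ η z • F z) y = η y * tdiv F y + fderiv ℝ η y (F y) := by
  rw [tdiv_eq, tdiv_eq, fderiv_fun_smul hη hF, map_add, map_smul, smul_eq_mul]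
  congr 1
  rw [traceL_apply]
  simp

lemma tdiv_add {F G : V → V} {y : V} (hF : DifferentiableAt ℝ F y) (hG : DifferentiableAt ℝ G y) :
    tdiv (fun z ↦ F z + G z) y = tdiv F y + tdiv G y := by
  rw [tdiv_eq, tdiv_eq, tdiv_eq, fderiv_fun_add hF hG, map_add]

lemma tdiv_congr {F G : V → V} {y : V} (h : F =ᶠ[𝓝 y] G) : tdiv F y = tdiv G y := by
  rw [tdiv_eq, tdiv_eq, h.fderiv_eq]

lemma continuous_tdiv {F : V → V} (hF : ContDiff ℝ 1 F) : Continuous (tdiv F) :=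
  traceL.continuous.comp (hF.continuous_fderiv one_ne_zero)

lemma hasCompactSupport_tdiv {F : V → V} (hF : HasCompactSupport F) : HasCompactSupport (tdiv F) :=
  (hF.fderiv (𝕜 := ℝ)).comp_left (g := fun C : V →L[ℝ] V ↦ traceL C) (map_zero _)

lemma integral_tdiv_eq_zero [MeasurableSpace V] [BorelSpace V] (μ : Measure V)
    [μ.IsAddHaarMeasure] {F : V → V} (hF : ContDiff ℝ 1 F) (hc : HasCompactSupport F) :
    ∫ y, tdiv F y ∂μ = 0 := by
  let b := Module.finBasis ℝ V
  have hi : ∀ i, Integrable (fun y ↦ b.coord i (fderiv ℝ F y (b i))) μ := by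
    intro i
    have h1 : Continuous fun y ↦ b.coord i (fderiv ℝ F y (b i)) :=
      (LinearMap.continuous_of_finiteDimensional _).comp
        ((hF.continuous_fderiv one_ne_zero).clm_apply continuous_const)
    refine h1.integrable_of_hasCompactSupport ?_
    exact (hc.fderiv (𝕜 := ℝ)).comp_left (g := fun C : V →L[ℝ] V ↦ b.coord i (C (b i))) (by simp)
  simp_rw [tdiv_eq_sum b]
  rw [integral_finsetSum _ fun i _ ↦ hi i]
  refine Finset.sum_eq_zero fun i _ ↦ ?_
  set G : V → ℝ := fun y ↦ b.coord i (F y)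
  have hG : ContDiff ℝ 1 G := (LinearMap.toContinuousLinearMap (b.coord i)).contDiff.comp hF
  have hGc : HasCompactSupport G := hc.comp_left (g := b.coord i) (map_zero _)
  have hfd : ∀ y, fderiv ℝ G y (b i) = b.coord i (fderiv ℝ F y (b i)) := by
    intro y
    have := ((LinearMap.toContinuousLinearMap (b.coord i)).hasFDerivAt.comp y
      (hF.differentiable one_ne_zero y).hasFDerivAt).fderiv
    have h2 : fderiv ℝ G y = _ := this
    rw [h2]; rfl
  have h := integral_mul_fderiv_eq_neg_fderiv_mul_of_integrable (μ := μ) (f := fun _ : V ↦ (1 : ℝ))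
    (g := G) (v := b i) (by simp)
    (by simpa [hfd] using hi i) (by simpa using hG.continuous.integrable_of_hasCompactSupport hGc)
    (fun x _ ↦ by fun_prop) (fun x _ ↦ hG.differentiable one_ne_zero x)
  simpa [hfd] using h

/-- Extension by zero of a `C¹` map with compact support in an open set. -/
lemma contDiff_of_zero_off_compact {F : Type*} [NormedAddCommGroup F] [NormedSpace ℝ F]
    {f : V → F} {T K : Set V} (hT : IsOpen T) (hf : ContDiffOn ℝ 1 f T) (hK : IsCompact K)
    (hKT : K ⊆ T) (h0 : ∀ y ∉ K, f y = 0) : ContDiff ℝ 1 f := by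
  rw [contDiff_iff_contDiffAt]
  intro y
  by_cases hy : y ∈ T
  · exact hf.contDiffAt (hT.mem_nhds hy)
  · have : f =ᶠ[𝓝 y] fun _ ↦ 0 := by
      filter_upwards [hK.isClosed.isOpen_compl.mem_nhds (fun h ↦ hy (hKT h))] with z hz
      exact h0 z hz
    exact contDiffAt_const.congr_of_eventuallyEq this

end Trace

section Divergence

variable {V : Type*} [NormedAddCommGroup V] [NormedSpace ℝ V] [FiniteDimensional ℝ V]
  [MeasurableSpace V] [BorelSpace V]
  {M : Type*} [TopologicalSpace M] [ChartedSpace V M] [IsManifold 𝓘(ℝ, V) ∞ M]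
  [MeasurableSpace M] [BorelSpace M]
  {g : TensorField 𝓘(ℝ, V) M}

/-- Vector fields of class `C¹`. -/
def C1Field (X : ∀ x : M, TangentSpace 𝓘(ℝ, V) x) : Prop :=
  ContMDiff 𝓘(ℝ, V) 𝓘(ℝ, V).tangent 1 (fun x ↦ (⟨x, X x⟩ : TangentBundle 𝓘(ℝ, V) M))

/-- The density `√(det g) X` in the chart at `c`. -/
def flux (g : TensorField 𝓘(ℝ, V) M) (c : M) (X : ∀ x : M, TangentSpace 𝓘(ℝ, V) x) (y : V) : V :=
  sqrtDet 𝓘(ℝ, V) g c y • rep c X y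

lemma C1Field.contDiffOn_rep {X : ∀ x : M, TangentSpace 𝓘(ℝ, V) x} (hX : C1Field X) (c : M) :
    ContDiffOn ℝ 1 (rep c X) (extChartAt 𝓘(ℝ, V) c).target := fun _ hy ↦
  ((contDiffAt_rep_iff hy).2 hX.contMDiffAt).contDiffWithinAt

lemma C1Field.contDiffOn_flux {X : ∀ x : M, TangentSpace 𝓘(ℝ, V) x} (hX : C1Field X)
    (hg : C1Metric g) (c : M) : ContDiffOn ℝ 1 (flux g c X) (extChartAt 𝓘(ℝ, V) c).target :=
  (contDiffOn_sqrtDet hg c).smul (hX.contDiffOn_rep c)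

lemma C1Field.differentiableAt_flux {X : ∀ x : M, TangentSpace 𝓘(ℝ, V) x} (hX : C1Field X)
    (hg : C1Metric g) {c : M} {y : V} (hy : y ∈ (extChartAt 𝓘(ℝ, V) c).target) :
    DifferentiableAt ℝ (flux g c X) y :=
  ((hX.contDiffOn_flux hg c).contDiffAt ((isOpen_extChartAt_target c).mem_nhds hy)).differentiableAt
    one_ne_zero

/-- The divergence may be computed in any chart. -/
lemma divergence_eq (hg : C1Metric g) {X : ∀ x : M, TangentSpace 𝓘(ℝ, V) x} (hX : C1Field X)
    {c p : M} (hp : p ∈ (extChartAt 𝓘(ℝ, V) c).source) :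
    sqrtDet 𝓘(ℝ, V) g c (extChartAt 𝓘(ℝ, V) c p) * divergence 𝓘(ℝ, V) g X p =
      tdiv (flux g c X) (extChartAt 𝓘(ℝ, V) c p) := by
  set y := extChartAt 𝓘(ℝ, V) p p
  have hy : y ∈ (extChartAt 𝓘(ℝ, V) p).target := mem_extChartAt_target p
  have e : (extChartAt 𝓘(ℝ, V) p).symm y = p := extChartAt_to_inv p
  have hy' : (extChartAt 𝓘(ℝ, V) p).symm y ∈ (extChartAt 𝓘(ℝ, V) c).source := by rwa [e]
  have hτy : transition (V := V) p c y = extChartAt 𝓘(ℝ, V) c p := by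
    simp only [transition, Function.comp_apply, e]
  have hnhds := (isOpen_transition_domain (V := V) p c).mem_nhds (show y ∈ _ from ⟨hy, hy'⟩)
  have hτt : transition (V := V) p c y ∈ (extChartAt 𝓘(ℝ, V) c).target := by
    rw [hτy]; exact (extChartAt 𝓘(ℝ, V) c).map_source hp
  have key := trace_fderiv_density_transition (τ := transition (V := V) p c) (y := y)
    ((contDiffAt_transition hy hy').of_le (by norm_cast))
    (fderiv_transition_inverse hy hy')
    (ρ := sqrtDet 𝓘(ℝ, V) g p) (ρ' := sqrtDet 𝓘(ℝ, V) g c) (W := rep p X) (W' := rep c X)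
    (by filter_upwards [hnhds] with z hz using sqrtDet_transition hg hz.1 hz.2)
    (by
      filter_upwards [hnhds] with z hz
      have h := coord_transition ((extChartAt 𝓘(ℝ, V) p).map_target hz.1) hz.2
        (X ((extChartAt 𝓘(ℝ, V) p).symm z))
      rw [(extChartAt 𝓘(ℝ, V) p).right_inv hz.1] at h
      unfold rep
      rw [← h]
      simp only [transition, Function.comp_apply]
      rw [(extChartAt 𝓘(ℝ, V) c).left_inv hz.2])
    (hX.differentiableAt_flux hg hy) (hX.differentiableAt_flux hg hτt)
  have hpos := sqrtDet_pos hg hy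
  have h1 : divergence 𝓘(ℝ, V) g X p = (sqrtDet 𝓘(ℝ, V) g p y)⁻¹ *
    (|(fderiv ℝ (transition (V := V) p c) y).det| * tdiv (flux g c X) (transition (V := V) p c y)) := by
    rw [← show _ = |(fderiv ℝ (transition (V := V) p c) y).det| *
      tdiv (flux g c X) (transition (V := V) p c y) from key]
    rfl
  rw [h1, ← hτy]
  have h2 := sqrtDet_transition hg hy hy'
  have hne : sqrtDet 𝓘(ℝ, V) g p y ≠ 0 := hpos.ne'
  have h3 : |(fderiv ℝ (transition (V := V) p c) y).det| ≠ 0 := by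
    intro h; rw [h, zero_mul] at h2; exact hne h2
  have h4 : sqrtDet 𝓘(ℝ, V) g c (transition (V := V) p c y) ≠ 0 := (sqrtDet_pos hg hτt).ne'
  rw [h2]
  field_simp

lemma divergence_eq_inv_mul (hg : C1Metric g) {X : ∀ x : M, TangentSpace 𝓘(ℝ, V) x}
    (hX : C1Field X) {c p : M} (hp : p ∈ (extChartAt 𝓘(ℝ, V) c).source) :
    divergence 𝓘(ℝ, V) g X p = (sqrtDet 𝓘(ℝ, V) g c (extChartAt 𝓘(ℝ, V) c p))⁻¹ *
      tdiv (flux g c X) (extChartAt 𝓘(ℝ, V) c p) := by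
  rw [← divergence_eq hg hX hp, inv_mul_cancel_left₀]
  exact (sqrtDet_pos hg ((extChartAt 𝓘(ℝ, V) c).map_source hp)).ne'

lemma continuous_divergence (hg : C1Metric g) {X : ∀ x : M, TangentSpace 𝓘(ℝ, V) x}
    (hX : C1Field X) : Continuous (divergence 𝓘(ℝ, V) g X) := by
  rw [continuous_iff_continuousAt]
  intro p
  have ht := isOpen_extChartAt_target (I := 𝓘(ℝ, V)) p
  have h1 : ContinuousOn (fun y ↦ (sqrtDet 𝓘(ℝ, V) g p y)⁻¹ * tdiv (flux g p X) y)
      (extChartAt 𝓘(ℝ, V) p).target := by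
    refine ((contDiffOn_sqrtDet hg p).continuousOn.inv₀ fun y hy ↦ (sqrtDet_pos hg hy).ne').mul ?_
    exact traceL.continuous.comp_continuousOn
      ((hX.contDiffOn_flux hg p).continuousOn_fderiv_of_isOpen ht le_rfl)
  have h2 : ContinuousAt (fun y ↦ (sqrtDet 𝓘(ℝ, V) g p y)⁻¹ * tdiv (flux g p X) y)
      (extChartAt 𝓘(ℝ, V) p p) := h1.continuousAt (ht.mem_nhds (mem_extChartAt_target p))
  refine (h2.comp (f := extChartAt 𝓘(ℝ, V) p) (continuousAt_extChartAt p)).congr ?_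
  filter_upwards [extChartAt_source_mem_nhds (I := 𝓘(ℝ, V)) p] with x hx
  exact (divergence_eq_inv_mul hg hX hx).symm

lemma differential_eq {η : M → ℝ} {c p : M} (hp : p ∈ (extChartAt 𝓘(ℝ, V) c).source)
    (hη : MDifferentiableAt 𝓘(ℝ, V) 𝓘(ℝ, ℝ) η p) (v : TangentSpace 𝓘(ℝ, V) p) :
    differential 𝓘(ℝ, V) η p v = fderiv ℝ (η ∘ (extChartAt 𝓘(ℝ, V) c).symm)
      (extChartAt 𝓘(ℝ, V) c p) (coord 𝓘(ℝ, V) c p v) := by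
  have e := (extChartAt 𝓘(ℝ, V) c).left_inv hp
  have h := mfderiv_comp (I' := 𝓘(ℝ, V)) (I'' := 𝓘(ℝ, ℝ)) (extChartAt 𝓘(ℝ, V) c p)
    (g := η) (f := (extChartAt 𝓘(ℝ, V) c).symm)
    (by rwa [e]) (mdifferentiableAt_symm ((extChartAt 𝓘(ℝ, V) c).map_source hp))
  rw [mfderiv_eq_fderiv] at h
  have h2 := coordVec_coord hp v
  unfold coordVec at h2
  rw [e] at h
  have h3 := congrArg (fun C : V →L[ℝ] ℝ ↦ C (coord 𝓘(ℝ, V) c p v)) h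
  refine Eq.trans ?_ h3.symm
  exact congrArg (mfderiv 𝓘(ℝ, V) 𝓘(ℝ, ℝ) η p) h2.symm

lemma C1Field.smul {X : ∀ x : M, TangentSpace 𝓘(ℝ, V) x} (hX : C1Field X) {η : M → ℝ}
    (hη : ContMDiff 𝓘(ℝ, V) 𝓘(ℝ, ℝ) 1 η) : C1Field fun x ↦ η x • X x := by
  exact ContMDiff.smul_section hη hX

lemma C1Field.add {X Y : ∀ x : M, TangentSpace 𝓘(ℝ, V) x} (hX : C1Field X) (hY : C1Field Y) :
    C1Field fun x ↦ X x + Y x := by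
  exact ContMDiff.add_section hX hY

lemma c1Field_zero : C1Field fun x : M ↦ (0 : TangentSpace 𝓘(ℝ, V) x) := by
  exact contMDiff_zeroSection (IB := 𝓘(ℝ, V)) (F := V) (n := 1) ℝ (TangentSpace 𝓘(ℝ, V) : M → Type _)

lemma divergence_smul (hg : C1Metric g) {X : ∀ x : M, TangentSpace 𝓘(ℝ, V) x} (hX : C1Field X)
    {η : M → ℝ} (hη : ContMDiff 𝓘(ℝ, V) 𝓘(ℝ, ℝ) 1 η) (p : M) :
    divergence 𝓘(ℝ, V) g (fun x ↦ η x • X x) p =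
      η p * divergence 𝓘(ℝ, V) g X p + differential 𝓘(ℝ, V) η p (X p) := by
  have hp := mem_extChartAt_source (I := 𝓘(ℝ, V)) p
  have hy := mem_extChartAt_target (I := 𝓘(ℝ, V)) p
  have e := (extChartAt 𝓘(ℝ, V) p).left_inv hp
  rw [divergence_eq_inv_mul hg (hX.smul hη) hp, divergence_eq_inv_mul hg hX hp]
  have h1 : flux g p (fun x ↦ η x • X x) =
      fun y ↦ (η ∘ (extChartAt 𝓘(ℝ, V) p).symm) y • flux g p X y := by
    funext y
    simp only [flux, rep, coord_smul, Function.comp_apply]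
    rw [smul_comm]
  have hd : DifferentiableAt ℝ (η ∘ (extChartAt 𝓘(ℝ, V) p).symm) (extChartAt 𝓘(ℝ, V) p p) :=
    ((contMDiffAt_comp_chart_iff (n := 1) hy).2 hη.contMDiffAt).differentiableAt one_ne_zero
  rw [h1, tdiv_smul hd (hX.differentiableAt_flux hg hy), differential_eq hp
    (hη.mdifferentiableAt one_ne_zero)]
  have hpos := (sqrtDet_pos hg hy).ne'
  simp only [flux, map_smul, smul_eq_mul, Function.comp_apply, rep]
  rw [e]
  field_simp

lemma divergence_add (hg : C1Metric g) {X Y : ∀ x : M, TangentSpace 𝓘(ℝ, V) x} (hX : C1Field X)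
    (hY : C1Field Y) (p : M) :
    divergence 𝓘(ℝ, V) g (fun x ↦ X x + Y x) p =
      divergence 𝓘(ℝ, V) g X p + divergence 𝓘(ℝ, V) g Y p := by
  have hp := mem_extChartAt_source (I := 𝓘(ℝ, V)) p
  have hy := mem_extChartAt_target (I := 𝓘(ℝ, V)) p
  rw [divergence_eq_inv_mul hg (hX.add hY) hp, divergence_eq_inv_mul hg hX hp,
    divergence_eq_inv_mul hg hY hp]
  have h1 : flux g p (fun x ↦ X x + Y x) = fun y ↦ flux g p X y + flux g p Y y := by
    funext y
    simp only [flux, rep, coord_add, smul_add]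
  rw [h1, tdiv_add (hX.differentiableAt_flux hg hy) (hY.differentiableAt_flux hg hy), mul_add]

lemma divergence_zero_of_eventually (hg : C1Metric g) {X : ∀ x : M, TangentSpace 𝓘(ℝ, V) x}
    (hX : C1Field X) {p : M} (h : ∀ᶠ x in 𝓝 p, X x = 0) : divergence 𝓘(ℝ, V) g X p = 0 := by
  have hp := mem_extChartAt_source (I := 𝓘(ℝ, V)) p
  rw [divergence_eq_inv_mul hg hX hp]
  have : flux g p X =ᶠ[𝓝 (extChartAt 𝓘(ℝ, V) p p)] fun _ ↦ 0 := by
    have hc : ContinuousAt (extChartAt 𝓘(ℝ, V) p).symm (extChartAt 𝓘(ℝ, V) p p) :=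
      continuousAt_extChartAt_symm p
    have h' : ∀ᶠ x in 𝓝 ((extChartAt 𝓘(ℝ, V) p).symm (extChartAt 𝓘(ℝ, V) p p)), X x = 0 := by
      rwa [extChartAt_to_inv]
    filter_upwards [hc.eventually h'] with y hy
    simp only [flux, rep, hy, coord_zero, smul_zero]
  rw [tdiv_congr this, tdiv_eq]
  simp

lemma divergence_zero_off (hg : C1Metric g) {X : ∀ x : M, TangentSpace 𝓘(ℝ, V) x}
    (hX : C1Field X) {C : Set M} (hC : IsClosed C) (h : ∀ x ∉ C, X x = 0) {p : M} (hp : p ∉ C) :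
    divergence 𝓘(ℝ, V) g X p = 0 :=
  divergence_zero_of_eventually hg hX (by
    filter_upwards [hC.isOpen_compl.mem_nhds hp] with x hx using h x hx)

variable [T2Space M] [SecondCountableTopology M]

lemma integrable_divergence (hg : C1Metric g) {X : ∀ x : M, TangentSpace 𝓘(ℝ, V) x}
    (hX : C1Field X) {C : Set M} (hC : IsCompact C) (h : ∀ x ∉ C, X x = 0) :
    Integrable (divergence 𝓘(ℝ, V) g X) (vol 𝓘(ℝ, V) g) := by
  have := isLocallyFiniteMeasure_vol hg
  refine (continuous_divergence hg hX).integrable_of_hasCompactSupport ?_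
  exact HasCompactSupport.intro hC fun x hx ↦ divergence_zero_off hg hX hC.isClosed h hx

/-- The integral of the divergence of a field supported in a chart, in coordinates. -/
lemma setIntegral_divergence_eq (hg : C1Metric g) {X : ∀ x : M, TangentSpace 𝓘(ℝ, V) x}
    (hX : C1Field X) {c : M} {C : Set M} (hC : IsClosed C)
    (hCs : C ⊆ (extChartAt 𝓘(ℝ, V) c).source) (h : ∀ x ∉ C, X x = 0) {f : M → ℝ}
    (hf : Measurable f) :
    ∫ x, f x * divergence 𝓘(ℝ, V) g X x ∂(vol 𝓘(ℝ, V) g) =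
      ∫ y in (extChartAt 𝓘(ℝ, V) c).target,
        f ((extChartAt 𝓘(ℝ, V) c).symm y) * tdiv (flux g c X) y ∂(Module.finBasis ℝ V).addHaar := by
  rw [integral_vol_eq hg c]
  · refine setIntegral_congr_fun (isOpen_extChartAt_target c).measurableSet fun y hy ↦ ?_
    have := divergence_eq hg hX ((extChartAt 𝓘(ℝ, V) c).map_target hy)
    rw [(extChartAt 𝓘(ℝ, V) c).right_inv hy] at this
    rw [mul_left_comm, this]
  · exact (hf.mul (continuous_divergence hg hX).measurable).aestronglyMeasurable
  · intro x hx
    rw [divergence_zero_off hg hX hC h fun hxC ↦ hx (hCs hxC), mul_zero]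

lemma isCompact_chart_image {c : M} {C : Set M} (hC : IsCompact C)
    (hCs : C ⊆ (extChartAt 𝓘(ℝ, V) c).source) : IsCompact (extChartAt 𝓘(ℝ, V) c '' C) :=
  hC.image_of_continuousOn ((continuousOn_extChartAt c).mono hCs)

/-- The density of a field with compact support in a chart domain extends by zero. -/
lemma contDiff_indicator_flux (hg : C1Metric g) {X : ∀ x : M, TangentSpace 𝓘(ℝ, V) x}
    (hX : C1Field X) {c : M} {C : Set M} (hC : IsCompact C)
    (hCs : C ⊆ (extChartAt 𝓘(ℝ, V) c).source) (h : ∀ x ∉ C, X x = 0) :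
    ContDiff ℝ 1 (indicator (extChartAt 𝓘(ℝ, V) c).target (flux g c X)) ∧
    ∀ y ∉ extChartAt 𝓘(ℝ, V) c '' C,
      indicator (extChartAt 𝓘(ℝ, V) c).target (flux g c X) y = 0 := by
  have h0 : ∀ y ∉ extChartAt 𝓘(ℝ, V) c '' C,
      indicator (extChartAt 𝓘(ℝ, V) c).target (flux g c X) y = 0 := by
    intro y hy
    by_cases hyt : y ∈ (extChartAt 𝓘(ℝ, V) c).target
    · rw [indicator_of_mem hyt]
      have : (extChartAt 𝓘(ℝ, V) c).symm y ∉ C := fun hyC ↦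
        hy ⟨_, hyC, (extChartAt 𝓘(ℝ, V) c).right_inv hyt⟩
      simp only [flux, rep, h _ this, coord_zero, smul_zero]
    · exact indicator_of_notMem hyt _
  refine ⟨contDiff_of_zero_off_compact (isOpen_extChartAt_target (I := 𝓘(ℝ, V)) c) ?_
    (isCompact_chart_image hC hCs) ?_ h0, h0⟩
  · exact (hX.contDiffOn_flux hg c).congr fun y hy ↦ indicator_of_mem hy _
  · rintro _ ⟨x, hx, rfl⟩
    exact (extChartAt 𝓘(ℝ, V) c).map_source (hCs hx)

lemma tdiv_indicator_flux {X : ∀ x : M, TangentSpace 𝓘(ℝ, V) x} {c : M} {y : V}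
    (hy : y ∈ (extChartAt 𝓘(ℝ, V) c).target) :
    tdiv (indicator (extChartAt 𝓘(ℝ, V) c).target (flux g c X)) y = tdiv (flux g c X) y := by
  refine tdiv_congr ?_
  filter_upwards [(isOpen_extChartAt_target c).mem_nhds hy] with z hz using indicator_of_mem hz _

lemma integral_divergence_chart (hg : C1Metric g) {X : ∀ x : M, TangentSpace 𝓘(ℝ, V) x}
    (hX : C1Field X) {c : M} {C : Set M} (hC : IsCompact C)
    (hCs : C ⊆ (extChartAt 𝓘(ℝ, V) c).source) (h : ∀ x ∉ C, X x = 0) :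
    ∫ x, divergence 𝓘(ℝ, V) g X x ∂(vol 𝓘(ℝ, V) g) = 0 := by
  have h1 := setIntegral_divergence_eq hg hX hC.isClosed hCs h (f := fun _ ↦ 1) measurable_const
  simp only [one_mul] at h1
  rw [h1]
  obtain ⟨hs, h0⟩ := contDiff_indicator_flux (V := V) hg hX hC hCs h
  have hcs : HasCompactSupport (indicator (extChartAt 𝓘(ℝ, V) c).target (flux g c X)) :=
    HasCompactSupport.intro (isCompact_chart_image hC hCs) h0
  rw [← integral_tdiv_eq_zero (Module.finBasis ℝ V).addHaar hs hcs]
  rw [← setIntegral_eq_integral_of_forall_compl_eq_zero (s := (extChartAt 𝓘(ℝ, V) c).target)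
    (f := tdiv (indicator (extChartAt 𝓘(ℝ, V) c).target (flux g c X)))]
  · exact setIntegral_congr_fun (isOpen_extChartAt_target c).measurableSet fun y hy ↦
      (tdiv_indicator_flux hy).symm
  · intro y hy
    have hyC : y ∉ extChartAt 𝓘(ℝ, V) c '' C := by
      rintro ⟨x, hx, rfl⟩
      exact hy ((extChartAt 𝓘(ℝ, V) c).map_source (hCs hx))
    have : indicator (extChartAt 𝓘(ℝ, V) c).target (flux g c X) =ᶠ[𝓝 y] fun _ ↦ 0 := by
      filter_upwards [(isCompact_chart_image hC hCs).isClosed.isOpen_compl.mem_nhds hyC] with z hz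
        using h0 z hz
    rw [tdiv_congr this, tdiv_eq]
    simp

/-- Smooth functions that sum up to one on a compact set, subordinate to a finite open cover. -/
lemma exists_finite_partition {ι : Type*} [Fintype ι] {U : ι → Set M} (hU : ∀ i, IsOpen (U i))
    {C : Set M} (hC : IsCompact C) (hCU : C ⊆ ⋃ i, U i) :
    ∃ ρ : ι → M → ℝ, (∀ i, ContMDiff 𝓘(ℝ, V) 𝓘(ℝ, ℝ) 1 (ρ i)) ∧ (∀ i x, 0 ≤ ρ i x) ∧
      (∀ i x, ρ i x ≤ 1) ∧ (∀ i, tsupport (ρ i) ⊆ U i) ∧ ∀ x ∈ C, ∑ i, ρ i x = 1 := by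
  have : LocallyCompactSpace M := ChartedSpace.locallyCompactSpace V M
  obtain ⟨f, hf⟩ := SmoothPartitionOfUnity.exists_isSubordinate 𝓘(ℝ, V) hC.isClosed U hU hCU
  refine ⟨fun i ↦ f i, fun i ↦ (f i).contMDiff.of_le (by norm_cast),
    fun i x ↦ f.nonneg i x, fun i x ↦ f.le_one i x, fun i ↦ hf i, fun x hx ↦ ?_⟩
  rw [← finsum_eq_sum_of_fintype]
  exact f.sum_eq_one hx

lemma c1Field_sum {ι : Type*} (s : Finset ι) {X : ι → ∀ x : M, TangentSpace 𝓘(ℝ, V) x}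
    (hX : ∀ i, C1Field (X i)) : C1Field fun x ↦ ∑ i ∈ s, X i x := by
  classical
  induction s using Finset.induction_on with
  | empty => simpa using c1Field_zero
  | insert i s hi ih =>
    simp only [Finset.sum_insert hi]
    exact (hX i).add ih

lemma divergence_sum (hg : C1Metric g) {ι : Type*} (s : Finset ι)
    {X : ι → ∀ x : M, TangentSpace 𝓘(ℝ, V) x} (hX : ∀ i, C1Field (X i)) (p : M) :
    divergence 𝓘(ℝ, V) g (fun x ↦ ∑ i ∈ s, X i x) p = ∑ i ∈ s, divergence 𝓘(ℝ, V) g (X i) p := by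
  classical
  induction s using Finset.induction_on with
  | empty =>
    simp only [Finset.sum_empty]
    exact divergence_zero_of_eventually hg c1Field_zero (Eventually.of_forall fun _ ↦ rfl)
  | insert i s hi ih =>
    simp only [Finset.sum_insert hi]
    rw [divergence_add hg (hX i) (c1Field_sum s hX), ih]

/-- The divergence theorem for fields with compact support. -/
theorem integral_divergence_eq_zero (hg : C1Metric g) {X : ∀ x : M, TangentSpace 𝓘(ℝ, V) x}
    (hX : C1Field X) {C : Set M} (hC : IsCompact C) (h : ∀ x ∉ C, X x = 0) :
    ∫ x, divergence 𝓘(ℝ, V) g X x ∂(vol 𝓘(ℝ, V) g) = 0 := by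
  obtain ⟨t, ht⟩ := hC.elim_finite_subcover (fun c : M ↦ (extChartAt 𝓘(ℝ, V) c).source)
    (fun c ↦ isOpen_extChartAt_source c) fun x _ ↦ mem_iUnion.2 ⟨x, mem_extChartAt_source x⟩
  obtain ⟨ρ, hρ, -, -, hsub, hsum⟩ := exists_finite_partition (V := V)
    (U := fun c : t ↦ (extChartAt 𝓘(ℝ, V) (c : M)).source)
    (fun c ↦ isOpen_extChartAt_source _) hC (by
      intro x hx
      obtain ⟨c, hc, hxc⟩ := mem_iUnion₂.1 (ht hx)
      exact mem_iUnion.2 ⟨⟨c, hc⟩, hxc⟩)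
  have hXs : X = fun x ↦ ∑ c, ρ c x • X x := by
    funext x
    by_cases hx : x ∈ C
    · rw [← Finset.sum_smul, hsum x hx, one_smul]
    · simp [h x hx]
  have hfield : ∀ c, C1Field fun x ↦ ρ c x • X x := fun c ↦ hX.smul (hρ c)
  have hzero : ∀ c, ∀ x ∉ C ∩ tsupport (ρ c), ρ c x • X x = 0 := by
    intro c x hx
    by_cases hxC : x ∈ C
    · rw [image_eq_zero_of_notMem_tsupport fun h' ↦ hx ⟨hxC, h'⟩, zero_smul]
    · rw [h x hxC, smul_zero]
  have hcomp : ∀ c, IsCompact (C ∩ tsupport (ρ c)) := fun c ↦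
    hC.inter_right (isClosed_tsupport _)
  rw [hXs]
  simp only [divergence_sum hg Finset.univ hfield]
  rw [integral_finsetSum _ fun c _ ↦ integrable_divergence hg (hfield c) (hcomp c) (hzero c)]
  exact Finset.sum_eq_zero fun c _ ↦ integral_divergence_chart hg (hfield c) (hcomp c)
    (inter_subset_right.trans (hsub c)) (hzero c)

end Divergence

end STIMCF
end

noncomputable section
namespace STIMCF
set_option linter.unusedSectionVars false

section Variation

variable {V : Type*} [NormedAddCommGroup V] [NormedSpace ℝ V] [FiniteDimensional ℝ V]
  [MeasurableSpace V] [BorelSpace V]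
  {M : Type*} [TopologicalSpace M] [ChartedSpace V M] [IsManifold 𝓘(ℝ, V) ∞ M]
  [MeasurableSpace M] [BorelSpace M] [T2Space M] [SecondCountableTopology M]
  {g : TensorField 𝓘(ℝ, V) M}

lemma C1Metric.convex (hg : C1Metric g) (x : M) {v w : TangentSpace 𝓘(ℝ, V) x} {a b r : ℝ}
    (ha : 0 ≤ a) (hb : 0 ≤ b) (hab : a + b = 1) (hv : g x v v ≤ r) (hw : g x w w ≤ r) :
    g x (a • v + b • w) (a • v + b • w) ≤ r := by
  have h0 : 0 ≤ g x (v + (-1 : ℝ) • w) (v + (-1 : ℝ) • w) := by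
    by_cases h : v + (-1 : ℝ) • w = 0
    · rw [h, hg.zero]
    · exact (hg.pos _ _ h).le
  simp only [hg.add_left, hg.add_right, hg.smul_left, hg.smul_right] at h0 ⊢
  rw [hg.symm x w v] at h0 ⊢
  have h1 : a * b * (g x v w + g x v w) ≤ a * b * (g x v v + g x w w) :=
    mul_le_mul_of_nonneg_left (by linarith) (mul_nonneg ha hb)
  have h2 : a * (a * g x v v) + b * (b * g x w w) + a * b * (g x v v + g x w w) ≤ r := by
    have : a * (a * g x v v) + b * (b * g x w w) + a * b * (g x v v + g x w w) =
      (a + b) * (a * g x v v + b * g x w w) := by ring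
    rw [this, hab, one_mul]
    have hr : r = a * r + b * r := by rw [← add_mul, hab, one_mul]
    rw [hr]
    exact add_le_add (mul_le_mul_of_nonneg_left hv ha) (mul_le_mul_of_nonneg_left hw hb)
  linarith

lemma le_variation {E U : Set M} {X : ∀ x : M, TangentSpace 𝓘(ℝ, V) x}
    (hX : IsTestField 𝓘(ℝ, V) g U X) :
    ENNReal.ofReal (∫ x in E, divergence 𝓘(ℝ, V) g X x ∂(vol 𝓘(ℝ, V) g)) ≤
      variation 𝓘(ℝ, V) g E U :=
  le_iSup₂ (f := fun X (_ : IsTestField 𝓘(ℝ, V) g U X) ↦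
    ENNReal.ofReal (∫ x in E, divergence 𝓘(ℝ, V) g X x ∂(vol 𝓘(ℝ, V) g))) X hX

lemma integral_le_variation {E U : Set M} {X : ∀ x : M, TangentSpace 𝓘(ℝ, V) x}
    (hX : IsTestField 𝓘(ℝ, V) g U X) (hf : variation 𝓘(ℝ, V) g E U ≠ ⊤) :
    ∫ x in E, divergence 𝓘(ℝ, V) g X x ∂(vol 𝓘(ℝ, V) g) ≤
      (variation 𝓘(ℝ, V) g E U).toReal :=
  (ENNReal.ofReal_le_iff_le_toReal hf).1 (le_variation hX)

lemma IsTestField.mono {U U' : Set M} (h : U ⊆ U') {X : ∀ x : M, TangentSpace 𝓘(ℝ, V) x}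
    (hX : IsTestField 𝓘(ℝ, V) g U X) : IsTestField 𝓘(ℝ, V) g U' X := by
  obtain ⟨h1, h2, C, h3, h4, h5⟩ := hX
  exact ⟨h1, h2, C, h3, h4.trans h, h5⟩

lemma variation_mono {E U U' : Set M} (h : U ⊆ U') :
    variation 𝓘(ℝ, V) g E U ≤ variation 𝓘(ℝ, V) g E U' :=
  iSup₂_le fun _ hX ↦ le_variation (hX.mono h)

lemma IsTestField.smul (hg : C1Metric g) {U U' : Set M} {X : ∀ x : M, TangentSpace 𝓘(ℝ, V) x}
    (hX : IsTestField 𝓘(ℝ, V) g U X) {η : M → ℝ} (hη : ContMDiff 𝓘(ℝ, V) 𝓘(ℝ, ℝ) 1 η)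
    (h0 : ∀ x, 0 ≤ η x) (h1 : ∀ x, η x ≤ 1) (hsupp : U ∩ tsupport η ⊆ U') :
    IsTestField 𝓘(ℝ, V) g U' fun x ↦ η x • X x := by
  obtain ⟨hX1, hX2, C, hC, hCU, hC0⟩ := hX
  refine ⟨C1Field.smul hX1 hη, fun x ↦ ?_, C ∩ tsupport η, hC.inter_right (isClosed_tsupport _),
    (inter_subset_inter_left _ hCU).trans hsupp, fun x hx ↦ ?_⟩
  · rw [hg.smul_left, hg.smul_right, ← mul_assoc]
    exact mul_le_one₀ (mul_le_one₀ (h1 x) (h0 x) (h1 x))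
      (by by_cases h : X x = 0
          · rw [h, hg.zero]
          · exact (hg.pos _ _ h).le) (hX2 x)
  · beta_reduce
    by_cases hxC : x ∈ C
    · rw [image_eq_zero_of_notMem_tsupport fun h' ↦ hx ⟨hxC, h'⟩, zero_smul]
    · rw [hC0 x hxC, smul_zero]

lemma IsTestField.integrable (hg : C1Metric g) {U : Set M} {X : ∀ x : M, TangentSpace 𝓘(ℝ, V) x}
    (hX : IsTestField 𝓘(ℝ, V) g U X) :
    Integrable (divergence 𝓘(ℝ, V) g X) (vol 𝓘(ℝ, V) g) := by
  obtain ⟨hX1, -, C, hC, -, hC0⟩ := hX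
  exact integrable_divergence hg hX1 hC hC0

lemma IsTestField.integral_eq_zero (hg : C1Metric g) {U : Set M}
    {X : ∀ x : M, TangentSpace 𝓘(ℝ, V) x} (hX : IsTestField 𝓘(ℝ, V) g U X) :
    ∫ x, divergence 𝓘(ℝ, V) g X x ∂(vol 𝓘(ℝ, V) g) = 0 := by
  obtain ⟨hX1, -, C, hC, -, hC0⟩ := hX
  exact integral_divergence_eq_zero hg hX1 hC hC0

lemma IsTestField.divergence_eq_zero (hg : C1Metric g) {U : Set M}
    {X : ∀ x : M, TangentSpace 𝓘(ℝ, V) x} (hX : IsTestField 𝓘(ℝ, V) g U X) {x : M} (hx : x ∉ U) :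
    divergence 𝓘(ℝ, V) g X x = 0 := by
  obtain ⟨hX1, -, C, hC, hCU, hC0⟩ := hX
  exact divergence_zero_off hg hX1 hC.isClosed hC0 fun h ↦ hx (hCU h)

/-- The variation is countably subadditive on open sets. -/
lemma variation_iUnion_le (hg : C1Metric g) {E : Set M} {ι : Type*} {U : ι → Set M}
    (hU : ∀ i, IsOpen (U i)) :
    variation 𝓘(ℝ, V) g E (⋃ i, U i) ≤ ∑' i, variation 𝓘(ℝ, V) g E (U i) := by
  refine iSup₂_le fun X hX ↦ ?_
  obtain ⟨hX1, hX2, C, hC, hCU, hC0⟩ := id hX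
  obtain ⟨t, ht⟩ := hC.elim_finite_subcover U hU hCU
  obtain ⟨ρ, hρ, hρ0, hρ1, hsub, hsum⟩ := exists_finite_partition (V := V)
    (U := fun i : t ↦ U i) (fun i ↦ hU _) hC (by
      intro x hx
      obtain ⟨c, hc, hxc⟩ := mem_iUnion₂.1 (ht hx)
      exact mem_iUnion.2 ⟨⟨c, hc⟩, hxc⟩)
  have hXs : X = fun x ↦ ∑ c, ρ c x • X x := by
    funext x
    by_cases hx : x ∈ C
    · rw [← Finset.sum_smul, hsum x hx, one_smul]
    · simp [hC0 x hx]
  have htest : ∀ c : t, IsTestField 𝓘(ℝ, V) g (U c) fun x ↦ ρ c x • X x := fun c ↦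
    hX.smul hg (hρ c) (hρ0 c) (hρ1 c) (inter_subset_right.trans (hsub c))
  rw [hXs]
  simp only [divergence_sum hg Finset.univ fun c ↦ (htest c).1]
  rw [integral_finsetSum _ fun c _ ↦ ((htest c).integrable hg).integrableOn]
  calc ENNReal.ofReal (∑ c : t, ∫ x in E, divergence 𝓘(ℝ, V) g (fun x ↦ ρ c x • X x) x
          ∂(vol 𝓘(ℝ, V) g))
      ≤ ∑ c : t, ENNReal.ofReal (∫ x in E, divergence 𝓘(ℝ, V) g (fun x ↦ ρ c x • X x) x
          ∂(vol 𝓘(ℝ, V) g)) := by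
        classical
        refine Finset.le_sum_of_subadditive _ ENNReal.ofReal_zero.le (fun a b ↦ ENNReal.ofReal_add_le) _ _
    _ ≤ ∑ c : t, variation 𝓘(ℝ, V) g E (U c) :=
        Finset.sum_le_sum fun c _ ↦ le_variation (htest c)
    _ = ∑ c ∈ t, variation 𝓘(ℝ, V) g E (U c) :=
        Finset.sum_coe_sort t fun c ↦ variation 𝓘(ℝ, V) g E (U c)
    _ ≤ _ := ENNReal.sum_le_tsum t

/-- The variation is superadditive on disjoint open sets. -/
lemma add_variation_le (hg : C1Metric g) {E U U' : Set M} (hd : Disjoint U U') :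
    variation 𝓘(ℝ, V) g E U + variation 𝓘(ℝ, V) g E U' ≤ variation 𝓘(ℝ, V) g E (U ∪ U') := by
  have hz : IsTestField 𝓘(ℝ, V) g (∅ : Set M) fun _ ↦ 0 :=
    ⟨c1Field_zero, fun x ↦ by rw [hg.zero]; norm_num, ∅, isCompact_empty, Subset.rfl, fun _ _ ↦ rfl⟩
  have key : ∀ X, IsTestField 𝓘(ℝ, V) g U X → ∀ Y, IsTestField 𝓘(ℝ, V) g U' Y →
      (∫ x in E, divergence 𝓘(ℝ, V) g X x ∂(vol 𝓘(ℝ, V) g)) +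
        ∫ x in E, divergence 𝓘(ℝ, V) g Y x ∂(vol 𝓘(ℝ, V) g) =
      ∫ x in E, divergence 𝓘(ℝ, V) g (fun x ↦ X x + Y x) x ∂(vol 𝓘(ℝ, V) g) ∧
      IsTestField 𝓘(ℝ, V) g (U ∪ U') fun x ↦ X x + Y x := by
    intro X hX Y hY
    refine ⟨?_, ?_⟩
    · rw [← integral_add (hX.integrable hg).integrableOn (hY.integrable hg).integrableOn]
      simp only [divergence_add hg hX.1 hY.1]
    obtain ⟨hX1, hX2, C, hC, hCU, hC0⟩ := hX
    obtain ⟨hY1, hY2, D, hD, hDU, hD0⟩ := hY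
    refine ⟨C1Field.add hX1 hY1, fun x ↦ ?_, C ∪ D, hC.union hD, union_subset_union hCU hDU,
      fun x hx ↦ by beta_reduce; rw [hC0 x fun h ↦ hx (Or.inl h), hD0 x fun h ↦ hx (Or.inr h), add_zero]⟩
    beta_reduce
    by_cases hx : x ∈ C
    · rw [hD0 x fun h ↦ disjoint_left.1 hd (hCU hx) (hDU h), add_zero]
      exact hX2 x
    · rw [hC0 x hx, zero_add]
      exact hY2 x
  unfold variation
  refine ENNReal.biSup_add_biSup_le' ⟨_, hz.mono (empty_subset _)⟩ ⟨_, hz.mono (empty_subset _)⟩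
    fun X hX Y hY ↦ ?_
  obtain ⟨h1, h2⟩ := key X hX Y hY
  by_cases hx : 0 ≤ ∫ x in E, divergence 𝓘(ℝ, V) g X x ∂(vol 𝓘(ℝ, V) g)
  · by_cases hy : 0 ≤ ∫ x in E, divergence 𝓘(ℝ, V) g Y x ∂(vol 𝓘(ℝ, V) g)
    · rw [← ENNReal.ofReal_add hx hy, h1]
      exact le_variation h2
    · rw [ENNReal.ofReal_of_nonpos (not_le.1 hy).le, add_zero]
      exact le_variation (hX.mono subset_union_left)
  · rw [ENNReal.ofReal_of_nonpos (not_le.1 hx).le, zero_add]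
    exact le_variation (hY.mono subset_union_right)

lemma variation_congr (hg : C1Metric g) {E E' U : Set M} (hE : MeasurableSet E)
    (hE' : MeasurableSet E') (h : ∀ᵐ x ∂(vol 𝓘(ℝ, V) g), x ∈ U → (x ∈ E ↔ x ∈ E')) :
    variation 𝓘(ℝ, V) g E U = variation 𝓘(ℝ, V) g E' U := by
  unfold variation
  refine iSup_congr fun X ↦ iSup_congr fun hX ↦ ?_
  rw [← integral_indicator hE, ← integral_indicator hE']
  congr 1
  refine integral_congr_ae ?_
  filter_upwards [h] with x hx
  by_cases hxU : x ∈ U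
  · by_cases hxE : x ∈ E
    · rw [indicator_of_mem hxE, indicator_of_mem ((hx hxU).1 hxE)]
    · rw [indicator_of_notMem hxE, indicator_of_notMem fun h ↦ hxE ((hx hxU).2 h)]
  · have := hX.divergence_eq_zero hg hxU
    simp [indicator, this]

/-- Lower semicontinuity of the variation. -/
lemma variation_le_of_tendsto (hg : C1Metric g) {E U : Set M} {Ek : ℕ → Set M}
    (hE : MeasurableSet E) (hEk : ∀ k, MeasurableSet (Ek k))
    (h : ∀ᵐ x ∂(vol 𝓘(ℝ, V) g), ∀ᶠ k in atTop, (x ∈ Ek k ↔ x ∈ E)) {B : ℕ → ℝ≥0∞} {b : ℝ≥0∞}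
    (hb : ∀ᶠ k in atTop, variation 𝓘(ℝ, V) g (Ek k) U ≤ B k) (hB : Tendsto B atTop (𝓝 b)) :
    variation 𝓘(ℝ, V) g E U ≤ b := by
  refine iSup₂_le fun X hX ↦ ?_
  have hlim : Tendsto (fun k ↦ ∫ x in Ek k, divergence 𝓘(ℝ, V) g X x ∂(vol 𝓘(ℝ, V) g)) atTop
      (𝓝 (∫ x in E, divergence 𝓘(ℝ, V) g X x ∂(vol 𝓘(ℝ, V) g))) := by
    simp only [← integral_indicator hE, ← integral_indicator (hEk _)]
    refine tendsto_integral_of_dominated_convergence (fun x ↦ ‖divergence 𝓘(ℝ, V) g X x‖)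
      (fun k ↦ ((hX.integrable hg).aestronglyMeasurable.indicator (hEk k)))
      (hX.integrable hg).norm (fun k ↦ Eventually.of_forall fun x ↦ norm_indicator_le_norm_self _ _) ?_
    filter_upwards [h] with x hx
    refine tendsto_const_nhds.congr' ?_
    filter_upwards [hx] with k hk
    by_cases hxE : x ∈ E
    · rw [indicator_of_mem hxE, indicator_of_mem (hk.2 hxE)]
    · rw [indicator_of_notMem hxE, indicator_of_notMem fun h ↦ hxE (hk.1 h)]
  refine le_of_tendsto_of_tendsto (ENNReal.tendsto_ofReal hlim) hB ?_
  filter_upwards [hb] with k hk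
  exact (le_variation hX).trans hk

lemma perimeter_eq_variation {E U : Set M} (hU : IsOpen U) :
    perimeter 𝓘(ℝ, V) g E U = variation 𝓘(ℝ, V) g E U :=
  le_antisymm (iInf_le_of_le U (iInf_le_of_le hU (iInf_le_of_le Subset.rfl le_rfl)))
    (le_iInf fun _ ↦ le_iInf fun _ ↦ le_iInf fun h ↦ variation_mono h)

lemma perimeter_mono {E A B : Set M} (h : A ⊆ B) :
    perimeter 𝓘(ℝ, V) g E A ≤ perimeter 𝓘(ℝ, V) g E B :=
  le_iInf fun U ↦ le_iInf fun hU ↦ le_iInf fun hB ↦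
    iInf_le_of_le U (iInf_le_of_le hU (iInf_le_of_le (h.trans hB) le_rfl))

lemma perimeter_le_variation {E A U : Set M} (hU : IsOpen U) (h : A ⊆ U) :
    perimeter 𝓘(ℝ, V) g E A ≤ variation 𝓘(ℝ, V) g E U :=
  (perimeter_mono h).trans (perimeter_eq_variation hU).le

lemma exists_open_variation_lt {E A : Set M} {b : ℝ≥0∞} (h : perimeter 𝓘(ℝ, V) g E A < b) :
    ∃ U, IsOpen U ∧ A ⊆ U ∧ variation 𝓘(ℝ, V) g E U < b := by
  simp only [perimeter, iInf_lt_iff] at h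
  obtain ⟨U, hU, hA, hb⟩ := h
  exact ⟨U, hU, hA, hb⟩

lemma perimeter_congr (hg : C1Metric g) {E E' U A : Set M} (hE : MeasurableSet E)
    (hE' : MeasurableSet E') (hU : IsOpen U) (hA : A ⊆ U)
    (h : ∀ᵐ x ∂(vol 𝓘(ℝ, V) g), x ∈ U → (x ∈ E ↔ x ∈ E')) :
    perimeter 𝓘(ℝ, V) g E A = perimeter 𝓘(ℝ, V) g E' A := by
  have key : ∀ E E' : Set M, MeasurableSet E → MeasurableSet E' →
      (∀ᵐ x ∂(vol 𝓘(ℝ, V) g), x ∈ U → (x ∈ E ↔ x ∈ E')) →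
      perimeter 𝓘(ℝ, V) g E A ≤ perimeter 𝓘(ℝ, V) g E' A := by
    intro E E' hE hE' h
    refine le_iInf fun W ↦ le_iInf fun hW ↦ le_iInf fun hAW ↦ ?_
    refine (perimeter_le_variation (hW.inter hU) (subset_inter hAW hA)).trans ?_
    rw [variation_congr hg hE hE' (by filter_upwards [h] with x hx using fun hxU ↦ hx hxU.2)]
    exact variation_mono inter_subset_left
  exact le_antisymm (key _ _ hE hE' h)
    (key _ _ hE' hE (by filter_upwards [h] with x hx using fun hxU ↦ (hx hxU).symm))

/-- The total variation measure as an outer measure. -/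
def perimeterOuter (hg : C1Metric g) (E : Set M) : OuterMeasure M where
  measureOf := perimeter 𝓘(ℝ, V) g E
  empty := by
    rw [perimeter_eq_variation isOpen_empty]
    have := variation_iUnion_le hg (E := E) (U := fun i : Empty ↦ (∅ : Set M)) (fun _ ↦ isOpen_empty)
    simpa using this
  mono h := perimeter_mono h
  iUnion_nat s _ := by
    refine ENNReal.le_of_forall_pos_le_add fun ε hε hb ↦ ?_
    obtain ⟨ε', hε', hsum⟩ := ENNReal.exists_pos_sum_of_countable
      (ENNReal.coe_pos.2 hε).ne' ℕ
    have hlt : ∀ i, perimeter 𝓘(ℝ, V) g E (s i) <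
        perimeter 𝓘(ℝ, V) g E (s i) + ε' i := fun i ↦ by
      refine ENNReal.lt_add_right ?_ (by simpa using (hε' i).ne')
      exact ((ENNReal.le_tsum i).trans_lt hb).ne
    choose U hU hsU hUlt using fun i ↦ exists_open_variation_lt (hlt i)
    calc perimeter 𝓘(ℝ, V) g E (⋃ i, s i) ≤ variation 𝓘(ℝ, V) g E (⋃ i, U i) :=
          perimeter_le_variation (isOpen_iUnion hU) (iUnion_mono hsU)
      _ ≤ ∑' i, variation 𝓘(ℝ, V) g E (U i) := variation_iUnion_le hg hU
      _ ≤ ∑' i, (perimeter 𝓘(ℝ, V) g E (s i) + ε' i) := ENNReal.tsum_le_tsum fun i ↦ (hUlt i).le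
      _ = (∑' i, perimeter 𝓘(ℝ, V) g E (s i)) + ∑' i, (ε' i : ℝ≥0∞) := ENNReal.tsum_add
      _ ≤ _ := by gcongr

lemma perimeterOuter_apply (hg : C1Metric g) (E A : Set M) :
    perimeterOuter hg E A = perimeter 𝓘(ℝ, V) g E A := rfl

lemma perimeter_union_le (hg : C1Metric g) (E A B : Set M) :
    perimeter 𝓘(ℝ, V) g E (A ∪ B) ≤ perimeter 𝓘(ℝ, V) g E A + perimeter 𝓘(ℝ, V) g E B :=
  measure_union_le (μ := perimeterOuter hg E) A B

lemma perimeter_eq_zero_of_subset (hg : C1Metric g) {E O : Set M}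
    (hO : IsOpen O) (h : O ⊆ E) : perimeter 𝓘(ℝ, V) g E O = 0 := by
  rw [perimeter_eq_variation hO, ← nonpos_iff_eq_zero]
  refine iSup₂_le fun X hX ↦ ?_
  have : ∫ x in E, divergence 𝓘(ℝ, V) g X x ∂(vol 𝓘(ℝ, V) g) = 0 := by
    rw [setIntegral_eq_integral_of_forall_compl_eq_zero, hX.integral_eq_zero hg]
    exact fun x hx ↦ hX.divergence_eq_zero hg fun hxO ↦ hx (h hxO)
  simp [this]

lemma perimeter_eq_zero_of_disjoint (hg : C1Metric g) {E O : Set M}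
    (hO : IsOpen O) (h : Disjoint O E) : perimeter 𝓘(ℝ, V) g E O = 0 := by
  rw [perimeter_eq_variation hO, ← nonpos_iff_eq_zero]
  refine iSup₂_le fun X hX ↦ ?_
  have : ∫ x in E, divergence 𝓘(ℝ, V) g X x ∂(vol 𝓘(ℝ, V) g) = 0 :=
    setIntegral_eq_zero_of_forall_eq_zero fun x hx ↦
      hX.divergence_eq_zero hg fun hxO ↦ disjoint_left.1 h hxO hx
  simp [this]

end Variation

section PerimeterMeasure

variable {V : Type*} [NormedAddCommGroup V] [NormedSpace ℝ V] [FiniteDimensional ℝ V]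
  [MeasurableSpace V] [BorelSpace V]
  {M : Type*} [EMetricSpace M] [ChartedSpace V M] [IsManifold 𝓘(ℝ, V) ∞ M]
  [MeasurableSpace M] [BorelSpace M] [SecondCountableTopology M]
  {g : TensorField 𝓘(ℝ, V) M}

lemma isMetric_perimeterOuter (hg : C1Metric g) (E : Set M) : (perimeterOuter hg E).IsMetric := by
  intro s t hst
  refine le_antisymm (measure_union_le s t) ?_
  obtain ⟨r, hr, hrd⟩ := hst
  set O := fun s : Set M ↦ ⋃ x ∈ s, Metric.eball x (r / 2)
  have hO : ∀ s, IsOpen (O s) := fun s ↦ isOpen_biUnion fun _ _ ↦ Metric.isOpen_eball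
  have hsO : ∀ s, s ⊆ O s := fun s x hx ↦ mem_biUnion hx (Metric.mem_eball_self (ENNReal.half_pos hr))
  have hd : Disjoint (O s) (O t) := by
    rw [disjoint_left]
    intro z hz hz'
    obtain ⟨x, hx, hzx⟩ := mem_iUnion₂.1 hz
    obtain ⟨y, hy, hzy⟩ := mem_iUnion₂.1 hz'
    have h1 := hrd x hx y hy
    have h2 : edist x y < r / 2 + r / 2 := by
      refine (edist_triangle_left x y z).trans_lt (ENNReal.add_lt_add ?_ ?_)
      · exact hzx
      · exact hzy
    rw [ENNReal.add_halves] at h2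
    exact absurd h2 (not_lt.2 h1)
  simp only [perimeterOuter_apply]
  refine le_iInf fun W ↦ le_iInf fun hW ↦ le_iInf fun hsW ↦ ?_
  calc perimeter 𝓘(ℝ, V) g E s + perimeter 𝓘(ℝ, V) g E t
      ≤ variation 𝓘(ℝ, V) g E (W ∩ O s) + variation 𝓘(ℝ, V) g E (W ∩ O t) :=
        add_le_add (perimeter_le_variation (hW.inter (hO s))
          (subset_inter (subset_union_left.trans hsW) (hsO s)))
          (perimeter_le_variation (hW.inter (hO t))
          (subset_inter (subset_union_right.trans hsW) (hsO t)))
    _ ≤ variation 𝓘(ℝ, V) g E (W ∩ O s ∪ W ∩ O t) :=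
        add_variation_le hg (hd.mono inter_subset_right inter_subset_right)
    _ ≤ _ := variation_mono (union_subset inter_subset_left inter_subset_left)

/-- The total variation measure of the characteristic function of `E`. -/
def perimeterMeasure (hg : C1Metric g) (E : Set M) : Measure M :=
  (perimeterOuter hg E).toMeasure (by
    exact (‹BorelSpace M›.measurable_eq.le).trans (isMetric_perimeterOuter hg E).borel_le_caratheodory)

lemma perimeterMeasure_apply (hg : C1Metric g) (E : Set M) {A : Set M} (hA : MeasurableSet A) :
    perimeterMeasure hg E A = perimeter 𝓘(ℝ, V) g E A :=
  toMeasure_apply _ _ hA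

end PerimeterMeasure

end STIMCF
end

noncomputable section
namespace STIMCF
set_option linter.unusedSectionVars false

section EuclideanTests

open scoped Pointwise

variable {V : Type*} [NormedAddCommGroup V] [NormedSpace ℝ V] [FiniteDimensional ℝ V]
  [MeasurableSpace V] [BorelSpace V]

/-- A continuous family of squared norms on `V`, parametrized by the points of `O`. -/
structure FormField (A : V → V → ℝ) (O : Set V) : Prop where
  continuousOn : ContinuousOn (fun p : V × V ↦ A p.1 p.2) (O ×ˢ univ)
  smul : ∀ y ∈ O, ∀ (a : ℝ) q, A y (a • q) = a ^ 2 * A y q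
  convex : ∀ y ∈ O, ∀ r : ℝ, Convex ℝ {q | A y q ≤ r}
  pos : ∀ y ∈ O, ∀ q ≠ 0, 0 < A y q

/-- Compactly supported `C¹` maps bounded by one with respect to the norms `√A`. -/
def EuclidTest (A : V → V → ℝ) (O : Set V) (Q : V → V) : Prop :=
  ContDiff ℝ 1 Q ∧ (∀ y ∈ O, A y (Q y) ≤ 1) ∧ ∃ K, IsCompact K ∧ K ⊆ O ∧ ∀ y ∉ K, Q y = 0

variable {A : V → V → ℝ} {O : Set V}

lemma FormField.zero (hA : FormField A O) {y : V} (hy : y ∈ O) : A y 0 = 0 := by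
  have := hA.smul y hy 0 0
  simpa using this

lemma FormField.nonneg (hA : FormField A O) {y : V} (hy : y ∈ O) (q : V) : 0 ≤ A y q := by
  rcases eq_or_ne q 0 with rfl | h
  · exact (hA.zero hy).ge
  · exact (hA.pos y hy q h).le

lemma FormField.continuous (hA : FormField A O) {y : V} (hy : y ∈ O) : Continuous (A y) := by
  rw [← continuousOn_univ]
  exact hA.continuousOn.comp (f := fun q ↦ (y, q)) (by fun_prop) fun q _ ↦ ⟨hy, mem_univ _⟩

lemma FormField.eventually_le (hA : FormField A O) (hO : IsOpen O) {K : Set V} (hK : IsCompact K)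
    (hKO : K ⊆ O) {l : ℝ} (hl : 1 < l) :
    ∀ᶠ h in 𝓝 (0 : V), ∀ k ∈ K, k + h ∈ O ∧ ∀ q, A (k + h) q ≤ l * A k q := by
  have h1 : ∀ᶠ h in 𝓝 (0 : V), ∀ k ∈ K, k + h ∈ O := by
    refine hK.eventually_forall_of_forall_eventually fun k hk ↦ ?_
    have : ContinuousAt (fun z : V × V ↦ z.2 + z.1) (0, k) := by fun_prop
    exact this (hO.mem_nhds (by simpa using hKO hk))
  have h2 : ∀ᶠ h in 𝓝 (0 : V), ∀ p ∈ K ×ˢ Metric.sphere (0 : V) 1,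
      A (p.1 + h) p.2 < l * A p.1 p.2 := by
    refine (hK.prod (isCompact_sphere _ _)).eventually_forall_of_forall_eventually fun p hp ↦ ?_
    have hat : ∀ q : V × V, q.1 ∈ O → ContinuousAt (fun p : V × V ↦ A p.1 p.2) q := fun q hq ↦
      hA.continuousOn.continuousAt ((hO.prod isOpen_univ).mem_nhds ⟨hq, mem_univ _⟩)
    have hpO := hKO hp.1
    have c1 : ContinuousAt (fun z : V × (V × V) ↦ A (z.2.1 + z.1) z.2.2) (0, p) := by
      refine ContinuousAt.comp (g := fun p : V × V ↦ A p.1 p.2)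
        (f := fun z : V × (V × V) ↦ (z.2.1 + z.1, z.2.2)) (hat _ (by simpa using hpO)) (by fun_prop)
    have c2 : ContinuousAt (fun z : V × (V × V) ↦ l * A z.2.1 z.2.2) (0, p) := by
      refine continuousAt_const.mul (ContinuousAt.comp (g := fun p : V × V ↦ A p.1 p.2)
        (f := fun z : V × (V × V) ↦ (z.2.1, z.2.2)) (hat _ (by simpa using hpO)) (by fun_prop))
    refine c1.eventually_lt c2 ?_
    have hne : p.2 ≠ 0 := by
      rintro h
      have := hp.2
      simp [h] at this
    have := hA.pos _ hpO _ hne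
    simp only [add_zero]
    nlinarith
  filter_upwards [h1, h2] with h h1 h2 k hk
  refine ⟨h1 k hk, fun q ↦ ?_⟩
  rcases eq_or_ne q 0 with rfl | hq
  · rw [hA.zero (h1 k hk), hA.zero (hKO hk)]; simp
  · have hn : ‖q‖ ≠ 0 := norm_ne_zero_iff.2 hq
    have e : q = ‖q‖ • (‖q‖⁻¹ • q) := by rw [smul_smul, mul_inv_cancel₀ hn, one_smul]
    have := (h2 (k, ‖q‖⁻¹ • q) ⟨hk, by simp [norm_smul, hn]⟩).le
    rw [e, hA.smul _ (h1 k hk), hA.smul _ (hKO hk)]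
    simp only at this
    nlinarith [sq_nonneg ‖q‖]

lemma EuclidTest.combination (hA : FormField A O) {X Y : V → V} (hX : EuclidTest A O X)
    (hY : EuclidTest A O Y) {θ : V → ℝ} (hθ : ContDiff ℝ 1 θ) (h0 : ∀ x, 0 ≤ θ x)
    (h1 : ∀ x, θ x ≤ 1) : EuclidTest A O fun x ↦ θ x • X x + (1 - θ x) • Y x := by
  obtain ⟨hX1, hX2, C, hC, hCU, hC0⟩ := hX
  obtain ⟨hY1, hY2, D, hD, hDU, hD0⟩ := hY
  refine ⟨(hθ.smul hX1).add ((contDiff_const.sub hθ).smul hY1), fun y hy ↦ ?_, C ∪ D, hC.union hD,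
    union_subset hCU hDU, fun y hy ↦ ?_⟩
  · exact hA.convex y hy 1 (hX2 y hy) (hY2 y hy) (h0 y) (by linarith [h1 y]) (by ring)
  · rw [mem_union, not_or] at hy
    beta_reduce
    rw [hC0 y hy.1, hD0 y hy.2, smul_zero, smul_zero, add_zero]

lemma EuclidTest.hasCompactSupport {Q : V → V} (hQ : EuclidTest A O Q) : HasCompactSupport Q := by
  obtain ⟨-, -, K, hK, -, h0⟩ := hQ
  exact HasCompactSupport.intro hK h0

variable (μ : Measure V) [μ.IsAddHaarMeasure]

/-- The mollification of `f` by the normalized bump function `η`. -/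
def mollify {F : Type*} [NormedAddCommGroup F] [NormedSpace ℝ F] (η : ContDiffBump (0 : V))
    (f : V → F) : V → F :=
  convolution (η.normed μ) f (ContinuousLinearMap.lsmul ℝ ℝ) μ

lemma mollify_apply {F : Type*} [NormedAddCommGroup F] [NormedSpace ℝ F] (η : ContDiffBump (0 : V))
    (f : V → F) (y : V) : mollify μ η f y = ∫ t, η.normed μ t • f (y - t) ∂μ := rfl

/-- Mollification averages over a ball. -/
lemma mollify_mem {F : Type*} [NormedAddCommGroup F] [NormedSpace ℝ F] [CompleteSpace F]
    (η : ContDiffBump (0 : V)) {f : V → F} {S : Set F} (hS : Convex ℝ S) (hS' : IsClosed S) {y : V}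
    (hf : Integrable (fun t ↦ η.normed μ t • f (y - t)) μ)
    (h : ∀ᵐ t ∂μ, ‖t‖ < η.rOut → f (y - t) ∈ S) : mollify μ η f y ∈ S := by
  have hm : Measurable fun t ↦ ENNReal.ofReal (η.normed μ t) :=
    (η.continuous_normed).measurable.ennreal_ofReal
  have hlt : ∀ᵐ t ∂μ, ENNReal.ofReal (η.normed μ t) < ⊤ := by simp
  have e : mollify μ η f y = ∫ t, f (y - t) ∂(μ.withDensity fun t ↦ ENNReal.ofReal (η.normed μ t)) := by
    rw [integral_withDensity_eq_integral_toReal_smul hm hlt, mollify_apply]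
    simp [ENNReal.toReal_ofReal (η.nonneg_normed _)]
  have hp : IsProbabilityMeasure (μ.withDensity fun t ↦ ENNReal.ofReal (η.normed μ t)) := by
    refine ⟨?_⟩
    rw [withDensity_apply _ MeasurableSet.univ, Measure.restrict_univ,
      ← ofReal_integral_eq_lintegral_ofReal η.integrable_normed
        (Eventually.of_forall η.nonneg_normed), η.integral_normed, ENNReal.ofReal_one]
  rw [e]
  refine hS.integral_mem hS' ?_ ?_
  · rw [ae_withDensity_iff hm]
    filter_upwards [h] with t ht h0
    refine ht ?_
    have : t ∈ Function.support (η.normed μ) := by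
      rintro h; exact h0 (by simp [h])
    rwa [η.support_normed_eq, mem_ball_zero_iff] at this
  · rw [integrable_withDensity_iff_integrable_smul' hm hlt]
    refine hf.congr (Eventually.of_forall fun t ↦ ?_)
    simp [ENNReal.toReal_ofReal (η.nonneg_normed _)]

lemma integrable_mollify_integrand {F : Type*} [NormedAddCommGroup F] [NormedSpace ℝ F]
    (η : ContDiffBump (0 : V)) {f : V → F} (hf : LocallyIntegrable f μ) (y : V) :
    Integrable (fun t ↦ η.normed μ t • f (y - t)) μ :=
  HasCompactSupport.convolutionExists_left (ContinuousLinearMap.lsmul ℝ ℝ)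
    η.hasCompactSupport_normed η.continuous_normed hf y

lemma contDiff_mollify {F : Type*} [NormedAddCommGroup F] [NormedSpace ℝ F]
    (η : ContDiffBump (0 : V)) {f : V → F} (hf : LocallyIntegrable f μ) :
    ContDiff ℝ 1 (mollify μ η f) :=
  HasCompactSupport.contDiff_convolution_left (n := 1) (ContinuousLinearMap.lsmul ℝ ℝ)
    η.hasCompactSupport_normed (η.contDiff_normed) hf

lemma tdiv_mollify (η : ContDiffBump (0 : V)) {Z : V → V} (hZ : ContDiff ℝ 1 Z)
    (hc : HasCompactSupport Z) (y : V) : tdiv (mollify μ η Z) y = mollify μ η (tdiv Z) y := by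
  have hl : LocallyIntegrable (η.normed μ) μ := η.continuous_normed.locallyIntegrable
  have h := (hc.hasFDerivAt_convolution_right (ContinuousLinearMap.lsmul ℝ ℝ) hl hZ y).fderiv
  have h' : fderiv ℝ (mollify μ η Z) y = _ := h
  have hcd : HasCompactSupport (fderiv ℝ Z) := hc.fderiv (𝕜 := ℝ)
  have hcont := hZ.continuous_fderiv one_ne_zero
  have h2 : fderiv ℝ (mollify μ η Z) y = mollify μ η (fderiv ℝ Z) y := by
    rw [h']
    ext w
    rw [convolution_precompR_apply _ hl hcd hcont, mollify_apply,
      ContinuousLinearMap.integral_apply (integrable_mollify_integrand μ η hcont.locallyIntegrable y)]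
    rfl
  rw [tdiv_eq, h2, mollify_apply, mollify_apply, ← ContinuousLinearMap.integral_comp_comm _
    (integrable_mollify_integrand μ η hcont.locallyIntegrable y)]
  simp [tdiv_eq]

lemma integral_mul_mollify (η : ContDiffBump (0 : V)) {f D : V → ℝ} (hf : Measurable f)
    (hf1 : ∀ y, ‖f y‖ ≤ 1) (hD : Continuous D) (hDc : HasCompactSupport D) :
    ∫ y, f y * mollify μ η D y ∂μ = ∫ y, mollify μ η f y * D y ∂μ := by
  have hDi : Integrable D μ := hD.integrable_of_hasCompactSupport hDc
  have hi := Integrable.convolution_integrand (μ := μ) (ContinuousLinearMap.lsmul ℝ ℝ)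
    (η.integrable_normed (μ := μ)) hDi
  have hi2 : Integrable (fun p : V × V ↦ f p.1 * (η.normed μ p.2 * D (p.1 - p.2))) (μ.prod μ) := by
    refine Integrable.bdd_mul (c := 1) hi ?_ ?_
    · exact (hf.comp measurable_fst).aestronglyMeasurable
    · exact Eventually.of_forall fun p ↦ hf1 _
  have e1 : ∫ y, f y * mollify μ η D y ∂μ =
      ∫ t, ∫ y, f y * (η.normed μ t * D (y - t)) ∂μ ∂μ := by
    rw [← integral_integral_swap hi2]
    refine integral_congr_ae (Eventually.of_forall fun y ↦ ?_)
    beta_reduce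
    rw [mollify_apply, ← integral_const_mul]
    rfl
  have e2 : ∀ t, ∫ y, f y * (η.normed μ t * D (y - t)) ∂μ =
      ∫ x, f (x + t) * (η.normed μ t * D x) ∂μ := by
    intro t
    rw [← integral_add_right_eq_self _ t]
    simp
  have hi3 : Integrable (fun p : V × V ↦ f (p.2 + p.1) * (η.normed μ p.1 * D p.2)) (μ.prod μ) := by
    refine Integrable.bdd_mul (c := 1) ?_ ?_ ?_
    · exact (η.integrable_normed (μ := μ)).mul_prod hDi
    · exact (hf.comp (measurable_snd.add measurable_fst)).aestronglyMeasurable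
    · exact Eventually.of_forall fun p ↦ hf1 _
  rw [e1]
  simp_rw [e2]
  rw [integral_integral_swap hi3]
  refine integral_congr_ae (Eventually.of_forall fun x ↦ ?_)
  beta_reduce
  rw [mollify_apply, ← integral_neg_eq_self, ← integral_mul_const]
  refine integral_congr_ae (Eventually.of_forall fun t ↦ ?_)
  simp only [η.normed_neg, smul_eq_mul]
  rw [← sub_eq_add_neg]; ring

lemma mollify_test (hA : FormField A O) (hO : IsOpen O) {K : Set V} (hK : IsCompact K)
    (hKO : K ⊆ O) {l : ℝ} (hl : 1 < l) : ∃ ε > 0, ∀ η : ContDiffBump (0 : V), η.rOut < ε →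
    ∀ Z : V → V, EuclidTest A O Z → (∀ y ∉ K, Z y = 0) →
      EuclidTest A O fun y ↦ l⁻¹ • mollify μ η Z y := by
  have hl2 : 1 < l ^ 2 := by nlinarith
  obtain ⟨r, hr, hr'⟩ := Metric.eventually_nhds_iff_ball.1 (hA.eventually_le hO hK hKO hl2)
  refine ⟨r / 2, by positivity, fun η hη Z hZ h0 ↦ ?_⟩
  have hli : LocallyIntegrable Z μ := hZ.1.continuous.locallyIntegrable
  refine ⟨contDiff_const.smul (contDiff_mollify μ η hli), fun y hy ↦ ?_,
    Metric.closedBall 0 (r / 2) + K, (isCompact_closedBall _ _).add hK, ?_, fun y hy ↦ ?_⟩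
  · rw [hA.smul y hy]
    have : mollify μ η Z y ∈ {q | A y q ≤ l ^ 2} := by
      refine mollify_mem μ η (hA.convex y hy _) (isClosed_le (hA.continuous hy) continuous_const)
        (integrable_mollify_integrand μ η hli y) (Eventually.of_forall fun t ht ↦ ?_)
      rw [mem_ofPred_eq]
      by_cases hk : y - t ∈ K
      · have := (hr' t (by rw [mem_ball_zero_iff]; linarith) _ hk).2 (Z (y - t))
        rw [sub_add_cancel] at this
        refine this.trans ?_
        have := hZ.2.1 _ (hKO hk)
        nlinarith
      · rw [h0 _ hk, hA.zero hy]; positivity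
    have hpos : 0 < l ^ 2 := by positivity
    rw [mem_ofPred_eq] at this
    rw [inv_pow, inv_mul_le_iff₀ hpos, mul_one]
    exact this
  · rintro _ ⟨h, hh, k, hk, rfl⟩
    beta_reduce
    rw [add_comm]
    refine (hr' h ?_ k hk).1
    rw [mem_closedBall_zero_iff] at hh
    rw [mem_ball_zero_iff]; linarith
  · have : mollify μ η Z y = 0 := by
      by_contra hne
      refine hy ?_
      have := support_convolution_subset (μ := μ) (ContinuousLinearMap.lsmul ℝ ℝ)
        (f := η.normed μ) (g := Z) (Function.mem_support.2 hne)
      refine add_subset_add ?_ ?_ this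
      · rw [η.support_normed_eq]
        exact Metric.ball_subset_closedBall.trans (Metric.closedBall_subset_closedBall hη.le)
      · intro z hz
        by_contra hzK
        exact hz (h0 z hzK)
    beta_reduce
    rw [this, smul_zero]

lemma measurable_mollify {η : ContDiffBump (0 : V)} {f : V → ℝ} (hf : LocallyIntegrable f μ) :
    Measurable (mollify μ η f) := (contDiff_mollify μ η hf).continuous.measurable

lemma locallyIntegrable_of_bounded {f : V → ℝ} (hf : Measurable f) (hf1 : ∀ y, ‖f y‖ ≤ 1) :
    LocallyIntegrable f μ :=
  (locallyIntegrable_const (1 : ℝ)).mono hf.aestronglyMeasurable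
    (Eventually.of_forall fun y ↦ by simpa using hf1 y)

lemma mollify_mem_Icc (η : ContDiffBump (0 : V)) {f : V → ℝ} (hf : Measurable f)
    (hf1 : ∀ y, f y ∈ Icc (0 : ℝ) 1) (y : V) : mollify μ η f y ∈ Icc (0 : ℝ) 1 := by
  have hl : LocallyIntegrable f μ := locallyIntegrable_of_bounded μ hf fun y ↦ by
    rw [Real.norm_of_nonneg (hf1 y).1]; exact (hf1 y).2
  exact mollify_mem μ η (convex_Icc _ _) isClosed_Icc (integrable_mollify_integrand μ η hl y)
    (Eventually.of_forall fun t _ ↦ hf1 _)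

/-- A sequence of bump functions concentrating at the origin. -/
lemma exists_bump_seq (V : Type*) [NormedAddCommGroup V] [NormedSpace ℝ V] [FiniteDimensional ℝ V] :
    ∃ η : ℕ → ContDiffBump (0 : V), Tendsto (fun n ↦ (η n).rOut) atTop (𝓝 0) ∧
      ∀ n, (η n).rOut ≤ 2 * (η n).rIn := by
  refine ⟨fun n ↦ ⟨1 / ((n : ℝ) + 1), 2 * (1 / ((n : ℝ) + 1)), by positivity, ?_⟩, ?_, fun n ↦ le_rfl⟩
  · have : 0 < 1 / ((n : ℝ) + 1) := by positivity
    linarith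
  · simpa using tendsto_one_div_add_atTop_nhds_zero_nat.const_mul (2 : ℝ)

/-- The smooth case of the submodularity of the total variation. -/
lemma max_min_le {f h : V → ℝ} (hf : ContDiff ℝ 1 f) (hh : ContDiff ℝ 1 h)
    (hf1 : ∀ y, f y ∈ Icc (0 : ℝ) 1) (hh1 : ∀ y, h y ∈ Icc (0 : ℝ) 1) {X Y : V → V}
    (hX : EuclidTest A O X) (hY : EuclidTest A O Y) (hA : FormField A O) {a b : ℝ} {K : Set V}
    (hXK : ∀ y ∉ K, X y = 0) (hYK : ∀ y ∉ K, Y y = 0)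
    (ha : ∀ Z, EuclidTest A O Z → (∀ y ∉ K, Z y = 0) → ∫ y, f y * tdiv Z y ∂μ ≤ a)
    (hb : ∀ Z, EuclidTest A O Z → (∀ y ∉ K, Z y = 0) → ∫ y, h y * tdiv Z y ∂μ ≤ b) :
    ∫ y, max (f y) (h y) * tdiv X y ∂μ + ∫ y, min (f y) (h y) * tdiv Y y ∂μ ≤ a + b := by
  set w : V → ℝ := fun y ↦ f y - h y
  have hw : ContDiff ℝ 1 w := hf.sub hh
  set T : ℕ → ℝ → ℝ := fun n r ↦ 1 / 2 + Real.pi⁻¹ * Real.arctan (n * r)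
  have hπ := Real.pi_pos
  have hT0 : ∀ n r, 0 ≤ T n r := fun n r ↦ by
    have := Real.neg_pi_div_two_lt_arctan (n * r)
    have h2 : Real.pi⁻¹ * (-(Real.pi / 2)) = -(1/2) := by field_simp
    have h3 := mul_le_mul_of_nonneg_left this.le (inv_pos.2 hπ).le
    simp only [T]; linarith
  have hT1 : ∀ n r, T n r ≤ 1 := fun n r ↦ by
    have := Real.arctan_lt_pi_div_two (n * r)
    have h2 : Real.pi⁻¹ * (Real.pi / 2) = 1/2 := by field_simp
    have h3 := mul_le_mul_of_nonneg_left this.le (inv_pos.2 hπ).le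
    simp only [T]; linarith
  have hTd : ∀ n r, HasDerivAt (T n) (Real.pi⁻¹ * (1 / (1 + (n * r) ^ 2) * n)) r := fun n r ↦ by
    have h1 : HasDerivAt (fun r : ℝ ↦ (n : ℝ) * r) n r := by
      simpa using (hasDerivAt_id r).const_mul (n : ℝ)
    exact ((Real.hasDerivAt_arctan _).comp r h1).const_mul _ |>.const_add _
  have hTs : ∀ n, ContDiff ℝ 1 (T n) := fun n ↦
    contDiff_const.add (contDiff_const.mul (Real.contDiff_arctan.comp (contDiff_const.mul contDiff_id)))
  set θ : ℕ → V → ℝ := fun n y ↦ T n (w y)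
  have hθ : ∀ n, ContDiff ℝ 1 (θ n) := fun n ↦ (hTs n).comp hw
  have hθd : ∀ n y v, fderiv ℝ (θ n) y v =
      Real.pi⁻¹ * (1 / (1 + (n * w y) ^ 2) * n) * fderiv ℝ w y v := fun n y v ↦ by
    have h2 := ((hTd n (w y)).comp_hasFDerivAt y (hw.differentiable one_ne_zero y).hasFDerivAt).fderiv
    have h3 : fderiv ℝ (θ n) y = _ := h2
    rw [h3]; rfl
  have hXd := hX.1.differentiable one_ne_zero
  have hYd := hY.1.differentiable one_ne_zero
  have tX := continuous_tdiv hX.1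
  have tY := continuous_tdiv hY.1
  have tXc := hasCompactSupport_tdiv hX.hasCompactSupport
  have tYc := hasCompactSupport_tdiv hY.hasCompactSupport
  have hcomb : ∀ {θ : V → ℝ}, ContDiff ℝ 1 θ → ∀ y, tdiv (fun x ↦ θ x • X x + (1 - θ x) • Y x) y =
      θ y * tdiv X y + (1 - θ y) * tdiv Y y + fderiv ℝ θ y (X y - Y y) := by
    intro θ hθ y
    have d := hθ.differentiable one_ne_zero y
    rw [tdiv_add (F := fun x ↦ θ x • X x) (G := fun x ↦ (1 - θ x) • Y x) (d.smul (hXd y))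
      ((d.const_sub 1).smul (hYd y)), tdiv_smul d (hXd y),
      tdiv_smul (d.const_sub 1) (hYd y), fderiv_const_sub, map_sub]
    simp only [_root_.neg_apply]
    ring
  have hθ' : ∀ n, ContDiff ℝ 1 fun y ↦ 1 - θ n y := fun n ↦ contDiff_const.sub (hθ n)
  have t1 := fun n ↦ hX.combination hA hY (hθ n) (fun y ↦ hT0 n _) (fun y ↦ hT1 n _)
  have t2 := fun n ↦ hX.combination hA hY (hθ' n) (fun y ↦ sub_nonneg.2 (hT1 n _))
    (fun y ↦ sub_le_self _ (hT0 n _))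
  have z1 : ∀ n, ∀ y ∉ K, θ n y • X y + (1 - θ n y) • Y y = 0 := fun n y hy ↦ by
    rw [hXK y hy, hYK y hy]; simp
  have z2 : ∀ n, ∀ y ∉ K, (1 - θ n y) • X y + (1 - (1 - θ n y)) • Y y = 0 := fun n y hy ↦ by
    rw [hXK y hy, hYK y hy]; simp
  have bound : ∀ n, ∫ y, f y * tdiv (fun x ↦ θ n x • X x + (1 - θ n x) • Y x) y ∂μ +
      ∫ y, h y * tdiv (fun x ↦ (1 - θ n x) • X x + (1 - (1 - θ n x)) • Y x) y ∂μ ≤ a + b :=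
    fun n ↦ add_le_add (ha _ (t1 n) (z1 n)) (hb _ (t2 n) (z2 n))
  have cf := hf.continuous
  have ch := hh.continuous
  have i1 : ∀ n, Integrable (fun y ↦ f y * tdiv (fun x ↦ θ n x • X x + (1 - θ n x) • Y x) y) μ :=
    fun n ↦ (cf.mul (continuous_tdiv (t1 n).1)).integrable_of_hasCompactSupport
      (hasCompactSupport_tdiv (t1 n).hasCompactSupport).mul_left
  have i2 : ∀ n, Integrable (fun y ↦ h y *
      tdiv (fun x ↦ (1 - θ n x) • X x + (1 - (1 - θ n x)) • Y x) y) μ :=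
    fun n ↦ (ch.mul (continuous_tdiv (t2 n).1)).integrable_of_hasCompactSupport
      (hasCompactSupport_tdiv (t2 n).hasCompactSupport).mul_left
  have iX : Integrable (tdiv X) μ := tX.integrable_of_hasCompactSupport tXc
  have iY : Integrable (tdiv Y) μ := tY.integrable_of_hasCompactSupport tYc
  have iM : Integrable (fun y ↦ max (f y) (h y) * tdiv X y) μ :=
    ((cf.max ch).mul tX).integrable_of_hasCompactSupport tXc.mul_left
  have im : Integrable (fun y ↦ min (f y) (h y) * tdiv Y y) μ :=
    ((cf.min ch).mul tY).integrable_of_hasCompactSupport tYc.mul_left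
  have cW : Continuous fun y ↦ fderiv ℝ w y (X y - Y y) :=
    (hw.continuous_fderiv one_ne_zero).clm_apply (hX.1.continuous.sub hY.1.continuous)
  have iW : Integrable (fun y ↦ fderiv ℝ w y (X y - Y y)) μ := by
    refine cW.integrable_of_hasCompactSupport ?_
    obtain ⟨-, -, C, hC, -, hC0⟩ := hX
    obtain ⟨-, -, D, hD, -, hD0⟩ := hY
    refine HasCompactSupport.intro (hC.union hD) fun y hy ↦ ?_
    rw [mem_union, not_or] at hy
    rw [hC0 y hy.1, hD0 y hy.2, sub_zero, map_zero]
  have lim : Tendsto (fun n ↦ ∫ y, f y * tdiv (fun x ↦ θ n x • X x + (1 - θ n x) • Y x) y ∂μ +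
      ∫ y, h y * tdiv (fun x ↦ (1 - θ n x) • X x + (1 - (1 - θ n x)) • Y x) y ∂μ) atTop
      (𝓝 (∫ y, max (f y) (h y) * tdiv X y ∂μ + ∫ y, min (f y) (h y) * tdiv Y y ∂μ)) := by
    rw [← integral_add iM im]
    simp_rw [← fun n ↦ integral_add (i1 n) (i2 n)]
    have key : ∀ n y, f y * tdiv (fun x ↦ θ n x • X x + (1 - θ n x) • Y x) y + h y *
        tdiv (fun x ↦ (1 - θ n x) • X x + (1 - (1 - θ n x)) • Y x) y =
        (h y + θ n y * w y) * tdiv X y + (f y - θ n y * w y) * tdiv Y y +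
          (Real.pi⁻¹ * (n * w y / (1 + (n * w y) ^ 2))) * fderiv ℝ w y (X y - Y y) := by
      intro n y
      have e : fderiv ℝ (fun y ↦ 1 - θ n y) y = -fderiv ℝ (θ n) y := by rw [fderiv_const_sub]
      rw [hcomb (hθ n), hcomb (hθ' n), e, _root_.neg_apply, hθd]
      simp only [w]
      ring
    simp_rw [key]
    have hq : ∀ r : ℝ, |r / (1 + r ^ 2)| ≤ 1 := fun r ↦ by
      rw [abs_div, abs_of_pos (by positivity : 0 < 1 + r ^ 2), div_le_one (by positivity)]
      nlinarith [sq_abs r, sq_nonneg (|r| - 1)]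
    have hw1 : ∀ y, |w y| ≤ 1 := fun y ↦ by
      rw [abs_le]; exact ⟨by simp only [w]; linarith [(hf1 y).1, (hh1 y).2],
        by simp only [w]; linarith [(hf1 y).2, (hh1 y).1]⟩
    have hmw : ∀ n y, |θ n y * w y| ≤ 1 := fun n y ↦ by
      rw [abs_mul, abs_of_nonneg (hT0 n _)]
      exact mul_le_one₀ (hT1 n _) (abs_nonneg _) (hw1 y)
    refine tendsto_integral_of_dominated_convergence
      (fun y ↦ 2 * |tdiv X y| + 2 * |tdiv Y y| + Real.pi⁻¹ * |fderiv ℝ w y (X y - Y y)|)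
      (fun n ↦ Continuous.aestronglyMeasurable ?_)
      (((iX.abs.const_mul 2).add (iY.abs.const_mul 2)).add (iW.abs.const_mul _)) (fun n ↦
        Eventually.of_forall fun y ↦ ?_) (Eventually.of_forall fun y ↦ ?_)
    · have c1 := (hθ n).continuous
      have c2 := hw.continuous
      refine ((ch.add (c1.mul c2)).mul tX |>.add ((cf.sub (c1.mul c2)).mul tY)).add
        ((continuous_const.mul ?_).mul cW)
      exact (continuous_const.mul c2).div (by fun_prop) fun y ↦ by positivity
    · rw [Real.norm_eq_abs]
      refine (abs_add_le _ _).trans (add_le_add ((abs_add_le _ _).trans (add_le_add ?_ ?_)) ?_)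
      · rw [abs_mul]
        refine mul_le_mul_of_nonneg_right ((abs_add_le _ _).trans ?_) (abs_nonneg _)
        have := hmw n y
        rw [abs_of_nonneg (hh1 y).1]
        linarith [(hh1 y).2]
      · rw [abs_mul]
        refine mul_le_mul_of_nonneg_right ((abs_sub _ _).trans ?_) (abs_nonneg _)
        have := hmw n y
        rw [abs_of_nonneg (hf1 y).1]
        linarith [(hf1 y).2]
      · rw [abs_mul, abs_mul, abs_of_pos (inv_pos.2 hπ)]
        refine mul_le_mul_of_nonneg_right ?_ (abs_nonneg _)
        exact mul_le_of_le_one_right (inv_pos.2 hπ).le (hq _)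
    · have l1 : Tendsto (fun n : ℕ ↦ θ n y * w y) atTop (𝓝 (max (w y) 0)) := by
        rcases lt_trichotomy (w y) 0 with hlt | heq | hgt
        · rw [max_eq_right hlt.le]
          have : Tendsto (fun n : ℕ ↦ θ n y) atTop (𝓝 (1 / 2 + Real.pi⁻¹ * (-(Real.pi / 2)))) :=
            (((Real.tendsto_arctan_atBot.mono_right nhdsWithin_le_nhds).comp
              (tendsto_natCast_atTop_atTop.atTop_mul_const_of_neg hlt)).const_mul _).const_add _
          have e : 1 / 2 + Real.pi⁻¹ * (-(Real.pi / 2)) = 0 := by field_simp; norm_num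
          rw [e] at this
          simpa using this.mul_const (w y)
        · simp [heq]
        · rw [max_eq_left hgt.le]
          have : Tendsto (fun n : ℕ ↦ θ n y) atTop (𝓝 (1 / 2 + Real.pi⁻¹ * (Real.pi / 2))) :=
            (((Real.tendsto_arctan_atTop.mono_right nhdsWithin_le_nhds).comp
              (tendsto_natCast_atTop_atTop.atTop_mul_const hgt)).const_mul _).const_add _
          have e : 1 / 2 + Real.pi⁻¹ * (Real.pi / 2) = 1 := by field_simp; norm_num
          rw [e] at this
          simpa using this.mul_const (w y)
      have l2 : Tendsto (fun n : ℕ ↦ (n * w y / (1 + (n * w y) ^ 2))) atTop (𝓝 0) := by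
        rcases eq_or_ne (w y) 0 with h0 | h0
        · simp [h0]
        refine squeeze_zero_norm (a := fun n : ℕ ↦ |w y|⁻¹ * (n : ℝ)⁻¹) (fun n ↦ ?_) ?_
        · rcases Nat.eq_zero_or_pos n with rfl | hn
          · simp
          have hn' : (0 : ℝ) < n := by exact_mod_cast hn
          have hw0 : 0 < |w y| := abs_pos.2 h0
          rw [Real.norm_eq_abs, abs_div, abs_of_pos (by positivity : 0 < 1 + (n * w y) ^ 2),
            div_le_iff₀ (by positivity), abs_mul, abs_of_pos hn', ← sq_abs, abs_mul, abs_of_pos hn']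
          field_simp
          nlinarith
        · simpa using tendsto_inv_atTop_nhds_zero_nat.const_mul (|w y|⁻¹)
      have e1 : max (f y) (h y) = h y + max (w y) 0 := by
        rw [← max_add_add_left, add_zero]; simp [w]
      have e2 : min (f y) (h y) = f y - max (w y) 0 := by
        have := min_add_max (f y) (h y)
        linarith
      rw [e1, e2]
      have := ((l1.const_add (h y)).mul_const (tdiv X y)).add ((l1.const_sub (f y)).mul_const (tdiv Y y))
      simpa using this.add ((l2.const_mul Real.pi⁻¹).mul_const (fderiv ℝ w y (X y - Y y)))
  exact le_of_tendsto' lim bound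

/-- Submodularity of the total variation of characteristic functions. -/
lemma euclid_submodular (hA : FormField A O) (hO : IsOpen O) {E F : Set V} (hE : MeasurableSet E)
    (hF : MeasurableSet F) {a b : ℝ} (ha : ∀ Z, EuclidTest A O Z → ∫ y in E, tdiv Z y ∂μ ≤ a)
    (hb : ∀ Z, EuclidTest A O Z → ∫ y in F, tdiv Z y ∂μ ≤ b) {X Y : V → V}
    (hX : EuclidTest A O X) (hY : EuclidTest A O Y) :
    ∫ y in E ∪ F, tdiv X y ∂μ + ∫ y in E ∩ F, tdiv Y y ∂μ ≤ a + b := by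
  obtain ⟨η, hη, hη2⟩ := exists_bump_seq V
  obtain ⟨-, -, C, hC, hCO, hC0⟩ := id hX
  obtain ⟨-, -, D, hD, hDO, hD0⟩ := id hY
  have key : ∀ l : ℝ, 1 < l →
      ∫ y in E ∪ F, tdiv X y ∂μ + ∫ y in E ∩ F, tdiv Y y ∂μ ≤ l * a + l * b := by
    intro l hl
    have hl0 : 0 < l := by linarith
    obtain ⟨ε, hε, hmol⟩ := mollify_test μ hA hO (hC.union hD) (union_subset hCO hDO) hl
    set f : Set V → V → ℝ := fun E ↦ indicator E 1
    have fm : ∀ {E}, MeasurableSet E → Measurable (f E) := fun hE ↦ measurable_one.indicator hE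
    have fI : ∀ E y, f E y ∈ Icc (0 : ℝ) 1 := fun E y ↦ by
      by_cases h : y ∈ E <;> simp [f, h]
    have fb : ∀ E y, ‖f E y‖ ≤ 1 := fun E y ↦ by
      rw [Real.norm_of_nonneg (fI E y).1]; exact (fI E y).2
    have fl : ∀ {E}, MeasurableSet E → LocallyIntegrable (f E) μ := fun hE ↦
      locallyIntegrable_of_bounded μ (fm hE) (fb _)
    have transfer : ∀ {E : Set V} {a : ℝ}, MeasurableSet E →
        (∀ Z, EuclidTest A O Z → ∫ y in E, tdiv Z y ∂μ ≤ a) → ∀ η : ContDiffBump (0 : V),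
        η.rOut < ε → ∀ Z, EuclidTest A O Z → (∀ y ∉ C ∪ D, Z y = 0) →
        ∫ y, mollify μ η (f E) y * tdiv Z y ∂μ ≤ l * a := by
      intro E a hE ha η hη Z hZ h0
      rw [← integral_mul_mollify μ η (fm hE) (fb E) (continuous_tdiv hZ.1)
        (hasCompactSupport_tdiv hZ.hasCompactSupport)]
      have := ha _ (hmol η hη Z hZ h0)
      have e : ∀ y, f E y * mollify μ η (tdiv Z) y =
          l * indicator E (tdiv fun y ↦ l⁻¹ • mollify μ η Z y) y := by
        intro y
        have : tdiv (fun y ↦ l⁻¹ • mollify μ η Z y) y = l⁻¹ * mollify μ η (tdiv Z) y := by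
          rw [← tdiv_mollify μ η hZ.1 hZ.hasCompactSupport, tdiv_eq,
            fderiv_fun_const_smul ((contDiff_mollify μ η
              hZ.1.continuous.locallyIntegrable).differentiable one_ne_zero y), map_smul]
          rfl
        by_cases hy : y ∈ E
        · rw [indicator_of_mem hy, this]; simp [f, hy]; field_simp
        · simp [f, hy]
      simp_rw [e]
      rw [integral_const_mul, integral_indicator hE]
      exact mul_le_mul_of_nonneg_left this hl0.le
    have tX := (continuous_tdiv hX.1).integrable_of_hasCompactSupport (μ := μ)
      (hasCompactSupport_tdiv hX.hasCompactSupport)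
    have tY := (continuous_tdiv hY.1).integrable_of_hasCompactSupport (μ := μ)
      (hasCompactSupport_tdiv hY.hasCompactSupport)
    have hbd : ∀ᶠ n in atTop,
        ∫ y, max (mollify μ (η n) (f E) y) (mollify μ (η n) (f F) y) * tdiv X y ∂μ +
        ∫ y, min (mollify μ (η n) (f E) y) (mollify μ (η n) (f F) y) * tdiv Y y ∂μ ≤
        l * a + l * b := by
      filter_upwards [hη.eventually_lt_const hε] with n hn
      exact max_min_le μ (contDiff_mollify μ _ (fl hE)) (contDiff_mollify μ _ (fl hF))
        (mollify_mem_Icc μ _ (fm hE) (fI E)) (mollify_mem_Icc μ _ (fm hF) (fI F)) hX hY hA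
        (K := C ∪ D) (fun y hy ↦ hC0 y fun h ↦ hy (Or.inl h)) (fun y hy ↦ hD0 y fun h ↦ hy (Or.inr h))
        (transfer hE ha _ hn) (transfer hF hb _ hn)
    have cE := ContDiffBump.ae_convolution_tendsto_right_of_locallyIntegrable (φ := η) (μ := μ) hη
      (Eventually.of_forall hη2) (fl hE)
    have cF := ContDiffBump.ae_convolution_tendsto_right_of_locallyIntegrable (φ := η) (μ := μ) hη
      (Eventually.of_forall hη2) (fl hF)
    have eM : ∀ y, max (f E y) (f F y) = f (E ∪ F) y := fun y ↦ by
      by_cases h1 : y ∈ E <;> by_cases h2 : y ∈ F <;> simp [f, h1, h2]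
    have em : ∀ y, min (f E y) (f F y) = f (E ∩ F) y := fun y ↦ by
      by_cases h1 : y ∈ E <;> by_cases h2 : y ∈ F <;> simp [f, h1, h2]
    have conv : ∀ (op : ℝ → ℝ → ℝ) (Z : V → V) (S : Set V), Continuous (fun p : ℝ × ℝ ↦ op p.1 p.2) →
        (∀ p ∈ Icc (0 : ℝ) 1, ∀ q ∈ Icc (0 : ℝ) 1, ‖op p q‖ ≤ 1) → (∀ y, op (f E y) (f F y) = f S y) →
        Integrable (tdiv Z) μ → Tendsto (fun n ↦ ∫ y, op (mollify μ (η n) (f E) y)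
          (mollify μ (η n) (f F) y) * tdiv Z y ∂μ) atTop (𝓝 (∫ y, f S y * tdiv Z y ∂μ)) := by
      intro op Z S hop hop1 hS hZ
      refine tendsto_integral_of_dominated_convergence (fun y ↦ |tdiv Z y|) (fun n ↦ ?_) hZ.abs
        (fun n ↦ Eventually.of_forall fun y ↦ ?_) ?_
      · exact ((hop.measurable.comp ((measurable_mollify μ (fl hE)).prodMk
          (measurable_mollify μ (fl hF)))).aestronglyMeasurable).mul hZ.aestronglyMeasurable
      · rw [norm_mul]
        refine mul_le_of_le_one_left (abs_nonneg _) (hop1 _ ?_ _ ?_)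
        · exact mollify_mem_Icc μ _ (fm hE) (fI E) y
        · exact mollify_mem_Icc μ _ (fm hF) (fI F) y
      · filter_upwards [cE, cF] with y h1 h2
        rw [← hS]
        exact ((hop.tendsto (f E y, f F y)).comp (h1.prodMk_nhds h2)).mul_const _
    have l1 := conv max X (E ∪ F) (by fun_prop) (fun p hp q hq ↦ by
      rw [Real.norm_of_nonneg (le_max_of_le_left hp.1)]; exact max_le hp.2 hq.2) eM tX
    have l2 := conv min Y (E ∩ F) (by fun_prop) (fun p hp q hq ↦ by
      rw [Real.norm_of_nonneg (le_min hp.1 hq.1)]; exact min_le_of_left_le hp.2) em tY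
    have e : ∀ (S : Set V) (Z : V → V), MeasurableSet S →
        ∫ y, f S y * tdiv Z y ∂μ = ∫ y in S, tdiv Z y ∂μ := by
      intro S Z hS
      rw [← integral_indicator hS]
      refine integral_congr_ae (Eventually.of_forall fun y ↦ ?_)
      by_cases h : y ∈ S <;> simp [f, h]
    rw [← e _ _ (hE.union hF), ← e _ _ (hE.inter hF)]
    exact le_of_tendsto (l1.add l2) hbd
  have lim : Tendsto (fun l : ℝ ↦ l * a + l * b) (𝓝[>] 1) (𝓝 (1 * a + 1 * b)) :=
    (Continuous.tendsto (by fun_prop) 1).mono_left nhdsWithin_le_nhds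
  rw [one_mul, one_mul] at lim
  exact ge_of_tendsto lim (eventually_nhdsWithin_of_forall fun l hl ↦ key l hl)

end EuclideanTests

end STIMCF
end

noncomputable section
namespace STIMCF
set_option linter.unusedSectionVars false

section ChartTests

variable {V : Type*} [NormedAddCommGroup V] [NormedSpace ℝ V] [FiniteDimensional ℝ V]
  [MeasurableSpace V] [BorelSpace V]
  {M : Type*} [TopologicalSpace M] [ChartedSpace V M] [IsManifold 𝓘(ℝ, V) ∞ M]
  [MeasurableSpace M] [BorelSpace M] [T2Space M] [SecondCountableTopology M]
  {g : TensorField 𝓘(ℝ, V) M}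

/-- The part of `E` in the chart domain at `c`, in coordinates. -/
def chartSet (c : M) (E : Set M) : Set V :=
  (extChartAt 𝓘(ℝ, V) c).target ∩ (extChartAt 𝓘(ℝ, V) c).symm ⁻¹' E

lemma measurableSet_chartSet (c : M) {E : Set M} (hE : MeasurableSet E) :
    MeasurableSet (chartSet (V := V) c E) := measurableSet_target_inter_preimage c hE

lemma isOpen_chartSet (c : M) {U : Set M} (hU : IsOpen U) : IsOpen (chartSet (V := V) c U) :=
  (continuousOn_extChartAt_symm c).isOpen_inter_preimage (isOpen_extChartAt_target c) hU

/-- The norm on densities `Q = √(det g) X` that corresponds to the norm of `X`. -/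
def chartForm (hg : C1Metric g) (c : M) (y q : V) : ℝ :=
  gramForm hg c y q q / sqrtDet 𝓘(ℝ, V) g c y ^ 2

lemma continuousOn_gramForm (hg : C1Metric g) (c : M) :
    ContinuousOn (fun p : V × V ↦ gramForm hg c p.1 p.2 p.2)
      ((extChartAt 𝓘(ℝ, V) c).target ×ˢ univ) := by
  set b := Module.finBasis ℝ V
  have e : ∀ p : V × V, gramForm hg c p.1 p.2 p.2 =
      ∑ i, ∑ j, b.coord i p.2 * (b.coord j p.2 * gramForm hg c p.1 (b i) (b j)) := by
    intro p
    have h := LinearMap.BilinForm.sum_repr_mul_repr_mul b (B := gramForm hg c p.1) p.2 p.2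
    rw [← h, Finsupp.sum_fintype _ _ (by simp)]
    refine Finset.sum_congr rfl fun i _ ↦ ?_
    rw [Finsupp.sum_fintype _ _ (by simp)]
    rfl
  simp_rw [e]
  refine continuousOn_finsetSum _ fun i _ ↦ continuousOn_finsetSum _ fun j _ ↦ ?_
  have hc : ∀ i, Continuous fun p : V × V ↦ b.coord i p.2 := fun i ↦
    (LinearMap.continuous_of_finiteDimensional (b.coord i)).comp continuous_snd
  exact (hc i).continuousOn.mul ((hc j).continuousOn.mul
    ((hg.contDiffOn c (b i) (b j)).continuousOn.comp continuousOn_fst fun p hp ↦ hp.1))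

lemma formField_chartForm (hg : C1Metric g) (c : M) {O : Set V}
    (hO : O ⊆ (extChartAt 𝓘(ℝ, V) c).target) : FormField (chartForm hg c) O where
  continuousOn := by
    refine ((continuousOn_gramForm hg c).mono (prod_mono_left hO)).div ?_ fun p hp ↦
      (pow_pos (sqrtDet_pos hg (hO hp.1)) 2).ne'
    exact (((contDiffOn_sqrtDet hg c).continuousOn.mono hO).comp continuousOn_fst
      fun p hp ↦ hp.1).pow 2
  smul y hy a q := by simp [chartForm]; ring
  convex y hy r := by
    have hs := pow_pos (sqrtDet_pos hg (hO hy)) 2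
    intro v hv w hw a b ha hb hab
    simp only [mem_ofPred_eq, chartForm, div_le_iff₀ hs, gramForm_apply] at hv hw ⊢
    rw [coordVec_add, coordVec_smul, coordVec_smul]
    exact hg.convex _ ha hb hab hv hw
  pos y hy q hq := div_pos (gramForm_pos hg (hO hy) hq) (pow_pos (sqrtDet_pos hg (hO hy)) 2)

lemma setIntegral_divergence_chartSet (hg : C1Metric g) {X : ∀ x : M, TangentSpace 𝓘(ℝ, V) x}
    (hX : C1Field X) {c : M} {C : Set M} (hC : IsClosed C)
    (hCs : C ⊆ (extChartAt 𝓘(ℝ, V) c).source) (h : ∀ x ∉ C, X x = 0) {E : Set M}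
    (hE : MeasurableSet E) : ∫ x in E, divergence 𝓘(ℝ, V) g X x ∂(vol 𝓘(ℝ, V) g) =
      ∫ y in chartSet c E, tdiv (flux g c X) y ∂(Module.finBasis ℝ V).addHaar := by
  have := setIntegral_divergence_eq hg hX hC hCs h (f := indicator E 1)
    (measurable_one.indicator hE)
  rw [← integral_indicator hE, ← integral_indicator (measurableSet_chartSet c hE)]
  have e1 : ∀ x, indicator E (divergence 𝓘(ℝ, V) g X) x =
      indicator E 1 x * divergence 𝓘(ℝ, V) g X x := fun x ↦ by
    by_cases h : x ∈ E <;> simp [h]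
  simp_rw [e1]
  rw [this, ← integral_indicator (isOpen_extChartAt_target c).measurableSet]
  refine integral_congr_ae (Eventually.of_forall fun y ↦ ?_)
  by_cases hy : y ∈ (extChartAt 𝓘(ℝ, V) c).target <;>
    by_cases hy' : (extChartAt 𝓘(ℝ, V) c).symm y ∈ E <;>
    simp only [chartSet, indicator, mem_inter_iff, mem_preimage, hy, hy', and_self, and_true,
      and_false, if_true, if_false, Pi.one_apply, one_mul, zero_mul]

lemma exists_euclidTest (hg : C1Metric g) {c : M} {U : Set M}
    (hU : U ⊆ (extChartAt 𝓘(ℝ, V) c).source) {X : ∀ x : M, TangentSpace 𝓘(ℝ, V) x}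
    (hX : IsTestField 𝓘(ℝ, V) g U X) : ∃ Q, EuclidTest (chartForm hg c) (chartSet c U) Q ∧
      ∀ E, MeasurableSet E → ∫ x in E, divergence 𝓘(ℝ, V) g X x ∂(vol 𝓘(ℝ, V) g) =
        ∫ y in chartSet c E, tdiv Q y ∂(Module.finBasis ℝ V).addHaar := by
  obtain ⟨hX1, hX2, C, hC, hCU, hC0⟩ := hX
  obtain ⟨h1, h2⟩ := contDiff_indicator_flux hg hX1 hC (hCU.trans hU) hC0
  refine ⟨_, ⟨h1, fun y hy ↦ ?_, _, isCompact_chart_image hC (hCU.trans hU), ?_, h2⟩, fun E hE ↦ ?_⟩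
  · have hs := sqrtDet_pos hg hy.1
    rw [indicator_of_mem hy.1, chartForm, div_le_one (by positivity), flux]
    simp only [map_smul, LinearMap.smul_apply, smul_eq_mul]
    rw [gramForm_rep hg hy.1]
    nlinarith [hX2 ((extChartAt 𝓘(ℝ, V) c).symm y), mul_pos hs hs]
  · rintro _ ⟨x, hx, rfl⟩
    refine ⟨(extChartAt 𝓘(ℝ, V) c).map_source (hU (hCU hx)), ?_⟩
    rw [mem_preimage, (extChartAt 𝓘(ℝ, V) c).left_inv (hU (hCU hx))]
    exact hCU hx
  · rw [setIntegral_divergence_chartSet hg hX1 hC.isClosed (hCU.trans hU) hC0 hE]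
    exact setIntegral_congr_fun (measurableSet_chartSet c hE) fun y hy ↦
      (tdiv_indicator_flux hy.1).symm

lemma exists_testField (hg : C1Metric g) {c : M} {U : Set M} {Q : V → V}
    (hQ : EuclidTest (chartForm hg c) (chartSet c U) Q) :
    ∃ X : ∀ x : M, TangentSpace 𝓘(ℝ, V) x,
      IsTestField 𝓘(ℝ, V) g (U ∩ (extChartAt 𝓘(ℝ, V) c).source) X ∧
      ∀ E, MeasurableSet E → ∫ x in E, divergence 𝓘(ℝ, V) g X x ∂(vol 𝓘(ℝ, V) g) =
        ∫ y in chartSet c E, tdiv Q y ∂(Module.finBasis ℝ V).addHaar := by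
  classical
  obtain ⟨hQ1, hQ2, K, hK, hKO, hK0⟩ := hQ
  set φ := extChartAt 𝓘(ℝ, V) c with hφ
  let f : M → V := fun x ↦ if x ∈ φ.source then
    (coordVec 𝓘(ℝ, V) c (φ x) ((sqrtDet 𝓘(ℝ, V) g c (φ x))⁻¹ • Q (φ x)) : V) else 0
  let X : ∀ x : M, TangentSpace 𝓘(ℝ, V) x := f
  have hK' : IsCompact (φ.symm '' K) := hK.image_of_continuousOn
    ((continuousOn_extChartAt_symm c).mono fun y hy ↦ (hKO hy).1)
  have hK's : φ.symm '' K ⊆ U ∩ φ.source := by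
    rintro _ ⟨y, hy, rfl⟩
    exact ⟨(hKO hy).2, φ.map_target (hKO hy).1⟩
  have hrep : ∀ y ∈ φ.target, rep c X y = (sqrtDet 𝓘(ℝ, V) g c y)⁻¹ • Q y := by
    intro y hy
    have hp := φ.map_target hy
    have e : f (φ.symm y) = (coordVec 𝓘(ℝ, V) c (φ (φ.symm y))
        ((sqrtDet 𝓘(ℝ, V) g c (φ (φ.symm y)))⁻¹ • Q (φ (φ.symm y))) : V) := if_pos hp
    have h := coord_coordVec' (V := V) hp ((sqrtDet 𝓘(ℝ, V) g c (φ (φ.symm y)))⁻¹ • Q (φ (φ.symm y)))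
    rw [← hφ, φ.right_inv hy] at h
    rw [φ.right_inv hy] at e
    unfold rep
    refine Eq.trans ?_ h
    exact congrArg (fun v : V ↦ coord 𝓘(ℝ, V) c (φ.symm y) v) e
  have hflux : ∀ y ∈ φ.target, flux g c X y = Q y := by
    intro y hy
    rw [flux, hrep y hy, smul_smul, mul_inv_cancel₀ (sqrtDet_pos hg hy).ne', one_smul]
  have hX0 : ∀ x ∉ φ.symm '' K, X x = 0 := by
    intro x hx
    change f x = 0
    by_cases hxs : x ∈ φ.source
    · have : Q (φ x) = 0 := hK0 _ fun h ↦ hx ⟨_, h, φ.left_inv hxs⟩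
      refine (if_pos hxs).trans ?_
      rw [this, smul_zero]
      exact map_zero (mfderiv 𝓘(ℝ, V) 𝓘(ℝ, V) (extChartAt 𝓘(ℝ, V) c).symm (φ x))
    · exact if_neg hxs
  have hX1 : C1Field X := by
    intro p
    by_cases hp : p ∈ φ.source
    · have hy := φ.map_source hp
      have h : ContDiffAt ℝ 1 (rep c X) (φ p) := by
        have h1 : ContDiffAt ℝ 1 (fun y ↦ (sqrtDet 𝓘(ℝ, V) g c y)⁻¹ • Q y) (φ p) :=
          (((contDiffOn_sqrtDet hg c).contDiffAt ((isOpen_extChartAt_target c).mem_nhds hy)).inv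
            (sqrtDet_pos hg hy).ne').smul hQ1.contDiffAt
        refine h1.congr_of_eventuallyEq ?_
        filter_upwards [(isOpen_extChartAt_target c).mem_nhds hy] with y hy using hrep y hy
      have h2 := (contDiffAt_rep_iff hy).1 h
      rwa [← hφ, φ.left_inv hp] at h2
    · refine (c1Field_zero p).congr_of_eventuallyEq ?_
      filter_upwards [hK'.isClosed.isOpen_compl.mem_nhds fun h ↦ hp (hK's h).2] with x hx
      rw [hX0 x hx]
  refine ⟨X, ⟨hX1, fun x ↦ ?_, _, hK', hK's, hX0⟩, fun E hE ↦ ?_⟩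
  · by_cases hx : x ∈ φ.symm '' K
    · obtain ⟨y, hy, rfl⟩ := hx
      have hyO := hKO hy
      have hs := sqrtDet_pos hg hyO.1
      have h := hQ2 y hyO
      rw [← gramForm_rep hg hyO.1, hrep y hyO.1]
      rw [chartForm, div_le_one (by positivity)] at h
      simp only [map_smul, LinearMap.smul_apply, smul_eq_mul]
      rw [← mul_assoc, ← mul_inv, inv_mul_le_iff₀ (by positivity), mul_one, ← sq]
      exact h
    · rw [hX0 x hx, hg.zero]; norm_num
  · rw [setIntegral_divergence_chartSet hg hX1 hK'.isClosed (hK's.trans inter_subset_right) hX0 hE]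
    refine setIntegral_congr_fun (measurableSet_chartSet c hE) fun y hy ↦ tdiv_congr ?_
    filter_upwards [(isOpen_extChartAt_target c).mem_nhds hy.1] with z hz using hflux z hz

lemma integral_tdiv_le (hg : C1Metric g) {c : M} {U E : Set M} (hE : MeasurableSet E)
    (hf : variation 𝓘(ℝ, V) g E U ≠ ⊤) {Q : V → V}
    (hQ : EuclidTest (chartForm hg c) (chartSet c U) Q) :
    ∫ y in chartSet c E, tdiv Q y ∂(Module.finBasis ℝ V).addHaar ≤
      (variation 𝓘(ℝ, V) g E U).toReal := by
  obtain ⟨X, hX, h⟩ := exists_testField hg hQ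
  rw [← h E hE]
  exact integral_le_variation (hX.mono inter_subset_left) hf

lemma variation_submodular_chart (hg : C1Metric g) {c : M} {U : Set M} (hUo : IsOpen U)
    (hU : U ⊆ (extChartAt 𝓘(ℝ, V) c).source) {E F : Set M} (hE : MeasurableSet E)
    (hF : MeasurableSet F) :
    variation 𝓘(ℝ, V) g (E ∪ F) U + variation 𝓘(ℝ, V) g (E ∩ F) U ≤
      variation 𝓘(ℝ, V) g E U + variation 𝓘(ℝ, V) g F U := by
  by_cases hEf : variation 𝓘(ℝ, V) g E U = ⊤
  · simp [hEf]
  by_cases hFf : variation 𝓘(ℝ, V) g F U = ⊤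
  · simp [hFf]
  have hA := formField_chartForm hg c (O := chartSet c U) inter_subset_left
  have hO := isOpen_chartSet (V := V) c hUo
  have key : ∀ X, IsTestField 𝓘(ℝ, V) g U X → ∀ Y, IsTestField 𝓘(ℝ, V) g U Y →
      (∫ x in E ∪ F, divergence 𝓘(ℝ, V) g X x ∂(vol 𝓘(ℝ, V) g)) +
        ∫ x in E ∩ F, divergence 𝓘(ℝ, V) g Y x ∂(vol 𝓘(ℝ, V) g) ≤
      (variation 𝓘(ℝ, V) g E U).toReal + (variation 𝓘(ℝ, V) g F U).toReal := by
    intro X hX Y hY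
    obtain ⟨Q, hQ, hQi⟩ := exists_euclidTest hg hU hX
    obtain ⟨R, hR, hRi⟩ := exists_euclidTest hg hU hY
    rw [hQi _ (hE.union hF), hRi _ (hE.inter hF)]
    have e1 : chartSet (V := V) c (E ∪ F) = chartSet c E ∪ chartSet c F := inter_union_distrib_left ..
    have e2 : chartSet (V := V) c (E ∩ F) = chartSet c E ∩ chartSet c F := by
      unfold chartSet; rw [preimage_inter, inter_inter_distrib_left]
    rw [e1, e2]
    exact euclid_submodular _ hA hO (measurableSet_chartSet c hE) (measurableSet_chartSet c hF)
      (fun Z hZ ↦ integral_tdiv_le hg hE hEf hZ) (fun Z hZ ↦ integral_tdiv_le hg hF hFf hZ) hQ hR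
  have hz : IsTestField 𝓘(ℝ, V) g U fun _ ↦ 0 :=
    ⟨c1Field_zero, fun x ↦ by rw [hg.zero]; norm_num, ∅, isCompact_empty, empty_subset _, fun _ _ ↦ rfl⟩
  have hz0 : ∀ S, ∫ x in S, divergence 𝓘(ℝ, V) g (fun _ ↦ 0) x ∂(vol 𝓘(ℝ, V) g) = 0 := fun S ↦
    setIntegral_eq_zero_of_forall_eq_zero fun x _ ↦ divergence_zero_of_eventually hg c1Field_zero
      (Eventually.of_forall fun _ ↦ rfl)
  rw [← ENNReal.ofReal_toReal hEf, ← ENNReal.ofReal_toReal hFf,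
    ← ENNReal.ofReal_add ENNReal.toReal_nonneg ENNReal.toReal_nonneg]
  unfold variation at key ⊢
  rw [iSup_subtype', iSup_subtype']
  have : Nonempty {X // IsTestField 𝓘(ℝ, V) g U X} := ⟨⟨_, hz⟩⟩
  refine ENNReal.iSup_add_iSup_le fun X Y ↦ ?_
  rcases le_total 0 (∫ x in E ∪ F, divergence 𝓘(ℝ, V) g X.1 x ∂(vol 𝓘(ℝ, V) g)) with h1 | h1 <;>
  rcases le_total 0 (∫ x in E ∩ F, divergence 𝓘(ℝ, V) g Y.1 x ∂(vol 𝓘(ℝ, V) g)) with h2 | h2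
  · rw [← ENNReal.ofReal_add h1 h2]
    exact ENNReal.ofReal_le_ofReal (key _ X.2 _ Y.2)
  · rw [ENNReal.ofReal_of_nonpos h2, add_zero]
    have := key _ X.2 _ hz
    rw [hz0, add_zero] at this
    exact ENNReal.ofReal_le_ofReal this
  · rw [ENNReal.ofReal_of_nonpos h1, zero_add]
    have := key _ hz _ Y.2
    rw [hz0, zero_add] at this
    exact ENNReal.ofReal_le_ofReal this
  · simp [ENNReal.ofReal_of_nonpos h1, ENNReal.ofReal_of_nonpos h2]

lemma perimeter_submodular_chart (hg : C1Metric g) {c : M} {A : Set M}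
    (hA : A ⊆ (extChartAt 𝓘(ℝ, V) c).source) {E F : Set M} (hE : MeasurableSet E)
    (hF : MeasurableSet F) :
    perimeter 𝓘(ℝ, V) g (E ∪ F) A + perimeter 𝓘(ℝ, V) g (E ∩ F) A ≤
      perimeter 𝓘(ℝ, V) g E A + perimeter 𝓘(ℝ, V) g F A := by
  refine ENNReal.le_of_forall_pos_le_add fun ε hε hfin ↦ ?_
  have hε' : (ε / 2 : ℝ≥0∞) ≠ 0 := by simpa using hε.ne'
  rw [ENNReal.add_lt_top] at hfin
  obtain ⟨U, hU, hAU, h1⟩ := exists_open_variation_lt (ENNReal.lt_add_right hfin.1.ne hε')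
  obtain ⟨W, hW, hAW, h2⟩ := exists_open_variation_lt (ENNReal.lt_add_right hfin.2.ne hε')
  set S := (U ∩ W) ∩ (extChartAt 𝓘(ℝ, V) c).source
  have hS : IsOpen S := (hU.inter hW).inter (isOpen_extChartAt_source c)
  have hAS : A ⊆ S := subset_inter (subset_inter hAU hAW) hA
  calc _ ≤ variation 𝓘(ℝ, V) g (E ∪ F) S + variation 𝓘(ℝ, V) g (E ∩ F) S :=
        add_le_add (perimeter_le_variation hS hAS) (perimeter_le_variation hS hAS)
    _ ≤ variation 𝓘(ℝ, V) g E S + variation 𝓘(ℝ, V) g F S :=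
        variation_submodular_chart hg hS inter_subset_right hE hF
    _ ≤ variation 𝓘(ℝ, V) g E U + variation 𝓘(ℝ, V) g F W :=
        add_le_add (variation_mono (inter_subset_left.trans inter_subset_left))
          (variation_mono (inter_subset_left.trans inter_subset_right))
    _ ≤ (perimeter 𝓘(ℝ, V) g E A + ε / 2) + (perimeter 𝓘(ℝ, V) g F A + ε / 2) :=
        add_le_add h1.le h2.le
    _ = _ := by rw [add_add_add_comm, ENNReal.add_halves]

end ChartTests

section Submodular

variable {V : Type*} [NormedAddCommGroup V] [NormedSpace ℝ V] [FiniteDimensional ℝ V]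
  [MeasurableSpace V] [BorelSpace V]
  {M : Type*} [EMetricSpace M] [ChartedSpace V M] [IsManifold 𝓘(ℝ, V) ∞ M]
  [MeasurableSpace M] [BorelSpace M] [SecondCountableTopology M]
  {g : TensorField 𝓘(ℝ, V) M}

/-- The perimeter is submodular. -/
theorem perimeter_submodular (hg : C1Metric g) {E F A : Set M} (hE : MeasurableSet E)
    (hF : MeasurableSet F) (hA : MeasurableSet A) :
    perimeter 𝓘(ℝ, V) g (E ∪ F) A + perimeter 𝓘(ℝ, V) g (E ∩ F) A ≤
      perimeter 𝓘(ℝ, V) g E A + perimeter 𝓘(ℝ, V) g F A := by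
  rcases isEmpty_or_nonempty M with hM | hM
  · have h0 : A = ∅ := Set.eq_empty_of_isEmpty A
    subst h0
    have : ∀ E : Set M, perimeter 𝓘(ℝ, V) g E ∅ = 0 := fun E ↦ (perimeterOuter hg E).empty
    simp [this]
  obtain ⟨x, D, hD, hDs, hd, hu⟩ := exists_chart_partition (V := V) (M := M)
  have key : ∀ E : Set M, perimeter 𝓘(ℝ, V) g E A = ∑' n, perimeter 𝓘(ℝ, V) g E (A ∩ D n) := by
    intro E
    rw [← perimeterMeasure_apply hg E hA]
    simp_rw [← fun n ↦ perimeterMeasure_apply hg E (hA.inter (hD n))]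
    rw [← measure_iUnion (fun i j hij ↦ (hd hij).mono inter_subset_right inter_subset_right)
      fun n ↦ hA.inter (hD n), ← inter_iUnion, hu, inter_univ]
  simp_rw [key]
  rw [← ENNReal.tsum_add, ← ENNReal.tsum_add]
  exact ENNReal.tsum_le_tsum fun n ↦
    perimeter_submodular_chart hg (inter_subset_right.trans (hDs n)) hE hF

end Submodular

end STIMCF
end

noncomputable section
namespace STIMCF
set_option linter.unusedSectionVars false

section Isoperimetric

variable {V : Type*} [NormedAddCommGroup V] [NormedSpace ℝ V] [FiniteDimensional ℝ V]
  [MeasurableSpace V] [BorelSpace V] (μ : Measure V) [μ.IsAddHaarMeasure]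

lemma contDiff_two_mollify (η : ContDiffBump (0 : V)) {f : V → ℝ} (hf : LocallyIntegrable f μ) :
    ContDiff ℝ 2 (mollify μ η f) :=
  HasCompactSupport.contDiff_convolution_left (n := 2) (ContinuousLinearMap.lsmul ℝ ℝ)
    η.hasCompactSupport_normed (η.contDiff_normed) hf

lemma mollify_eq_zero {F : Type*} [NormedAddCommGroup F] [NormedSpace ℝ F]
    (η : ContDiffBump (0 : V)) {f : V → F} {z : V} {ρ : ℝ}
    (h0 : ∀ y ∉ Metric.closedBall z ρ, f y = 0) {y : V}
    (hy : y ∉ Metric.closedBall z (ρ + η.rOut)) : mollify μ η f y = 0 := by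
  rw [mollify_apply]
  refine integral_eq_zero_of_ae (Eventually.of_forall fun t ↦ ?_)
  by_cases ht : η.normed μ t = 0
  · simp [ht]
  have ht' : t ∈ Function.support (η.normed μ) := ht
  rw [η.support_normed_eq, mem_ball_zero_iff] at ht'
  beta_reduce
  rw [h0 (y - t), smul_zero, Pi.zero_apply]
  rw [Metric.mem_closedBall, dist_eq_norm, not_le] at hy ⊢
  have : ‖y - z‖ ≤ ‖y - t - z‖ + ‖t‖ := by
    have e : y - z = (y - t - z) + t := by abel
    rw [e]; exact norm_add_le _ _
  linarith

/-- A bound on the total variation of a smooth function through its integrals against divergences. -/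
lemma integral_abs_fderiv_le {f : V → ℝ} (hf : ContDiff ℝ 2 f) (hc : HasCompactSupport f) (b : V)
    {a : ℝ} (h : ∀ Z : V → V, ContDiff ℝ 1 Z → (∀ y, ‖Z y‖ ≤ ‖b‖) → (∀ y ∉ tsupport f, Z y = 0) →
      ∫ y, f y * tdiv Z y ∂μ ≤ a) : ∫ y, |fderiv ℝ f y b| ∂μ ≤ a := by
  set D : V → ℝ := fun y ↦ fderiv ℝ f y b
  have hf1 : ContDiff ℝ 1 f := hf.of_le (by norm_num)
  have hD : ContDiff ℝ 1 D := (hf.fderiv_right (by norm_num)).clm_apply contDiff_const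
  have hD0 : ∀ y ∉ tsupport f, D y = 0 := fun y hy ↦ by
    have : fderiv ℝ f y = 0 := by
      by_contra hne
      exact hy (support_fderiv_subset ℝ hne)
    simp [D, this]
  have hDc : HasCompactSupport D := HasCompactSupport.intro hc hD0
  have hDi : Integrable D μ := hD.continuous.integrable_of_hasCompactSupport hDc
  have key : ∀ n : ℕ, ∫ y, D y ^ 2 / Real.sqrt (D y ^ 2 + (1 / ((n : ℝ) + 1)) ^ 2) ∂μ ≤ a := by
    intro n
    set κ : ℝ := 1 / ((n : ℝ) + 1)
    have hκ : 0 < κ := by positivity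
    have hpos : ∀ y, 0 < D y ^ 2 + κ ^ 2 := fun y ↦ by positivity
    set ζ : V → ℝ := fun y ↦ D y / Real.sqrt (D y ^ 2 + κ ^ 2)
    have hζ : ContDiff ℝ 1 ζ := hD.div (((hD.pow 2).add contDiff_const).sqrt fun y ↦ (hpos y).ne')
      fun y ↦ (Real.sqrt_pos.2 (hpos y)).ne'
    have hζ1 : ∀ y, |ζ y| ≤ 1 := fun y ↦ by
      rw [abs_div, abs_of_pos (Real.sqrt_pos.2 (hpos y)), div_le_one (Real.sqrt_pos.2 (hpos y))]
      exact Real.abs_le_sqrt (by nlinarith)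
    set Z : V → V := fun y ↦ (-ζ y) • b
    have hZ : ContDiff ℝ 1 Z := hζ.neg.smul contDiff_const
    have hZ0 : ∀ y ∉ tsupport f, Z y = 0 := fun y hy ↦ by simp [Z, ζ, hD0 y hy]
    have h1 := h Z hZ (fun y ↦ by
      simp only [Z]
      rw [norm_smul, norm_neg, Real.norm_eq_abs]
      exact mul_le_of_le_one_left (norm_nonneg _) (hζ1 y)) hZ0
    have hZc : HasCompactSupport Z := HasCompactSupport.intro hc hZ0
    have hfZ : ContDiff ℝ 1 fun y ↦ f y • Z y := hf1.smul hZ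
    have h2 := integral_tdiv_eq_zero μ hfZ hZc.smul_left
    have e : ∀ y, tdiv (fun y ↦ f y • Z y) y = f y * tdiv Z y - D y ^ 2 / Real.sqrt (D y ^ 2 + κ ^ 2) := by
      intro y
      rw [tdiv_smul (hf1.differentiable one_ne_zero y) (hZ.differentiable one_ne_zero y)]
      simp only [Z, map_smul, smul_eq_mul]
      change _ + -ζ y * D y = _
      simp only [ζ]
      ring
    simp_rw [e] at h2
    rw [integral_sub] at h2
    · linarith
    · exact (hf1.continuous.mul (continuous_tdiv hZ)).integrable_of_hasCompactSupport
        (hasCompactSupport_tdiv hZc).mul_left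
    · refine Continuous.integrable_of_hasCompactSupport ?_ (HasCompactSupport.intro hc fun y hy ↦ ?_)
      · exact (hD.continuous.pow 2).div (by have := hD.continuous; fun_prop)
          fun y ↦ (Real.sqrt_pos.2 (hpos y)).ne'
      · simp [hD0 y hy]
  have lim : Tendsto (fun n : ℕ ↦ ∫ y, D y ^ 2 / Real.sqrt (D y ^ 2 + (1 / ((n : ℝ) + 1)) ^ 2) ∂μ)
      atTop (𝓝 (∫ y, |D y| ∂μ)) := by
    refine tendsto_integral_of_dominated_convergence (fun y ↦ |D y|) (fun n ↦ ?_) hDi.abs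
      (fun n ↦ Eventually.of_forall fun y ↦ ?_) (Eventually.of_forall fun y ↦ ?_)
    · have := hD.continuous.measurable
      exact (by fun_prop : Measurable fun y ↦
        D y ^ 2 / Real.sqrt (D y ^ 2 + (1 / ((n : ℝ) + 1)) ^ 2)).aestronglyMeasurable
    · have hκ : 0 < 1 / ((n : ℝ) + 1) := by positivity
      have hp : 0 < D y ^ 2 + (1 / ((n : ℝ) + 1)) ^ 2 := by positivity
      rw [Real.norm_of_nonneg (by positivity), div_le_iff₀ (Real.sqrt_pos.2 hp)]
      calc D y ^ 2 = |D y| * |D y| := by rw [← sq_abs, sq]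
        _ ≤ _ := mul_le_mul_of_nonneg_left (Real.abs_le_sqrt (by nlinarith)) (abs_nonneg _)
    · rcases eq_or_ne (D y) 0 with h0 | h0
      · simp [h0]
      have hκ : Tendsto (fun n : ℕ ↦ 1 / ((n : ℝ) + 1)) atTop (𝓝 0) :=
        tendsto_one_div_add_atTop_nhds_zero_nat
      have hcont : ContinuousAt (fun κ : ℝ ↦ D y ^ 2 / Real.sqrt (D y ^ 2 + κ ^ 2)) 0 := by
        refine ContinuousAt.div (by fun_prop) (by fun_prop) ?_
        have : 0 < D y ^ 2 := by positivity
        exact (Real.sqrt_pos.2 (by simpa using this)).ne'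
      have := hcont.tendsto.comp hκ
      have e : D y ^ 2 / Real.sqrt (D y ^ 2 + 0 ^ 2) = |D y| := by
        rw [zero_pow two_ne_zero, add_zero, Real.sqrt_sq_eq_abs, ← sq_abs, sq]
        field_simp
      rwa [e] at this
  exact le_of_tendsto' lim key

/-- The isoperimetric inequality for sets in a ball. -/
lemma exists_isoperimetric_constant {p : ℝ}
    (hp : Real.HolderConjugate (Module.finrank ℝ V) p) :
    ∃ C : ℝ, 0 < C ∧ ∀ (S : Set V), MeasurableSet S → ∀ (z : V) (ρ R : ℝ), ρ < R →
      S ⊆ Metric.closedBall z ρ → ∀ a : ℝ, 0 ≤ a →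
      (∀ Q : V → V, ContDiff ℝ 1 Q → (∀ y, ‖Q y‖ ≤ 1) →
        (∃ r < R, ∀ y ∉ Metric.closedBall z r, Q y = 0) → ∫ y in S, tdiv Q y ∂μ ≤ a) →
      μ.real S ≤ C * a ^ p := by
  set b := Module.finBasis ℝ V
  obtain ⟨C1, hC1, hop⟩ := b.exists_opNorm_le (F := ℝ)
  set B : ℝ := ∑ i, ‖b i‖
  have hB : 0 ≤ B := Finset.sum_nonneg fun i _ ↦ norm_nonneg _
  set C0 := lintegralPowLePowLIntegralFDerivConst μ p
  refine ⟨C0 * (C1 * B) ^ p + 1, by positivity, fun S hS z ρ R hρ hSz a ha h ↦ ?_⟩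
  obtain ⟨η, hη, hη2⟩ := exists_bump_seq V
  set f : V → ℝ := indicator S 1
  have fm : Measurable f := measurable_one.indicator hS
  have fI : ∀ y, f y ∈ Icc (0 : ℝ) 1 := fun y ↦ by by_cases h : y ∈ S <;> simp [f, h]
  have fb : ∀ y, ‖f y‖ ≤ 1 := fun y ↦ by
    rw [Real.norm_of_nonneg (fI y).1]; exact (fI y).2
  have fl : LocallyIntegrable f μ := locallyIntegrable_of_bounded μ fm fb
  have f0 : ∀ y ∉ Metric.closedBall z ρ, f y = 0 := fun y hy ↦
    indicator_of_notMem (fun hyS ↦ hy (hSz hyS)) _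
  have hp0 : 0 < p := hp.symm.pos
  have bound : ∀ᶠ n in atTop, ∫⁻ y, ‖mollify μ (η n) f y‖ₑ ^ p ∂μ ≤
      C0 * ENNReal.ofReal (C1 * B * a) ^ p := by
    have hε : 0 < (R - ρ) / 2 := by linarith
    filter_upwards [hη.eventually_lt_const hε] with n hn
    set w := mollify μ (η n) f
    have hw : ContDiff ℝ 2 w := contDiff_two_mollify μ _ fl
    have hw1 : ContDiff ℝ 1 w := hw.of_le (by norm_num)
    have hw0 : ∀ y ∉ Metric.closedBall z (ρ + (η n).rOut), w y = 0 := fun y hy ↦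
      mollify_eq_zero μ (η n) f0 hy
    have hwc : HasCompactSupport w := HasCompactSupport.intro (isCompact_closedBall _ _) hw0
    have hts : tsupport w ⊆ Metric.closedBall z (ρ + (η n).rOut) :=
      closure_minimal (fun y hy ↦ by_contra fun h ↦ hy (hw0 y h)) Metric.isClosed_closedBall
    have hi : ∀ i, ∫ y, |fderiv ℝ w y (b i)| ∂μ ≤ ‖b i‖ * a := by
      intro i
      refine integral_abs_fderiv_le μ hw hwc (b i) fun Z hZ hZ1 hZ0 ↦ ?_
      have hZc : HasCompactSupport Z := HasCompactSupport.intro hwc hZ0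
      have hZl := hZ.continuous.locallyIntegrable (μ := μ)
      rw [← integral_mul_mollify μ (η n) fm fb (continuous_tdiv hZ) (hasCompactSupport_tdiv hZc)]
      have hb : 0 < ‖b i‖ := norm_pos_iff.2 (b.ne_zero i)
      have h1 := h (fun y ↦ ‖b i‖⁻¹ • mollify μ (η n) Z y)
        (contDiff_const.smul (contDiff_mollify μ _ hZl)) (fun y ↦ ?_)
        ⟨ρ + (η n).rOut + (η n).rOut, by linarith, fun y hy ↦ ?_⟩
      · have e : ∀ y, f y * mollify μ (η n) (tdiv Z) y =
            ‖b i‖ * indicator S (tdiv fun y ↦ ‖b i‖⁻¹ • mollify μ (η n) Z y) y := by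
          intro y
          have : tdiv (fun y ↦ ‖b i‖⁻¹ • mollify μ (η n) Z y) y =
              ‖b i‖⁻¹ * mollify μ (η n) (tdiv Z) y := by
            rw [← tdiv_mollify μ (η n) hZ hZc, tdiv_eq,
              fderiv_fun_const_smul ((contDiff_mollify μ (η n) hZl).differentiable one_ne_zero y),
              map_smul]
            rfl
          by_cases hy : y ∈ S
          · rw [indicator_of_mem hy, this]; simp only [f, indicator_of_mem hy, Pi.one_apply]
            field_simp
          · simp [f, hy]
        simp_rw [e]
        rw [integral_const_mul, integral_indicator hS]
        exact mul_le_mul_of_nonneg_left h1 hb.le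
      · have : mollify μ (η n) Z y ∈ Metric.closedBall (0 : V) ‖b i‖ :=
          mollify_mem μ (η n) (convex_closedBall _ _) Metric.isClosed_closedBall
            (integrable_mollify_integrand μ _ hZl y)
            (Eventually.of_forall fun t _ ↦ mem_closedBall_zero_iff.2 (hZ1 _))
        rw [norm_smul, norm_inv, norm_norm, inv_mul_le_iff₀ hb, mul_one]
        exact mem_closedBall_zero_iff.1 this
      · rw [mollify_eq_zero μ (η n) (fun y hy ↦ hZ0 y fun h ↦ hy (hts h)) hy, smul_zero]
    have cd := hw1.continuous_fderiv one_ne_zero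
    have ii : ∀ v, Integrable (fun y ↦ fderiv ℝ w y v) μ := fun v ↦
      (cd.clm_apply continuous_const).integrable_of_hasCompactSupport
        ((hwc.fderiv (𝕜 := ℝ)).comp_left (g := fun C : V →L[ℝ] ℝ ↦ C v) (by simp))
    have i2 : Integrable (fun y ↦ ‖fderiv ℝ w y‖) μ :=
      (cd.integrable_of_hasCompactSupport (hwc.fderiv (𝕜 := ℝ))).norm
    have hn1 : ∫ y, ‖fderiv ℝ w y‖ ∂μ ≤ C1 * B * a := by
      calc ∫ y, ‖fderiv ℝ w y‖ ∂μ ≤ ∫ y, C1 * ∑ i, |fderiv ℝ w y (b i)| ∂μ := by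
            refine integral_mono i2 ((integrable_finsetSum _ fun i _ ↦ (ii _).abs).const_mul _)
              fun y ↦ ?_
            exact hop (Finset.sum_nonneg fun i _ ↦ abs_nonneg _) fun i ↦
              Finset.single_le_sum (f := fun i ↦ |fderiv ℝ w y (b i)|)
                (fun i _ ↦ abs_nonneg _) (Finset.mem_univ i)
        _ = C1 * ∑ i, ∫ y, |fderiv ℝ w y (b i)| ∂μ := by
            rw [integral_const_mul, integral_finsetSum _ fun i _ ↦ (ii _).abs]
        _ ≤ C1 * ∑ i, ‖b i‖ * a := by gcongr with i; exact hi i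
        _ = _ := by rw [← Finset.sum_mul]; ring
    have hg := lintegral_pow_le_pow_lintegral_fderiv μ hw1 hwc hp
    refine hg.trans ?_
    gcongr
    rw [← ofReal_integral_norm_eq_lintegral_enorm (cd.integrable_of_hasCompactSupport
      (hwc.fderiv (𝕜 := ℝ)))]
    exact ENNReal.ofReal_le_ofReal hn1
  have lim := ContDiffBump.ae_convolution_tendsto_right_of_locallyIntegrable (φ := η) (μ := μ) hη
    (Eventually.of_forall hη2) fl
  have hfin : μ S ≤ C0 * ENNReal.ofReal (C1 * B * a) ^ p := by
    calc μ S = ∫⁻ y, ‖f y‖ₑ ^ p ∂μ := by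
          rw [← lintegral_indicator_one hS]
          refine lintegral_congr fun y ↦ ?_
          by_cases hy : y ∈ S <;> simp [f, hy, hp0]
      _ ≤ ∫⁻ y, liminf (fun n ↦ ‖mollify μ (η n) f y‖ₑ ^ p) atTop ∂μ := by
          refine lintegral_mono_ae ?_
          filter_upwards [lim] with y hy
          have : Tendsto (fun n ↦ ‖mollify μ (η n) f y‖ₑ ^ p) atTop (𝓝 (‖f y‖ₑ ^ p)) :=
            (ENNReal.continuous_rpow_const.tendsto _).comp ((continuous_enorm.tendsto _).comp hy)
          rw [this.liminf_eq]
      _ ≤ liminf (fun n ↦ ∫⁻ y, ‖mollify μ (η n) f y‖ₑ ^ p ∂μ) atTop :=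
          lintegral_liminf_le fun n ↦ by
            have := measurable_mollify μ (η := η n) fl
            fun_prop
      _ ≤ _ := liminf_le_of_frequently_le' bound.frequently
  have hne : (C0 : ℝ≥0∞) * ENNReal.ofReal (C1 * B * a) ^ p ≠ ⊤ :=
    ENNReal.mul_ne_top ENNReal.coe_ne_top (ENNReal.rpow_ne_top_of_nonneg hp0.le ENNReal.ofReal_ne_top)
  have := ENNReal.toReal_mono hne hfin
  rw [ENNReal.toReal_mul, ← ENNReal.toReal_rpow, ENNReal.toReal_ofReal (by positivity),
    Real.mul_rpow (by positivity) ha, ENNReal.coe_toReal] at this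
  refine (show μ.real S ≤ _ from this).trans ?_
  have := Real.rpow_nonneg ha p
  nlinarith

end Isoperimetric

end STIMCF
end

noncomputable section
namespace STIMCF
set_option linter.unusedSectionVars false

lemma exists_deriv_smoothTransition_bound : ∃ L : ℝ, 0 < L ∧ ∀ x, |deriv Real.smoothTransition x| ≤ L := by
  have hc : Continuous (deriv Real.smoothTransition) :=
    (Real.smoothTransition.contDiff (n := 1)).continuous_deriv le_rfl
  obtain ⟨C, hC⟩ := isCompact_Icc.exists_bound_of_continuousOn (s := Icc (0 : ℝ) 1) hc.continuousOn
  refine ⟨max C 1, by positivity, fun x ↦ ?_⟩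
  rcases lt_or_ge x 0 with h | h
  · have : Real.smoothTransition =ᶠ[𝓝 x] fun _ ↦ 0 := by
      filter_upwards [gt_mem_nhds h] with y hy using Real.smoothTransition.zero_of_nonpos hy.le
    rw [this.deriv_eq]; simp
  rcases lt_or_ge 1 x with h1 | h1
  · have : Real.smoothTransition =ᶠ[𝓝 x] fun _ ↦ 1 := by
      filter_upwards [lt_mem_nhds h1] with y hy using Real.smoothTransition.one_of_one_le hy.le
    rw [this.deriv_eq]; simp
  · exact (hC x ⟨h, h1⟩).trans (le_max_left _ _)

/-- A monotone function satisfying a differential inequality of isoperimetric type grows at a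
definite rate. -/
lemma growth_of_deriv_ge {n : ℝ → ℝ} (hn : Monotone n) {d p : ℝ} (hp : d.HolderConjugate p)
    {r c : ℝ} (hr : 0 < r) (hc : 0 < c)
    (h : ∀ s ∈ Ioo (r ^ 2 / 4) (r ^ 2), DifferentiableAt ℝ n s → n s ^ p⁻¹ ≤ c * r * deriv n s)
    (h0 : 0 < n (r ^ 2 / 4)) : 3 / 4 * r / (d * c) ≤ n (r ^ 2) ^ d⁻¹ := by
  have hd : 0 < d := hp.pos
  have hr2 : r ^ 2 / 4 ≤ r ^ 2 := by nlinarith [sq_nonneg r]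
  have hpos : ∀ s, r ^ 2 / 4 ≤ s → 0 < n s := fun s hs ↦ h0.trans_le (hn hs)
  set q : ℝ → ℝ := fun s ↦ n s ^ d⁻¹
  have hq : MonotoneOn q (uIcc (r ^ 2 / 4) (r ^ 2)) := by
    rw [uIcc_of_le hr2]
    intro s hs t ht hst
    exact Real.rpow_le_rpow (hpos s hs.1).le (hn hst) (inv_pos.2 hd).le
  have hint := hq.intervalIntegral_deriv_mem_uIcc
  have hq0 : 0 ≤ q (r ^ 2 / 4) := Real.rpow_nonneg h0.le _
  have hmono : q (r ^ 2 / 4) ≤ q (r ^ 2) := hq left_mem_uIcc right_mem_uIcc hr2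
  rw [uIcc_of_le (by linarith)] at hint
  have hlow : ∫ x in (r ^ 2 / 4)..(r ^ 2), (1 / (d * c * r)) ≤ ∫ x in (r ^ 2 / 4)..(r ^ 2), deriv q x := by
    refine intervalIntegral.integral_mono_ae_restrict hr2 intervalIntegrable_const
      hq.intervalIntegrable_deriv ?_
    rw [← Measure.restrict_congr_set Ioo_ae_eq_Icc]
    filter_upwards [ae_restrict_of_ae hn.ae_differentiableAt, ae_restrict_mem measurableSet_Ioo]
      with s hs hsI
    have hs0 := hpos s hsI.1.le
    have hder : deriv q s = deriv n s * d⁻¹ * n s ^ (d⁻¹ - 1) := by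
      exact (hs.hasDerivAt.rpow_const (Or.inl hs0.ne')).deriv
    rw [hder]
    have e : n s ^ (d⁻¹ - 1) = (n s ^ p⁻¹)⁻¹ := by
      rw [← Real.rpow_neg hs0.le, ← hp.one_sub_inv]; congr 1; ring
    rw [e]
    have h1 := h s hsI hs
    have h2 : 0 < n s ^ p⁻¹ := Real.rpow_pos_of_pos hs0 _
    rw [div_le_iff₀ (by positivity)]
    calc (1 : ℝ) = n s ^ p⁻¹ * (n s ^ p⁻¹)⁻¹ := (mul_inv_cancel₀ h2.ne').symm
      _ ≤ c * r * deriv n s * (n s ^ p⁻¹)⁻¹ := by gcongr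
      _ = _ := by field_simp
  rw [intervalIntegral.integral_const, smul_eq_mul] at hlow
  have e : (r ^ 2 - r ^ 2 / 4) * (1 / (d * c * r)) = 3 / 4 * r / (d * c) := by field_simp; ring
  rw [e] at hlow
  change _ ≤ q (r ^ 2)
  linarith [hint.2]

section Cutoff

variable {V : Type*} [NormedAddCommGroup V] [InnerProductSpace ℝ V] [FiniteDimensional ℝ V]
  [MeasurableSpace V] [BorelSpace V]

/-- A smooth radial cutoff function, equal to one where `‖y - z‖² ≤ σ + h` and to zero where
`‖y - z‖² ≥ σ + 2h`. -/
def cutoff (z : V) (σ h : ℝ) (y : V) : ℝ :=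
  1 - Real.smoothTransition ((‖y - z‖ ^ 2 - σ - h) / h)

variable {z : V} {σ h : ℝ}

lemma contDiff_cutoff : ContDiff ℝ 1 (cutoff z σ h) := by
  refine contDiff_const.sub ((Real.smoothTransition.contDiff (n := 1)).comp ?_)
  exact ((((contDiff_id.sub contDiff_const).norm_sq ℝ).sub contDiff_const).sub contDiff_const).div_const _

lemma cutoff_nonneg (y : V) : 0 ≤ cutoff z σ h y := sub_nonneg.2 (Real.smoothTransition.le_one _)

lemma cutoff_le_one (y : V) : cutoff z σ h y ≤ 1 := sub_le_self _ (Real.smoothTransition.nonneg _)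

lemma cutoff_eq_one (hh : 0 < h) {y : V} (hy : ‖y - z‖ ^ 2 ≤ σ + h) : cutoff z σ h y = 1 := by
  rw [cutoff, Real.smoothTransition.zero_of_nonpos, sub_zero]
  exact div_nonpos_of_nonpos_of_nonneg (by linarith) hh.le

lemma cutoff_eq_zero (hh : 0 < h) {y : V} (hy : σ + 2 * h ≤ ‖y - z‖ ^ 2) : cutoff z σ h y = 0 := by
  rw [cutoff, Real.smoothTransition.one_of_one_le, sub_self]
  rw [le_div_iff₀ hh]; linarith

lemma fderiv_cutoff (y v : V) : fderiv ℝ (cutoff z σ h) y v =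
    -(deriv Real.smoothTransition ((‖y - z‖ ^ 2 - σ - h) / h) * (2 * inner ℝ (y - z) v / h)) := by
  have h1 : HasFDerivAt (fun y : V ↦ ‖y - z‖ ^ 2) (2 • (innerSL ℝ (y - z))) y := by
    have := (hasStrictFDerivAt_norm_sq (y - z)).hasFDerivAt.comp y ((hasFDerivAt_id y).sub_const z)
    rwa [ContinuousLinearMap.comp_id] at this
  have h2 : HasFDerivAt (fun y : V ↦ (‖y - z‖ ^ 2 - σ - h) / h) (h⁻¹ • (2 • (innerSL ℝ (y - z)))) y := by
    have := ((h1.sub_const σ).sub_const h).const_mul h⁻¹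
    refine this.congr_of_eventuallyEq (Eventually.of_forall fun y ↦ ?_)
    beta_reduce; rw [div_eq_inv_mul]
  have h3 : HasDerivAt Real.smoothTransition _ ((‖y - z‖ ^ 2 - σ - h) / h) :=
    ((Real.smoothTransition.contDiff (n := 1)).differentiable one_ne_zero _).hasDerivAt
  have h4 := ((h3.comp_hasFDerivAt y h2).const_sub 1).fderiv
  have h5 : fderiv ℝ (cutoff z σ h) y = _ := h4
  rw [h5]
  simp only [_root_.neg_apply, _root_.smul_apply, smul_eq_mul, innerSL_apply_apply, nsmul_eq_mul]
  push_cast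
  ring

lemma abs_fderiv_cutoff_le {L : ℝ} (hL0 : 0 < L) (hL : ∀ x, |deriv Real.smoothTransition x| ≤ L)
    (hh : 0 < h) (y v : V) : |fderiv ℝ (cutoff z σ h) y v| ≤
      indicator {y | σ < ‖y - z‖ ^ 2 ∧ ‖y - z‖ ^ 2 ≤ σ + 2 * h}
        (fun _ ↦ L * (2 * Real.sqrt (σ + 2 * h) / h)) y * ‖v‖ := by
  by_cases hy : σ < ‖y - z‖ ^ 2 ∧ ‖y - z‖ ^ 2 ≤ σ + 2 * h
  · rw [indicator_of_mem (by exact hy), fderiv_cutoff, abs_neg, abs_mul, abs_div, abs_mul, abs_of_pos hh, mul_assoc]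
    refine mul_le_mul (hL _) ?_ (by positivity) hL0.le
    rw [div_mul_eq_mul_div, abs_two]
    refine div_le_div_of_nonneg_right ?_ hh.le
    rw [mul_assoc]
    refine mul_le_mul_of_nonneg_left ((abs_real_inner_le_norm _ _).trans ?_) two_pos.le
    exact mul_le_mul_of_nonneg_right (Real.le_sqrt_of_sq_le hy.2) (norm_nonneg _)
  · rw [indicator_of_notMem (by exact hy), zero_mul, fderiv_cutoff]
    have : deriv Real.smoothTransition ((‖y - z‖ ^ 2 - σ - h) / h) = 0 := by
      rw [not_and_or, not_lt, not_le] at hy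
      rcases hy with hy | hy
      · have h1 : (‖y - z‖ ^ 2 - σ - h) / h < 0 := div_neg_of_neg_of_pos (by linarith) hh
        have : Real.smoothTransition =ᶠ[𝓝 ((‖y - z‖ ^ 2 - σ - h) / h)] fun _ ↦ 0 := by
          filter_upwards [gt_mem_nhds h1] with y hy using Real.smoothTransition.zero_of_nonpos hy.le
        rw [this.deriv_eq]; simp
      · have h1 : 1 < (‖y - z‖ ^ 2 - σ - h) / h := by rw [lt_div_iff₀ hh]; linarith
        have : Real.smoothTransition =ᶠ[𝓝 ((‖y - z‖ ^ 2 - σ - h) / h)] fun _ ↦ 1 := by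
          filter_upwards [lt_mem_nhds h1] with y hy using Real.smoothTransition.one_of_one_le hy.le
        rw [this.deriv_eq]; simp
    rw [this]; simp

variable (μ : Measure V) [μ.IsAddHaarMeasure]

lemma measurableSet_normSq_le (z : V) (s : ℝ) : MeasurableSet {y | ‖y - z‖ ^ 2 ≤ s} :=
  (isClosed_le (by fun_prop) continuous_const).measurableSet

lemma normSq_le_eq_closedBall (z : V) {s : ℝ} (hs : 0 ≤ s) :
    {y | ‖y - z‖ ^ 2 ≤ s} = Metric.closedBall z (Real.sqrt s) := by
  ext y
  rw [Metric.mem_closedBall, dist_eq_norm, Real.le_sqrt (norm_nonneg _) hs]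
  rfl

lemma measure_normSq_le_lt_top (z : V) (s : ℝ) : μ {y | ‖y - z‖ ^ 2 ≤ s} < ⊤ := by
  refine (measure_mono ?_).trans_lt (measure_closedBall_lt_top (x := z) (r := Real.sqrt |s|))
  rw [← normSq_le_eq_closedBall z (abs_nonneg s)]
  exact fun y hy ↦ le_trans hy (le_abs_self s)

/-- The volume that `E` leaves free in the ball of squared radius `s` about `z`. -/
def freeVolume (E : Set V) (z : V) (s : ℝ) : ℝ := μ.real ({y | ‖y - z‖ ^ 2 ≤ s} \ E)

lemma monotone_freeVolume (E : Set V) (z : V) : Monotone (freeVolume μ E z) := by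
  intro s t hst
  refine measureReal_mono (sdiff_subset_sdiff_left fun y hy ↦ le_trans hy hst) ?_
  exact ((measure_mono sdiff_subset).trans_lt (measure_normSq_le_lt_top μ z t)).ne

lemma abs_integral_fderiv_cutoff_le {L : ℝ} (hL0 : 0 < L)
    (hL : ∀ x, |deriv Real.smoothTransition x| ≤ L) (hh : 0 < h) {E : Set V}
    (hE : MeasurableSet E) {Q : V → V} {Λ : ℝ} (hΛ : 0 ≤ Λ) (hQ1 : ∀ y, ‖Q y‖ ≤ Λ) :
    |∫ y in Eᶜ, fderiv ℝ (cutoff z σ h) y (Q y) ∂μ| ≤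
      L * 2 * Λ * Real.sqrt (σ + 2 * h) *
        ((freeVolume μ E z (σ + 2 * h) - freeVolume μ E z σ) / h) := by
  set T : Set V := {y | σ < ‖y - z‖ ^ 2 ∧ ‖y - z‖ ^ 2 ≤ σ + 2 * h}
  have hTe : T = {y | ‖y - z‖ ^ 2 ≤ σ + 2 * h} \ {y | ‖y - z‖ ^ 2 ≤ σ} := by
    ext y; simp [T, and_comm]
  have hTm : MeasurableSet T := by
    rw [hTe]; exact (measurableSet_normSq_le z _).diff (measurableSet_normSq_le z _)
  have hTf : μ T < ⊤ := by
    rw [hTe]; exact (measure_mono sdiff_subset).trans_lt (measure_normSq_le_lt_top μ z _)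
  set k : ℝ := L * (2 * Real.sqrt (σ + 2 * h) / h) * Λ
  have hk : 0 ≤ k := by positivity
  calc |∫ y in Eᶜ, fderiv ℝ (cutoff z σ h) y (Q y) ∂μ|
      ≤ ∫ y in Eᶜ, indicator T (fun _ ↦ k) y ∂μ := by
        rw [← Real.norm_eq_abs]
        refine norm_integral_le_of_norm_le ?_ (Eventually.of_forall fun y ↦ ?_)
        · exact ((integrable_indicator_iff hTm).2 (integrableOn_const hTf.ne)).integrableOn
        · refine (abs_fderiv_cutoff_le hL0 hL hh y (Q y)).trans ?_
          by_cases hy : y ∈ T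
          · rw [indicator_of_mem hy, indicator_of_mem hy]
            exact mul_le_mul_of_nonneg_left (hQ1 y) (by positivity)
          · rw [indicator_of_notMem hy, indicator_of_notMem hy, zero_mul]
    _ = μ.real (T ∩ Eᶜ) * k := by
        rw [setIntegral_indicator hTm, setIntegral_const, smul_eq_mul, inter_comm]
    _ = (freeVolume μ E z (σ + 2 * h) - freeVolume μ E z σ) * k := by
        congr 1
        have hsub : {y | ‖y - z‖ ^ 2 ≤ σ} \ E ⊆ {y | ‖y - z‖ ^ 2 ≤ σ + 2 * h} \ E :=
          sdiff_subset_sdiff_left fun y (hy : ‖y - z‖ ^ 2 ≤ σ) ↦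
            show ‖y - z‖ ^ 2 ≤ σ + 2 * h by linarith
        rw [freeVolume, freeVolume, ← measureReal_sdiff hsub ((measurableSet_normSq_le z _).diff hE)
          ((measure_mono sdiff_subset).trans_lt (measure_normSq_le_lt_top μ z _)).ne]
        congr 1
        rw [hTe]
        ext y
        simp only [mem_inter_iff, Set.mem_sdiff, mem_compl_iff]
        tauto
    _ = _ := by simp only [k]; ring

lemma tendsto_integral_cutoff {E : Set V} {Q : V → V}
    (hQ : ContDiff ℝ 1 Q) (hc : HasCompactSupport Q) :
    Tendsto (fun h ↦ ∫ y in Eᶜ, cutoff z σ h y * tdiv Q y ∂μ) (𝓝[>] 0)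
      (𝓝 (∫ y in {y | ‖y - z‖ ^ 2 ≤ σ} \ E, tdiv Q y ∂μ)) := by
  have hi : Integrable (tdiv Q) μ :=
    (continuous_tdiv hQ).integrable_of_hasCompactSupport (hasCompactSupport_tdiv hc)
  have e : ∫ y in {y | ‖y - z‖ ^ 2 ≤ σ} \ E, tdiv Q y ∂μ =
      ∫ y in Eᶜ, indicator {y | ‖y - z‖ ^ 2 ≤ σ} (tdiv Q) y ∂μ := by
    rw [setIntegral_indicator (measurableSet_normSq_le z _), inter_comm, sdiff_eq]
  rw [e]
  refine tendsto_integral_filter_of_dominated_convergence (fun y ↦ |tdiv Q y|)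
    (Eventually.of_forall fun h ↦ ?_) ?_ hi.abs.integrableOn (Eventually.of_forall fun y ↦ ?_)
  · exact (contDiff_cutoff.continuous.mul (continuous_tdiv hQ)).aestronglyMeasurable
  · refine Eventually.of_forall fun h ↦ Eventually.of_forall fun y ↦ ?_
    rw [norm_mul, Real.norm_of_nonneg (cutoff_nonneg y)]
    exact mul_le_of_le_one_left (abs_nonneg _) (cutoff_le_one y)
  · refine tendsto_const_nhds.congr' ?_
    by_cases hy : ‖y - z‖ ^ 2 ≤ σ
    · filter_upwards [self_mem_nhdsWithin] with h (hh : 0 < h)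
      rw [indicator_of_mem (by exact hy), cutoff_eq_one hh (by linarith), one_mul]
    · rw [indicator_of_notMem (by exact hy)]
      rw [not_le] at hy
      filter_upwards [self_mem_nhdsWithin, Ioo_mem_nhdsGT (show 0 < (‖y - z‖ ^ 2 - σ) / 2 by linarith)]
        with h (hh : 0 < h) hh2
      rw [cutoff_eq_zero hh (by linarith [hh2.2]), zero_mul]

lemma tendsto_slope_bound {E : Set V} (L Λ : ℝ)
    (hn : DifferentiableAt ℝ (freeVolume μ E z) σ) :
    Tendsto (fun h ↦ L * 2 * Λ * Real.sqrt (σ + 2 * h) *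
        ((freeVolume μ E z (σ + 2 * h) - freeVolume μ E z σ) / h)) (𝓝[>] 0)
      (𝓝 (4 * L * Λ * Real.sqrt σ * deriv (freeVolume μ E z) σ)) := by
  have h1 : HasDerivAt (fun h ↦ freeVolume μ E z (σ + 2 * h)) (deriv (freeVolume μ E z) σ * 2) 0 := by
    have h2 : HasDerivAt (fun h : ℝ ↦ σ + 2 * h) 2 0 := by
      simpa using ((hasDerivAt_id (0 : ℝ)).const_mul 2).const_add σ
    have h3 : HasDerivAt (freeVolume μ E z) (deriv (freeVolume μ E z) σ) (σ + 2 * 0) := by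
      simpa using hn.hasDerivAt
    exact h3.comp 0 h2
  have h4 := h1.hasDerivWithinAt (s := Ioi 0)
  rw [hasDerivWithinAt_iff_tendsto_slope' (by simp)] at h4
  have h5 : Tendsto (fun h : ℝ ↦ L * 2 * Λ * Real.sqrt (σ + 2 * h)) (𝓝[>] 0)
      (𝓝 (L * 2 * Λ * Real.sqrt (σ + 2 * 0))) :=
    (Continuous.tendsto (by fun_prop) 0).mono_left nhdsWithin_le_nhds
  have h6 := h5.mul h4
  rw [mul_zero, add_zero] at h6
  convert h6 using 2
  · simp [slope, div_eq_inv_mul]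
  · ring

/-- Cutting with a ball: the two halves of the estimate. -/
lemma cutoff_estimates {L : ℝ} (hL0 : 0 < L) (hL : ∀ x, |deriv Real.smoothTransition x| ≤ L)
    {E : Set V} (hE : MeasurableSet E)
    (hn : DifferentiableAt ℝ (freeVolume μ E z) σ) {Q : V → V} (hQ : ContDiff ℝ 1 Q)
    (hc : HasCompactSupport Q) {Λ : ℝ} (hΛ : 0 ≤ Λ) (hQ1 : ∀ y, ‖Q y‖ ≤ Λ) {v : ℝ} :
    ((∀ᶠ h in 𝓝[>] 0, ∫ y in E, tdiv (fun y ↦ (-cutoff z σ h y) • Q y) y ∂μ ≤ v) →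
      ∫ y in {y | ‖y - z‖ ^ 2 ≤ σ} \ E, tdiv Q y ∂μ ≤
        v + 4 * L * Λ * Real.sqrt σ * deriv (freeVolume μ E z) σ) ∧
    ((∀ᶠ h in 𝓝[>] 0, ∫ y in E, tdiv (fun y ↦ (1 - cutoff z σ h y) • Q y) y ∂μ ≤ v) →
      ∫ y in E ∪ {y | ‖y - z‖ ^ 2 ≤ σ}, tdiv Q y ∂μ ≤
        v + 4 * L * Λ * Real.sqrt σ * deriv (freeVolume μ E z) σ) := by
  have hi : Integrable (tdiv Q) μ :=
    (continuous_tdiv hQ).integrable_of_hasCompactSupport (hasCompactSupport_tdiv hc)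
  have hQd := hQ.differentiable one_ne_zero
  have hηd : ∀ h, Differentiable ℝ (cutoff z σ h) := fun h ↦ contDiff_cutoff.differentiable one_ne_zero
  have hηQ : ∀ h, ContDiff ℝ 1 fun y ↦ cutoff z σ h y • Q y := fun h ↦ contDiff_cutoff.smul hQ
  have hηc : ∀ h, HasCompactSupport fun y ↦ cutoff z σ h y • Q y := fun h ↦ hc.smul_left
  have hηi : ∀ h, Integrable (tdiv fun y ↦ cutoff z σ h y • Q y) μ := fun h ↦
    (continuous_tdiv (hηQ h)).integrable_of_hasCompactSupport (hasCompactSupport_tdiv (hηc h))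
  have hneg : ∀ h y, tdiv (fun y ↦ (-cutoff z σ h y) • Q y) y =
      -tdiv (fun y ↦ cutoff z σ h y • Q y) y := by
    intro h y
    rw [tdiv_smul (η := fun y ↦ -cutoff z σ h y) (hηd h y).neg (hQd y),
      tdiv_smul (hηd h y) (hQd y), fderiv_fun_neg, _root_.neg_apply]
    ring
  have hone : ∀ h y, tdiv (fun y ↦ (1 - cutoff z σ h y) • Q y) y =
      tdiv Q y - tdiv (fun y ↦ cutoff z σ h y • Q y) y := by
    intro h y
    rw [tdiv_smul ((hηd h y).const_sub 1) (hQd y), tdiv_smul (hηd h y) (hQd y), fderiv_const_sub,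
      _root_.neg_apply]
    ring
  have id1 : ∀ h, ∫ y in Eᶜ, cutoff z σ h y * tdiv Q y ∂μ =
      -∫ y in E, tdiv (fun y ↦ cutoff z σ h y • Q y) y ∂μ -
        ∫ y in Eᶜ, fderiv ℝ (cutoff z σ h) y (Q y) ∂μ := by
    intro h
    have h0 := integral_tdiv_eq_zero μ (hηQ h) (hηc h)
    rw [← integral_add_compl hE (hηi h)] at h0
    have hs : ∀ y, cutoff z σ h y * tdiv Q y =
        tdiv (fun y ↦ cutoff z σ h y • Q y) y - fderiv ℝ (cutoff z σ h) y (Q y) := fun y ↦ by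
      rw [tdiv_smul (hηd h y) (hQd y)]; ring
    simp_rw [hs]
    rw [integral_sub (hηi h).integrableOn]
    · linarith
    · refine Integrable.integrableOn (Continuous.integrable_of_hasCompactSupport ?_ ?_)
      · exact (contDiff_cutoff.continuous_fderiv one_ne_zero).clm_apply hQ.continuous
      · refine HasCompactSupport.intro hc fun y hy ↦ ?_
        rw [image_eq_zero_of_notMem_tsupport hy, map_zero]
  have lim1 := tendsto_integral_cutoff (z := z) (σ := σ) μ (E := E) hQ hc
  have lim2 := tendsto_slope_bound (z := z) (σ := σ) μ L Λ hn
  have bound : ∀ h > 0, -∫ y in Eᶜ, fderiv ℝ (cutoff z σ h) y (Q y) ∂μ ≤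
      L * 2 * Λ * Real.sqrt (σ + 2 * h) *
        ((freeVolume μ E z (σ + 2 * h) - freeVolume μ E z σ) / h) := fun h hh ↦
    (neg_le_abs _).trans (abs_integral_fderiv_cutoff_le μ hL0 hL hh hE hΛ hQ1)
  refine ⟨fun hv ↦ ?_, fun hv ↦ ?_⟩
  · refine le_of_tendsto_of_tendsto lim1 (lim2.const_add v) ?_
    filter_upwards [hv, self_mem_nhdsWithin] with h h1 (hh : 0 < h)
    rw [id1]
    simp_rw [hneg] at h1
    rw [integral_neg] at h1
    linarith [bound h hh]
  · have e : ∫ y in E ∪ {y | ‖y - z‖ ^ 2 ≤ σ}, tdiv Q y ∂μ = ∫ y in E, tdiv Q y ∂μ +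
        ∫ y in {y | ‖y - z‖ ^ 2 ≤ σ} \ E, tdiv Q y ∂μ := by
      rw [← union_sdiff_self, setIntegral_union disjoint_sdiff_right
        ((measurableSet_normSq_le z _).diff hE) hi.integrableOn hi.integrableOn]
    rw [e]
    refine le_of_tendsto_of_tendsto (lim1.const_add _) (lim2.const_add v) ?_
    filter_upwards [hv, self_mem_nhdsWithin] with h h1 (hh : 0 < h)
    rw [id1]
    simp_rw [hone] at h1
    rw [integral_sub hi.integrableOn (hηi h).integrableOn] at h1
    linarith [bound h hh]

end Cutoff

end STIMCF
end

noncomputable section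
namespace STIMCF
set_option linter.unusedSectionVars false

section ChartImages

variable {V : Type*} [NormedAddCommGroup V] [NormedSpace ℝ V]
  {M : Type*} [TopologicalSpace M] [ChartedSpace V M]

lemma chartSet_image {c : M} {T : Set V} (hT : T ⊆ (extChartAt 𝓘(ℝ, V) c).target) :
    chartSet c ((extChartAt 𝓘(ℝ, V) c).symm '' T) = T := by
  ext y
  constructor
  · rintro ⟨hy, t, ht, hty⟩
    have := congrArg (extChartAt 𝓘(ℝ, V) c) hty
    rw [(extChartAt 𝓘(ℝ, V) c).right_inv hy, (extChartAt 𝓘(ℝ, V) c).right_inv (hT ht)] at this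
    rwa [← this]
  · exact fun hy ↦ ⟨hT hy, mem_image_of_mem _ hy⟩

lemma chartSet_sdiff (c : M) (A B : Set M) :
    chartSet (V := V) c (A \ B) = chartSet c A \ chartSet c B := by
  ext y
  simp only [chartSet, mem_inter_iff, mem_preimage, Set.mem_sdiff]
  tauto

lemma chartSet_inter (c : M) (A B : Set M) :
    chartSet (V := V) c (A ∩ B) = chartSet c A ∩ chartSet c B := by
  ext y
  simp only [chartSet, mem_inter_iff, mem_preimage]
  tauto

lemma isOpen_chart_image {c : M} {T : Set V} (hT : T ⊆ (extChartAt 𝓘(ℝ, V) c).target)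
    (hTo : IsOpen T) : IsOpen ((extChartAt 𝓘(ℝ, V) c).symm '' T) := by
  rw [PartialEquiv.symm_image_eq_source_inter_preimage _ hT]
  exact (continuousOn_extChartAt c).isOpen_inter_preimage (isOpen_extChartAt_source c) hTo

lemma isCompact_chart_symm_image {c : M} {T : Set V} (hT : T ⊆ (extChartAt 𝓘(ℝ, V) c).target)
    (hTo : IsCompact T) : IsCompact ((extChartAt 𝓘(ℝ, V) c).symm '' T) :=
  hTo.image_of_continuousOn ((continuousOn_extChartAt_symm c).mono hT)

end ChartImages

lemma FormField.exists_bounds {V : Type*} [NormedAddCommGroup V] [NormedSpace ℝ V]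
    [FiniteDimensional ℝ V] [MeasurableSpace V]
    [BorelSpace V] {A : V → V → ℝ} {O : Set V} (hA : FormField A O) {K : Set V}
    (hK : IsCompact K) (hKO : K ⊆ O) : ∃ l : ℝ, 1 ≤ l ∧ ∀ y ∈ K, ∀ q,
      A y q ≤ l ^ 2 * ‖q‖ ^ 2 ∧ ‖q‖ ^ 2 ≤ l ^ 2 * A y q := by
  have hc : ContinuousOn (fun p : V × V ↦ A p.1 p.2) (K ×ˢ Metric.sphere (0 : V) 1) :=
    hA.continuousOn.mono (prod_mono hKO (subset_univ _))
  have hne : ∀ q ∈ Metric.sphere (0 : V) 1, q ≠ 0 := by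
    rintro q hq rfl
    simp at hq
  have hpos : ∀ p ∈ K ×ˢ Metric.sphere (0 : V) 1, 0 < A p.1 p.2 := fun p hp ↦
    hA.pos _ (hKO hp.1) _ (hne _ hp.2)
  obtain ⟨C1, h1⟩ := (hK.prod (isCompact_sphere (0 : V) 1)).exists_bound_of_continuousOn hc
  obtain ⟨C2, h2⟩ := (hK.prod (isCompact_sphere (0 : V) 1)).exists_bound_of_continuousOn
    (hc.inv₀ fun p hp ↦ (hpos p hp).ne')
  set l := max (max C1 C2) 1
  have hl : 1 ≤ l := le_max_right _ _
  have hl1 : C1 ≤ l ^ 2 := ((le_max_left _ _).trans (le_max_left _ _)).trans (by nlinarith : l ≤ l ^ 2)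
  have hl2 : C2 ≤ l ^ 2 := ((le_max_right _ _).trans (le_max_left _ _)).trans (by nlinarith : l ≤ l ^ 2)
  refine ⟨l, hl, fun y hy q ↦ ?_⟩
  rcases eq_or_ne q 0 with rfl | hq
  · simp [hA.zero (hKO hy)]
  have hn : 0 < ‖q‖ := norm_pos_iff.2 hq
  have hs : (y, ‖q‖⁻¹ • q) ∈ K ×ˢ Metric.sphere (0 : V) 1 := ⟨hy, by simp [norm_smul, hn.ne']⟩
  have e : A y q = ‖q‖ ^ 2 * A y (‖q‖⁻¹ • q) := by
    rw [← hA.smul y (hKO hy), smul_smul, mul_inv_cancel₀ hn.ne', one_smul]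
  have b1 := h1 _ hs
  have b2 := h2 _ hs
  have hp := hpos _ hs
  simp only [Pi.inv_apply] at b1 b2 hp
  rw [Real.norm_of_nonneg hp.le] at b1
  rw [Real.norm_of_nonneg (inv_pos.2 hp).le] at b2
  rw [e]
  refine ⟨by nlinarith [sq_nonneg ‖q‖], ?_⟩
  have b3 : 1 ≤ l ^ 2 * A y (‖q‖⁻¹ • q) := by
    rw [← inv_le_iff_one_le_mul₀ hp]; exact b2.trans hl2
  nlinarith [sq_nonneg ‖q‖]

section Density

variable {V : Type*} [NormedAddCommGroup V] [InnerProductSpace ℝ V] [FiniteDimensional ℝ V]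
  [MeasurableSpace V] [BorelSpace V]
  {M : Type*} [EMetricSpace M] [ChartedSpace V M] [IsManifold 𝓘(ℝ, V) ∞ M]
  [MeasurableSpace M] [BorelSpace M] [SecondCountableTopology M]
  {g : TensorField 𝓘(ℝ, V) M}

lemma EuclidTest.smul {A : V → V → ℝ} {O O' : Set V} (hA : FormField A O) (hO : O' ⊆ O)
    {Q : V → V} (hQ : EuclidTest A O Q) {θ : V → ℝ} (hθ : ContDiff ℝ 1 θ) (h1 : ∀ y, |θ y| ≤ 1)
    {T : Set V} (hT : IsClosed T) (hTO : O ∩ T ⊆ O') (h0 : ∀ y ∉ T, θ y = 0) :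
    EuclidTest A O' fun y ↦ θ y • Q y := by
  obtain ⟨hQ1, hQ2, K, hK, hKO, hK0⟩ := hQ
  refine ⟨hθ.smul hQ1, fun y hy ↦ ?_, K ∩ T, hK.inter_right hT,
    (inter_subset_inter_left T hKO).trans hTO, fun y hy ↦ ?_⟩
  · rw [hA.smul y (hO hy)]
    have h2 : θ y ^ 2 ≤ 1 := by rw [← sq_abs]; exact pow_le_one₀ (abs_nonneg _) (h1 y)
    have := hQ2 y (hO hy)
    have := hA.nonneg (hO hy) (Q y)
    nlinarith
  · beta_reduce
    rw [mem_inter_iff, not_and_or] at hy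
    rcases hy with hy | hy
    · rw [hK0 y hy, smul_zero]
    · rw [h0 y hy, zero_smul]

/-- Adding a coordinate ball to a set. -/
lemma variation_union_ball_le (hg : C1Metric g) {c : M} {z : V} {R σ : ℝ} (hR : 0 < R)
    (hσR : σ < R ^ 2) (hz : Metric.closedBall z R ⊆ (extChartAt 𝓘(ℝ, V) c).target)
    {F : Set M} (hF : MeasurableSet F) {L : ℝ} (hL0 : 0 < L)
    (hL : ∀ x, |deriv Real.smoothTransition x| ≤ L) {Λ : ℝ} (hΛ : 0 ≤ Λ)
    (hQΛ : ∀ Q, EuclidTest (chartForm hg c) (Metric.ball z R) Q → ∀ y, ‖Q y‖ ≤ Λ)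
    (hn : DifferentiableAt ℝ (freeVolume (Module.finBasis ℝ V).addHaar (chartSet c F) z) σ) :
    variation 𝓘(ℝ, V) g (F ∪ (extChartAt 𝓘(ℝ, V) c).symm '' {y | ‖y - z‖ ^ 2 ≤ σ})
        ((extChartAt 𝓘(ℝ, V) c).symm '' Metric.ball z R) ≤
      variation 𝓘(ℝ, V) g F ((extChartAt 𝓘(ℝ, V) c).symm '' Metric.ball z R \
        (extChartAt 𝓘(ℝ, V) c).symm '' {y | ‖y - z‖ ^ 2 ≤ σ}) +
      ENNReal.ofReal (4 * L * Λ * Real.sqrt σ *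
        deriv (freeVolume (Module.finBasis ℝ V).addHaar (chartSet c F) z) σ) := by
  set φ := extChartAt 𝓘(ℝ, V) c
  set μ := (Module.finBasis ℝ V).addHaar
  set B : Set V := {y | ‖y - z‖ ^ 2 ≤ σ}
  have hBb : B ⊆ Metric.ball z R := fun y (hy : ‖y - z‖ ^ 2 ≤ σ) ↦ by
    rw [Metric.mem_ball, dist_eq_norm]
    exact lt_of_pow_lt_pow_left₀ 2 hR.le (hy.trans_lt hσR)
  have hbT : Metric.ball z R ⊆ φ.target := Metric.ball_subset_closedBall.trans hz
  have hBT : B ⊆ φ.target := hBb.trans hbT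
  have hBc : IsClosed B := isClosed_le (by fun_prop) continuous_const
  by_cases hv : variation 𝓘(ℝ, V) g F (φ.symm '' Metric.ball z R \ φ.symm '' B) = ⊤
  · simp [hv]
  have hcb : chartSet c (φ.symm '' Metric.ball z R) = Metric.ball z R := chartSet_image hbT
  have hcB : chartSet c (φ.symm '' B) = B := chartSet_image hBT
  have hcd : chartSet c (φ.symm '' Metric.ball z R \ φ.symm '' B) = Metric.ball z R \ B := by
    rw [chartSet_sdiff, hcb, hcB]
  have hcu : chartSet c (F ∪ φ.symm '' B) = chartSet c F ∪ B := by
    conv_rhs => rw [← hcB]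
    exact inter_union_distrib_left ..
  have hBm : MeasurableSet (φ.symm '' B) := by
    have : φ.symm '' B = φ.source ∩ φ ⁻¹' B := PartialEquiv.symm_image_eq_source_inter_preimage _ hBT
    rw [this]
    exact measurableSet_source_inter_preimage c hBc.measurableSet
  have hA := formField_chartForm hg c (O := Metric.ball z R) hbT
  refine iSup₂_le fun X hX ↦ ?_
  have hWs : φ.symm '' Metric.ball z R ⊆ φ.source := by
    rintro _ ⟨y, hy, rfl⟩; exact φ.map_target (hbT hy)
  obtain ⟨Q, hQ, hQi⟩ := exists_euclidTest hg hWs hX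
  rw [hcb] at hQ
  rw [hQi _ (hF.union hBm), hcu]
  refine (ENNReal.ofReal_le_ofReal ((cutoff_estimates μ hL0 hL (measurableSet_chartSet c hF) hn
    hQ.1 hQ.hasCompactSupport hΛ (hQΛ Q hQ)
    (v := (variation 𝓘(ℝ, V) g F (φ.symm '' Metric.ball z R \ φ.symm '' B)).toReal)).2 ?_)).trans ?_
  · filter_upwards [self_mem_nhdsWithin] with h (hh : 0 < h)
    refine integral_tdiv_le hg hF hv ?_
    rw [hcd]
    refine hQ.smul hA sdiff_subset (T := {y | σ + h ≤ ‖y - z‖ ^ 2}) (contDiff_const.sub contDiff_cutoff)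
      (fun y ↦ ?_) (isClosed_le continuous_const (by fun_prop)) ?_ fun y hy ↦ ?_
    · rw [abs_of_nonneg (sub_nonneg.2 (cutoff_le_one y))]
      exact sub_le_self _ (cutoff_nonneg y)
    · rintro y ⟨hy1, hy2⟩
      refine ⟨hy1, fun hyB ↦ ?_⟩
      have h1 : ‖y - z‖ ^ 2 ≤ σ := hyB
      have h2 : σ + h ≤ ‖y - z‖ ^ 2 := hy2
      linarith
    · have h2 : ¬ (σ + h ≤ ‖y - z‖ ^ 2) := hy
      rw [cutoff_eq_one hh (by linarith), sub_self]
  · refine (ENNReal.ofReal_add_le).trans ?_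
    rw [ENNReal.ofReal_toReal hv]

/-- The complement of an outward minimizing set has volume density bounded below at the points where
it does not vanish. -/
lemma exists_growth_constant (hd : 1 < Module.finrank ℝ V) (hg : C1Metric g) {c : M} {z : V} {R : ℝ}
    {U F : Set M} (hR : 0 < R) (hz : Metric.closedBall z R ⊆ chartSet c U) (hF : MeasurableSet F)
    (hfin : ∀ K, IsCompact K → K ⊆ U → perimeter 𝓘(ℝ, V) g F K < ⊤)
    (hmin : ∀ K G, IsCompact K → K ⊆ U → MeasurableSet G → F ⊆ G → G \ F ⊆ K →
      perimeter 𝓘(ℝ, V) g F K ≤ perimeter 𝓘(ℝ, V) g G K) :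
    ∃ k : ℝ, 0 < k ∧ ∀ r, 0 < r → r < R →
      0 < freeVolume (Module.finBasis ℝ V).addHaar (chartSet c F) z (r ^ 2 / 4) →
      k * r ≤ freeVolume (Module.finBasis ℝ V).addHaar (chartSet c F) z (r ^ 2) ^
        ((Module.finrank ℝ V : ℝ)⁻¹) := by
  set φ := extChartAt 𝓘(ℝ, V) c
  set μ := (Module.finBasis ℝ V).addHaar
  set d : ℝ := ((Module.finrank ℝ V : ℕ) : ℝ) with hddef
  have hd1 : 1 < d := by rw [hddef]; exact_mod_cast hd
  obtain ⟨p, hp⟩ : ∃ p, d.HolderConjugate p :=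
    ⟨Real.conjExponent d, Real.HolderConjugate.conjExponent hd1⟩
  obtain ⟨L, hL0, hL⟩ := exists_deriv_smoothTransition_bound
  obtain ⟨C, hC, hiso⟩ := exists_isoperimetric_constant μ hp
  have hzT : Metric.closedBall z R ⊆ φ.target := hz.trans inter_subset_left
  have hbT : Metric.ball z R ⊆ φ.target := Metric.ball_subset_closedBall.trans hzT
  have hA := formField_chartForm hg c (O := φ.target) Subset.rfl
  have hAb := formField_chartForm hg c (O := Metric.ball z R) hbT
  obtain ⟨l, hl, hbd⟩ := hA.exists_bounds (isCompact_closedBall z R) hzT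
  have hl0 : 0 < l := by linarith
  have hQΛ : ∀ Q, EuclidTest (chartForm hg c) (Metric.ball z R) Q → ∀ y, ‖Q y‖ ≤ l := by
    intro Q hQ y
    by_cases hy : y ∈ Metric.ball z R
    · have h1 := (hbd y (Metric.ball_subset_closedBall hy) (Q y)).2
      have h2 := hQ.2.1 y hy
      refine le_of_sq_le_sq ?_ hl0.le
      nlinarith [sq_nonneg l]
    · obtain ⟨-, -, K, -, hKO, hK0⟩ := hQ
      rw [hK0 y fun h ↦ hy (hKO h), norm_zero]; exact hl0.le
  set n := freeVolume μ (chartSet c F) z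
  have hcb : chartSet c (φ.symm '' Metric.ball z R) = Metric.ball z R := chartSet_image hbT
  set W := φ.symm '' Metric.ball z R
  set K := φ.symm '' Metric.closedBall z R
  have hWo : IsOpen W := isOpen_chart_image hbT Metric.isOpen_ball
  have hKc : IsCompact K := isCompact_chart_symm_image hzT (isCompact_closedBall z R)
  have hWK : W ⊆ K := image_mono Metric.ball_subset_closedBall
  have hKU : K ⊆ U := by
    rintro _ ⟨y, hy, rfl⟩; exact (hz hy).2
  set c0 := C ^ p⁻¹ * (8 * l * L * l)
  refine ⟨3 / 4 / (d * c0), by positivity, fun r hr hrR h0 ↦ ?_⟩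
  have hmain := growth_of_deriv_ge (monotone_freeVolume μ (chartSet c F) z) hp (c := c0) hr
    (by positivity) ?_ h0
  · calc 3 / 4 / (d * c0) * r = 3 / 4 * r / (d * c0) := by ring
      _ ≤ _ := hmain
  intro σ hσ hn
  change n σ ^ p⁻¹ ≤ c0 * r * deriv n σ
  have hσ0 : 0 < σ := lt_trans (by positivity) hσ.1
  have hσr : Real.sqrt σ ≤ r := Real.sqrt_le_iff.2 ⟨hr.le, hσ.2.le⟩
  have hσR : σ < R ^ 2 := hσ.2.trans (by nlinarith)
  have hn0 : 0 ≤ deriv n σ := (monotone_freeVolume μ (chartSet c F) z).deriv_nonneg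
  set B : Set V := {y | ‖y - z‖ ^ 2 ≤ σ}
  have hBb : B ⊆ Metric.ball z R := fun y (hy : ‖y - z‖ ^ 2 ≤ σ) ↦ by
    rw [Metric.mem_ball, dist_eq_norm]
    exact lt_of_pow_lt_pow_left₀ 2 hR.le (hy.trans_lt hσR)
  have hBT : B ⊆ φ.target := hBb.trans hbT
  have hBcl : B = Metric.closedBall z (Real.sqrt σ) := normSq_le_eq_closedBall z hσ0.le
  have hBcomp : IsCompact B := by rw [hBcl]; exact isCompact_closedBall _ _
  set S := φ.symm '' B
  have hSc : IsCompact S := isCompact_chart_symm_image hBT hBcomp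
  have hSW : S ⊆ W := image_mono hBb
  set κ : ℝ := 4 * L * l * Real.sqrt σ * deriv n σ
  have hκ : 0 ≤ κ := by positivity
  have hvar := variation_union_ball_le hg hR hσR hzT hF hL0 hL hl0.le hQΛ hn
  -- comparison with the union
  have hPS : perimeter 𝓘(ℝ, V) g F S ≤ ENNReal.ofReal κ := by
    have hcomp := hmin K (F ∪ S) hKc hKU (hF.union hSc.isClosed.measurableSet) subset_union_left
      (by rw [union_sdiff_left]; exact sdiff_subset.trans (hSW.trans hWK))
    have hKm := hKc.isClosed.measurableSet
    have hSm := hSc.isClosed.measurableSet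
    have e1 : ∀ E, perimeter 𝓘(ℝ, V) g E K = perimeter 𝓘(ℝ, V) g E W +
        perimeter 𝓘(ℝ, V) g E (K \ W) := fun E ↦ by
      rw [← perimeterMeasure_apply hg E hKm, ← perimeterMeasure_apply hg E hWo.measurableSet,
        ← perimeterMeasure_apply hg E (hKm.diff hWo.measurableSet),
        ← measure_inter_add_sdiff K hWo.measurableSet, inter_eq_self_of_subset_right hWK]
    have e2 : perimeter 𝓘(ℝ, V) g F W = perimeter 𝓘(ℝ, V) g F S +
        perimeter 𝓘(ℝ, V) g F (W \ S) := by
      rw [← perimeterMeasure_apply hg F hWo.measurableSet, ← perimeterMeasure_apply hg F hSm,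
        ← perimeterMeasure_apply hg F (hWo.measurableSet.diff hSm),
        ← measure_inter_add_sdiff W hSm, inter_eq_self_of_subset_right hSW]
    have e3 : perimeter 𝓘(ℝ, V) g (F ∪ S) (K \ W) = perimeter 𝓘(ℝ, V) g F (K \ W) :=
      perimeter_congr hg (hF.union hSm) hF hSc.isClosed.isOpen_compl
        (fun x hx hxS ↦ hx.2 (hSW hxS)) (Eventually.of_forall fun x hx ↦
          ⟨fun h ↦ h.resolve_right hx, Or.inl⟩)
    have hf := hfin K hKc hKU
    rw [e1, e1 (F ∪ S), e3] at hcomp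
    have hf2 : perimeter 𝓘(ℝ, V) g F (K \ W) ≠ ⊤ := ((perimeter_mono sdiff_subset).trans_lt hf).ne
    have hcomp2 := (ENNReal.add_le_add_iff_right hf2).1 hcomp
    rw [perimeter_eq_variation hWo (E := F ∪ S)] at hcomp2
    have h3 := hcomp2.trans hvar
    have hf3 : perimeter 𝓘(ℝ, V) g F (W \ S) ≠ ⊤ :=
      ((perimeter_mono (sdiff_subset.trans hWK)).trans_lt hf).ne
    rw [← perimeter_eq_variation (hWo.sdiff hSc.isClosed), e2, add_comm] at h3
    exact (ENNReal.add_le_add_iff_left hf3).1 h3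
  -- test fields on the difference
  have htest : ∀ Q : V → V, ContDiff ℝ 1 Q → (∀ y, ‖Q y‖ ≤ 1) →
      (∃ r < R, ∀ y ∉ Metric.closedBall z r, Q y = 0) →
      ∫ y in B \ chartSet c F, tdiv Q y ∂μ ≤ 2 * l * κ := by
    rintro Q hQ hQ1 ⟨r', hr', hQ0⟩
    set Q' : V → V := fun y ↦ l⁻¹ • Q y
    have hQ' : EuclidTest (chartForm hg c) (Metric.ball z R) Q' := by
      refine ⟨contDiff_const.smul hQ, fun y hy ↦ ?_, _, isCompact_closedBall z r',
        Metric.closedBall_subset_ball hr', fun y hy ↦ by simp [Q', hQ0 y hy]⟩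
      have h1 := (hbd y (Metric.ball_subset_closedBall hy) (Q y)).1
      rw [hAb.smul y hy, inv_pow, inv_mul_le_iff₀ (by positivity)]
      refine h1.trans ?_
      have := hQ1 y
      have h3 : ‖Q y‖ ^ 2 ≤ 1 := pow_le_one₀ (norm_nonneg _) this
      nlinarith [sq_nonneg l]
    have hb : ∫ y in B \ chartSet c F, tdiv Q' y ∂μ ≤ 2 * κ := by
      refine le_of_forall_pos_le_add fun ε hε ↦ ?_
      obtain ⟨O, hO, hSO, hOlt⟩ := exists_open_variation_lt (b := ENNReal.ofReal (κ + ε))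
        (hPS.trans_lt ((ENNReal.ofReal_lt_ofReal_iff (by linarith)).2 (by linarith)))
      have hBO : B ⊆ chartSet c O := fun y hy ↦ ⟨hBT hy, hSO (mem_image_of_mem _ hy)⟩
      -- slightly larger balls are still contained in the open set
      obtain ⟨δ, hδ, hδO⟩ : ∃ δ > 0, ∀ h, 0 < h → h < δ →
          {y : V | ‖y - z‖ ^ 2 ≤ σ + 2 * h} ⊆ chartSet c O := by
        set T := Metric.closedBall z R \ chartSet c O
        have hT : IsCompact T := (isCompact_closedBall z R).diff (isOpen_chartSet c hO)
        have hball : ∀ h, h < (R ^ 2 - σ) / 2 → ∀ y : V, ‖y - z‖ ^ 2 ≤ σ + 2 * h →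
            y ∈ Metric.closedBall z R := fun h hh y hy ↦ by
          rw [Metric.mem_closedBall, dist_eq_norm]
          exact le_of_sq_le_sq (by linarith) hR.le
        rcases T.eq_empty_or_nonempty with hTe | hTne
        · refine ⟨(R ^ 2 - σ) / 2, by linarith, fun h hh hh2 y hy ↦ ?_⟩
          by_contra hyO
          have : y ∈ T := ⟨hball h hh2 y hy, hyO⟩
          rw [hTe] at this; exact this
        · obtain ⟨y0, hy0, hmin0⟩ := hT.exists_isMinOn hTne
            (f := fun y ↦ ‖y - z‖ ^ 2) (by fun_prop)
          have hy0σ : σ < ‖y0 - z‖ ^ 2 := by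
            by_contra hle
            exact hy0.2 (hBO (not_lt.1 hle))
          refine ⟨min ((R ^ 2 - σ) / 2) ((‖y0 - z‖ ^ 2 - σ) / 2),
            lt_min (by linarith) (by linarith), fun h hh hh2 y hy ↦ ?_⟩
          by_contra hyO
          have h1 := hmin0 ⟨hball h (hh2.trans_le (min_le_left _ _)) y hy, hyO⟩
          have h2 := hh2.trans_le (min_le_right _ _)
          have h3 : ‖y0 - z‖ ^ 2 ≤ ‖y - z‖ ^ 2 := h1
          have h4 : ‖y - z‖ ^ 2 ≤ σ + 2 * h := hy
          linarith
      have hne : variation 𝓘(ℝ, V) g F (W ∩ O) ≠ ⊤ :=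
        ((variation_mono inter_subset_right).trans_lt (hOlt.trans ENNReal.ofReal_lt_top)).ne
      have hcap : chartSet c (W ∩ O) = Metric.ball z R ∩ chartSet c O := by
        rw [chartSet_inter, hcb]
      have hest := (cutoff_estimates (z := z) (σ := σ) μ hL0 hL (measurableSet_chartSet c hF) hn
        hQ'.1 hQ'.hasCompactSupport hl0.le (hQΛ _ hQ') (v := κ + ε)).1 ?_
      · change _ ≤ κ + ε + κ at hest
        linarith
      · filter_upwards [Ioo_mem_nhdsGT hδ] with h hh
        refine (integral_tdiv_le hg hF hne ?_).trans ?_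
        · rw [hcap]
          refine hQ'.smul hAb inter_subset_left (T := {y | ‖y - z‖ ^ 2 ≤ σ + 2 * h})
            contDiff_cutoff.neg (fun y ↦ ?_) (isClosed_le (by fun_prop) continuous_const)
            (inter_subset_inter_right _ (hδO h hh.1 hh.2)) fun y hy ↦ ?_
          · rw [abs_neg, abs_of_nonneg (cutoff_nonneg y)]; exact cutoff_le_one y
          · have h2 : ¬ (‖y - z‖ ^ 2 ≤ σ + 2 * h) := hy
            rw [cutoff_eq_zero hh.1 (by linarith), neg_zero]
        · refine ENNReal.toReal_le_of_le_ofReal (by linarith) ?_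
          exact (variation_mono inter_subset_right).trans hOlt.le
    have e : ∀ y, tdiv Q y = l * tdiv Q' y := fun y ↦ by
      have : tdiv Q' y = l⁻¹ * tdiv Q y := by
        rw [tdiv_eq, fderiv_fun_const_smul (hQ.differentiable one_ne_zero y), map_smul]; rfl
      rw [this, ← mul_assoc, mul_inv_cancel₀ hl0.ne', one_mul]
    simp_rw [e]
    rw [integral_const_mul]
    nlinarith
  have hBm : MeasurableSet B := hBcomp.isClosed.measurableSet
  have hfinal := hiso (B \ chartSet c F) (hBm.diff (measurableSet_chartSet c hF)) z (Real.sqrt σ) R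
    (by rw [Real.sqrt_lt' hR]; exact hσR) (hBcl ▸ sdiff_subset) (2 * l * κ) (by positivity) htest
  change n σ ≤ _ at hfinal
  have hnn : 0 ≤ n σ := measureReal_nonneg
  have hp0 : 0 < p := hp.symm.pos
  calc n σ ^ p⁻¹ ≤ (C * (2 * l * κ) ^ p) ^ p⁻¹ :=
        Real.rpow_le_rpow hnn hfinal (inv_pos.2 hp0).le
    _ = C ^ p⁻¹ * (2 * l * κ) := by
        rw [Real.mul_rpow hC.le (by positivity), ← Real.rpow_mul (by positivity),
          mul_inv_cancel₀ hp0.ne', Real.rpow_one]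
    _ = C ^ p⁻¹ * (8 * l * L * l) * Real.sqrt σ * deriv n σ := by simp only [κ]; ring
    _ ≤ c0 * r * deriv n σ := by gcongr

end Density

end STIMCF
end

noncomputable section
namespace STIMCF
set_option linter.unusedSectionVars false

section NullSets

variable {V : Type*} [NormedAddCommGroup V] [NormedSpace ℝ V] [FiniteDimensional ℝ V]
  [MeasurableSpace V] [BorelSpace V]
  {M : Type*} [TopologicalSpace M] [ChartedSpace V M] [IsManifold 𝓘(ℝ, V) ∞ M]
  [MeasurableSpace M] [BorelSpace M] [T2Space M] [SecondCountableTopology M]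
  {g : TensorField 𝓘(ℝ, V) M}

lemma vol_eq_zero_iff_chartSet (hg : C1Metric g) {c : M} {S : Set M} (hS : MeasurableSet S)
    (hsub : S ⊆ (extChartAt 𝓘(ℝ, V) c).source) :
    vol 𝓘(ℝ, V) g S = 0 ↔ (Module.finBasis ℝ V).addHaar (chartSet c S) = 0 := by
  rw [vol_apply_of_subset hg c hS hsub, chartMeasure_apply c hS]
  constructor
  · intro h
    have hm := measurableSet_chartSet (V := V) c hS
    change ∫⁻ y in chartSet c S, _ ∂_ = 0 at h
    rw [setLIntegral_eq_zero_iff' hm] at h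
    · by_contra hne
      have : ∀ᵐ y ∂(Module.finBasis ℝ V).addHaar, y ∉ chartSet c S := by
        filter_upwards [h] with y hy hyS
        have := hy hyS
        rw [ENNReal.ofReal_eq_zero] at this
        exact absurd this (not_le.2 (sqrtDet_pos hg hyS.1))
      exact hne (by simpa using measure_eq_zero_iff_ae_notMem.2 this)
    · refine (AEMeasurable.ennreal_ofReal ?_)
      exact (aemeasurable_sqrtDet hg c).mono_measure (Measure.restrict_mono inter_subset_left le_rfl)
  · exact fun h ↦ setLIntegral_measure_zero _ _ h

end NullSets

section Density

variable {V : Type*} [NormedAddCommGroup V] [InnerProductSpace ℝ V] [FiniteDimensional ℝ V]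
  [MeasurableSpace V] [BorelSpace V]
  {M : Type*} [EMetricSpace M] [ChartedSpace V M] [IsManifold 𝓘(ℝ, V) ∞ M]
  [MeasurableSpace M] [BorelSpace M] [SecondCountableTopology M]
  {g : TensorField 𝓘(ℝ, V) M}

/-- An outward minimizing set is open up to a null set. -/
theorem exists_open_ae_eq (hd : 1 < Module.finrank ℝ V) (hg : C1Metric g)
    {U F : Set M} (hU : IsOpen U) (hF : MeasurableSet F)
    (hfin : ∀ K, IsCompact K → K ⊆ U → perimeter 𝓘(ℝ, V) g F K < ⊤)
    (hmin : ∀ K G, IsCompact K → K ⊆ U → MeasurableSet G → F ⊆ G → G \ F ⊆ K →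
      perimeter 𝓘(ℝ, V) g F K ≤ perimeter 𝓘(ℝ, V) g G K) :
    ∃ G, IsOpen G ∧ G ⊆ U ∧ vol 𝓘(ℝ, V) g (G \ F) = 0 ∧ vol 𝓘(ℝ, V) g ((F ∩ U) \ G) = 0 := by
  set 𝒩 : Set (Set M) := {N | IsOpen N ∧ N ⊆ U ∧ vol 𝓘(ℝ, V) g (N \ F) = 0}
  have hGo : IsOpen (⋃₀ 𝒩) := isOpen_sUnion fun N hN ↦ hN.1
  refine ⟨⋃₀ 𝒩, hGo, sUnion_subset fun N hN ↦ hN.2.1, ?_, ?_⟩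
  · obtain ⟨T, hTc, hT, hTu⟩ := TopologicalSpace.isOpen_sUnion_countable 𝒩 fun N hN ↦ hN.1
    have e : (⋃₀ T) \ F = ⋃ N ∈ T, N \ F := by
      ext x
      simp only [Set.mem_sdiff, mem_sUnion, mem_iUnion₂, exists_prop]
      tauto
    rw [← hTu, e]
    exact (measure_biUnion_null_iff hTc).2 fun N hN ↦ (hT hN).2.2
  refine measure_null_of_locally_null _ fun c _ ↦ ?_
  set φ := extChartAt 𝓘(ℝ, V) c
  set μ := (Module.finBasis ℝ V).addHaar
  set S := ((F ∩ U) \ ⋃₀ 𝒩) ∩ φ.source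
  have hSm : MeasurableSet S := (((hF.inter hU.measurableSet).diff hGo.measurableSet).inter
    (isOpen_extChartAt_source c).measurableSet)
  refine ⟨S, inter_mem_nhdsWithin _ (extChartAt_source_mem_nhds c), ?_⟩
  rw [vol_eq_zero_iff_chartSet hg hSm inter_subset_right, measure_eq_zero_iff_ae_notMem]
  filter_upwards [Besicovitch.ae_tendsto_measure_inter_div_of_measurableSet μ
    (measurableSet_chartSet (V := V) c hF)] with y hy hyS
  have hyF : y ∈ chartSet c F := ⟨hyS.1, hyS.2.1.1.1⟩
  have hyU : y ∈ chartSet c U := ⟨hyS.1, hyS.2.1.1.2⟩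
  refine hyS.2.1.2 ?_
  rw [indicator_of_mem hyF, Pi.one_apply] at hy
  obtain ⟨R, hR, hRU⟩ := Metric.nhds_basis_closedBall.mem_iff.1 ((isOpen_chartSet c hU).mem_nhds hyU)
  obtain ⟨k, hk, hgrow⟩ := exists_growth_constant hd hg hR hRU hF hfin hmin
  set n := freeVolume μ (chartSet c F) y
  set D := μ.real (Metric.ball (0 : V) 1)
  have hD : 0 < D := 
    ENNReal.toReal_pos (Metric.measure_ball_pos μ _ one_pos).ne' measure_ball_lt_top.ne
  set d := Module.finrank ℝ V
  have hd0 : d ≠ 0 := by omega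
  have hball : ∀ r, 0 ≤ r → μ.real (Metric.closedBall y r) = r ^ d * D := fun r hr ↦ by
    rw [Measure.real, Measure.addHaar_closedBall μ y hr, ENNReal.toReal_mul,
      ENNReal.toReal_ofReal (by positivity)]
    rfl
  have hev : ∀ᶠ r in 𝓝[>] (0 : ℝ), 1 - min (k ^ d / D) 1 / 2 <
      (μ (chartSet c F ∩ Metric.closedBall y r) / μ (Metric.closedBall y r)).toReal := by
    have h1 := (ENNReal.tendsto_toReal ENNReal.one_ne_top).comp hy
    refine h1.eventually (lt_mem_nhds ?_)
    have : 0 < min (k ^ d / D) 1 := by positivity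
    rw [ENNReal.toReal_one]; linarith
  obtain ⟨r, hr, hrI⟩ := (hev.and (Ioo_mem_nhdsGT hR)).exists
  have hr0 := hrI.1
  have hB : {x : V | ‖x - y‖ ^ 2 ≤ r ^ 2} = Metric.closedBall y r := by
    rw [normSq_le_eq_closedBall y (sq_nonneg r), Real.sqrt_sq hr0.le]
  have hfinB : μ (Metric.closedBall y r) ≠ ⊤ := measure_closedBall_lt_top.ne
  have hn : n (r ^ 2) = r ^ d * D - μ.real (chartSet c F ∩ Metric.closedBall y r) := by
    rw [← hball r hr0.le]
    change μ.real ({x : V | ‖x - y‖ ^ 2 ≤ r ^ 2} \ _) = _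
    rw [hB, inter_comm]
    have := measureReal_inter_add_sdiff (μ := μ) (s := Metric.closedBall y r)
      (measurableSet_chartSet (V := V) c hF) hfinB
    linarith
  have hsmall : n (r ^ 2) < (k * r) ^ d := by
    rw [ENNReal.toReal_div] at hr
    change _ < μ.real _ / μ.real _ at hr
    rw [hball r hr0.le, lt_div_iff₀ (by positivity)] at hr
    have h1 : min (k ^ d / D) 1 ≤ k ^ d / D := min_le_left _ _
    have h2 : 0 < r ^ d * D := by positivity
    have h3 : min (k ^ d / D) 1 / 2 * (r ^ d * D) < k ^ d / D * (r ^ d * D) := by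
      refine mul_lt_mul_of_pos_right ?_ h2
      have : 0 < k ^ d / D := by positivity
      linarith
    have h4 : k ^ d / D * (r ^ d * D) = (k * r) ^ d := by rw [mul_pow]; field_simp
    rw [hn]
    linarith
  have hzero : n (r ^ 2 / 4) = 0 := by
    by_contra hne
    have hpos : 0 < n (r ^ 2 / 4) := lt_of_le_of_ne measureReal_nonneg (Ne.symm hne)
    have h1 := hgrow r hr0 hrI.2 hpos
    have hn0 : 0 ≤ n (r ^ 2) := measureReal_nonneg
    have h2 := pow_le_pow_left₀ (by positivity) h1 d
    rw [Real.rpow_inv_natCast_pow hn0 hd0] at h2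
    linarith
  have hbU : Metric.ball y (r / 2) ⊆ chartSet c U :=
    (Metric.ball_subset_closedBall.trans (Metric.closedBall_subset_closedBall
      (by linarith [hrI.2]))).trans hRU
  have hbT : Metric.ball y (r / 2) ⊆ φ.target := hbU.trans inter_subset_left
  refine mem_sUnion.2 ⟨φ.symm '' Metric.ball y (r / 2), ⟨isOpen_chart_image hbT Metric.isOpen_ball,
    ?_, ?_⟩, mem_image_of_mem _ (Metric.mem_ball_self (by positivity))⟩
  · rintro _ ⟨x, hx, rfl⟩; exact (hbU hx).2
  · rw [vol_eq_zero_iff_chartSet hg ((isOpen_chart_image hbT Metric.isOpen_ball).measurableSet.diff hF)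
      (c := c), chartSet_sdiff, chartSet_image hbT]
    · have h1 : μ ({x : V | ‖x - y‖ ^ 2 ≤ r ^ 2 / 4} \ chartSet c F) = 0 := by
        refine (measureReal_eq_zero_iff ?_).1 hzero
        exact ((measure_mono sdiff_subset).trans_lt (measure_normSq_le_lt_top μ y _)).ne
      refine measure_mono_null (sdiff_subset_sdiff_left fun x hx ↦ ?_) h1
      rw [Metric.mem_ball, dist_eq_norm] at hx
      change ‖x - y‖ ^ 2 ≤ r ^ 2 / 4
      nlinarith [norm_nonneg (x - y)]
    · rintro _ ⟨⟨x, hx, rfl⟩, -⟩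
      exact φ.map_target (hbT hx)

end Density

end STIMCF
end

noncomputable section
namespace STIMCF
set_option linter.unusedSectionVars false

section CylinderAlgebra

variable {V : Type*} [AddCommGroup V] [Module ℝ V]

/-- The trace of a bilinear form with respect to another one, computed in a basis. -/
def formTrace {ι : Type*} [Fintype ι] [DecidableEq ι] (b : Module.Basis ι ℝ V)
    (G K : LinearMap.BilinForm ℝ V) : ℝ :=
  ∑ i, ∑ j, (LinearMap.BilinForm.toMatrix b G)⁻¹ i j * K (b i) (b j)

lemma formTrace_eq_trace {ι : Type*} [Fintype ι] [DecidableEq ι] (b : Module.Basis ι ℝ V)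
    (G K : LinearMap.BilinForm ℝ V) : formTrace b G K =
      ((LinearMap.BilinForm.toMatrix b G)⁻¹ *
        (LinearMap.BilinForm.toMatrix b K).transpose).trace := by
  simp [formTrace, Matrix.trace, Matrix.mul_apply, LinearMap.BilinForm.toMatrix_apply]

lemma formTrace_basis {ι : Type*} [Fintype ι] [DecidableEq ι] (b c : Module.Basis ι ℝ V)
    (G K : LinearMap.BilinForm ℝ V) : formTrace c G K = formTrace b G K := by
  rw [formTrace_eq_trace, formTrace_eq_trace, ← LinearMap.BilinForm.toMatrix_mul_basis_toMatrix b c,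
    ← LinearMap.BilinForm.toMatrix_mul_basis_toMatrix b c]
  set P := b.toMatrix c
  have hP : IsUnit P.det := by
    have := b.invertibleToMatrix c
    exact (Matrix.isUnit_iff_isUnit_det _).1 (isUnit_of_invertible P)
  have hPT : IsUnit P.transpose.det := by rwa [Matrix.det_transpose]
  set A := LinearMap.BilinForm.toMatrix b G
  set B := LinearMap.BilinForm.toMatrix b K
  rw [Matrix.mul_inv_rev, Matrix.mul_inv_rev, Matrix.transpose_mul, Matrix.transpose_mul,
    Matrix.transpose_transpose]
  have : P⁻¹ * (A⁻¹ * P.transpose⁻¹) * (P.transpose * (B.transpose * P)) =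
      P⁻¹ * (A⁻¹ * B.transpose) * P := by
    simp only [Matrix.mul_assoc]
    rw [← Matrix.mul_assoc P.transpose⁻¹, Matrix.nonsing_inv_mul _ hPT, Matrix.one_mul]
  rw [this, Matrix.trace_mul_comm, ← Matrix.mul_assoc, Matrix.mul_nonsing_inv _ hP, Matrix.one_mul]

variable [FiniteDimensional ℝ V]

variable (V) in
/-- The basis of `V × ℝ` that extends the chosen basis of `V` by the vertical unit vector. -/
def cylBasis : Module.Basis (Fin (Module.finrank ℝ (V × ℝ))) ℝ (V × ℝ) :=
  ((Module.finBasis ℝ V).prod (Module.Basis.singleton Unit ℝ)).reindex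
    (Fintype.equivOfCardEq (by simp))

/-- The bilinear form `G + dz²` on `V × ℝ`. -/
def cylForm (G : LinearMap.BilinForm ℝ V) (a : ℝ) : LinearMap.BilinForm ℝ (V × ℝ) :=
  G.comp (LinearMap.fst ℝ V ℝ) (LinearMap.fst ℝ V ℝ) +
    a • (LinearMap.mul ℝ ℝ).compl₁₂ (LinearMap.snd ℝ V ℝ) (LinearMap.snd ℝ V ℝ)

lemma cylForm_apply (G : LinearMap.BilinForm ℝ V) (a : ℝ) (v w : V × ℝ) :
    cylForm G a v w = G v.1 w.1 + a * (v.2 * w.2) := by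
  simp [cylForm]

lemma toMatrix_cylForm (G : LinearMap.BilinForm ℝ V) (a : ℝ) :
    LinearMap.BilinForm.toMatrix (cylBasis V) (cylForm G a) =
      (Matrix.fromBlocks (LinearMap.BilinForm.toMatrix (Module.finBasis ℝ V) G) 0 0
        (a • (1 : Matrix Unit Unit ℝ))).submatrix (Fintype.equivOfCardEq (by simp)).symm
          (Fintype.equivOfCardEq (by simp)).symm := by
  ext i j
  rw [LinearMap.BilinForm.toMatrix_apply, cylForm_apply, Matrix.submatrix_apply]
  simp only [cylBasis, Module.Basis.reindex_apply]
  rcases (Fintype.equivOfCardEq _).symm i with i | i <;>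
  rcases (Fintype.equivOfCardEq _).symm j with j | j <;>
  simp [LinearMap.BilinForm.toMatrix_apply]

lemma det_cylForm (G : LinearMap.BilinForm ℝ V) :
    (LinearMap.BilinForm.toMatrix (Module.finBasis ℝ (V × ℝ)) (cylForm G 1)).det =
      ((cylBasis V).toMatrix (Module.finBasis ℝ (V × ℝ))).det ^ 2 *
        (LinearMap.BilinForm.toMatrix (Module.finBasis ℝ V) G).det := by
  rw [← LinearMap.BilinForm.toMatrix_mul_basis_toMatrix (cylBasis V), Matrix.det_mul,
    Matrix.det_mul, Matrix.det_transpose, toMatrix_cylForm, Matrix.det_submatrix_equiv_self,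
    Matrix.det_fromBlocks_zero₂₁]
  simp
  ring

lemma formTrace_cylForm {G : LinearMap.BilinForm ℝ V}
    (hG : IsUnit (LinearMap.BilinForm.toMatrix (Module.finBasis ℝ V) G).det)
    (K : LinearMap.BilinForm ℝ V) :
    formTrace (Module.finBasis ℝ (V × ℝ)) (cylForm G 1) (cylForm K 0) =
      formTrace (Module.finBasis ℝ V) G K := by
  rw [formTrace_basis (cylBasis V), formTrace_eq_trace, formTrace_eq_trace, toMatrix_cylForm,
    toMatrix_cylForm, Matrix.inv_submatrix_equiv, Matrix.transpose_submatrix,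
    Matrix.submatrix_mul_equiv, Matrix.inv_fromBlocks_zero₂₁_of_isUnit_iff _ _ _
      (by simp [Matrix.isUnit_iff_isUnit_det, isUnit_iff_ne_zero.1 hG])]
  simp only [Matrix.trace, Matrix.diag_apply, Matrix.submatrix_apply]
  rw [Equiv.sum_comp (Fintype.equivOfCardEq _).symm
    (fun i ↦ (_ : Matrix (_ ⊕ Unit) (_ ⊕ Unit) ℝ) i i), Fintype.sum_sum_type]
  simp [Matrix.fromBlocks_transpose, Matrix.fromBlocks_multiply]

lemma exists_addHaar_cylinder {V : Type*} [NormedAddCommGroup V] [NormedSpace ℝ V]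
    [FiniteDimensional ℝ V] [MeasurableSpace V] [BorelSpace V] :
    ∃ κ : ℝ≥0∞, κ ≠ 0 ∧ κ ≠ ⊤ ∧ (Module.finBasis ℝ (V × ℝ)).addHaar =
      κ • ((Module.finBasis ℝ V).addHaar.prod (volume : Measure ℝ)) := by
  set μ := (Module.finBasis ℝ V).addHaar.prod (volume : Measure ℝ)
  set K := (Module.finBasis ℝ (V × ℝ)).parallelepiped
  have h : μ = μ K • (Module.finBasis ℝ (V × ℝ)).addHaar := by
    rw [Module.Basis.addHaar_def]
    exact Measure.addHaarMeasure_unique μ K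
  have h0 : μ K ≠ 0 := (Measure.measure_pos_of_nonempty_interior μ K.interior_nonempty).ne'
  have h1 : μ K ≠ ⊤ := K.isCompact.measure_lt_top.ne
  refine ⟨(μ K)⁻¹, ENNReal.inv_ne_zero.2 h1, ENNReal.inv_ne_top.2 h0, ?_⟩
  have h2 := congrArg (fun m ↦ (μ K)⁻¹ • m) h
  simp only [smul_smul] at h2
  rw [h2, ENNReal.inv_mul_cancel h0 h1, one_smul]

end CylinderAlgebra

section CylinderCharts

variable {V : Type*} [NormedAddCommGroup V] [NormedSpace ℝ V]
  {M : Type*} [TopologicalSpace M] [ChartedSpace V M] [IsManifold 𝓘(ℝ, V) ∞ M]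
  {g : TensorField 𝓘(ℝ, V) M}

lemma extChartAt_cyl_symm (X₀ : M × ℝ) (y : V × ℝ) :
    (extChartAt (𝓘(ℝ, V).prod 𝓘(ℝ, ℝ)) X₀).symm y =
      ((extChartAt 𝓘(ℝ, V) X₀.1).symm y.1, y.2) := rfl

lemma extChartAt_cyl_target (X₀ : M × ℝ) : (extChartAt (𝓘(ℝ, V).prod 𝓘(ℝ, ℝ)) X₀).target =
    (extChartAt 𝓘(ℝ, V) X₀.1).target ×ˢ univ := by
  rw [extChartAt_prod, PartialEquiv.prod_target, extChartAt_model_space_eq_id]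
  rfl

lemma coord_cyl {X₀ X : M × ℝ} (hX : X.1 ∈ (extChartAt 𝓘(ℝ, V) X₀.1).source)
    (v : TangentSpace (𝓘(ℝ, V).prod 𝓘(ℝ, ℝ)) X) :
    coord (𝓘(ℝ, V).prod 𝓘(ℝ, ℝ)) X₀ X v = (coord 𝓘(ℝ, V) X₀.1 X.1 v.1, v.2) := by
  unfold coord
  have h1 : MDifferentiableAt 𝓘(ℝ, V) 𝓘(ℝ, V) (extChartAt 𝓘(ℝ, V) X₀.1) X.1 :=
    mdifferentiableAt_extChartAt (by simpa using hX)
  have h := mfderiv_prodMap (p := X) h1 (mdifferentiableAt_id (I := 𝓘(ℝ, ℝ)) (x := X.2))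
  rw [modelWithCornersSelf_prod, ← chartedSpaceSelf_prod]
  refine (congrArg (fun C ↦ C v) h).trans ?_
  simp
  rfl

lemma coordVec_cyl {X₀ : M × ℝ} {y : V × ℝ} (hy : y.1 ∈ (extChartAt 𝓘(ℝ, V) X₀.1).target)
    (v : V × ℝ) : coordVec (𝓘(ℝ, V).prod 𝓘(ℝ, ℝ)) X₀ y v =
      (coordVec 𝓘(ℝ, V) X₀.1 y.1 v.1, v.2) := by
  unfold coordVec
  have h := mfderiv_prodMap (p := y) (mdifferentiableAt_symm hy)
    (mdifferentiableAt_id (I := 𝓘(ℝ, ℝ)) (x := y.2))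
  rw [modelWithCornersSelf_prod, ← chartedSpaceSelf_prod]
  refine (congrArg (fun C ↦ C v) h).trans ?_
  simp
  rfl

variable [FiniteDimensional ℝ V]

variable (V) in
/-- The ratio between the volume densities of the cylinder and of its base. -/
def cylRatio : ℝ := |((cylBasis V).toMatrix (Module.finBasis ℝ (V × ℝ))).det|

lemma cylRatio_pos : 0 < cylRatio V := by
  refine abs_pos.2 ?_
  have := (cylBasis V).invertibleToMatrix (Module.finBasis ℝ (V × ℝ))
  exact ((Matrix.isUnit_iff_isUnit_det _).1 (isUnit_of_invertible
    ((cylBasis V).toMatrix (Module.finBasis ℝ (V × ℝ))))).ne_zero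

lemma sqrtDet_cyl (hg : C1Metric g) {X₀ : M × ℝ} {y : V × ℝ}
    (hy : y.1 ∈ (extChartAt 𝓘(ℝ, V) X₀.1).target) :
    sqrtDet (𝓘(ℝ, V).prod 𝓘(ℝ, ℝ)) (cylMetric 𝓘(ℝ, V) g) X₀ y =
      cylRatio V * sqrtDet 𝓘(ℝ, V) g X₀.1 y.1 := by
  rw [sqrtDet_eq hg, cylRatio, ← Real.sqrt_sq_eq_abs, ← Real.sqrt_mul (sq_nonneg _),
    ← det_cylForm]
  unfold sqrtDet
  congr 2
  ext i j
  rw [LinearMap.BilinForm.toMatrix_apply, cylForm_apply, Matrix.of_apply, coordVec_cyl hy,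
    coordVec_cyl hy, gramForm_apply]
  simp [cylMetric]
  rfl

end CylinderCharts

section CylinderVolume

variable {V : Type*} [NormedAddCommGroup V] [NormedSpace ℝ V] [FiniteDimensional ℝ V]
  [MeasurableSpace V] [BorelSpace V]
  {M : Type*} [TopologicalSpace M] [ChartedSpace V M] [IsManifold 𝓘(ℝ, V) ∞ M]
  [MeasurableSpace M] [BorelSpace M] [SecondCountableTopology M]
  {g : TensorField 𝓘(ℝ, V) M}

lemma sigmaFinite_vol (hg : C1Metric g) : SigmaFinite (vol 𝓘(ℝ, V) g) := by
  have := isLocallyFiniteMeasure_vol hg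
  infer_instance

lemma exists_vol_cylinder (hg : C1Metric g) : ∃ c : ℝ, 0 < c ∧
    vol (𝓘(ℝ, V).prod 𝓘(ℝ, ℝ)) (cylMetric 𝓘(ℝ, V) g) =
      ENNReal.ofReal c • (vol 𝓘(ℝ, V) g).prod (volume : Measure ℝ) := by
  have hsf := sigmaFinite_vol hg
  obtain ⟨κ, hκ0, hκ, hH⟩ := exists_addHaar_cylinder (V := V)
  have hc0 : ENNReal.ofReal (cylRatio V) ≠ 0 := by simpa using cylRatio_pos
  set l := κ * ENNReal.ofReal (cylRatio V)
  have hl0 : l ≠ 0 := mul_ne_zero hκ0 hc0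
  have hl : l ≠ ⊤ := ENNReal.mul_ne_top hκ ENNReal.ofReal_ne_top
  refine ⟨l.toReal, ENNReal.toReal_pos hl0 hl, ?_⟩
  rw [ENNReal.ofReal_toReal hl]
  have hsfc : ∀ c : M, SigmaFinite (chartMeasure g c) := fun c ↦ by
    rw [← vol_restrict_source hg]; infer_instance
  have hchart : ∀ X₀ : M × ℝ, Measure.map (extChartAt (𝓘(ℝ, V).prod 𝓘(ℝ, ℝ)) X₀).symm
      (((Module.finBasis ℝ (V × ℝ)).addHaar.restrict
        (extChartAt (𝓘(ℝ, V).prod 𝓘(ℝ, ℝ)) X₀).target).withDensity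
      fun y ↦ ENNReal.ofReal (sqrtDet (𝓘(ℝ, V).prod 𝓘(ℝ, ℝ)) (cylMetric 𝓘(ℝ, V) g) X₀ y)) =
        l • (chartMeasure g X₀.1).prod volume := by
    intro X₀
    have hTm := (isOpen_extChartAt_target (I := 𝓘(ℝ, V)) X₀.1).measurableSet
    have hinv : l⁻¹ * l = 1 := ENNReal.inv_mul_cancel hl0 hl
    suffices h : (chartMeasure g X₀.1).prod volume = l⁻¹ •
        Measure.map (extChartAt (𝓘(ℝ, V).prod 𝓘(ℝ, ℝ)) X₀).symm
        (((Module.finBasis ℝ (V × ℝ)).addHaar.restrict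
          (extChartAt (𝓘(ℝ, V).prod 𝓘(ℝ, ℝ)) X₀).target).withDensity
        fun y ↦ ENNReal.ofReal (sqrtDet (𝓘(ℝ, V).prod 𝓘(ℝ, ℝ)) (cylMetric 𝓘(ℝ, V) g) X₀ y)) by
      rw [h, smul_smul, mul_comm l, hinv, one_smul]
    refine Measure.prod_eq fun s t hs ht ↦ ?_
    have hs' := measurableSet_target_inter_preimage (V := V) X₀.1 hs
    have hae : AEMeasurable (extChartAt (𝓘(ℝ, V).prod 𝓘(ℝ, ℝ)) X₀).symm
        ((Module.finBasis ℝ (V × ℝ)).addHaar.restrict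
          (extChartAt (𝓘(ℝ, V).prod 𝓘(ℝ, ℝ)) X₀).target) :=
      (continuousOn_extChartAt_symm (I := 𝓘(ℝ, V).prod 𝓘(ℝ, ℝ)) X₀).aemeasurable
        (isOpen_extChartAt_target X₀).measurableSet
    rw [Measure.smul_apply, Measure.map_apply_of_aemeasurable
      (hae.mono_ac (withDensity_absolutelyContinuous _ _)) (hs.prod ht), withDensity_apply',
      Measure.restrict_restrict' (isOpen_extChartAt_target X₀).measurableSet]
    have hset : (extChartAt (𝓘(ℝ, V).prod 𝓘(ℝ, ℝ)) X₀).symm ⁻¹' s ×ˢ t ∩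
        (extChartAt (𝓘(ℝ, V).prod 𝓘(ℝ, ℝ)) X₀).target =
        ((extChartAt 𝓘(ℝ, V) X₀.1).target ∩ (extChartAt 𝓘(ℝ, V) X₀.1).symm ⁻¹' s) ×ˢ t := by
      rw [extChartAt_cyl_target]
      ext y
      simp only [mem_inter_iff, mem_preimage, extChartAt_cyl_symm, mem_prod, mem_univ, and_true]
      tauto
    rw [hset, setLIntegral_congr_fun (hs'.prod ht) (g := fun y ↦ ENNReal.ofReal (cylRatio V) *
      (ENNReal.ofReal (sqrtDet 𝓘(ℝ, V) g X₀.1 y.1) * 1)), lintegral_const_mul' _ _ ENNReal.ofReal_ne_top, hH,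
      Measure.restrict_smul, lintegral_smul_measure, ← Measure.prod_restrict,
      lintegral_prod_mul (f := fun y ↦ ENNReal.ofReal (sqrtDet 𝓘(ℝ, V) g X₀.1 y))
        (g := fun _ ↦ 1), chartMeasure_apply _ hs]
    · simp only [lintegral_const, one_mul, Measure.restrict_apply_univ, smul_eq_mul]
      rw [← mul_assoc (ENNReal.ofReal _), mul_comm (ENNReal.ofReal _) κ, ← mul_assoc l⁻¹, hinv,
        one_mul]
    · exact ((aemeasurable_sqrtDet hg X₀.1).mono_set inter_subset_left).ennreal_ofReal
    · exact aemeasurable_const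
    · intro y hy
      beta_reduce
      rw [sqrtDet_cyl hg hy.1.1, ENNReal.ofReal_mul cylRatio_pos.le, mul_one]
  have hsup : vol (𝓘(ℝ, V).prod 𝓘(ℝ, ℝ)) (cylMetric 𝓘(ℝ, V) g) =
      ⨆ X₀ : M × ℝ, l • (chartMeasure g X₀.1).prod volume := iSup_congr hchart
  rw [hsup]
  rcases isEmpty_or_nonempty M with hM | hM
  · ext s
    have : IsEmpty (M × ℝ) := inferInstance
    simp [Set.eq_empty_of_isEmpty s]
  obtain ⟨x, D, hm, hD, hd, hu⟩ := exists_chart_partition (V := V) (M := M)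
  have hres : ∀ (c : M) (n : ℕ), (l • (chartMeasure g c).prod volume).restrict (D n ×ˢ univ) =
      l • ((chartMeasure g c).restrict (D n)).prod (volume : Measure ℝ) := fun c n ↦ by
    rw [Measure.restrict_smul, ← Measure.prod_restrict, Measure.restrict_univ]
  have hle : ∀ (c : M) (n : ℕ), ((chartMeasure g c).restrict (D n)).prod (volume : Measure ℝ) ≤
      ((chartMeasure g (x n)).restrict (D n)).prod volume := fun c n ↦ by
    refine Measure.prod_mono (Measure.le_iff.2 fun s hs' ↦ ?_) le_rfl
    rw [Measure.restrict_apply hs', Measure.restrict_apply hs']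
    exact chartMeasure_le hg _ _ (hs'.inter (hm n)) (inter_subset_right.trans (hD n))
  rw [iSup_measure_eq_sum _ (fun n ↦ D n ×ˢ (univ : Set ℝ)) (fun n ↦ (x n, 0))
    (fun n ↦ (hm n).prod MeasurableSet.univ)
    (fun i j hij ↦ Set.disjoint_prod.2 (Or.inl (hd hij)))
    (by rw [← iUnion_prod_const, hu, univ_prod_univ])
    (fun X n ↦ by
      rw [hres, hres]
      exact fun s ↦ by
        rw [Measure.smul_apply, Measure.smul_apply, smul_eq_mul, smul_eq_mul]
        exact mul_le_mul' le_rfl (hle X.1 n s))]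
  simp only [hres]
  rw [vol_eq_sum hg hm hD hd hu, Measure.prod_sum_left]
  ext s hs
  rw [Measure.smul_apply, Measure.sum_apply _ hs, Measure.sum_apply _ hs, smul_eq_mul,
    ← ENNReal.tsum_mul_left]
  simp

end CylinderVolume
end STIMCF
end

noncomputable section
namespace STIMCF
set_option linter.unusedSectionVars false

section CylinderGradient

variable {V : Type*} [NormedAddCommGroup V] [NormedSpace ℝ V]
  {M : Type*} [TopologicalSpace M] [ChartedSpace V M]
  {g : TensorField 𝓘(ℝ, V) M}

lemma differential_cyl (f : M → ℝ) (X : M × ℝ)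
    (v : TangentSpace (𝓘(ℝ, V).prod 𝓘(ℝ, ℝ)) X) :
    differential (𝓘(ℝ, V).prod 𝓘(ℝ, ℝ)) (fun Y : M × ℝ ↦ f Y.1) X v =
      differential 𝓘(ℝ, V) f X.1 v.1 := by
  unfold differential
  by_cases hf : MDifferentiableAt 𝓘(ℝ, V) 𝓘(ℝ, ℝ) f X.1
  · have h := mfderiv_comp (I := 𝓘(ℝ, V).prod 𝓘(ℝ, ℝ)) (I' := 𝓘(ℝ, V)) (I'' := 𝓘(ℝ, ℝ)) X
      (f := Prod.fst) (g := f) hf mdifferentiableAt_fst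
    rw [show (fun Y : M × ℝ ↦ f Y.1) = f ∘ Prod.fst from rfl]
    refine (congrArg (fun C ↦ C v) h).trans ?_
    rw [mfderiv_fst]
    rfl
  · rw [mfderiv_zero_of_not_mdifferentiableAt hf, mfderiv_zero_of_not_mdifferentiableAt]
    · rfl
    · intro h
      refine hf ?_
      have hι : MDifferentiableAt 𝓘(ℝ, V) (𝓘(ℝ, V).prod 𝓘(ℝ, ℝ)) (fun p : M ↦ (p, X.2)) X.1 :=
        mdifferentiableAt_id.prodMk mdifferentiableAt_const
      exact MDifferentiableAt.comp (I' := 𝓘(ℝ, V).prod 𝓘(ℝ, ℝ))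
        (g := fun Y : M × ℝ ↦ f Y.1) X.1 h hι

lemma gradNorm_cyl (f : M → ℝ) (X : M × ℝ) :
    gradNorm (𝓘(ℝ, V).prod 𝓘(ℝ, ℝ)) (cylMetric 𝓘(ℝ, V) g) (fun Y : M × ℝ ↦ f Y.1) X =
      gradNorm 𝓘(ℝ, V) g f X.1 := by
  unfold gradNorm
  congr 1
  ext d
  constructor
  · rintro ⟨v, hv, hd⟩
    rw [differential_cyl] at hd
    refine ⟨v.1, ?_, hd⟩
    simp only [cylMetric] at hv
    nlinarith [mul_self_nonneg v.2]
  · rintro ⟨v, hv, hd⟩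
    refine ⟨((v, (0 : ℝ)) : V × ℝ), ?_, ?_⟩
    · simp only [cylMetric, mul_zero, add_zero]
      exact hv
    · exact (differential_cyl f X _).trans hd

variable [FiniteDimensional ℝ V]

lemma trace_eq_formTrace {N : Type*} {H : Type*} [TopologicalSpace H] {I : ModelWithCorners ℝ V H}
    [TopologicalSpace N] [ChartedSpace H N] (g K : TensorField I N) (x : N)
    {G B : LinearMap.BilinForm ℝ V} (hG : ∀ v w : V, g x v w = G v w)
    (hB : ∀ v w : V, K x v w = B v w) :
    trace I g K x = formTrace (Module.finBasis ℝ V) G B := by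
  unfold trace formTrace
  refine Finset.sum_congr rfl fun i _ ↦ Finset.sum_congr rfl fun j _ ↦ ?_
  have h : (Matrix.of fun k l ↦ g x (Module.finBasis ℝ V k) (Module.finBasis ℝ V l)) =
      LinearMap.BilinForm.toMatrix (Module.finBasis ℝ V) G := by
    ext k l
    rw [LinearMap.BilinForm.toMatrix_apply, ← hG]
    rfl
  rw [← h, ← hB]
  rfl

/-- A metric tensor at a point, as a bilinear form. -/
def C1Metric.form [IsManifold 𝓘(ℝ, V) ∞ M] (hg : C1Metric g) (x : M) : LinearMap.BilinForm ℝ V :=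
  LinearMap.mk₂ ℝ (fun v w ↦ g x v w) (hg.add_left x) (hg.smul_left x) (hg.add_right x)
    (hg.smul_right x)

lemma C1Metric.isUnit_det_form [IsManifold 𝓘(ℝ, V) ∞ M] (hg : C1Metric g) (x : M) :
    IsUnit (LinearMap.BilinForm.toMatrix (Module.finBasis ℝ V) (hg.form x)).det := by
  rw [isUnit_iff_ne_zero, ← LinearMap.BilinForm.nondegenerate_iff_det_ne_zero]
  refine ⟨fun v hv ↦ ?_, fun v hv ↦ ?_⟩ <;>
  · by_contra h
    exact (hg.pos x v h).ne' (hv v)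

lemma expansion_cyl [IsManifold 𝓘(ℝ, V) ∞ M] (hg : C1Metric g) {K : TensorField 𝓘(ℝ, V) M}
    (hK : ∀ x, ∃ B : LinearMap.BilinForm ℝ V, ∀ v w : V, K x v w = B v w)
    (ν : ∀ X : M × ℝ, TangentSpace (𝓘(ℝ, V).prod 𝓘(ℝ, ℝ)) X) {X : M × ℝ}
    (hν : (ν X : V × ℝ) = (ν (X.1, 0) : V × ℝ)) :
    expansion (𝓘(ℝ, V).prod 𝓘(ℝ, ℝ)) (cylMetric 𝓘(ℝ, V) g) (cylExtend 𝓘(ℝ, V) K) ν X =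
      expansion 𝓘(ℝ, V) g K (projField 𝓘(ℝ, V) ν) X.1 := by
  obtain ⟨B, hB⟩ := hK X.1
  unfold expansion
  congr 1
  · rw [trace_eq_formTrace g K X.1 (G := hg.form X.1) (fun _ _ ↦ rfl) hB,
      ← formTrace_cylForm (hg.isUnit_det_form X.1)]
    refine trace_eq_formTrace _ _ X (fun v w ↦ ?_) (fun v w ↦ ?_)
    · rw [cylForm_apply, one_mul]; rfl
    · rw [cylForm_apply, zero_mul, add_zero]; exact hB _ _
  · have h1 : (ν X).1 = (ν (X.1, 0)).1 := congrArg Prod.fst hν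
    simp only [cylExtend, projField]
    rw [h1]

end CylinderGradient

section CylinderFields

variable {V : Type*} [NormedAddCommGroup V] [NormedSpace ℝ V]
  {M : Type*} [TopologicalSpace M] [ChartedSpace V M] [IsManifold 𝓘(ℝ, V) ∞ M]
  {g : TensorField 𝓘(ℝ, V) M}

/-- Vector fields of class `C¹` on the cylinder. -/
def C1CylField (Y : ∀ X : M × ℝ, TangentSpace (𝓘(ℝ, V).prod 𝓘(ℝ, ℝ)) X) : Prop :=
  ContMDiff (𝓘(ℝ, V).prod 𝓘(ℝ, ℝ)) (𝓘(ℝ, V).prod 𝓘(ℝ, ℝ)).tangent 1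
    (fun X ↦ (⟨X, Y X⟩ : TangentBundle (𝓘(ℝ, V).prod 𝓘(ℝ, ℝ)) (M × ℝ)))

/-- The horizontal part of a vector field on the cylinder, at a fixed height. -/
def horizontal (Y : ∀ X : M × ℝ, TangentSpace (𝓘(ℝ, V).prod 𝓘(ℝ, ℝ)) X) (z : ℝ) :
    ∀ x : M, TangentSpace 𝓘(ℝ, V) x := fun p ↦ (Y (p, z)).1

/-- The vertical component of a vector field on the cylinder. -/
def vertical (Y : ∀ X : M × ℝ, TangentSpace (𝓘(ℝ, V).prod 𝓘(ℝ, ℝ)) X) (X : M × ℝ) : ℝ := (Y X).2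

variable {Y : ∀ X : M × ℝ, TangentSpace (𝓘(ℝ, V).prod 𝓘(ℝ, ℝ)) X}

lemma C1CylField.contMDiff_fst (hY : C1CylField Y) :
    ContMDiff (𝓘(ℝ, V).prod 𝓘(ℝ, ℝ)) 𝓘(ℝ, V).tangent 1
      (fun X : M × ℝ ↦ (⟨X.1, (Y X).1⟩ : TangentBundle 𝓘(ℝ, V) M)) := by
  have h : ContMDiff (𝓘(ℝ, V).prod 𝓘(ℝ, ℝ)).tangent 𝓘(ℝ, V).tangent 1
      (tangentMap (𝓘(ℝ, V).prod 𝓘(ℝ, ℝ)) 𝓘(ℝ, V) (Prod.fst : M × ℝ → M)) :=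
    ContMDiff.contMDiff_tangentMap (n := ∞) _root_.contMDiff_fst (by norm_cast)
  refine (h.comp hY).congr fun X ↦ ?_
  simp only [Function.comp_apply]
  rw [tangentMap_prodFst]

lemma C1CylField.contMDiff_vertical (hY : C1CylField Y) :
    ContMDiff (𝓘(ℝ, V).prod 𝓘(ℝ, ℝ)) 𝓘(ℝ, ℝ) 1 (vertical Y) := by
  have h : ContMDiff (𝓘(ℝ, V).prod 𝓘(ℝ, ℝ)).tangent 𝓘(ℝ, ℝ).tangent 1
      (tangentMap (𝓘(ℝ, V).prod 𝓘(ℝ, ℝ)) 𝓘(ℝ, ℝ) (Prod.snd : M × ℝ → ℝ)) :=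
    ContMDiff.contMDiff_tangentMap (n := ∞) _root_.contMDiff_snd (by norm_cast)
  refine ((contMDiff_snd_tangentBundle_modelSpace ℝ 𝓘(ℝ, ℝ)).comp (h.comp hY)).congr fun X ↦ ?_
  exact (congrArg (fun P : TangentBundle 𝓘(ℝ, ℝ) ℝ ↦ (P.snd : ℝ)) (tangentMap_prodSnd
    (I := 𝓘(ℝ, V)) (I' := 𝓘(ℝ, ℝ)) (p := (⟨X, Y X⟩ :
      TangentBundle (𝓘(ℝ, V).prod 𝓘(ℝ, ℝ)) (M × ℝ))))).symm

lemma C1CylField.horizontal (hY : C1CylField Y) (z : ℝ) : C1Field (horizontal Y z) := by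
  have h : ContMDiff 𝓘(ℝ, V) (𝓘(ℝ, V).prod 𝓘(ℝ, ℝ)) 1 (fun p : M ↦ (p, z)) :=
    contMDiff_id.prodMk contMDiff_const
  exact hY.contMDiff_fst.comp h

lemma contMDiff_chart_symm_prod (c : M) : ContMDiffOn (𝓘(ℝ, V).prod 𝓘(ℝ, ℝ))
    (𝓘(ℝ, V).prod 𝓘(ℝ, ℝ)) 1
    (fun y : V × ℝ ↦ (((extChartAt 𝓘(ℝ, V) c).symm y.1, y.2) : M × ℝ))
    ((extChartAt 𝓘(ℝ, V) c).target ×ˢ univ) := by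
  have : IsManifold 𝓘(ℝ, V) 1 M := inferInstance
  exact (((contMDiffOn_extChartAt_symm c).comp contMDiffOn_fst (fun y hy ↦ hy.1)).prodMk
    contMDiffOn_snd)

lemma contDiffOn_of_contMDiff_cyl {F : Type*} [NormedAddCommGroup F] [NormedSpace ℝ F] {c : M}
    {f : M × ℝ → F}
    (hf : ContMDiffOn (𝓘(ℝ, V).prod 𝓘(ℝ, ℝ)) 𝓘(ℝ, F) 1 f
      ((extChartAt 𝓘(ℝ, V) c).source ×ˢ univ)) :
    ContDiffOn ℝ 1 (fun y : V × ℝ ↦ f ((extChartAt 𝓘(ℝ, V) c).symm y.1, y.2))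
      ((extChartAt 𝓘(ℝ, V) c).target ×ˢ univ) := by
  have h := hf.comp (contMDiff_chart_symm_prod c)
    (fun y hy ↦ ⟨(extChartAt 𝓘(ℝ, V) c).map_target hy.1, mem_univ _⟩)
  rw [← modelWithCornersSelf_prod, chartedSpaceSelf_prod] at h
  exact contMDiffOn_iff_contDiffOn.1 h

/-- The components of the horizontal part of a field in the chart at `c`. -/
lemma C1CylField.contDiffOn_rep (hY : C1CylField Y) (c : M) :
    ContDiffOn ℝ 1 (fun y : V × ℝ ↦ rep c (STIMCF.horizontal Y y.2) y.1)
      ((extChartAt 𝓘(ℝ, V) c).target ×ˢ univ) := by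
  refine contDiffOn_of_contMDiff_cyl (f := fun X ↦ coord 𝓘(ℝ, V) c X.1 (Y X).1) ?_
  intro X hX
  have := isManifold_two (V := V) (M := M)
  have h := (Trivialization.contMDiffAt_iff (e := trivializationAt V (TangentSpace 𝓘(ℝ, V)) c)
    (IM := 𝓘(ℝ, V).prod 𝓘(ℝ, ℝ)) (IB := 𝓘(ℝ, V)) (n := 1)
    (f := fun X : M × ℝ ↦ (⟨X.1, (Y X).1⟩ : TangentBundle 𝓘(ℝ, V) M)) (x₀ := X)
    (by rw [Trivialization.mem_source]; simpa using hX.1)).1 (hY.contMDiff_fst X)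
  refine (h.2.congr_of_eventuallyEq ?_).contMDiffWithinAt
  filter_upwards [((isOpen_extChartAt_source (I := 𝓘(ℝ, V)) c).prod isOpen_univ).mem_nhds hX]
    with Z hZ
  exact (trivializationAt_snd hZ.1 _).symm

lemma C1CylField.contDiffOn_vertical (hY : C1CylField Y) (c : M) :
    ContDiffOn ℝ 1 (fun y : V × ℝ ↦ vertical Y ((extChartAt 𝓘(ℝ, V) c).symm y.1, y.2))
      ((extChartAt 𝓘(ℝ, V) c).target ×ˢ univ) :=
  contDiffOn_of_contMDiff_cyl hY.contMDiff_vertical.contMDiffOn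

/-- The horizontal field `η(z) X` on the cylinder. -/
def liftField (η : ℝ → ℝ) (X : ∀ x : M, TangentSpace 𝓘(ℝ, V) x) :
    ∀ X : M × ℝ, TangentSpace (𝓘(ℝ, V).prod 𝓘(ℝ, ℝ)) X :=
  fun Z ↦ ((η Z.2 • X Z.1 : TangentSpace 𝓘(ℝ, V) Z.1), (0 : ℝ))

lemma C1Field.liftField {X : ∀ x : M, TangentSpace 𝓘(ℝ, V) x} (hX : C1Field X) {η : ℝ → ℝ}
    (hη : ContDiff ℝ 1 η) : C1CylField (liftField η X) := by
  have h1 : ContMDiff (𝓘(ℝ, V).prod 𝓘(ℝ, ℝ)) 𝓘(ℝ, V).tangent 1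
      (fun Z : M × ℝ ↦ (⟨Z.1, η Z.2 • X Z.1⟩ : TangentBundle 𝓘(ℝ, V) M)) := by
    intro Z
    have := isManifold_two (V := V) (M := M)
    have hX' := (contMDiffAt_field_iff (c := Z.1) (mem_extChartAt_source Z.1)).1 (hX Z.1)
    refine (Trivialization.contMDiffAt_iff (e := trivializationAt V (TangentSpace 𝓘(ℝ, V)) Z.1)
      (IM := 𝓘(ℝ, V).prod 𝓘(ℝ, ℝ)) (IB := 𝓘(ℝ, V)) (n := 1)
      (f := fun Z : M × ℝ ↦ (⟨Z.1, η Z.2 • X Z.1⟩ : TangentBundle 𝓘(ℝ, V) M)) (x₀ := Z)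
      (by rw [Trivialization.mem_source]; simp)).2 ⟨contMDiffAt_fst, ?_⟩
    have h3 : ContMDiffAt (𝓘(ℝ, V).prod 𝓘(ℝ, ℝ)) 𝓘(ℝ, V) 1
        (fun W : M × ℝ ↦ η W.2 • coord 𝓘(ℝ, V) Z.1 W.1 (X W.1)) Z := by
      have h4 : ContMDiffAt (𝓘(ℝ, V).prod 𝓘(ℝ, ℝ)) 𝓘(ℝ, ℝ) 1 (fun W : M × ℝ ↦ η W.2) Z :=
        hη.contMDiff.contMDiffAt.comp Z contMDiffAt_snd
      have h5 : ContMDiffAt (𝓘(ℝ, V).prod 𝓘(ℝ, ℝ)) 𝓘(ℝ, V) 1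
          (fun W : M × ℝ ↦ coord 𝓘(ℝ, V) Z.1 W.1 (X W.1)) Z :=
        ContMDiffAt.comp (I' := 𝓘(ℝ, V)) Z (f := Prod.fst)
          (g := fun x ↦ coord 𝓘(ℝ, V) Z.1 x (X x)) hX' contMDiffAt_fst
      exact h4.smul h5
    refine h3.congr_of_eventuallyEq ?_
    filter_upwards [((isOpen_extChartAt_source (I := 𝓘(ℝ, V)) Z.1).prod isOpen_univ).mem_nhds
      (show Z ∈ _ from ⟨mem_extChartAt_source Z.1, mem_univ Z.2⟩)] with W hW
    rw [trivializationAt_snd hW.1, coord_smul]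
  have h2 : ContMDiff (𝓘(ℝ, V).prod 𝓘(ℝ, ℝ)) 𝓘(ℝ, ℝ).tangent 1
      (fun Z : M × ℝ ↦ (⟨Z.2, (0 : ℝ)⟩ : TangentBundle 𝓘(ℝ, ℝ) ℝ)) :=
    (Bundle.contMDiff_zeroSection ℝ (TangentSpace 𝓘(ℝ, ℝ) (M := ℝ))).comp contMDiff_snd
  exact (contMDiff_equivTangentBundleProd_symm (I := 𝓘(ℝ, V)) (I' := 𝓘(ℝ, ℝ)) (M := M)
    (M' := ℝ)).comp (h1.prodMk h2)

variable [FiniteDimensional ℝ V]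

lemma tdiv_prod {G : V × ℝ → V × ℝ} {y : V × ℝ} (hG : DifferentiableAt ℝ G y) :
    tdiv G y = tdiv (fun v ↦ (G (v, y.2)).1) y.1 + deriv (fun z ↦ (G (y.1, z)).2) y.2 := by
  have h1 : HasFDerivAt (fun v ↦ (G (v, y.2)).1)
      (((ContinuousLinearMap.fst ℝ V ℝ).comp (fderiv ℝ G y)).comp
        (ContinuousLinearMap.inl ℝ V ℝ)) y.1 := by
    have := (hasFDerivAt_prodMk_left (𝕜 := ℝ) y.1 y.2)
    exact HasFDerivAt.comp (g := fun w ↦ (G w).1) (f := fun v ↦ (v, y.2)) y.1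
      ((ContinuousLinearMap.fst ℝ V ℝ).hasFDerivAt.comp y hG.hasFDerivAt) this
  have h2 : HasDerivAt (fun z ↦ (G (y.1, z)).2) (fderiv ℝ G y (0, 1)).2 y.2 := by
    have := (hasFDerivAt_prodMk_right (𝕜 := ℝ) y.1 y.2)
    have h3 := HasFDerivAt.comp (g := fun w ↦ (G w).2) (f := fun z ↦ (y.1, z)) y.2
      ((ContinuousLinearMap.snd ℝ V ℝ).hasFDerivAt.comp y hG.hasFDerivAt) this
    exact h3.hasDerivAt.congr_deriv (by simp)
  rw [h2.deriv, tdiv_eq_sum ((Module.finBasis ℝ V).prod (Module.Basis.singleton Unit ℝ)),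
    tdiv_eq_sum (Module.finBasis ℝ V), h1.fderiv, Fintype.sum_sum_type]
  simp

variable [MeasurableSpace V] [BorelSpace V] [MeasurableSpace M] [BorelSpace M]

lemma C1CylField.contDiffOn_flux (hY : C1CylField Y) (hg : C1Metric g) (c : M) :
    ContDiffOn ℝ 1 (fun y : V × ℝ ↦ flux g c (STIMCF.horizontal Y y.2) y.1)
      ((extChartAt 𝓘(ℝ, V) c).target ×ˢ univ) :=
  ((contDiffOn_sqrtDet hg c).comp contDiffOn_fst fun _ hy ↦ hy.1).smul (hY.contDiffOn_rep c)

lemma isOpen_cyl_target (c : M) :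
    IsOpen ((extChartAt 𝓘(ℝ, V) c).target ×ˢ (univ : Set ℝ)) :=
  (isOpen_extChartAt_target c).prod isOpen_univ

lemma divergence_cyl (hg : C1Metric g) (hY : C1CylField Y) (X : M × ℝ) :
    divergence (𝓘(ℝ, V).prod 𝓘(ℝ, ℝ)) (cylMetric 𝓘(ℝ, V) g) Y X =
      divergence 𝓘(ℝ, V) g (horizontal Y X.2) X.1 + deriv (fun z ↦ vertical Y (X.1, z)) X.2 := by
  set y := extChartAt 𝓘(ℝ, V) X.1 X.1
  have hy : y ∈ (extChartAt 𝓘(ℝ, V) X.1).target := mem_extChartAt_target X.1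
  have e : (extChartAt 𝓘(ℝ, V) X.1).symm y = X.1 := extChartAt_to_inv X.1
  have hT := (isOpen_cyl_target (V := V) X.1).mem_nhds (show (y, X.2) ∈ _ from ⟨hy, mem_univ _⟩)
  set G : V × ℝ → V × ℝ := fun w ↦ (flux g X.1 (horizontal Y w.2) w.1,
    sqrtDet 𝓘(ℝ, V) g X.1 w.1 * vertical Y ((extChartAt 𝓘(ℝ, V) X.1).symm w.1, w.2)) with hGd
  have hG : DifferentiableAt ℝ G (y, X.2) := by
    have h1 : ContDiffOn ℝ 1 G ((extChartAt 𝓘(ℝ, V) X.1).target ×ˢ univ) :=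
      (hY.contDiffOn_flux hg X.1).prodMk
        (((contDiffOn_sqrtDet hg X.1).comp contDiffOn_fst fun _ hy ↦ hy.1).mul
          (hY.contDiffOn_vertical X.1))
    exact (h1.contDiffAt hT).differentiableAt one_ne_zero
  have h0 : (fun w : V × ℝ ↦ sqrtDet (𝓘(ℝ, V).prod 𝓘(ℝ, ℝ)) (cylMetric 𝓘(ℝ, V) g) X w •
      coord (𝓘(ℝ, V).prod 𝓘(ℝ, ℝ)) X ((extChartAt (𝓘(ℝ, V).prod 𝓘(ℝ, ℝ)) X).symm w)
        (Y ((extChartAt (𝓘(ℝ, V).prod 𝓘(ℝ, ℝ)) X).symm w))) =ᶠ[𝓝 (y, X.2)]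
      fun w ↦ cylRatio V • G w := by
    filter_upwards [hT] with w hw
    rw [sqrtDet_cyl hg hw.1, coord_cyl ((extChartAt 𝓘(ℝ, V) X.1).map_target hw.1), mul_smul]
    rfl
  have h1 : divergence (𝓘(ℝ, V).prod 𝓘(ℝ, ℝ)) (cylMetric 𝓘(ℝ, V) g) Y X =
      (cylRatio V * sqrtDet 𝓘(ℝ, V) g X.1 y)⁻¹ * (cylRatio V * tdiv G (y, X.2)) := by
    have h2 : tdiv (fun w ↦ cylRatio V • G w) (y, X.2) = cylRatio V * tdiv G (y, X.2) := by
      rw [tdiv_eq, tdiv_eq, fderiv_fun_const_smul hG, map_smul, smul_eq_mul]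
    rw [← h2, ← tdiv_congr h0, ← sqrtDet_cyl hg (X₀ := X) (y := (y, X.2)) hy]
    rfl
  have ha : cylRatio V ≠ 0 := cylRatio_pos.ne'
  have hs : sqrtDet 𝓘(ℝ, V) g X.1 y ≠ 0 := (sqrtDet_pos hg hy).ne'
  rw [h1, tdiv_prod hG, divergence_eq_inv_mul hg (hY.horizontal X.2) (mem_extChartAt_source X.1)]
  simp only [hGd, e]
  rw [deriv_const_mul_field]
  change _ = (sqrtDet 𝓘(ℝ, V) g X.1 y)⁻¹ * tdiv (flux g X.1 (horizontal Y X.2)) y + _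
  change _ * (_ * (tdiv (flux g X.1 (horizontal Y X.2)) y + _)) = _
  field_simp

lemma deriv_vertical_eq (hY : C1CylField Y) {c : M} {y : V × ℝ}
    (hy : y.1 ∈ (extChartAt 𝓘(ℝ, V) c).target) :
    HasDerivAt (fun z ↦ vertical Y ((extChartAt 𝓘(ℝ, V) c).symm y.1, z))
      (fderiv ℝ (fun y : V × ℝ ↦ vertical Y ((extChartAt 𝓘(ℝ, V) c).symm y.1, y.2)) y (0, 1))
      y.2 := by
  have hT := (isOpen_cyl_target (V := V) c).mem_nhds (show y ∈ _ from ⟨hy, mem_univ _⟩)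
  have h := (((hY.contDiffOn_vertical c).contDiffAt hT).differentiableAt one_ne_zero).hasFDerivAt
  have h2 := (HasFDerivAt.comp
    (g := fun y : V × ℝ ↦ vertical Y ((extChartAt 𝓘(ℝ, V) c).symm y.1, y.2))
    (f := fun z ↦ (y.1, z)) y.2 h (hasFDerivAt_prodMk_right (𝕜 := ℝ) y.1 y.2)).hasDerivAt
  refine h2.congr_deriv ?_
  rw [ContinuousLinearMap.comp_apply, ContinuousLinearMap.inr_apply]

lemma hasDerivAt_vertical (hY : C1CylField Y) (X : M × ℝ) :
    HasDerivAt (fun z ↦ vertical Y (X.1, z)) (deriv (fun z ↦ vertical Y (X.1, z)) X.2) X.2 := by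
  have h := deriv_vertical_eq hY (c := X.1) (y := (extChartAt 𝓘(ℝ, V) X.1 X.1, X.2))
    (mem_extChartAt_target X.1)
  simp only [extChartAt_to_inv] at h
  exact h.differentiableAt.hasDerivAt

lemma continuous_of_chart_cyl {F : Type*} [TopologicalSpace F] {f : M × ℝ → F}
    (h : ∀ c : M, ContinuousOn (fun y : V × ℝ ↦ f ((extChartAt 𝓘(ℝ, V) c).symm y.1, y.2))
      ((extChartAt 𝓘(ℝ, V) c).target ×ˢ univ)) : Continuous f := by
  rw [continuous_iff_continuousAt]
  intro X
  have h2 := (h X.1).continuousAt ((isOpen_cyl_target (V := V) X.1).mem_nhds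
    (show (extChartAt 𝓘(ℝ, V) X.1 X.1, X.2) ∈ _ from ⟨mem_extChartAt_target X.1, mem_univ _⟩))
  have h3 : ContinuousAt (fun Z : M × ℝ ↦ (extChartAt 𝓘(ℝ, V) X.1 Z.1, Z.2)) X :=
    ((continuousAt_extChartAt X.1).comp continuousAt_fst).prodMk continuousAt_snd
  refine (ContinuousAt.comp (x := X) (f := fun Z : M × ℝ ↦ (extChartAt 𝓘(ℝ, V) X.1 Z.1, Z.2))
    h2 h3).congr ?_
  filter_upwards [((isOpen_extChartAt_source (I := 𝓘(ℝ, V)) X.1).prod isOpen_univ).mem_nhds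
      (show X ∈ _ from ⟨mem_extChartAt_source X.1, mem_univ X.2⟩)] with Z hZ
  simp only [Function.comp_apply]
  rw [(extChartAt 𝓘(ℝ, V) X.1).left_inv hZ.1]

lemma continuous_deriv_vertical (hY : C1CylField Y) :
    Continuous fun X : M × ℝ ↦ deriv (fun z ↦ vertical Y (X.1, z)) X.2 := by
  refine continuous_of_chart_cyl (V := V) fun c ↦ ?_
  refine (((hY.contDiffOn_vertical c).continuousOn_fderiv_of_isOpen (isOpen_cyl_target c)
    le_rfl).clm_apply (continuousOn_const (c := ((0, 1) : V × ℝ)))).congr fun y hy ↦ ?_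
  exact (deriv_vertical_eq hY hy.1).deriv

lemma continuous_divergence_horizontal (hg : C1Metric g) (hY : C1CylField Y) :
    Continuous fun X : M × ℝ ↦ divergence 𝓘(ℝ, V) g (horizontal Y X.2) X.1 := by
  refine continuous_of_chart_cyl (V := V) fun c ↦ ?_
  have h1 : ContinuousOn (fun y : V × ℝ ↦ (sqrtDet 𝓘(ℝ, V) g c y.1)⁻¹)
      ((extChartAt 𝓘(ℝ, V) c).target ×ˢ univ) :=
    (((contDiffOn_sqrtDet hg c).continuousOn).comp continuousOn_fst fun _ hy ↦ hy.1).inv₀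
      fun y hy ↦ (sqrtDet_pos hg hy.1).ne'
  have h2 := (hY.contDiffOn_flux hg c).continuousOn_fderiv_of_isOpen (isOpen_cyl_target c) le_rfl
  refine (h1.mul (traceL.continuous.comp_continuousOn (h2.clm_comp
    (continuousOn_const (c := ContinuousLinearMap.inl ℝ V ℝ))))).congr fun y hy ↦ ?_
  rw [divergence_eq_inv_mul hg (hY.horizontal y.2) ((extChartAt 𝓘(ℝ, V) c).map_target hy.1),
    (extChartAt 𝓘(ℝ, V) c).right_inv hy.1, tdiv_eq]
  have h3 := ((((hY.contDiffOn_flux hg c).contDiffAt ((isOpen_cyl_target c).mem_nhds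
    hy)).differentiableAt one_ne_zero).hasFDerivAt.comp y.1
      (hasFDerivAt_prodMk_left (𝕜 := ℝ) y.1 y.2)).fderiv
  exact congrArg (fun L ↦ (sqrtDet 𝓘(ℝ, V) g c y.1)⁻¹ * traceL L) h3

end CylinderFields
end STIMCF
end

noncomputable section
namespace STIMCF
set_option linter.unusedSectionVars false

section ProductIntegrals

variable {α β : Type*} [MeasurableSpace α] [MeasurableSpace β]

/-- The lower integral of a function of the first variable, without measurability. -/
lemma lintegral_prod_fst (μ : Measure α) [SFinite μ] (ν : Measure β) [IsFiniteMeasure ν]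
    (f : α → ℝ≥0∞) : ∫⁻ z, f z.1 ∂(μ.prod ν) = ν univ * ∫⁻ x, f x ∂μ := by
  apply le_antisymm
  · obtain ⟨H, hHm, hHle, hH⟩ := exists_measurable_le_lintegral_eq (μ.prod ν) fun z ↦ f z.1
    rw [hH, lintegral_prod _ hHm.aemeasurable, mul_comm,
      ← lintegral_mul_const' _ _ (measure_ne_top ν univ)]
    refine lintegral_mono fun x ↦ ?_
    refine (lintegral_mono fun y ↦ hHle (x, y)).trans ?_
    simp
  · obtain ⟨h, hm, hle, hh⟩ := exists_measurable_le_lintegral_eq μ f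
    rw [hh]
    refine le_trans (le_of_eq ?_) (lintegral_mono fun z : α × β ↦ hle z.1)
    rw [lintegral_prod (fun a : α × β ↦ h a.1) (hm.comp measurable_fst).aemeasurable,
      ← lintegral_const_mul' _ _ (measure_ne_top ν univ)]
    simp [mul_comm]

end ProductIntegrals

section CylinderPerimeter

variable {V : Type*} [NormedAddCommGroup V] [NormedSpace ℝ V] [FiniteDimensional ℝ V]
  [MeasurableSpace V] [BorelSpace V]
  {M : Type*} [TopologicalSpace M] [ChartedSpace V M] [IsManifold 𝓘(ℝ, V) ∞ M]
  [MeasurableSpace M] [BorelSpace M] [T2Space M] [SecondCountableTopology M]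
  {g : TensorField 𝓘(ℝ, V) M}

/-- The constant by which the normalizations of the volumes of the cylinder and of the product
differ. -/
def cylScale (hg : C1Metric g) : ℝ := (exists_vol_cylinder hg).choose

lemma cylScale_pos (hg : C1Metric g) : 0 < cylScale hg := (exists_vol_cylinder hg).choose_spec.1

lemma vol_cyl (hg : C1Metric g) : vol (𝓘(ℝ, V).prod 𝓘(ℝ, ℝ)) (cylMetric 𝓘(ℝ, V) g) =
    ENNReal.ofReal (cylScale hg) • (vol 𝓘(ℝ, V) g).prod (volume : Measure ℝ) :=
  (exists_vol_cylinder hg).choose_spec.2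

lemma C1Metric.nonneg (hg : C1Metric g) (x : M) (v : TangentSpace 𝓘(ℝ, V) x) : 0 ≤ g x v v := by
  by_cases h : v = 0
  · rw [h, hg.zero]
  · exact (hg.pos _ _ h).le

lemma IsTestField.liftField (hg : C1Metric g) {O : Set M} {X : ∀ x : M, TangentSpace 𝓘(ℝ, V) x}
    (hX : IsTestField 𝓘(ℝ, V) g O X) {η : ℝ → ℝ} (hη : ContDiff ℝ 1 η) (h0 : ∀ z, |η z| ≤ 1)
    {D : Set ℝ} (hD : IsCompact D) (hη0 : ∀ z ∉ D, η z = 0) :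
    IsTestField (𝓘(ℝ, V).prod 𝓘(ℝ, ℝ)) (cylMetric 𝓘(ℝ, V) g) (O ×ˢ D) (liftField η X) := by
  obtain ⟨h1, h2, C, hC, hCO, hC0⟩ := hX
  refine ⟨C1Field.liftField h1 hη, fun Z ↦ ?_, C ×ˢ D, hC.prod hD, prod_mono hCO le_rfl,
    fun Z hZ ↦ ?_⟩
  · have h3 : cylMetric 𝓘(ℝ, V) g Z (STIMCF.liftField η X Z) (STIMCF.liftField η X Z) =
        g Z.1 (η Z.2 • X Z.1) (η Z.2 • X Z.1) := by
      simp [cylMetric, STIMCF.liftField]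
    have h5 : 0 ≤ g Z.1 (X Z.1) (X Z.1) := hg.nonneg _ _
    rw [h3, hg.smul_left, hg.smul_right, ← mul_assoc]
    have h4 : η Z.2 * η Z.2 ≤ 1 := by
      rw [← abs_mul_abs_self]
      exact mul_le_one₀ (h0 _) (abs_nonneg _) (h0 _)
    exact (mul_le_of_le_one_left h5 h4).trans (h2 Z.1)
  · have h3 : η Z.2 • X Z.1 = 0 := by
      by_cases h : Z.1 ∈ C
      · rw [hη0 Z.2 fun h' ↦ hZ ⟨h, h'⟩, zero_smul]
      · rw [hC0 _ h, smul_zero]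
    exact Prod.ext h3 rfl

lemma divergence_liftField (hg : C1Metric g) {X : ∀ x : M, TangentSpace 𝓘(ℝ, V) x}
    (hX : C1Field X) {η : ℝ → ℝ} (hη : ContDiff ℝ 1 η) (Z : M × ℝ) :
    divergence (𝓘(ℝ, V).prod 𝓘(ℝ, ℝ)) (cylMetric 𝓘(ℝ, V) g) (liftField η X) Z =
      divergence 𝓘(ℝ, V) g X Z.1 * η Z.2 := by
  rw [divergence_cyl hg (hX.liftField hη)]
  have h1 : horizontal (liftField η X) Z.2 = fun x ↦ (fun _ : M ↦ η Z.2) x • X x := rfl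
  have h2 : (fun z ↦ vertical (liftField η X) (Z.1, z)) = fun _ ↦ 0 := rfl
  rw [h1, h2, deriv_const, add_zero, divergence_smul hg hX contMDiff_const]
  simp [differential, mul_comm]
  exact add_zero _

theorem mul_perimeter_le_cyl (hg : C1Metric g) (E : Set M) {A : Set M} (hA : IsCompact A)
    {L : ℝ} (hL : 0 < L) :
    ENNReal.ofReal (cylScale hg * (2 * L)) * perimeter 𝓘(ℝ, V) g E A ≤
      perimeter (𝓘(ℝ, V).prod 𝓘(ℝ, ℝ)) (cylMetric 𝓘(ℝ, V) g) (E ×ˢ univ)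
        (A ×ˢ Icc (-L) L) := by
  have hsf := sigmaFinite_vol hg
  refine le_iInf₂ fun U hU ↦ le_iInf fun hAU ↦ ?_
  obtain ⟨O, W, hO, hW, hAO, hLW, hOW⟩ := generalized_tube_lemma hA isCompact_Icc hU hAU
  obtain ⟨δ, hδ, hδW⟩ : ∃ δ > 0, Icc (-(L + δ)) (L + δ) ⊆ W := by
    obtain ⟨δ, hδ, h⟩ := isCompact_Icc.exists_cthickening_subset_open hW hLW
    refine ⟨δ, hδ, fun z hz ↦ h ?_⟩
    refine Metric.mem_cthickening_of_dist_le z (max (-L) (min z L)) δ _ ?_ ?_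
    · constructor
      · exact le_max_left _ _
      · exact max_le (by linarith) (min_le_right _ _)
    · rw [Real.dist_eq, abs_le]
      constructor <;> rcases max_cases (-L) (min z L) with h | h <;>
        rcases min_cases z L with h' | h' <;> linarith [hz.1, hz.2]
  let η : ContDiffBump (0 : ℝ) := ⟨L, L + δ, hL, by linarith⟩
  have hη1 : ∀ z ∈ Icc (-L) L, η z = 1 := fun z hz ↦ η.one_of_mem_closedBall (by
    rw [Metric.mem_closedBall, Real.dist_eq, sub_zero, abs_le]; exact hz)
  have hη0 : ∀ z ∉ Icc (-(L + δ)) (L + δ), η z = 0 := fun z hz ↦ η.zero_of_le_dist (by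
    rw [Real.dist_eq, sub_zero]
    by_contra h
    exact hz (abs_le.1 (not_le.1 h).le))
  have hηI : 2 * L ≤ ∫ z, η z := by
    have h1 : ∫ z in Icc (-L) L, η z = 2 * L := by
      rw [setIntegral_congr_fun measurableSet_Icc hη1]
      simp
      rw [max_eq_left (by linarith)]
      ring
    rw [← h1]
    exact setIntegral_le_integral η.integrable (Eventually.of_forall fun z ↦ η.nonneg)
  refine le_trans (mul_le_mul' le_rfl (perimeter_le_variation hO hAO)) ?_
  unfold variation
  rw [ENNReal.mul_iSup]
  refine iSup_le fun X ↦ ?_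
  rw [ENNReal.mul_iSup]
  refine iSup_le fun hX ↦ ?_
  have hY := hX.liftField hg η.contDiff (fun z ↦ by
    rw [abs_of_nonneg η.nonneg]; exact η.le_one) isCompact_Icc hη0
  have hY' : IsTestField (𝓘(ℝ, V).prod 𝓘(ℝ, ℝ)) (cylMetric 𝓘(ℝ, V) g) U (liftField η X) := by
    obtain ⟨h1, h2, C, h3, h4, h5⟩ := hY
    exact ⟨h1, h2, C, h3, (h4.trans (prod_mono le_rfl hδW)).trans hOW, h5⟩
  refine le_trans ?_ (le_iSup₂ (f := fun X
    (_ : IsTestField (𝓘(ℝ, V).prod 𝓘(ℝ, ℝ)) (cylMetric 𝓘(ℝ, V) g) U X) ↦ ENNReal.ofReal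
      (∫ x in E ×ˢ univ, divergence (𝓘(ℝ, V).prod 𝓘(ℝ, ℝ)) (cylMetric 𝓘(ℝ, V) g) X x
        ∂(vol (𝓘(ℝ, V).prod 𝓘(ℝ, ℝ)) (cylMetric 𝓘(ℝ, V) g)))) _ hY')
  rw [← ENNReal.ofReal_mul (mul_nonneg (cylScale_pos hg).le (by linarith))]
  simp only [divergence_liftField hg hX.1 η.contDiff]
  rw [vol_cyl hg, Measure.restrict_smul, integral_smul_measure, ← Measure.prod_restrict,
    Measure.restrict_univ, integral_prod_mul (fun x ↦ divergence 𝓘(ℝ, V) g X x) (fun z ↦ η z),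
    ENNReal.toReal_ofReal (cylScale_pos hg).le, smul_eq_mul, mul_assoc]
  set I := ∫ x in E, divergence 𝓘(ℝ, V) g X x ∂(vol 𝓘(ℝ, V) g)
  rcases le_total I 0 with hI | hI
  · rw [ENNReal.ofReal_of_nonpos]
    · exact zero_le
    · exact mul_nonpos_of_nonneg_of_nonpos (cylScale_pos hg).le
        (mul_nonpos_of_nonneg_of_nonpos (by linarith) hI)
  · refine ENNReal.ofReal_le_ofReal (mul_le_mul_of_nonneg_left ?_ (cylScale_pos hg).le)
    rw [mul_comm]
    exact mul_le_mul_of_nonneg_left hηI hI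

/-- The set that equals `F` at heights in `(-L, L)` and `E` at all other heights. -/
def cylModification (E F : Set M) (L : ℝ) : Set (M × ℝ) :=
  {X | (X.2 ∈ Ioo (-L) L ∧ X.1 ∈ F) ∨ (X.2 ∉ Ioo (-L) L ∧ X.1 ∈ E)}

lemma measurableSet_cylModification {E F : Set M} (hE : MeasurableSet E) (hF : MeasurableSet F)
    (L : ℝ) : MeasurableSet (cylModification E F L) :=
  ((measurable_snd measurableSet_Ioo).inter (measurable_fst hF)).union
    ((measurable_snd measurableSet_Ioo).compl.inter (measurable_fst hE))

variable {Y : ∀ X : M × ℝ, TangentSpace (𝓘(ℝ, V).prod 𝓘(ℝ, ℝ)) X}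

lemma IsTestField.horizontal {U : Set M} {D : Set ℝ}
    (hY : IsTestField (𝓘(ℝ, V).prod 𝓘(ℝ, ℝ)) (cylMetric 𝓘(ℝ, V) g) (U ×ˢ D) Y) (z : ℝ) :
    IsTestField 𝓘(ℝ, V) g U (horizontal Y z) := by
  obtain ⟨h1, h2, C, hC, hCU, hC0⟩ := hY
  refine ⟨C1CylField.horizontal h1 z, fun x ↦ ?_, Prod.fst '' C, hC.image continuous_fst, ?_,
    fun x hx ↦ ?_⟩
  · refine le_trans ?_ (h2 (x, z))
    simp only [cylMetric, STIMCF.horizontal]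
    linarith [mul_self_nonneg (Y (x, z)).2]
  · rintro _ ⟨X, hX, rfl⟩
    exact (hCU hX).1
  · exact congrArg Prod.fst (hC0 (x, z) fun h ↦ hx ⟨_, h, rfl⟩)

lemma IsTestField.abs_vertical_le (hg : C1Metric g) {W : Set (M × ℝ)}
    (hY : IsTestField (𝓘(ℝ, V).prod 𝓘(ℝ, ℝ)) (cylMetric 𝓘(ℝ, V) g) W Y) (X : M × ℝ) :
    |vertical Y X| ≤ 1 := by
  have h := hY.2.1 X
  have h2 : 0 ≤ g X.1 (Y X).1 (Y X).1 := hg.nonneg _ _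
  simp only [cylMetric] at h
  have h3 : (Y X).2 * (Y X).2 ≤ 1 := by linarith
  rw [← sq_le_one_iff_abs_le_one, sq]
  exact h3

lemma IsTestField.integral_vertical_le (hg : C1Metric g) {W : Set (M × ℝ)}
    (hY : IsTestField (𝓘(ℝ, V).prod 𝓘(ℝ, ℝ)) (cylMetric 𝓘(ℝ, V) g) W Y) (E F : Set M) (p : M)
    {L : ℝ} (hL : 0 < L) :
    ∫ z, (cylModification E F L).indicator (fun X ↦ deriv (fun z ↦ vertical Y (X.1, z)) X.2) (p, z)
      ≤ (symmDiff E F).indicator (fun _ ↦ 2) p := by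
  have hab := hY.abs_vertical_le hg
  obtain ⟨h1, -, C, hC, -, hC0⟩ := hY
  set v : ℝ → ℝ := fun z ↦ vertical Y (p, z)
  set D : ℝ → ℝ := fun z ↦ deriv v z
  have hv : ∀ z, HasDerivAt v (D z) z := fun z ↦ hasDerivAt_vertical h1 (p, z)
  have hDc : Continuous D := (continuous_deriv_vertical h1).comp (by fun_prop : Continuous fun z : ℝ ↦ (p, z))
  have hvs : HasCompactSupport v := by
    refine HasCompactSupport.intro (hC.image continuous_snd) fun z hz ↦ ?_
    exact congrArg Prod.snd (hC0 (p, z) fun h ↦ hz ⟨_, h, rfl⟩)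
  have hDs : HasCompactSupport D := hvs.deriv
  have hDi : Integrable D := hDc.integrable_of_hasCompactSupport hDs
  have hD0 : ∫ z, D z = 0 := by
    have := integral_of_hasDerivAt_of_tendsto (f := v) (f' := D) (m := 0) (n := 0) hv hDi
      (hvs.is_zero_at_infty.mono_left atBot_le_cocompact)
      (hvs.is_zero_at_infty.mono_left atTop_le_cocompact)
    simpa using this
  have hDL : ∫ z in Ioo (-L) L, D z = v L - v (-L) := by
    rw [← integral_Ioc_eq_integral_Ioo, ← intervalIntegral.integral_of_le (by linarith)]
    exact intervalIntegral.integral_eq_sub_of_hasDerivAt (fun z _ ↦ hv z)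
      (hDc.intervalIntegrable _ _)
  have hDL' : ∫ z in (Ioo (-L) L)ᶜ, D z = -(v L - v (-L)) := by
    have := integral_add_compl (measurableSet_Ioo (a := -L) (b := L)) hDi
    linarith
  have ha := abs_le.1 (hab (p, L))
  have hb := abs_le.1 (hab (p, -L))
  have ha' : -1 ≤ v L ∧ v L ≤ 1 := ha
  have hb' : -1 ≤ v (-L) ∧ v (-L) ≤ 1 := hb
  have key : (fun z ↦ (cylModification E F L).indicator
      (fun X ↦ deriv (fun z ↦ vertical Y (X.1, z)) X.2) (p, z)) =
      {z | (p, z) ∈ cylModification E F L}.indicator D := by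
    ext z; rfl
  rw [key]
  by_cases hpE : p ∈ E <;> by_cases hpF : p ∈ F
  · have : {z | (p, z) ∈ cylModification E F L} = univ := by
      ext z; simp only [cylModification, hpE, hpF, and_true, em, mem_ofPred_eq, mem_univ]
    rw [this, indicator_univ, hD0]
    exact indicator_nonneg (fun _ _ ↦ by norm_num) _
  · have : {z | (p, z) ∈ cylModification E F L} = (Ioo (-L) L)ᶜ := by
      ext z; simp [cylModification, hpE, hpF]
    rw [this, integral_indicator measurableSet_Ioo.compl, hDL',
      indicator_of_mem (show p ∈ symmDiff E F from Or.inl ⟨hpE, hpF⟩)]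
    linarith
  · have : {z | (p, z) ∈ cylModification E F L} = Ioo (-L) L := by
      ext z; simp [cylModification, hpE, hpF]
    rw [this, integral_indicator measurableSet_Ioo, hDL,
      indicator_of_mem (show p ∈ symmDiff E F from Or.inr ⟨hpF, hpE⟩)]
    linarith
  · have : {z | (p, z) ∈ cylModification E F L} = ∅ := by
      ext z; simp [cylModification, hpE, hpF]
    rw [this, indicator_empty, integral_zero]
    exact indicator_nonneg (fun _ _ ↦ by norm_num) _

lemma IsTestField.integral_horizontal_le (hg : C1Metric g) {U E F : Set M} {L δ : ℝ} (hE : MeasurableSet E) (hF : MeasurableSet F)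
    (hY : IsTestField (𝓘(ℝ, V).prod 𝓘(ℝ, ℝ)) (cylMetric 𝓘(ℝ, V) g)
      (U ×ˢ Ioo (-(L + δ)) (L + δ)) Y)
    (hEf : variation 𝓘(ℝ, V) g E U ≠ ⊤) (hFf : variation 𝓘(ℝ, V) g F U ≠ ⊤) (z : ℝ) :
    ∫ p, (cylModification E F L).indicator
        (fun X ↦ divergence 𝓘(ℝ, V) g (STIMCF.horizontal Y X.2) X.1) (p, z) ∂(vol 𝓘(ℝ, V) g) ≤
      (Ioo (-L) L).indicator (fun _ ↦ (variation 𝓘(ℝ, V) g F U).toReal) z +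
        (Ioo (-(L + δ)) (L + δ) \ Ioo (-L) L).indicator
          (fun _ ↦ (variation 𝓘(ℝ, V) g E U).toReal) z := by
  have hT := hY.horizontal z
  have key : (fun p ↦ (cylModification E F L).indicator
      (fun X ↦ divergence 𝓘(ℝ, V) g (STIMCF.horizontal Y X.2) X.1) (p, z)) =
      {p | (p, z) ∈ cylModification E F L}.indicator
        (divergence 𝓘(ℝ, V) g (STIMCF.horizontal Y z)) := by
    ext p; rfl
  rw [key]
  by_cases hz : z ∈ Ioo (-L) L
  · have : {p | (p, z) ∈ cylModification E F L} = F := by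
      ext p; simp [cylModification, hz.1, hz.2]
    rw [this, integral_indicator hF, indicator_of_mem hz, indicator_of_notMem fun h ↦ h.2 hz,
      add_zero]
    exact integral_le_variation hT hFf
  · have : {p | (p, z) ∈ cylModification E F L} = E := by
      ext p
      simp only [cylModification, mem_ofPred_eq, hz, false_and, false_or, not_false_eq_true,
        true_and]
    rw [this, integral_indicator hE, indicator_of_notMem hz, zero_add]
    by_cases hz' : z ∈ Ioo (-(L + δ)) (L + δ)
    · rw [indicator_of_mem (show z ∈ _ \ _ from ⟨hz', hz⟩)]
      exact integral_le_variation hT hEf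
    · obtain ⟨h1, h2, C, hC, hCU, hC0⟩ := hY
      have h0 : STIMCF.horizontal Y z = fun _ ↦ 0 := by
        funext p
        exact congrArg Prod.fst (hC0 (p, z) fun h ↦ hz' (hCU h).2)
      rw [h0, indicator_of_notMem fun h ↦ hz' h.1]
      refine le_of_eq (integral_eq_zero_of_ae (Eventually.of_forall fun p ↦ ?_))
      exact divergence_zero_off hg c1Field_zero isClosed_empty (fun _ _ ↦ rfl) (by simp)

theorem perimeter_cylModification_le (hg : C1Metric g) {E F A : Set M} (hE : MeasurableSet E)
    (hF : MeasurableSet F) (hA : IsCompact A) (hEF : symmDiff E F ⊆ A)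
    (hEf : perimeter 𝓘(ℝ, V) g E A ≠ ⊤) (hFf : perimeter 𝓘(ℝ, V) g F A ≠ ⊤)
    {L : ℝ} (hL : 0 < L) :
    perimeter (𝓘(ℝ, V).prod 𝓘(ℝ, ℝ)) (cylMetric 𝓘(ℝ, V) g) (cylModification E F L)
        (A ×ˢ Icc (-L) L) ≤
      ENNReal.ofReal (cylScale hg * (2 * L)) * perimeter 𝓘(ℝ, V) g F A +
        ENNReal.ofReal (cylScale hg * (2 + 2 * (vol 𝓘(ℝ, V) g).real A)) := by
  have hsf := sigmaFinite_vol hg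
  have hlf := isLocallyFiniteMeasure_vol hg
  have hb : perimeter 𝓘(ℝ, V) g F A < perimeter 𝓘(ℝ, V) g F A + ENNReal.ofReal (1 / (2 * L)) :=
    ENNReal.lt_add_right hFf (by simpa using hL)
  obtain ⟨U₁, hU₁, hAU₁, hv₁⟩ := exists_open_variation_lt hb
  obtain ⟨U₂, hU₂, hAU₂, hv₂⟩ := exists_open_variation_lt (lt_top_iff_ne_top.2 hEf)
  set U := U₁ ∩ U₂
  have hvF : variation 𝓘(ℝ, V) g F U < _ := (variation_mono inter_subset_left).trans_lt hv₁
  have hvE : variation 𝓘(ℝ, V) g E U ≠ ⊤ := ((variation_mono inter_subset_right).trans_lt hv₂).ne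
  have hvF' : variation 𝓘(ℝ, V) g F U ≠ ⊤ := hvF.ne_top
  set f := (variation 𝓘(ℝ, V) g F U).toReal with hf
  set e := (variation 𝓘(ℝ, V) g E U).toReal with he
  have he0 : 0 ≤ e := ENNReal.toReal_nonneg
  have hfle : f ≤ (perimeter 𝓘(ℝ, V) g F A).toReal + 1 / (2 * L) := by
    have h := ENNReal.toReal_mono (by finiteness) hvF.le
    rwa [ENNReal.toReal_add hFf ENNReal.ofReal_ne_top,
      ENNReal.toReal_ofReal (by positivity)] at h
  set δ : ℝ := 1 / (2 * (e + 1))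
  have hδ : 0 < δ := by positivity
  have hδe : 2 * δ * e ≤ 1 := by
    simp only [δ]
    rw [div_eq_mul_inv, mul_inv]
    have : (e + 1)⁻¹ * e ≤ 1 := by rw [inv_mul_le_one₀ (by linarith)]; linarith
    linarith
  have hsub : A ×ˢ Icc (-L) L ⊆ U ×ˢ Ioo (-(L + δ)) (L + δ) :=
    prod_mono (subset_inter hAU₁ hAU₂) fun z hz ↦ ⟨by linarith [hz.1], by linarith [hz.2]⟩
  refine ((iInf₂_le _ ((hU₁.inter hU₂).prod isOpen_Ioo)).trans (iInf_le _ hsub)).trans ?_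
  refine iSup₂_le fun Y hY ↦ ?_
  rw [← ENNReal.ofReal_toReal hFf, ← ENNReal.ofReal_mul (by positivity [cylScale_pos hg]),
    ← ENNReal.ofReal_add (by positivity [cylScale_pos hg]) (by positivity [cylScale_pos hg])]
  refine ENNReal.ofReal_le_ofReal ?_
  have hGm := measurableSet_cylModification hE hF L
  obtain ⟨h1, -, C, hC, hCU, hC0⟩ := id hY
  have hCc := hC.isClosed
  set D₁ : M × ℝ → ℝ := fun X ↦ divergence 𝓘(ℝ, V) g (horizontal Y X.2) X.1
  set D₂ : M × ℝ → ℝ := fun X ↦ deriv (fun z ↦ vertical Y (X.1, z)) X.2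
  have hD₁ : Integrable D₁ ((vol 𝓘(ℝ, V) g).prod volume) := by
    refine (continuous_divergence_horizontal hg h1).integrable_of_hasCompactSupport
      (HasCompactSupport.intro hC fun X hX ↦ ?_)
    refine divergence_zero_off hg (C1CylField.horizontal h1 X.2) (C := {p | (p, X.2) ∈ C})
      (hCc.preimage (by fun_prop)) (fun p hp ↦ ?_) hX
    exact congrArg Prod.fst (hC0 _ hp)
  have hD₂ : Integrable D₂ ((vol 𝓘(ℝ, V) g).prod volume) := by
    refine (continuous_deriv_vertical h1).integrable_of_hasCompactSupport
      (HasCompactSupport.intro hC fun X hX ↦ ?_)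
    have h0 : (fun z ↦ vertical Y (X.1, z)) =ᶠ[𝓝 X.2] fun _ ↦ 0 := by
      have hopen : IsOpen {z : ℝ | (X.1, z) ∈ C}ᶜ := (hCc.preimage (by fun_prop)).isOpen_compl
      filter_upwards [hopen.mem_nhds hX] with z hz
      exact congrArg Prod.snd (hC0 _ hz)
    exact h0.deriv_eq.trans (deriv_const _ _)
  have hsplit : ∫ X in cylModification E F L,
      divergence (𝓘(ℝ, V).prod 𝓘(ℝ, ℝ)) (cylMetric 𝓘(ℝ, V) g) Y X
        ∂(vol (𝓘(ℝ, V).prod 𝓘(ℝ, ℝ)) (cylMetric 𝓘(ℝ, V) g)) = cylScale hg *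
      (∫ X, (cylModification E F L).indicator D₁ X ∂((vol 𝓘(ℝ, V) g).prod volume) +
        ∫ X, (cylModification E F L).indicator D₂ X ∂((vol 𝓘(ℝ, V) g).prod volume)) := by
    rw [vol_cyl hg, Measure.restrict_smul, integral_smul_measure,
      ENNReal.toReal_ofReal (cylScale_pos hg).le, smul_eq_mul, integral_indicator hGm,
      integral_indicator hGm, ← integral_add hD₁.integrableOn hD₂.integrableOn]
    simp only [divergence_cyl hg h1]
    rfl
  have hI₁ : ∫ X, (cylModification E F L).indicator D₁ X ∂((vol 𝓘(ℝ, V) g).prod volume) ≤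
      2 * L * f + 2 * δ * e := by
    rw [integral_prod_symm _ (hD₁.indicator hGm)]
    have hm : MeasurableSet (Ioo (-(L + δ)) (L + δ) \ Ioo (-L) L) :=
      measurableSet_Ioo.diff measurableSet_Ioo
    have hb₁ : Integrable ((Ioo (-L) L).indicator fun _ : ℝ ↦ f) :=
      (integrable_indicator_iff measurableSet_Ioo).2 (by simp)
    have hb₂ : Integrable ((Ioo (-(L + δ)) (L + δ) \ Ioo (-L) L).indicator fun _ : ℝ ↦ e) :=
      (integrable_indicator_iff hm).2 (integrableOn_const
        ((measure_mono sdiff_subset).trans_lt (by simp)).ne)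
    refine (integral_mono (hD₁.indicator hGm).integral_prod_right (hb₁.add hb₂)
      fun z ↦ hY.integral_horizontal_le hg hE hF hvE hvF' z).trans (le_of_eq ?_)
    simp only [Pi.add_apply]
    rw [integral_add hb₁ hb₂, integral_indicator measurableSet_Ioo, integral_indicator hm,
      setIntegral_const, setIntegral_const, measureReal_sdiff
        (Ioo_subset_Ioo (by linarith) (by linarith)) measurableSet_Ioo
        (by rw [Real.volume_Ioo]; exact ENNReal.ofReal_ne_top)]
    simp only [Real.volume_real_Ioo, smul_eq_mul]
    rw [max_eq_left (by linarith), max_eq_left (by linarith)]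
    ring
  have hvA : vol 𝓘(ℝ, V) g A ≠ ⊤ := hA.measure_lt_top.ne
  have hI₂ : ∫ X, (cylModification E F L).indicator D₂ X ∂((vol 𝓘(ℝ, V) g).prod volume) ≤
      2 * (vol 𝓘(ℝ, V) g).real A := by
    rw [integral_prod _ (hD₂.indicator hGm)]
    have hm : MeasurableSet (symmDiff E F) := hE.symmDiff hF
    have hb₁ : Integrable ((symmDiff E F).indicator fun _ : M ↦ (2 : ℝ)) (vol 𝓘(ℝ, V) g) :=
      (integrable_indicator_iff hm).2 (integrableOn_const
        ((measure_mono hEF).trans_lt (lt_top_iff_ne_top.2 hvA)).ne)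
    refine (integral_mono (hD₂.indicator hGm).integral_prod_left hb₁
      fun p ↦ hY.integral_vertical_le hg E F p hL).trans ?_
    rw [integral_indicator hm, setIntegral_const, smul_eq_mul, mul_comm]
    exact mul_le_mul_of_nonneg_left (measureReal_mono hEF hvA) (by norm_num)
  rw [hsplit, mul_assoc, ← mul_add]
  refine mul_le_mul_of_nonneg_left ?_ (cylScale_pos hg).le
  have h3 : 2 * L * f ≤ 2 * L * (perimeter 𝓘(ℝ, V) g F A).toReal + 1 := by
    have h := mul_le_mul_of_nonneg_left hfle (by linarith : 0 ≤ 2 * L)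
    rwa [mul_add, mul_one_div_cancel (by positivity)] at h
  linarith

/-- The bulk energy over a product is a multiple of the bulk energy over the base. -/
lemma bulk_cyl (hg : C1Metric g) {K : TensorField 𝓘(ℝ, V) M}
    (hK : ∀ x, ∃ B : LinearMap.BilinForm ℝ V, ∀ v w : V, K x v w = B v w)
    {u : M → ℝ} {U : M × ℝ → ℝ} (hU : ∀ X, U X = u X.1)
    {ν : ∀ X : M × ℝ, TangentSpace (𝓘(ℝ, V).prod 𝓘(ℝ, ℝ)) X} {S : Set M} (hS : MeasurableSet S)
    (hν : ∀ X : M × ℝ, X.1 ∈ S → (ν X : V × ℝ) = (ν (X.1, 0) : V × ℝ)) {T : Set ℝ}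
    (hT : MeasurableSet T) (hTf : volume T ≠ ⊤) :
    bulk (𝓘(ℝ, V).prod 𝓘(ℝ, ℝ)) (cylMetric 𝓘(ℝ, V) g) (cylExtend 𝓘(ℝ, V) K) U ν (S ×ˢ T) =
      ENNReal.ofReal (cylScale hg) * volume T *
        bulk 𝓘(ℝ, V) g K u (projField 𝓘(ℝ, V) ν) S := by
  have hsf := sigmaFinite_vol hg
  have hfin : IsFiniteMeasure ((volume : Measure ℝ).restrict T) :=
    ⟨by rw [Measure.restrict_apply_univ]; exact lt_top_iff_ne_top.2 hTf⟩
  unfold bulk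
  rw [vol_cyl hg, Measure.restrict_smul, lintegral_smul_measure]
  have h1 : ∀ X ∈ S ×ˢ T, ENNReal.ofReal (Real.sqrt
      (gradNorm (𝓘(ℝ, V).prod 𝓘(ℝ, ℝ)) (cylMetric 𝓘(ℝ, V) g) U X ^ 2 +
      expansion (𝓘(ℝ, V).prod 𝓘(ℝ, ℝ)) (cylMetric 𝓘(ℝ, V) g) (cylExtend 𝓘(ℝ, V) K) ν X ^ 2)) =
      (fun x : M ↦ ENNReal.ofReal (Real.sqrt (gradNorm 𝓘(ℝ, V) g u x ^ 2 +
        expansion 𝓘(ℝ, V) g K (projField 𝓘(ℝ, V) ν) x ^ 2))) X.1 := by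
    intro X hX
    rw [show U = fun X ↦ u X.1 from funext hU, gradNorm_cyl, expansion_cyl hg hK ν (hν X hX.1)]
  rw [setLIntegral_congr_fun (hS.prod hT) h1, ← Measure.prod_restrict, lintegral_prod_fst _ _
    (fun x : M ↦ ENNReal.ofReal (Real.sqrt (gradNorm 𝓘(ℝ, V) g u x ^ 2 +
        expansion 𝓘(ℝ, V) g K (projField 𝓘(ℝ, V) ν) x ^ 2))), Measure.restrict_apply_univ, smul_eq_mul, mul_assoc]

/-- If a cylinder minimizes in a cylinder, then its cross section minimizes. -/
theorem minimizes_of_cylinder (hg : C1Metric g) {K : TensorField 𝓘(ℝ, V) M}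
    (hK : ∀ x, ∃ B : LinearMap.BilinForm ℝ V, ∀ v w : V, K x v w = B v w)
    {u : M → ℝ} {U : M × ℝ → ℝ} (hU : ∀ X, U X = u X.1)
    {ν : ∀ X : M × ℝ, TangentSpace (𝓘(ℝ, V).prod 𝓘(ℝ, ℝ)) X} {Ω E : Set M}
    (hν : ∀ X : M × ℝ, X.1 ∈ Ω → (ν X : V × ℝ) = (ν (X.1, 0) : V × ℝ)) (hE : MeasurableSet E)
    (hmin : Minimizes (𝓘(ℝ, V).prod 𝓘(ℝ, ℝ)) (cylMetric 𝓘(ℝ, V) g) (cylExtend 𝓘(ℝ, V) K) U ν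
      (Ω ×ˢ univ) (E ×ˢ univ)) :
    Minimizes 𝓘(ℝ, V) g K u (projField 𝓘(ℝ, V) ν) Ω E := by
  have hc := cylScale_pos hg
  have hper : ∀ A : Set M, IsCompact A → A ⊆ Ω → perimeter 𝓘(ℝ, V) g E A < ⊤ := by
    intro A hA hAΩ
    have h1 := (mul_perimeter_le_cyl hg E hA one_pos).trans_lt
      (hmin.1.2 (A ×ˢ Icc (-1) 1) (hA.prod isCompact_Icc) (prod_mono hAΩ (subset_univ _)))
    refine lt_top_iff_ne_top.2 fun h ↦ ?_
    rw [h, ENNReal.mul_top (by simpa using hc)] at h1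
    exact lt_irrefl _ h1
  refine ⟨⟨hE, hper⟩, fun F A hF hA hAΩ hEF ↦ ?_⟩
  by_cases hFt : perimeter 𝓘(ℝ, V) g F A = ⊤
  · rw [hFt, top_add]; exact le_top
  have hEt := (hper A hA hAΩ).ne
  have hAm := hA.isClosed.measurableSet
  have key : ∀ L : ℝ, 0 < L → ENNReal.ofReal (cylScale hg * (2 * L)) *
      (perimeter 𝓘(ℝ, V) g E A + bulk 𝓘(ℝ, V) g K u (projField 𝓘(ℝ, V) ν) (F ∩ A)) ≤
      ENNReal.ofReal (cylScale hg * (2 * L)) *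
      (perimeter 𝓘(ℝ, V) g F A + bulk 𝓘(ℝ, V) g K u (projField 𝓘(ℝ, V) ν) (E ∩ A)) +
        ENNReal.ofReal (cylScale hg * (2 + 2 * (vol 𝓘(ℝ, V) g).real A)) := by
    intro L hL
    have hmul : ENNReal.ofReal (cylScale hg * (2 * L)) =
        ENNReal.ofReal (cylScale hg) * ENNReal.ofReal (2 * L) := ENNReal.ofReal_mul hc.le
    have hvIoo : volume (Ioo (-L) L) = ENNReal.ofReal (2 * L) := by
      rw [Real.volume_Ioo]; congr 1; ring
    have hvIcc : volume (Icc (-L) L) = ENNReal.ofReal (2 * L) := by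
      rw [Real.volume_Icc]; congr 1; ring
    have h1 := hmin.2 (cylModification E F L) (A ×ˢ Icc (-L) L)
      (measurableSet_cylModification hE hF L) (hA.prod isCompact_Icc)
      (prod_mono hAΩ (subset_univ _)) (by
        rintro ⟨p, z⟩ h
        by_cases hz : z ∈ Ioo (-L) L
        · refine ⟨hEF ?_, Ioo_subset_Icc_self hz⟩
          rcases h with ⟨h1, h2⟩ | ⟨h1, h2⟩
          · exact Or.inl ⟨h1.1, fun h3 ↦ h2 (Or.inl ⟨hz, h3⟩)⟩
          · refine Or.inr ⟨?_, fun h3 ↦ h2 ⟨h3, mem_univ _⟩⟩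
            rcases h1 with h1 | h1
            · exact h1.2
            · exact absurd hz h1.1
        · exfalso
          rcases h with ⟨h1, h2⟩ | ⟨h1, h2⟩
          · exact h2 (Or.inr ⟨hz, h1.1⟩)
          · rcases h1 with h1 | h1
            · exact hz h1.1
            · exact h2 ⟨h1.2, mem_univ _⟩)
    have hb1 : ENNReal.ofReal (cylScale hg * (2 * L)) *
        bulk 𝓘(ℝ, V) g K u (projField 𝓘(ℝ, V) ν) (F ∩ A) ≤
        bulk (𝓘(ℝ, V).prod 𝓘(ℝ, ℝ)) (cylMetric 𝓘(ℝ, V) g) (cylExtend 𝓘(ℝ, V) K) U ν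
          (cylModification E F L ∩ A ×ˢ Icc (-L) L) := by
      rw [hmul, ← hvIoo, ← bulk_cyl hg hK hU (hF.inter hAm) (fun X hX ↦ hν X (hAΩ hX.2))
        measurableSet_Ioo (by rw [hvIoo]; exact ENNReal.ofReal_ne_top)]
      exact lintegral_mono_set fun X hX ↦
        ⟨Or.inl ⟨hX.2, hX.1.1⟩, hX.1.2, Ioo_subset_Icc_self hX.2⟩
    have hb2 : bulk (𝓘(ℝ, V).prod 𝓘(ℝ, ℝ)) (cylMetric 𝓘(ℝ, V) g) (cylExtend 𝓘(ℝ, V) K) U ν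
        (E ×ˢ univ ∩ A ×ˢ Icc (-L) L) = ENNReal.ofReal (cylScale hg * (2 * L)) *
        bulk 𝓘(ℝ, V) g K u (projField 𝓘(ℝ, V) ν) (E ∩ A) := by
      rw [hmul, ← hvIcc, ← bulk_cyl hg hK hU (hE.inter hAm) (fun X hX ↦ hν X (hAΩ hX.2))
        measurableSet_Icc (by rw [hvIcc]; exact ENNReal.ofReal_ne_top), prod_inter_prod, univ_inter]
    rw [hb2] at h1
    have h2 := perimeter_cylModification_le hg hE hF hA hEF hEt hFt hL
    rw [mul_add, mul_add]
    refine (add_le_add (mul_perimeter_le_cyl hg E hA hL) hb1).trans (h1.trans ?_)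
    rw [add_right_comm]
    exact add_le_add h2 le_rfl
  set a := perimeter 𝓘(ℝ, V) g E A + bulk 𝓘(ℝ, V) g K u (projField 𝓘(ℝ, V) ν) (F ∩ A)
  set b := perimeter 𝓘(ℝ, V) g F A + bulk 𝓘(ℝ, V) g K u (projField 𝓘(ℝ, V) ν) (E ∩ A)
  set k := cylScale hg * (2 + 2 * (vol 𝓘(ℝ, V) g).real A)
  have hk : 0 ≤ k := by positivity
  refine ENNReal.le_of_forall_pos_le_add fun ε hε _ ↦ ?_
  have hL : 0 < (k + 1) / (cylScale hg * 2 * ε) := by positivity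
  have h := key _ hL
  set q := cylScale hg * (2 * ((k + 1) / (cylScale hg * 2 * ε))) with hq
  have hqe : q * ε = k + 1 := by
    rw [hq]
    have : (ε : ℝ) ≠ 0 := by positivity
    field_simp
  have hq0 : 0 < q := by positivity
  have h3 : ENNReal.ofReal k ≤ ENNReal.ofReal q * ε := by
    rw [← ENNReal.ofReal_coe_nnreal, ← ENNReal.ofReal_mul hq0.le, hqe]
    exact ENNReal.ofReal_le_ofReal (by linarith)
  have h4 := h.trans (add_le_add le_rfl h3)
  rw [← mul_add] at h4
  exact (ENNReal.mul_le_mul_iff_right (by simpa using hq0) ENNReal.ofReal_ne_top).1 h4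

end CylinderPerimeter
end STIMCF
end

noncomputable section
namespace STIMCF
set_option linter.unusedSectionVars false

section LevelSets

variable {V : Type*} [NormedAddCommGroup V] [NormedSpace ℝ V] [FiniteDimensional ℝ V]
  [MeasurableSpace V] [BorelSpace V]
  {M : Type*} [EMetricSpace M] [ChartedSpace V M] [IsManifold 𝓘(ℝ, V) ∞ M]
  [MeasurableSpace M] [BorelSpace M] [SecondCountableTopology M]
  {g : TensorField 𝓘(ℝ, V) M}

lemma perimeter_inter_add_sdiff (hg : C1Metric g) (E : Set M) {A B : Set M} (hA : MeasurableSet A)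
    (hB : MeasurableSet B) : perimeter 𝓘(ℝ, V) g E (A ∩ B) + perimeter 𝓘(ℝ, V) g E (A \ B) =
      perimeter 𝓘(ℝ, V) g E A := by
  rw [← perimeterMeasure_apply hg E (hA.inter hB), ← perimeterMeasure_apply hg E (hA.diff hB),
    ← perimeterMeasure_apply hg E hA, measure_inter_add_sdiff _ hB]

lemma perimeter_univ_eq (hg : C1Metric g) {E A : Set M} (h : closure E ⊆ A) :
    perimeter 𝓘(ℝ, V) g E univ = perimeter 𝓘(ℝ, V) g E A := by
  refine le_antisymm ?_ (perimeter_mono (subset_univ _))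
  have h1 := perimeter_union_le hg E A (closure E)ᶜ
  rw [perimeter_eq_zero_of_disjoint hg isClosed_closure.isOpen_compl
    (disjoint_compl_left.mono_right subset_closure), add_zero] at h1
  refine (perimeter_mono fun x _ ↦ ?_).trans h1
  by_cases hx : x ∈ closure E
  · exact Or.inl (h hx)
  · exact Or.inr hx

/-- Inequalities between the perimeters of two sets do not depend on the region, as long as it
contains the set where they differ. -/
lemma perimeter_le_iff (hg : C1Metric g) {E F A B : Set M} (hE : MeasurableSet E)
    (hF : MeasurableSet F) (hA : IsClosed A) (hB : MeasurableSet B) (hAB : A ⊆ B)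
    (hEF : symmDiff E F ⊆ A) (hfin : perimeter 𝓘(ℝ, V) g E (B \ A) ≠ ⊤) (x y : ℝ≥0∞) :
    perimeter 𝓘(ℝ, V) g E A + x ≤ perimeter 𝓘(ℝ, V) g F A + y ↔
      perimeter 𝓘(ℝ, V) g E B + x ≤ perimeter 𝓘(ℝ, V) g F B + y := by
  have h := perimeter_congr hg hE hF (A := B \ A) hA.isOpen_compl (fun x hx ↦ hx.2)
    (Eventually.of_forall fun z hz ↦ by
      by_contra hc
      apply hz (hEF _)
      by_cases h1 : z ∈ E
      · exact Or.inl ⟨h1, fun h2 ↦ hc ⟨fun _ ↦ h2, fun _ ↦ h1⟩⟩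
      · refine Or.inr ⟨?_, h1⟩
        by_contra h2
        exact hc ⟨fun h ↦ absurd h h1, fun h ↦ absurd h h2⟩)
  rw [← perimeter_inter_add_sdiff hg E hB hA.measurableSet,
    ← perimeter_inter_add_sdiff hg F hB hA.measurableSet, inter_eq_right.2 hAB, ← h,
    add_right_comm, add_right_comm (perimeter 𝓘(ℝ, V) g F A)]
  exact (ENNReal.add_le_add_iff_right hfin).symm

/-- Lower semicontinuity of the perimeter, with an additional constant. -/
lemma perimeter_add_le_of_tendsto (hg : C1Metric g) {E U : Set M} (hU : IsOpen U) {Ek : ℕ → Set M}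
    (hE : MeasurableSet E) (hEk : ∀ k, MeasurableSet (Ek k))
    (h : ∀ x, ∀ᶠ k in atTop, (x ∈ Ek k ↔ x ∈ E)) {B : ℕ → ℝ≥0∞} {b m : ℝ≥0∞} (hm : m ≠ ⊤)
    (hb : ∀ᶠ k in atTop, perimeter 𝓘(ℝ, V) g (Ek k) U + m ≤ B k) (hB : Tendsto B atTop (𝓝 b)) :
    perimeter 𝓘(ℝ, V) g E U + m ≤ b := by
  have h1 : m ≤ b := ge_of_tendsto hB (by filter_upwards [hb] with k hk using le_add_self.trans hk)
  have h2 : perimeter 𝓘(ℝ, V) g E U ≤ b - m := by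
    rw [perimeter_eq_variation hU]
    refine variation_le_of_tendsto hg hE hEk (Eventually.of_forall h) (B := fun k ↦ B k - m) ?_
      (ENNReal.Tendsto.sub hB tendsto_const_nhds (Or.inr hm))
    filter_upwards [hb] with k hk
    rw [← perimeter_eq_variation hU]
    exact ENNReal.le_sub_of_add_le_right hm hk
  exact (add_le_add h2 le_rfl).trans (tsub_add_cancel_of_le h1).le

/-- A function `u` whose sublevel sets minimize `|∂* F| - ∫_F f` outside of `E₀ = {u < 0}`, where
`f` is locally bounded outside of `E₀` and equals `p ≤ f` almost everywhere on the level sets. -/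
structure LevelSetFlow (g : TensorField 𝓘(ℝ, V) M) (f p : M → ℝ≥0∞) (E₀ : Set M) (u : M → ℝ) :
    Prop where
  metric : C1Metric g
  continuous : Continuous u
  neg_iff : ∀ x, u x < 0 ↔ x ∈ E₀
  isCompact : ∀ t, 0 < t → IsCompact (closure {x | u x < t})
  le : ∀ x, p x ≤ f x
  bounded : ∀ A, IsCompact A → A ⊆ E₀ᶜ → ∃ C : ℝ≥0, ∀ x ∈ A, f x ≤ C
  level : ∀ t, 0 ≤ t → ∀ᵐ x ∂(vol 𝓘(ℝ, V) g), u x = t → f x = p x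
  finite : ∀ t, 0 < t → ∀ A, IsCompact A → A ⊆ E₀ᶜ →
    perimeter 𝓘(ℝ, V) g {x | u x < t} A < ⊤
  minimizes : ∀ t, 0 < t → ∀ F A, MeasurableSet F → IsCompact A → A ⊆ E₀ᶜ →
    symmDiff {x | u x < t} F ⊆ A →
    perimeter 𝓘(ℝ, V) g {x | u x < t} A + ∫⁻ x in F ∩ A, f x ∂(vol 𝓘(ℝ, V) g) ≤
      perimeter 𝓘(ℝ, V) g F A + ∫⁻ x in {x | u x < t} ∩ A, f x ∂(vol 𝓘(ℝ, V) g)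

namespace LevelSetFlow

variable {f p : M → ℝ≥0∞} {E₀ : Set M} {u : M → ℝ}

lemma isOpen_lt (h : LevelSetFlow g f p E₀ u) (t : ℝ) : IsOpen {x | u x < t} :=
  _root_.isOpen_lt h.continuous continuous_const

lemma isClosed_le (h : LevelSetFlow g f p E₀ u) (t : ℝ) : IsClosed {x | u x ≤ t} :=
  _root_.isClosed_le h.continuous continuous_const

lemma eq_setOf (h : LevelSetFlow g f p E₀ u) : E₀ = {x | u x < 0} :=
  Set.ext fun x ↦ (h.neg_iff x).symm

lemma isOpen (h : LevelSetFlow g f p E₀ u) : IsOpen E₀ := h.eq_setOf ▸ h.isOpen_lt 0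

lemma subset_lt (h : LevelSetFlow g f p E₀ u) {t : ℝ} (ht : 0 ≤ t) : E₀ ⊆ {x | u x < t} :=
  fun x hx ↦ ((h.neg_iff x).2 hx).trans_le ht

lemma subset_le (h : LevelSetFlow g f p E₀ u) {t : ℝ} (ht : 0 ≤ t) : E₀ ⊆ {x | u x ≤ t} :=
  fun x hx ↦ ((h.neg_iff x).2 hx).le.trans ht

lemma lintegral_lt_top (h : LevelSetFlow g f p E₀ u) {A S : Set M} (hA : IsCompact A) (hS : S ⊆ A)
    (hS0 : Disjoint S E₀) : ∫⁻ x in S, f x ∂(vol 𝓘(ℝ, V) g) < ⊤ := by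
  have hlf := isLocallyFiniteMeasure_vol h.metric
  have hA' : IsCompact (A \ E₀) := hA.diff h.isOpen
  obtain ⟨C, hC⟩ := h.bounded _ hA' fun x hx ↦ hx.2
  refine (lintegral_mono_set (subset_sdiff.2 ⟨hS, hS0⟩)).trans_lt ?_
  refine (setLIntegral_mono' hA'.isClosed.measurableSet (g := fun _ ↦ (C : ℝ≥0∞)) hC).trans_lt ?_
  rw [setLIntegral_const]
  exact ENNReal.mul_lt_top ENNReal.coe_lt_top hA'.measure_lt_top

lemma perimeter_lt_top (h : LevelSetFlow g f p E₀ u) {t : ℝ} (ht : 0 < t) (A : Set M) :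
    perimeter 𝓘(ℝ, V) g {x | u x < t} A < ⊤ := by
  refine (perimeter_mono (subset_univ A)).trans_lt ?_
  rw [perimeter_univ_eq h.metric Subset.rfl]
  refine (perimeter_mono (B := closure {x | u x < t} \ E₀ ∪ E₀) fun x hx ↦ ?_).trans_lt
    ((perimeter_union_le h.metric _ _ _).trans_lt ?_)
  · by_cases hx0 : x ∈ E₀
    · exact Or.inr hx0
    · exact Or.inl ⟨hx, hx0⟩
  · rw [perimeter_eq_zero_of_subset h.metric h.isOpen (h.subset_lt ht.le), add_zero]
    exact h.finite t ht _ ((h.isCompact t ht).diff h.isOpen) fun x hx ↦ hx.2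

/-- The perimeter of a set that contains `E₀` may be computed outside of `E₀`. -/
lemma perimeter_sdiff (h : LevelSetFlow g f p E₀ u) {E A : Set M} (hE : E₀ ⊆ E) :
    perimeter 𝓘(ℝ, V) g E (A \ E₀) = perimeter 𝓘(ℝ, V) g E A := by
  refine le_antisymm (perimeter_mono sdiff_subset) ?_
  refine (perimeter_mono (B := A \ E₀ ∪ E₀) fun x hx ↦ ?_).trans
    ((perimeter_union_le h.metric _ _ _).trans ?_)
  · by_cases hx0 : x ∈ E₀
    · exact Or.inr hx0
    · exact Or.inl ⟨hx, hx0⟩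
  · rw [perimeter_eq_zero_of_subset h.metric h.isOpen hE, add_zero]

lemma outward_lt (h : LevelSetFlow g f p E₀ u) {t : ℝ} (ht : 0 < t) {F A B : Set M}
    (hF : MeasurableSet F) (hEF : {x | u x < t} ⊆ F) (hA : IsCompact A)
    (hFA : F \ {x | u x < t} ⊆ A) (hB : MeasurableSet B) (hAB : A ⊆ B) :
    perimeter 𝓘(ℝ, V) g {x | u x < t} B + ∫⁻ x in F \ {x | u x < t}, f x ∂(vol 𝓘(ℝ, V) g) ≤
      perimeter 𝓘(ℝ, V) g F B := by
  have hEm := (h.isOpen_lt t).measurableSet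
  have hE0 := h.subset_lt ht.le
  have hd : symmDiff {x | u x < t} F ⊆ A := by
    rw [symmDiff_of_le hEF]; exact hFA
  have hd' : symmDiff {x | u x < t} F ⊆ A \ E₀ := by
    rw [symmDiff_of_le hEF]
    exact fun x hx ↦ ⟨hFA hx, fun h0 ↦ hx.2 (hE0 h0)⟩
  have hA' : IsCompact (A \ E₀) := hA.diff h.isOpen
  have key := h.minimizes t ht F _ hF hA' (fun x hx ↦ hx.2) hd'
  rw [h.perimeter_sdiff hE0, h.perimeter_sdiff (hE0.trans hEF),
    ← lintegral_inter_add_sdiff (A := F ∩ (A \ E₀)) _ hEm] at key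
  have e1 : F ∩ (A \ E₀) ∩ {x | u x < t} = {x | u x < t} ∩ (A \ E₀) := by
    ext x; constructor
    · exact fun hx ↦ ⟨hx.2, hx.1.2⟩
    · exact fun hx ↦ ⟨⟨hEF hx.1, hx.2⟩, hx.1⟩
  have e2 : (F ∩ (A \ E₀)) \ {x | u x < t} = F \ {x | u x < t} := by
    ext x; constructor
    · exact fun hx ↦ ⟨hx.1.1, hx.2⟩
    · exact fun hx ↦ ⟨⟨hx.1, hFA hx, fun h0 ↦ hx.2 (hE0 h0)⟩, hx.2⟩
  have hfin : ∫⁻ x in {x | u x < t} ∩ (A \ E₀), f x ∂(vol 𝓘(ℝ, V) g) ≠ ⊤ :=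
    (h.lintegral_lt_top hA (fun x hx ↦ hx.2.1) (disjoint_left.2 fun x hx ↦ hx.2.2)).ne
  rw [e1, e2, add_comm (lintegral _ _), ← add_assoc, ENNReal.add_le_add_iff_right hfin] at key
  have h2 := (perimeter_le_iff h.metric hEm hF hA.isClosed hB hAB hd
    (h.perimeter_lt_top ht _).ne (∫⁻ x in F \ {x | u x < t}, f x ∂(vol 𝓘(ℝ, V) g)) 0).1
  rw [add_zero, add_zero] at h2
  exact h2 key

lemma inward_lt (h : LevelSetFlow g f p E₀ u) {t : ℝ} (ht : 0 < t) {F A B : Set M}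
    (hF : MeasurableSet F) (h0F : E₀ ⊆ F) (hFE : F ⊆ {x | u x < t}) (hA : IsCompact A)
    (hFA : {x | u x < t} \ F ⊆ A) (hB : MeasurableSet B) (hAB : A ⊆ B) :
    perimeter 𝓘(ℝ, V) g {x | u x < t} B ≤
      perimeter 𝓘(ℝ, V) g F B + ∫⁻ x in {x | u x < t} \ F, f x ∂(vol 𝓘(ℝ, V) g) := by
  have hEm := (h.isOpen_lt t).measurableSet
  have hE0 := h.subset_lt ht.le
  have hd : symmDiff {x | u x < t} F ⊆ A := by
    rw [symmDiff_of_ge hFE]; exact hFA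
  have hd' : symmDiff {x | u x < t} F ⊆ A \ E₀ := by
    rw [symmDiff_of_ge hFE]
    exact fun x hx ↦ ⟨hFA hx, fun h0 ↦ hx.2 (h0F h0)⟩
  have hA' : IsCompact (A \ E₀) := hA.diff h.isOpen
  have key := h.minimizes t ht F _ hF hA' (fun x hx ↦ hx.2) hd'
  rw [h.perimeter_sdiff hE0, h.perimeter_sdiff h0F,
    ← lintegral_inter_add_sdiff (A := {x | u x < t} ∩ (A \ E₀)) _ hF] at key
  have e1 : {x | u x < t} ∩ (A \ E₀) ∩ F = F ∩ (A \ E₀) := by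
    ext x; constructor
    · exact fun hx ↦ ⟨hx.2, hx.1.2⟩
    · exact fun hx ↦ ⟨⟨hFE hx.1, hx.2⟩, hx.1⟩
  have e2 : ({x | u x < t} ∩ (A \ E₀)) \ F = {x | u x < t} \ F := by
    ext x; constructor
    · exact fun hx ↦ ⟨hx.1.1, hx.2⟩
    · exact fun hx ↦ ⟨⟨hx.1, hFA hx, fun h0 ↦ hx.2 (h0F h0)⟩, hx.2⟩
  have hfin : ∫⁻ x in F ∩ (A \ E₀), f x ∂(vol 𝓘(ℝ, V) g) ≠ ⊤ :=
    (h.lintegral_lt_top hA (fun x hx ↦ hx.2.1) (disjoint_left.2 fun x hx ↦ hx.2.2)).ne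
  have hkey : perimeter 𝓘(ℝ, V) g {x | u x < t} A ≤
      perimeter 𝓘(ℝ, V) g F A + ∫⁻ x in {x | u x < t} \ F, f x ∂(vol 𝓘(ℝ, V) g) := by
    rw [e1, e2] at key
    refine (ENNReal.add_le_add_iff_right hfin).1 (key.trans (le_of_eq ?_))
    rw [add_comm (lintegral _ _), ← add_assoc]
  have h2 := (perimeter_le_iff h.metric hEm hF hA.isClosed hB hAB hd
    (h.perimeter_lt_top ht _).ne 0 (∫⁻ x in {x | u x < t} \ F, f x ∂(vol 𝓘(ℝ, V) g))).1
  rw [add_zero, add_zero] at h2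
  exact h2 hkey

/-- The times `t + 1 / (k + 1)`. -/
lemma exists_times (t : ℝ) : ∃ s : ℕ → ℝ, (∀ k, t < s k) ∧ (∀ k, s k ≤ t + 1) ∧ Antitone s ∧
    Tendsto s atTop (𝓝 t) := by
  refine ⟨fun k ↦ t + 1 / ((k : ℝ) + 1), fun k ↦ ?_, fun k ↦ ?_, fun k l hkl ↦ ?_, ?_⟩
  · have : 0 < 1 / ((k : ℝ) + 1) := by positivity
    linarith
  · have : 1 / ((k : ℝ) + 1) ≤ 1 := by
      rw [div_le_one (by positivity)]
      linarith [(Nat.cast_nonneg k : (0 : ℝ) ≤ k)]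
    linarith
  · have : 1 / ((l : ℝ) + 1) ≤ 1 / ((k : ℝ) + 1) := by gcongr
    simpa using this
  · simpa using (tendsto_const_nhds (x := t)).add tendsto_one_div_add_atTop_nhds_zero_nat

lemma eventually_lt_iff {s : ℕ → ℝ} {t : ℝ} (hs : ∀ k, t < s k) (hlim : Tendsto s atTop (𝓝 t))
    (x : M) : ∀ᶠ k in atTop, (u x < s k ↔ u x ≤ t) := by
  by_cases hx : u x ≤ t
  · exact Eventually.of_forall fun k ↦ ⟨fun _ ↦ hx, fun _ ↦ hx.trans_lt (hs k)⟩
  · filter_upwards [hlim.eventually (gt_mem_nhds (not_le.1 hx))] with k hk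
    exact ⟨fun h ↦ absurd (h.trans hk) (lt_irrefl _), fun h ↦ absurd h hx⟩

lemma tendsto_lintegral_sdiff (h : LevelSetFlow g f p E₀ u) {t : ℝ} (ht : 0 ≤ t) {s : ℕ → ℝ}
    (hs1 : ∀ k, s k ≤ t + 1) (hanti : Antitone s) (hlim : Tendsto s atTop (𝓝 t)) :
    Tendsto (fun k ↦ ∫⁻ x in {x | u x < s k} \ {x | u x ≤ t}, f x ∂(vol 𝓘(ℝ, V) g)) atTop
      (𝓝 0) := by
  have hlf := isLocallyFiniteMeasure_vol h.metric
  have hK : IsCompact (closure {x | u x < t + 1} \ E₀) :=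
    (h.isCompact (t + 1) (by linarith)).diff h.isOpen
  obtain ⟨C, hC⟩ := h.bounded _ hK fun x hx ↦ hx.2
  have hm : ∀ k, MeasurableSet ({x | u x < s k} \ {x | u x ≤ t}) := fun k ↦
    (h.isOpen_lt _).measurableSet.diff (h.isClosed_le t).measurableSet
  have hsub : ∀ k, {x | u x < s k} \ {x | u x ≤ t} ⊆ closure {x | u x < t + 1} \ E₀ := fun k x hx ↦
    ⟨subset_closure (lt_of_lt_of_le hx.1 (hs1 k)), fun h0 ↦ hx.2 (h.subset_le ht h0)⟩
  have hv : Tendsto (fun k ↦ vol 𝓘(ℝ, V) g ({x | u x < s k} \ {x | u x ≤ t})) atTop (𝓝 0) := by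
    have h1 := tendsto_measure_iInter_atTop (μ := vol 𝓘(ℝ, V) g) (fun k ↦ (hm k).nullMeasurableSet)
      (fun k l hkl x hx ↦ ⟨lt_of_lt_of_le hx.1 (hanti hkl), hx.2⟩)
      ⟨0, ((measure_mono (hsub 0)).trans_lt hK.measure_lt_top).ne⟩
    have h2 : ⋂ k, {x | u x < s k} \ {x | u x ≤ t} = ∅ := by
      refine eq_empty_of_forall_notMem fun x hx ↦ ?_
      rw [mem_iInter] at hx
      exact (hx 0).2 (ge_of_tendsto hlim (Eventually.of_forall fun k ↦ (hx k).1.le))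
    rwa [h2, measure_empty] at h1
  have hv' := ENNReal.Tendsto.const_mul (a := (C : ℝ≥0∞)) hv (Or.inr ENNReal.coe_ne_top)
  rw [mul_zero] at hv'
  refine tendsto_of_tendsto_of_tendsto_of_le_of_le tendsto_const_nhds hv' (fun k ↦ zero_le)
    fun k ↦ ?_
  refine (setLIntegral_mono' (hm k) (g := fun _ ↦ (C : ℝ≥0∞)) fun x hx ↦ hC x (hsub k hx)).trans ?_
  rw [setLIntegral_const]

lemma perimeter_le_lt_top (h : LevelSetFlow g f p E₀ u) {t : ℝ} (ht : 0 ≤ t) (A : Set M) :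
    perimeter 𝓘(ℝ, V) g {x | u x ≤ t} A < ⊤ := by
  obtain ⟨s, hs, hs1, hanti, hlim⟩ := exists_times t
  refine (perimeter_mono (subset_univ A)).trans_lt ?_
  have h1 : perimeter 𝓘(ℝ, V) g {x | u x ≤ t} univ + 0 ≤
      perimeter 𝓘(ℝ, V) g {x | u x < t + 1} univ := by
    refine perimeter_add_le_of_tendsto h.metric isOpen_univ (h.isClosed_le t).measurableSet
      (Ek := fun k ↦ {x | u x < s k})
      (fun k ↦ (h.isOpen_lt (s k)).measurableSet) (fun x ↦ eventually_lt_iff hs hlim x)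
      ENNReal.zero_ne_top (Eventually.of_forall fun k ↦ ?_) tendsto_const_nhds
    rw [add_zero]
    exact le_self_add.trans (h.outward_lt (ht.trans_lt (hs k)) (h.isOpen_lt _).measurableSet
      (fun x hx ↦ lt_of_lt_of_le hx (hs1 k)) (h.isCompact (t + 1) (by linarith))
      (fun x hx ↦ subset_closure hx.1) MeasurableSet.univ (subset_univ _))
  rw [add_zero] at h1
  exact h1.trans_lt (h.perimeter_lt_top (by linarith) _)

lemma outward_le (h : LevelSetFlow g f p E₀ u) {t : ℝ} (ht : 0 ≤ t) {F A B : Set M}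
    (hF : MeasurableSet F) (hEF : {x | u x ≤ t} ⊆ F) (hA : IsCompact A)
    (hFA : F \ {x | u x ≤ t} ⊆ A) (hB : MeasurableSet B) (hAB : A ⊆ B) :
    perimeter 𝓘(ℝ, V) g {x | u x ≤ t} B + ∫⁻ x in F \ {x | u x ≤ t}, f x ∂(vol 𝓘(ℝ, V) g) ≤
      perimeter 𝓘(ℝ, V) g F B := by
  have hEm := (h.isClosed_le t).measurableSet
  have hd : symmDiff {x | u x ≤ t} F ⊆ A := by
    rw [symmDiff_of_le hEF]; exact hFA
  obtain ⟨s, hs, hs1, hanti, hlim⟩ := exists_times t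
  set m := ∫⁻ x in F \ {x | u x ≤ t}, f x ∂(vol 𝓘(ℝ, V) g)
  have hm : m ≠ ⊤ := (h.lintegral_lt_top hA hFA
    (disjoint_left.2 fun x hx h0 ↦ hx.2 (h.subset_le ht h0))).ne
  have key : perimeter 𝓘(ℝ, V) g {x | u x ≤ t} univ + m ≤ perimeter 𝓘(ℝ, V) g F univ := by
    refine perimeter_add_le_of_tendsto h.metric isOpen_univ hEm
      (Ek := fun k ↦ {x | u x < s k} ∩ F)
      (fun k ↦ (h.isOpen_lt (s k)).measurableSet.inter hF) (fun x ↦ ?_) hm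
      (B := fun k ↦ perimeter 𝓘(ℝ, V) g F univ +
        ∫⁻ x in {x | u x < s k} \ {x | u x ≤ t}, f x ∂(vol 𝓘(ℝ, V) g))
      (Eventually.of_forall fun k ↦ ?_) ?_
    · filter_upwards [eventually_lt_iff (u := u) hs hlim x] with k hk
      exact ⟨fun hx ↦ hk.1 hx.1, fun hx ↦ ⟨hk.2 hx, hEF hx⟩⟩
    · have hs0 := ht.trans_lt (hs k)
      have hkm := (h.isOpen_lt (s k)).measurableSet
      have h1 := h.outward_lt hs0 (F := {x | u x < s k} ∪ F) (hkm.union hF) subset_union_left hA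
        (fun x hx ↦ hFA ⟨hx.1.resolve_left hx.2, fun h' ↦ hx.2 (lt_of_le_of_lt h' (hs k))⟩)
        MeasurableSet.univ (subset_univ _)
      have h2 := perimeter_submodular h.metric hkm hF MeasurableSet.univ
      rw [union_sdiff_left] at h1
      have h3 : m ≤ ∫⁻ x in F \ {x | u x < s k}, f x ∂(vol 𝓘(ℝ, V) g) +
          ∫⁻ x in {x | u x < s k} \ {x | u x ≤ t}, f x ∂(vol 𝓘(ℝ, V) g) := by
        refine le_trans (lintegral_mono_set fun x hx ↦ ?_) (lintegral_union_le _ _ _)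
        by_cases hxs : u x < s k
        · exact Or.inr ⟨hxs, hx.2⟩
        · exact Or.inl ⟨hx.1, hxs⟩
      have h4 : perimeter 𝓘(ℝ, V) g ({x | u x < s k} ∩ F) univ +
          ∫⁻ x in F \ {x | u x < s k}, f x ∂(vol 𝓘(ℝ, V) g) ≤ perimeter 𝓘(ℝ, V) g F univ := by
        have h5 := (add_le_add h1 (le_refl
          (perimeter 𝓘(ℝ, V) g ({x | u x < s k} ∩ F) univ))).trans h2
        rw [add_assoc, add_comm (lintegral _ _)] at h5
        exact (ENNReal.add_le_add_iff_left (h.perimeter_lt_top hs0 _).ne).1 h5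
      refine (add_le_add le_rfl h3).trans ?_
      rw [← add_assoc]
      exact add_le_add h4 le_rfl
    · simpa using (tendsto_const_nhds (x := perimeter 𝓘(ℝ, V) g F univ)).add
        (h.tendsto_lintegral_sdiff ht hs1 hanti hlim)
  have h2 := fun B hB hAB ↦ perimeter_le_iff h.metric hEm hF hA.isClosed (B := B) hB hAB hd
    (h.perimeter_le_lt_top ht _).ne m 0
  simp only [add_zero] at h2
  exact (h2 B hB hAB).1 ((h2 univ MeasurableSet.univ (subset_univ _)).2 key)

lemma inward_le (h : LevelSetFlow g f p E₀ u) {t : ℝ} (ht : 0 ≤ t) {F : Set M}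
    (hF : MeasurableSet F) (h0F : E₀ ⊆ F) (hFE : F ⊆ {x | u x ≤ t}) :
    perimeter 𝓘(ℝ, V) g {x | u x ≤ t} univ ≤
      perimeter 𝓘(ℝ, V) g F univ + ∫⁻ x in {x | u x ≤ t} \ F, f x ∂(vol 𝓘(ℝ, V) g) := by
  obtain ⟨s, hs, hs1, hanti, hlim⟩ := exists_times t
  rw [← add_zero (perimeter 𝓘(ℝ, V) g {x | u x ≤ t} univ)]
  refine perimeter_add_le_of_tendsto h.metric isOpen_univ (h.isClosed_le t).measurableSet
    (Ek := fun k ↦ {x | u x < s k}) (fun k ↦ (h.isOpen_lt (s k)).measurableSet)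
    (fun x ↦ eventually_lt_iff hs hlim x) ENNReal.zero_ne_top
    (B := fun k ↦ perimeter 𝓘(ℝ, V) g F univ +
      (∫⁻ x in {x | u x ≤ t} \ F, f x ∂(vol 𝓘(ℝ, V) g) +
        ∫⁻ x in {x | u x < s k} \ {x | u x ≤ t}, f x ∂(vol 𝓘(ℝ, V) g)))
    (Eventually.of_forall fun k ↦ ?_) ?_
  · have hs0 := ht.trans_lt (hs k)
    rw [add_zero]
    refine (h.inward_lt hs0 hF h0F (hFE.trans fun x hx ↦ lt_of_le_of_lt hx (hs k))
      (h.isCompact _ hs0) (fun x hx ↦ subset_closure hx.1) MeasurableSet.univ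
      (subset_univ _)).trans (add_le_add le_rfl ?_)
    refine le_trans (lintegral_mono_set fun x hx ↦ ?_) (lintegral_union_le _ _ _)
    by_cases hxt : u x ≤ t
    · exact Or.inl ⟨hxt, hx.2⟩
    · exact Or.inr ⟨hx.1, hxt⟩
  · simpa using (tendsto_const_nhds (x := perimeter 𝓘(ℝ, V) g F univ)).add
      ((tendsto_const_nhds (x := ∫⁻ x in {x | u x ≤ t} \ F, f x ∂(vol 𝓘(ℝ, V) g))).add
        (h.tendsto_lintegral_sdiff ht hs1 hanti hlim))

lemma lintegral_mono_le (h : LevelSetFlow g f p E₀ u) (S : Set M) :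
    ∫⁻ x in S, p x ∂(vol 𝓘(ℝ, V) g) ≤ ∫⁻ x in S, f x ∂(vol 𝓘(ℝ, V) g) :=
  lintegral_mono h.le

lemma lintegral_level (h : LevelSetFlow g f p E₀ u) {t : ℝ} (ht : 0 ≤ t) {S : Set M}
    (hSm : MeasurableSet S) (hS : S ⊆ {x | u x = t}) :
    ∫⁻ x in S, f x ∂(vol 𝓘(ℝ, V) g) = ∫⁻ x in S, p x ∂(vol 𝓘(ℝ, V) g) :=
  setLIntegral_congr_fun_ae hSm (by filter_upwards [h.level t ht] with x hx using fun hxS ↦ hx (hS hxS))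

theorem perimeter_le_eq (h : LevelSetFlow g f p E₀ u) {t : ℝ} (ht : 0 < t) :
    perimeter 𝓘(ℝ, V) g {x | u x ≤ t} univ = perimeter 𝓘(ℝ, V) g {x | u x < t} univ +
      ∫⁻ x in {x | u x ≤ t} \ {x | u x < t}, p x ∂(vol 𝓘(ℝ, V) g) := by
  have hm := (h.isOpen_lt t).measurableSet
  have hm' := (h.isClosed_le t).measurableSet
  have hsub : {x | u x < t} ⊆ {x | u x ≤ t} :=
    fun x hx ↦ (show u x ≤ t from le_of_lt hx)
  rw [← h.lintegral_level ht.le (hm'.diff hm) (fun x hx ↦ le_antisymm hx.1 (not_lt.1 hx.2))]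
  refine le_antisymm (h.inward_le ht.le hm (h.subset_lt ht.le) hsub) ?_
  refine h.outward_lt ht hm' hsub (h.isCompact (t + 1) (by linarith)) (fun x hx ↦ subset_closure ?_)
    MeasurableSet.univ (subset_univ _)
  exact lt_of_le_of_lt (show u x ≤ t from hx.1) (by linarith)

end LevelSetFlow
end LevelSets
end STIMCF
end

noncomputable section
namespace STIMCF
set_option linter.unusedSectionVars false

section LebesguePoints

variable {M : Type*} [EMetricSpace M] [MeasurableSpace M] {μ : Measure M}

lemma lebesguePoints_subset {E : Set M} (hE : IsClosed E) : lebesguePoints μ E ⊆ E := by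
  intro x hx
  by_contra hxE
  obtain ⟨ε, hε, hb⟩ := EMetric.isOpen_iff.1 hE.isOpen_compl x hxE
  have h0 : Tendsto ENNReal.ofReal (𝓝[>] 0) (𝓝 0) := by
    simpa using (ENNReal.continuous_ofReal.tendsto 0).mono_left nhdsWithin_le_nhds
  refine zero_ne_one (tendsto_nhds_unique (tendsto_const_nhds.congr' ?_) hx)
  filter_upwards [h0.eventually (gt_mem_nhds hε)] with r hr
  have he : E ∩ Metric.eball x (ENNReal.ofReal r) = ∅ := by
    refine eq_empty_of_forall_notMem fun y hy ↦ hb ?_ hy.1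
    exact Metric.eball_subset_eball hr.le hy.2
  rw [he, measure_empty, ENNReal.zero_div]

lemma lebesguePoints_mono {E F : Set M} (h : μ (E \ F) = 0) :
    lebesguePoints μ E ⊆ lebesguePoints μ F := by
  intro x hx
  refine tendsto_of_tendsto_of_tendsto_of_le_of_le hx tendsto_const_nhds (fun r ↦ ?_) fun r ↦ ?_
  · refine ENNReal.div_le_div_right ?_ _
    refine (measure_mono (t := F ∩ Metric.eball x (ENNReal.ofReal r) ∪ E \ F) fun y hy ↦ ?_).trans
      ((measure_union_le _ _).trans (by rw [h, add_zero]))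
    by_cases hyF : y ∈ F
    · exact Or.inl ⟨hyF, hy.2⟩
    · exact Or.inr ⟨hy.1, hyF⟩
  · exact ENNReal.div_le_of_le_mul (by rw [one_mul]; exact measure_mono inter_subset_right)

end LebesguePoints

section LevelSets

variable {V : Type*} [NormedAddCommGroup V] [NormedSpace ℝ V] [FiniteDimensional ℝ V]
  [MeasurableSpace V] [BorelSpace V]
  {M : Type*} [EMetricSpace M] [ChartedSpace V M] [IsManifold 𝓘(ℝ, V) ∞ M]
  [MeasurableSpace M] [BorelSpace M] [SecondCountableTopology M]
  {g k : TensorField 𝓘(ℝ, V) M} {ν : ∀ x : M, TangentSpace 𝓘(ℝ, V) x}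

namespace LevelSetFlow

variable {f : M → ℝ≥0∞} {E₀ : Set M} {u : M → ℝ}

lemma isCompact_le {p : M → ℝ≥0∞} (h : LevelSetFlow g f p E₀ u) {t : ℝ} (ht : 0 ≤ t) :
    IsCompact {x | u x ≤ t} :=
  (h.isCompact (t + 1) (by linarith)).of_isClosed_subset (h.isClosed_le t) fun x hx ↦
    subset_closure (lt_of_le_of_lt (show u x ≤ t from hx) (by linarith))

theorem outwardOptimizing_lt
    (h : LevelSetFlow g f (fun x ↦ ENNReal.ofReal |expansion 𝓘(ℝ, V) g k ν x|) E₀ u) {t : ℝ}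
    (ht : 0 < t) : OutwardOptimizing 𝓘(ℝ, V) g k ν univ {x | u x < t} :=
  ⟨⟨(h.isOpen_lt t).measurableSet, fun A _ _ ↦ h.perimeter_lt_top ht A⟩, fun _F _A hF hEF hA _ hFA ↦
    (add_le_add le_rfl (h.lintegral_mono_le _)).trans
      (h.outward_lt ht hF hEF hA hFA hA.isClosed.measurableSet Subset.rfl)⟩

theorem outwardOptimizing_le
    (h : LevelSetFlow g f (fun x ↦ ENNReal.ofReal |expansion 𝓘(ℝ, V) g k ν x|) E₀ u) {t : ℝ}
    (ht : 0 ≤ t) (Ω : Set M) : OutwardOptimizing 𝓘(ℝ, V) g k ν Ω {x | u x ≤ t} :=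
  ⟨⟨(h.isClosed_le t).measurableSet, fun A _ _ ↦ h.perimeter_le_lt_top ht A⟩,
    fun _F _A hF hEF hA _ hFA ↦ (add_le_add le_rfl (h.lintegral_mono_le _)).trans
      (h.outward_le ht hF hEF hA hFA hA.isClosed.measurableSet Subset.rfl)⟩

theorem outwardOptimizing_iff
    (h : LevelSetFlow g f (fun x ↦ ENNReal.ofReal |expansion 𝓘(ℝ, V) g k ν x|) E₀ u) :
    OutwardOptimizing 𝓘(ℝ, V) g k ν univ E₀ ↔
      perimeter 𝓘(ℝ, V) g {x | u x ≤ 0} univ = perimeter 𝓘(ℝ, V) g E₀ univ +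
        bulkP 𝓘(ℝ, V) g k ν ({x | u x ≤ 0} \ E₀) := by
  have hEm := h.isOpen.measurableSet
  have hEm' := (h.isClosed_le 0).measurableSet
  have hsub := h.subset_le le_rfl
  have hlev : ∀ S : Set M, MeasurableSet S → S ⊆ {x | u x ≤ 0} \ E₀ →
      ∫⁻ x in S, f x ∂(vol 𝓘(ℝ, V) g) = bulkP 𝓘(ℝ, V) g k ν S := fun S hS hS' ↦
    h.lintegral_level le_rfl hS fun x hx ↦
      le_antisymm (hS' hx).1 (not_lt.1 fun h0 ↦ (hS' hx).2 ((h.neg_iff x).1 h0))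
  constructor
  · intro hoo
    refine le_antisymm ?_ ?_
    · rw [← hlev _ (hEm'.diff hEm) Subset.rfl]
      exact h.inward_le le_rfl hEm Subset.rfl hsub
    · have h1 := hoo.2 _ _ hEm' hsub (h.isCompact_le le_rfl) (subset_univ _) sdiff_subset
      have hfin : perimeter 𝓘(ℝ, V) g E₀ univ < ⊤ := by
        rw [perimeter_univ_eq h.metric (closure_minimal hsub (h.isClosed_le 0))]
        exact hoo.1.2 _ (h.isCompact_le le_rfl) (subset_univ _)
      have h2 := (perimeter_le_iff h.metric hEm hEm' (h.isClosed_le 0) MeasurableSet.univ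
        (subset_univ _) (by rw [symmDiff_of_le hsub]; exact sdiff_subset)
        ((perimeter_mono (subset_univ _)).trans_lt hfin).ne
        (bulkP 𝓘(ℝ, V) g k ν ({x | u x ≤ 0} \ E₀)) 0).1
      simp only [add_zero] at h2
      exact h2 h1
  · intro heq
    have hfin : perimeter 𝓘(ℝ, V) g E₀ univ < ⊤ :=
      (heq ▸ le_self_add : perimeter 𝓘(ℝ, V) g E₀ univ ≤ _).trans_lt
        (h.perimeter_le_lt_top le_rfl univ)
    refine ⟨⟨hEm, fun A _ _ ↦ (perimeter_mono (subset_univ A)).trans_lt hfin⟩, ?_⟩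
    intro F A hF hEF hA _ hFA
    set E : Set M := {x | u x ≤ 0} with hE
    have h1 := h.outward_le le_rfl (hF.union hEm') subset_union_right hA
      (fun x hx ↦ hFA ⟨hx.1.resolve_right hx.2, fun h0 ↦ hx.2 (hsub h0)⟩) MeasurableSet.univ
      (subset_univ _)
    have h2 := perimeter_submodular h.metric hF hEm' MeasurableSet.univ
    have h3 := h.inward_le le_rfl (hF.inter hEm') (subset_inter hEF hsub) inter_subset_right
    rw [union_sdiff_right] at h1
    have e : E \ (F ∩ E) = E \ F := by
      ext x; constructor
      · exact fun hx ↦ ⟨hx.1, fun hF ↦ hx.2 ⟨hF, hx.1⟩⟩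
      · exact fun hx ↦ ⟨hx.1, fun hF ↦ hx.2 hF.1⟩
    rw [e, hlev _ (hEm'.diff hF) (sdiff_subset_sdiff_right hEF)] at h3
    have h1' := (add_le_add le_rfl (h.lintegral_mono_le (F \ E))).trans h1
    change perimeter 𝓘(ℝ, V) g E univ + bulkP 𝓘(ℝ, V) g k ν (F \ E) ≤ _ at h1'
    have hfinE : perimeter 𝓘(ℝ, V) g E univ ≠ ⊤ := (h.perimeter_le_lt_top le_rfl univ).ne
    have hb : bulkP 𝓘(ℝ, V) g k ν (E \ F) ≠ ⊤ := by
      rw [← hlev _ (hEm'.diff hF) (sdiff_subset_sdiff_right hEF)]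
      exact (h.lintegral_lt_top (h.isCompact_le le_rfl) sdiff_subset
        (disjoint_left.2 fun x hx h0 ↦ hx.2 (hEF h0))).ne
    have h4 : perimeter 𝓘(ℝ, V) g E univ + bulkP 𝓘(ℝ, V) g k ν (F \ E) ≤
        perimeter 𝓘(ℝ, V) g F univ + bulkP 𝓘(ℝ, V) g k ν (E \ F) := by
      refine (ENNReal.add_le_add_iff_right hfinE).1 ((add_le_add h1' h3).trans ?_)
      rw [← add_assoc, add_right_comm _ _ (perimeter 𝓘(ℝ, V) g E univ)]
      exact add_le_add h2 le_rfl
    have h5 : bulkP 𝓘(ℝ, V) g k ν (E \ E₀) =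
        bulkP 𝓘(ℝ, V) g k ν ((E ∩ F) \ E₀) + bulkP 𝓘(ℝ, V) g k ν (E \ F) := by
      unfold bulkP
      rw [← lintegral_inter_add_sdiff (A := E \ E₀) _ hF]
      congr 3
      · ext x; exact ⟨fun hx ↦ ⟨⟨hx.1.1, hx.2⟩, hx.1.2⟩, fun hx ↦ ⟨⟨hx.1.1, hx.2⟩, hx.1.2⟩⟩
      · ext x; exact ⟨fun hx ↦ ⟨hx.1.1, hx.2⟩, fun hx ↦ ⟨⟨hx.1, fun h0 ↦ hx.2 (hEF h0)⟩, hx.2⟩⟩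
    have h6 : bulkP 𝓘(ℝ, V) g k ν (F \ E₀) ≤
        bulkP 𝓘(ℝ, V) g k ν ((E ∩ F) \ E₀) + bulkP 𝓘(ℝ, V) g k ν (F \ E) := by
      refine le_trans (lintegral_mono_set fun x hx ↦ ?_) (lintegral_union_le _ _ _)
      by_cases hxE : x ∈ E
      · exact Or.inl ⟨⟨hxE, hx.1⟩, hx.2⟩
      · exact Or.inr ⟨hx.1, hxE⟩
    have h7 : perimeter 𝓘(ℝ, V) g E₀ univ + bulkP 𝓘(ℝ, V) g k ν (F \ E₀) ≤
        perimeter 𝓘(ℝ, V) g F univ := by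
      refine (ENNReal.add_le_add_iff_right hb).1 (le_trans ?_ h4)
      rw [heq, h5, add_assoc, add_assoc, add_assoc]
      refine add_le_add le_rfl ((add_le_add h6 le_rfl).trans (le_of_eq ?_))
      ring
    have h8 := (perimeter_le_iff h.metric hEm hF hA.isClosed MeasurableSet.univ
        (subset_univ _) (by rw [symmDiff_of_le hEF]; exact hFA)
        ((perimeter_mono (subset_univ _)).trans_lt hfin).ne
        (bulkP 𝓘(ℝ, V) g k ν (F \ E₀)) 0).2
    simp only [add_zero] at h8
    exact h8 h7

lemma exists_subset_of_le_subset {p : M → ℝ≥0∞} (h : LevelSetFlow g f p E₀ u) {t : ℝ} (ht : 0 ≤ t)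
    {Ω : Set M} (hΩ : IsOpen Ω) (hsub : {x | u x ≤ t} ⊆ Ω) : ∃ s, t < s ∧ {x | u x ≤ s} ⊆ Ω := by
  have hC : IsCompact ({x | u x ≤ t + 1} \ Ω) := (h.isCompact_le (by linarith)).diff hΩ
  rcases ({x | u x ≤ t + 1} \ Ω).eq_empty_or_nonempty with he | hne
  · exact ⟨t + 1, by linarith, sdiff_eq_empty.1 he⟩
  · obtain ⟨x₀, hx₀, hmin⟩ := hC.exists_isMinOn hne h.continuous.continuousOn
    have h1 : t < u x₀ := not_le.1 fun h0 ↦ hx₀.2 (hsub h0)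
    have h2 : u x₀ ≤ t + 1 := hx₀.1
    refine ⟨(t + u x₀) / 2, by linarith, fun x hx ↦ ?_⟩
    have hx' : u x ≤ (t + u x₀) / 2 := hx
    by_contra hxΩ
    have h3 : u x₀ ≤ u x := hmin ⟨show u x ≤ t + 1 by linarith, hxΩ⟩
    linarith

/-- Strictly outward optimizing sets that contain `{u < t}` contain `{u ≤ t}`. -/
lemma vol_le_sdiff_eq_zero
    (h : LevelSetFlow g f (fun x ↦ ENNReal.ofReal |expansion 𝓘(ℝ, V) g k ν x|) E₀ u) {t : ℝ}
    (ht : 0 ≤ t) {Ω : Set M} (hΩ : IsOpen Ω) (hsub : {x | u x ≤ t} ⊆ Ω) {G : Set M}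
    (hG : {x | u x < t} ⊆ G) (hGs : StrictlyOutwardOptimizing 𝓘(ℝ, V) g k ν Ω G) :
    vol 𝓘(ℝ, V) g ({x | u x ≤ t} \ G) = 0 := by
  obtain ⟨s₁, hts₁, hs₁⟩ := h.exists_subset_of_le_subset ht hΩ hsub
  obtain ⟨s₂, hts₂, hs₂⟩ := exists_between hts₁
  obtain ⟨s, hs, hs1, hanti, hlim⟩ := exists_times t
  have hGm := hGs.1.1.1
  have h0G : E₀ ⊆ G := (h.subset_lt ht).trans hG
  set O := {x | u x < s₁} with hO
  set A := {x | u x ≤ s₂} with hAdef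
  have hA : IsCompact A := h.isCompact_le (by linarith)
  have hAO : A ⊆ O := fun x hx ↦ lt_of_le_of_lt hx hs₂
  have hOo : IsOpen O := h.isOpen_lt s₁
  have hPG : perimeter 𝓘(ℝ, V) g G O < ⊤ :=
    (perimeter_mono fun x hx ↦ (show u x ≤ s₁ from le_of_lt hx)).trans_lt
      (hGs.1.1.2 _ (h.isCompact_le (by linarith)) hs₁)
  set m := ∫⁻ x in {x | u x ≤ t} \ G, f x ∂(vol 𝓘(ℝ, V) g) with hm
  have hEm := (h.isClosed_le t).measurableSet
  have key : perimeter 𝓘(ℝ, V) g ({x | u x ≤ t} ∪ G) O + 0 ≤ perimeter 𝓘(ℝ, V) g G O + m := by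
    refine perimeter_add_le_of_tendsto h.metric hOo (hEm.union hGm)
      (Ek := fun k ↦ {x | u x < s k} ∪ G) (fun k ↦ (h.isOpen_lt (s k)).measurableSet.union hGm)
      (fun x ↦ ?_) ENNReal.zero_ne_top (B := fun k ↦ perimeter 𝓘(ℝ, V) g G O +
        (m + ∫⁻ x in {x | u x < s k} \ {x | u x ≤ t}, f x ∂(vol 𝓘(ℝ, V) g))) ?_ ?_
    · filter_upwards [eventually_lt_iff (u := u) hs hlim x] with k hk
      exact or_congr hk Iff.rfl
    · filter_upwards [hlim.eventually (gt_mem_nhds hts₂)] with k hk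
      have hs0 := ht.trans_lt (hs k)
      have hkm := (h.isOpen_lt (s k)).measurableSet
      have h1 := h.inward_lt hs0 (F := {x | u x < s k} ∩ G) (hkm.inter hGm)
        (subset_inter (h.subset_lt hs0.le) h0G) inter_subset_left hA
        (fun x hx ↦ (show u x ≤ s₂ from (lt_trans hx.1 hk).le)) hOo.measurableSet hAO
      rw [sdiff_self_inter] at h1
      have h2 := perimeter_submodular h.metric hkm hGm hOo.measurableSet
      have hfin : perimeter 𝓘(ℝ, V) g ({x | u x < s k} ∩ G) O ≠ ⊤ :=
        ((le_add_self.trans h2).trans_lt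
          (ENNReal.add_lt_top.2 ⟨h.perimeter_lt_top hs0 _, hPG⟩)).ne
      have h3 : ∫⁻ x in {x | u x < s k} \ G, f x ∂(vol 𝓘(ℝ, V) g) ≤
          m + ∫⁻ x in {x | u x < s k} \ {x | u x ≤ t}, f x ∂(vol 𝓘(ℝ, V) g) := by
        refine le_trans (lintegral_mono_set fun x hx ↦ ?_) (lintegral_union_le _ _ _)
        by_cases hxt : u x ≤ t
        · exact Or.inl ⟨hxt, hx.2⟩
        · exact Or.inr ⟨hx.1, hxt⟩
      rw [add_zero]
      refine (ENNReal.add_le_add_iff_right hfin).1 (h2.trans ?_)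
      refine (add_le_add (h1.trans (add_le_add le_rfl h3)) le_rfl).trans (le_of_eq ?_)
      ring
    · simpa using (tendsto_const_nhds (x := perimeter 𝓘(ℝ, V) g G O)).add
        ((tendsto_const_nhds (x := m)).add (h.tendsto_lintegral_sdiff ht hs1 hanti hlim))
  have hmp : m = bulkP 𝓘(ℝ, V) g k ν ({x | u x ≤ t} \ G) :=
    h.lintegral_level ht (hEm.diff hGm) fun x hx ↦
      le_antisymm hx.1 (not_lt.1 fun h0 ↦ hx.2 (hG h0))
  have hfin : perimeter 𝓘(ℝ, V) g ({x | u x ≤ t} ∪ G) (O \ A) ≠ ⊤ := by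
    refine ((perimeter_mono sdiff_subset).trans_lt (lt_of_le_of_lt ?_
      (ENNReal.add_lt_top.2 ⟨h.perimeter_le_lt_top ht O, hPG⟩))).ne
    exact le_self_add.trans (perimeter_submodular h.metric hEm hGm hOo.measurableSet)
  have hd : symmDiff ({x | u x ≤ t} ∪ G) G ⊆ A := by
    rw [symmDiff_of_ge subset_union_right, union_sdiff_right]
    exact fun x hx ↦ (show u x ≤ s₂ from le_trans hx.1 hts₂.le)
  have h4 := (perimeter_le_iff h.metric (hEm.union hGm) hGm hA.isClosed hOo.measurableSet hAO hd
    hfin 0 m).2 key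
  have hAΩ : A ⊆ Ω := fun x hx ↦ hs₁ (show u x ≤ s₁ from le_trans hx hs₂.le)
  have hFA : ({x | u x ≤ t} ∪ G) \ G ⊆ A := by
    rw [union_sdiff_right]
    exact fun x hx ↦ (show u x ≤ s₂ from le_trans hx.1 hts₂.le)
  have h5 := hGs.1.2 _ A (hEm.union hGm) subset_union_right hA hAΩ hFA
  have h6 := hGs.2 _ A (hEm.union hGm) subset_union_right hA hAΩ hFA (le_antisymm h5 (by
    rw [add_zero, hmp] at h4
    rwa [union_sdiff_right]))
  refine measure_mono_null (fun x hx ↦ ?_) (ae_le_set.1 h6.le)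
  exact ⟨⟨Or.inl hx.1, hsub hx.1⟩, fun h' ↦ hx.2 h'.1⟩

theorem hull_lt_ae_eq
    (h : LevelSetFlow g f (fun x ↦ ENNReal.ofReal |expansion 𝓘(ℝ, V) g k ν x|) E₀ u) {t : ℝ}
    (ht : 0 ≤ t) {Ω : Set M} (hΩ : IsOpen Ω) (hsub : {x | u x ≤ t} ⊆ Ω)
    (hs : StrictlyOutwardOptimizing 𝓘(ℝ, V) g k ν Ω {x | u x ≤ t})
    (hdens : vol 𝓘(ℝ, V) g ({x | u x ≤ t} \ lebesguePoints (vol 𝓘(ℝ, V) g) {x | u x ≤ t}) = 0) :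
    hull 𝓘(ℝ, V) g k ν Ω {x | u x < t} =ᵐ[vol 𝓘(ℝ, V) g] {x | u x ≤ t} := by
  have h1 : hull 𝓘(ℝ, V) g k ν Ω {x | u x < t} ⊆ {x | u x ≤ t} :=
    (iInter₂_subset_of_subset {x | u x ≤ t} (fun x hx ↦ (show u x ≤ t from le_of_lt hx))
      (iInter_subset _ hs)).trans (lebesguePoints_subset (h.isClosed_le t))
  have h2 : lebesguePoints (vol 𝓘(ℝ, V) g) {x | u x ≤ t} ⊆
      hull 𝓘(ℝ, V) g k ν Ω {x | u x < t} :=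
    subset_iInter₂ fun G hG ↦ subset_iInter fun hGs ↦
      lebesguePoints_mono (h.vol_le_sdiff_eq_zero ht hΩ hsub hG hGs)
  refine (ae_le_set.2 ?_).antisymm (ae_le_set.2 (measure_mono_null (sdiff_subset_sdiff_right h2)
    hdens))
  rw [sdiff_eq_empty.2 h1, measure_empty]

end LevelSetFlow
end LevelSets

section Strict

variable {V : Type*} [NormedAddCommGroup V] [InnerProductSpace ℝ V] [FiniteDimensional ℝ V]
  [MeasurableSpace V] [BorelSpace V]
  {M : Type*} [EMetricSpace M] [ChartedSpace V M] [IsManifold 𝓘(ℝ, V) ∞ M]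
  [MeasurableSpace M] [BorelSpace M] [SecondCountableTopology M]
  {g k : TensorField 𝓘(ℝ, V) M} {ν : ∀ x : M, TangentSpace 𝓘(ℝ, V) x}
  {f : M → ℝ≥0∞} {E₀ : Set M} {u : M → ℝ}

theorem LevelSetFlow.strictlyOutwardOptimizing_le (hd : 1 < Module.finrank ℝ V)
    (h : LevelSetFlow g f (fun x ↦ ENNReal.ofReal |expansion 𝓘(ℝ, V) g k ν x|) E₀ u)
    (hrigid : ∀ W : Set M, IsOpen W → W ⊆ E₀ᶜ → bulkP 𝓘(ℝ, V) g k ν W ≠ ⊤ →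
      ∫⁻ x in W, f x ∂(vol 𝓘(ℝ, V) g) ≤ bulkP 𝓘(ℝ, V) g k ν W →
      ∀ x ∈ W, x ∈ interior {y | u y = u x})
    {t : ℝ} (ht : 0 ≤ t) {Ω : Set M} (hΩ : ∀ t', t < t' → Disjoint Ω (jumpRegion u t')) :
    StrictlyOutwardOptimizing 𝓘(ℝ, V) g k ν Ω {x | u x ≤ t} := by
  refine ⟨h.outwardOptimizing_le ht Ω, fun F A hF hEF hA hAΩ hFA heq ↦ ?_⟩
  have hEm := (h.isClosed_le t).measurableSet
  set E := {x | u x ≤ t} with hE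
  have hPE := fun B ↦ (h.perimeter_le_lt_top ht B).ne
  have hFE0 : Disjoint (F \ E) E₀ := disjoint_left.2 fun x hx h0 ↦ hx.2 (h.subset_le ht h0)
  have hmass : ∫⁻ x in F \ E, f x ∂(vol 𝓘(ℝ, V) g) ≤ bulkP 𝓘(ℝ, V) g k ν (F \ E) := by
    have h1 := h.outward_le ht hF hEF hA hFA hA.isClosed.measurableSet Subset.rfl
    rw [← heq] at h1
    exact (ENNReal.add_le_add_iff_left (hPE A)).1 h1
  have hmfin : ∫⁻ x in F \ E, f x ∂(vol 𝓘(ℝ, V) g) < ⊤ := h.lintegral_lt_top hA hFA hFE0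
  have hbfin : bulkP 𝓘(ℝ, V) g k ν (F \ E) < ⊤ := (h.lintegral_mono_le _).trans_lt hmfin
  have hd' : symmDiff F E ⊆ A := by rw [symmDiff_of_ge hEF]; exact hFA
  have hPF : perimeter 𝓘(ℝ, V) g F univ < ⊤ := by
    refine (perimeter_mono (B := A ∪ Aᶜ) (by rw [union_compl_self])).trans_lt
      ((perimeter_union_le h.metric F A Aᶜ).trans_lt (ENNReal.add_lt_top.2 ⟨?_, ?_⟩))
    · rw [← heq]; exact ENNReal.add_lt_top.2 ⟨(hPE A).lt_top, hbfin⟩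
    · rw [perimeter_congr h.metric hF hEm hA.isClosed.isOpen_compl Subset.rfl
        (Eventually.of_forall fun z hz ↦ ?_)]
      · exact (hPE _).lt_top
      · exact ⟨fun h1 ↦ by_contra fun h2 ↦ hz (hFA ⟨h1, h2⟩), fun h1 ↦ hEF h1⟩
  have heq' : perimeter 𝓘(ℝ, V) g F univ ≤
      perimeter 𝓘(ℝ, V) g E univ + bulkP 𝓘(ℝ, V) g k ν (F \ E) := by
    have h1 := (perimeter_le_iff h.metric hF hEm hA.isClosed MeasurableSet.univ (subset_univ A) hd'
      ((perimeter_mono (subset_univ _)).trans_lt hPF).ne 0 (bulkP 𝓘(ℝ, V) g k ν (F \ E))).1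
      (by rw [add_zero, heq])
    rwa [add_zero] at h1
  obtain ⟨G, hGo, -, hG1, hG2⟩ := exists_open_ae_eq hd h.metric isOpen_univ hF
    (fun K _ _ ↦ (perimeter_mono (subset_univ K)).trans_lt hPF)
    (fun K G hK _ hG hFG hGK ↦ by
      have h1 := (perimeter_le_iff h.metric hF hG hK.isClosed MeasurableSet.univ (subset_univ K)
        (by rw [symmDiff_of_le hFG]; exact hGK)
        ((perimeter_mono (subset_univ _)).trans_lt hPF).ne 0 0).2
      simp only [add_zero] at h1
      refine h1 (heq'.trans (le_trans (add_le_add le_rfl ((h.lintegral_mono_le _).trans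
        (lintegral_mono_set (sdiff_subset_sdiff_left hFG)))) (h.outward_le ht hG (hEF.trans hFG)
          (hA.union hK) (fun x hx ↦ ?_) MeasurableSet.univ (subset_univ _))))
      by_cases hxF : x ∈ F
      · exact Or.inl (hFA ⟨hxF, hx.2⟩)
      · exact Or.inr (hGK ⟨hx.1, hxF⟩))
  rw [inter_univ] at hG2
  have hWo : IsOpen (G \ E) := hGo.sdiff (h.isClosed_le t)
  have hnull : ∀ (q : M → ℝ≥0∞) (S T : Set M), vol 𝓘(ℝ, V) g (S \ T) = 0 →
      ∫⁻ x in S, q x ∂(vol 𝓘(ℝ, V) g) ≤ ∫⁻ x in T, q x ∂(vol 𝓘(ℝ, V) g) := fun q S T hST ↦ by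
    refine (lintegral_mono_set (t := T ∪ S \ T) fun x hx ↦ ?_).trans
      ((lintegral_union_le _ _ _).trans ?_)
    · by_cases hxT : x ∈ T
      · exact Or.inl hxT
      · exact Or.inr ⟨hx, hxT⟩
    · rw [setLIntegral_measure_zero _ _ hST, add_zero]
  have hWF : vol 𝓘(ℝ, V) g ((G \ E) \ (F \ E)) = 0 :=
    measure_mono_null (t := G \ F) (fun x (hx : x ∈ (G \ E) \ (F \ E)) ↦
      ⟨hx.1.1, fun hF ↦ hx.2 ⟨hF, hx.1.2⟩⟩) hG1
  have hFW : vol 𝓘(ℝ, V) g ((F \ E) \ (G \ E)) = 0 :=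
    measure_mono_null (t := F \ G) (fun x (hx : x ∈ (F \ E) \ (G \ E)) ↦
      ⟨hx.1.1, fun hF ↦ hx.2 ⟨hF, hx.1.2⟩⟩) hG2
  have hr := hrigid (G \ E) hWo (fun x hx h0 ↦ hx.2 (h.subset_le ht h0))
    ((hnull _ _ _ hWF).trans_lt hbfin).ne ((hnull _ _ _ hWF).trans (hmass.trans (hnull _ _ _ hFW)))
  refine EventuallyLE.antisymm (ae_le_set.2 (measure_mono_null (fun x hx ↦ ?_) hG2))
    (ae_le_set.2 ?_)
  · refine ⟨hx.1.1, fun hxG ↦ ?_⟩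
    have hxE : x ∉ E := fun hxE ↦ hx.2 ⟨hxE, hx.1.2⟩
    exact disjoint_left.1 (hΩ (u x) (not_le.1 hxE)) hx.1.2 (hr x ⟨hxG, hxE⟩)
  · rw [sdiff_eq_empty.2 (inter_subset_inter_left _ hEF), measure_empty]

end Strict
end STIMCF
end

noncomputable section
namespace STIMCF
set_option linter.unusedSectionVars false

section EuclideanGradient

variable {V : Type*} [NormedAddCommGroup V] [NormedSpace ℝ V] [FiniteDimensional ℝ V]
  [MeasurableSpace V] [BorelSpace V] (μ : Measure V) [μ.IsAddHaarMeasure]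

/-- The derivative of a function vanishes almost everywhere on its level sets. -/
lemma measure_level_fderiv_ne_zero {w : V → ℝ} {S : Set V} (hS : MeasurableSet S) {t : ℝ}
    (h : ∀ y ∈ S, w y = t) : μ {y ∈ S | fderiv ℝ w y ≠ 0} = 0 := by
  set T := {y ∈ S | fderiv ℝ w y ≠ 0} with hT
  have hTm : MeasurableSet T :=
    hS.inter ((measurable_fderiv ℝ w) (measurableSet_singleton 0).compl)
  rcases T.eq_empty_or_nonempty with he | ⟨y₀, hy₀⟩
  · rw [he, measure_empty]
  obtain ⟨e, he⟩ : ∃ e : V, e ≠ 0 := by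
    by_contra! hc
    exact hy₀.2 (ContinuousLinearMap.ext fun v ↦ by rw [hc v, map_zero, map_zero])
  have happ : ApproximatesLinearOn (fun y ↦ w y • e) (0 : V →L[ℝ] V) T 0 := by
    intro x hx y hy
    simp [h x hx.1, h y hy.1]
  have hd := happ.norm_fderiv_sub_le μ hTm (fun y ↦ (fderiv ℝ w y).smulRight e) fun y hy ↦ by
    have hdy : DifferentiableAt ℝ w y := by
      by_contra hc
      exact hy.2 (fderiv_zero_of_not_differentiableAt hc)
    exact (hdy.hasFDerivAt.smul_const e).hasFDerivWithinAt
  rw [ae_restrict_iff' hTm] at hd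
  refine measure_mono_null (fun y hy ↦ ?_) (ae_iff.1 hd)
  simp only [mem_ofPred_eq, Classical.not_imp]
  refine ⟨hy, fun hc ↦ hy.2 ?_⟩
  rw [sub_zero, nonpos_iff_eq_zero, nnnorm_eq_zero] at hc
  ext v
  have := congrArg (fun A : V →L[ℝ] V ↦ A v) hc
  simpa [he] using this

/-- A Lipschitz function on a ball whose derivative vanishes almost everywhere is constant. -/
lemma eq_of_fderiv_ae_eq_zero {w : V → ℝ} {y₀ : V} {R : ℝ} {C : ℝ≥0}
    (hw : LipschitzOnWith C w (Metric.ball y₀ R))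
    (h : ∀ᵐ y ∂μ, y ∈ Metric.ball y₀ R → fderiv ℝ w y = 0) {y : V} (hy : y ∈ Metric.ball y₀ R) :
    w y = w y₀ := by
  obtain ⟨W, hW, hWw⟩ := hw.extend_real
  set B := Metric.ball y₀ R
  have hy₀ : y₀ ∈ B := Metric.mem_ball_self (Metric.pos_of_mem_ball hy)
  rw [hWw hy, hWw hy₀]
  set s := {z : V | z ∈ B → DifferentiableAt ℝ W z ∧ fderiv ℝ W z = 0} with hs
  have hsm : MeasurableSet s := by
    have : s = Bᶜ ∪ ({z | DifferentiableAt ℝ W z} ∩ {z | fderiv ℝ W z = 0}) := by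
      ext z; simp [hs, imp_iff_not_or]
    rw [this]
    exact Metric.isOpen_ball.measurableSet.compl.union ((measurableSet_of_differentiableAt ℝ W).inter
      ((measurable_fderiv ℝ W) (measurableSet_singleton 0)))
  have hae : ∀ᵐ z ∂μ, z ∈ s := by
    filter_upwards [h, hW.ae_differentiableAt (μ := μ)] with z hz hzd hzB
    refine ⟨hzd, ?_⟩
    rw [← hz hzB]
    exact Filter.EventuallyEq.fderiv_eq (by
      filter_upwards [Metric.isOpen_ball.mem_nhds hzB] with z' hz' using (hWw hz').symm)
  set v := y - y₀
  set L : ℝ →ₗ[ℝ] V := LinearMap.toSpanSingleton ℝ V v with hL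
  have hline := (ae_ae_add_linearMap_mem_iff L (volume : Measure ℝ) μ hsm).2 hae
  set O := B ∩ (fun z ↦ z + v) ⁻¹' B with hO
  have hOo : IsOpen O := Metric.isOpen_ball.inter
    (Metric.isOpen_ball.preimage (by fun_prop))
  have heq : EqOn (fun z ↦ W (z + v)) W O := by
    refine Measure.eqOn_open_of_ae_eq (μ := μ) ?_ hOo
      (hW.continuous.comp (by fun_prop)).continuousOn hW.continuous.continuousOn
    refine (ae_restrict_iff' hOo.measurableSet).2 ?_
    filter_upwards [hline] with z hz hzO
    set f : ℝ → ℝ := fun t ↦ W (z + t • v) with hf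
    have hfL : LipschitzWith (C * ‖v‖₊) f := hW.comp (LipschitzWith.of_dist_le_mul fun a b ↦ by
      rw [dist_add_left, dist_eq_norm, ← sub_smul, norm_smul, dist_eq_norm, mul_comm]
      rfl)
    obtain ⟨c, hc⟩ := ((hfL.lipschitzOnWith (s := uIcc 0 1)).absolutelyContinuousOnInterval
      ).const_of_ae_hasDerivAt_zero (by
        filter_upwards [hz] with t ht ht01
        rw [uIcc_of_le zero_le_one] at ht01
        have hB : z + t • v ∈ B := by
          have h1 := (convex_ball y₀ R).add_smul_sub_mem hzO.1 hzO.2 ht01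
          rwa [add_sub_cancel_left] at h1
        have hd := ht (by simpa [hL] using hB)
        rw [hL, LinearMap.toSpanSingleton_apply] at hd
        have h2 : HasFDerivAt W (0 : V →L[ℝ] ℝ) (z + t • v) := hd.2 ▸ hd.1.hasFDerivAt
        have h3 : HasDerivAt (fun t : ℝ ↦ z + t • v) v t := by
          simpa using ((hasDerivAt_id t).smul_const v).const_add z
        simpa [hf, Function.comp_def] using h2.comp_hasDerivAt t h3)
    have h0 := hc 0 left_mem_uIcc
    have h1 := hc 1 right_mem_uIcc
    simp only [hf, zero_smul, add_zero, one_smul] at h0 h1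
    rw [h0, h1]
  have := heq (x := y₀) ⟨hy₀, by simpa [v] using hy⟩
  simpa [v] using this

end EuclideanGradient

section Gradient

variable {V : Type*} [NormedAddCommGroup V] [NormedSpace ℝ V] [FiniteDimensional ℝ V]
  [MeasurableSpace V] [BorelSpace V]
  {M : Type*} [TopologicalSpace M] [ChartedSpace V M] [IsManifold 𝓘(ℝ, V) ∞ M]
  [MeasurableSpace M] [BorelSpace M] [T2Space M] [SecondCountableTopology M]
  {g : TensorField 𝓘(ℝ, V) M}

lemma differential_eq_fderiv (u : M → ℝ) {c p : M} (hp : p ∈ (extChartAt 𝓘(ℝ, V) c).source)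
    (v : TangentSpace 𝓘(ℝ, V) p) : differential 𝓘(ℝ, V) u p v =
      fderiv ℝ (u ∘ (extChartAt 𝓘(ℝ, V) c).symm) (extChartAt 𝓘(ℝ, V) c p) (coord 𝓘(ℝ, V) c p v) := by
  by_cases hu : MDifferentiableAt 𝓘(ℝ, V) 𝓘(ℝ, ℝ) u p
  · exact differential_eq hp hu v
  · unfold differential
    rw [mfderiv_zero_of_not_mdifferentiableAt hu, fderiv_zero_of_not_differentiableAt]
    · rfl
    · intro hd
      refine hu ?_
      have h1 : MDifferentiableAt 𝓘(ℝ, V) 𝓘(ℝ, V) (extChartAt 𝓘(ℝ, V) c) p :=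
        mdifferentiableAt_extChartAt (by simpa using hp)
      refine (hd.mdifferentiableAt.comp p h1).congr_of_eventuallyEq ?_
      filter_upwards [(isOpen_extChartAt_source (I := 𝓘(ℝ, V)) c).mem_nhds hp] with q hq
      exact congrArg u ((extChartAt 𝓘(ℝ, V) c).left_inv hq).symm

lemma gramForm_coord (hg : C1Metric g) {c p : M} (hp : p ∈ (extChartAt 𝓘(ℝ, V) c).source)
    (v w : TangentSpace 𝓘(ℝ, V) p) : gramForm hg c (extChartAt 𝓘(ℝ, V) c p)
      (coord 𝓘(ℝ, V) c p v) (coord 𝓘(ℝ, V) c p w) = g p v w := by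
  rw [gramForm_apply]
  have h := fun v ↦ coordVec_coord hp v
  rw [(extChartAt 𝓘(ℝ, V) c).left_inv hp]
  congr 1 <;> exact h _

lemma formField_gramForm (hg : C1Metric g) (c : M) :
    FormField (fun y q ↦ gramForm hg c y q q) (extChartAt 𝓘(ℝ, V) c).target where
  continuousOn := continuousOn_gramForm hg c
  smul y hy a q := by simp; ring
  convex y hy r := by
    intro v hv w hw a b ha hb hab
    simp only [mem_ofPred_eq, gramForm_apply] at hv hw ⊢
    rw [coordVec_add, coordVec_smul, coordVec_smul]
    exact hg.convex _ ha hb hab hv hw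
  pos y hy q hq := gramForm_pos hg hy hq

/-- On compact subsets of a chart the norm of tangent vectors is comparable to that of their
components. -/
lemma C1Metric.exists_bounds (hg : C1Metric g) (c : M) {T : Set V} (hT : IsCompact T)
    (hTt : T ⊆ (extChartAt 𝓘(ℝ, V) c).target) :
    ∃ l : ℝ, 1 ≤ l ∧ ∀ p ∈ (extChartAt 𝓘(ℝ, V) c).source, extChartAt 𝓘(ℝ, V) c p ∈ T →
      ∀ v : TangentSpace 𝓘(ℝ, V) p, g p v v ≤ l ^ 2 * ‖coord 𝓘(ℝ, V) c p v‖ ^ 2 ∧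
        ‖coord 𝓘(ℝ, V) c p v‖ ^ 2 ≤ l ^ 2 * g p v v := by
  obtain ⟨l, hl, h⟩ := (formField_gramForm hg c).exists_bounds hT hTt
  refine ⟨l, hl, fun p hp hpT v ↦ ?_⟩
  have h1 := h _ hpT (coord 𝓘(ℝ, V) c p v)
  rwa [gramForm_coord hg hp] at h1

lemma gradNorm_nonneg (u : M → ℝ) (hg : C1Metric g) (x : M) : 0 ≤ gradNorm 𝓘(ℝ, V) g u x := by
  by_cases hb : BddAbove {d : ℝ | ∃ v : TangentSpace 𝓘(ℝ, V) x, g x v v ≤ 1 ∧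
      differential 𝓘(ℝ, V) u x v = d}
  · refine le_csSup hb ⟨0, ?_, ?_⟩
    · rw [hg.zero]; exact zero_le_one
    · exact map_zero (mfderiv 𝓘(ℝ, V) 𝓘(ℝ, ℝ) u x)
  · unfold gradNorm
    rw [Real.sSup_of_not_bddAbove hb]

lemma gradNorm_bounds (u : M → ℝ) (hg : C1Metric g) {c p : M}
    (hp : p ∈ (extChartAt 𝓘(ℝ, V) c).source) {l : ℝ} (hl : 1 ≤ l)
    (h : ∀ v : TangentSpace 𝓘(ℝ, V) p, g p v v ≤ l ^ 2 * ‖coord 𝓘(ℝ, V) c p v‖ ^ 2 ∧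
        ‖coord 𝓘(ℝ, V) c p v‖ ^ 2 ≤ l ^ 2 * g p v v) :
    gradNorm 𝓘(ℝ, V) g u p ≤
        l * ‖fderiv ℝ (u ∘ (extChartAt 𝓘(ℝ, V) c).symm) (extChartAt 𝓘(ℝ, V) c p)‖ ∧
      ‖fderiv ℝ (u ∘ (extChartAt 𝓘(ℝ, V) c).symm) (extChartAt 𝓘(ℝ, V) c p)‖ ≤
        l * gradNorm 𝓘(ℝ, V) g u p := by
  set D := fderiv ℝ (u ∘ (extChartAt 𝓘(ℝ, V) c).symm) (extChartAt 𝓘(ℝ, V) c p) with hD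
  have hl0 : 0 < l := by linarith
  have hub : ∀ d ∈ {d : ℝ | ∃ v : TangentSpace 𝓘(ℝ, V) p, g p v v ≤ 1 ∧
      differential 𝓘(ℝ, V) u p v = d}, d ≤ l * ‖D‖ := by
    rintro d ⟨v, hv, rfl⟩
    rw [differential_eq_fderiv u hp]
    have h1 : ‖coord 𝓘(ℝ, V) c p v‖ ≤ l := by
      refine le_of_sq_le_sq ?_ hl0.le
      nlinarith [(h v).2, sq_nonneg l]
    refine (le_abs_self _).trans ((D.le_opNorm _).trans ?_)
    rw [mul_comm]
    gcongr
  have hne : {d : ℝ | ∃ v : TangentSpace 𝓘(ℝ, V) p, g p v v ≤ 1 ∧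
      differential 𝓘(ℝ, V) u p v = d}.Nonempty :=
    ⟨_, 0, by rw [hg.zero]; exact zero_le_one, rfl⟩
  refine ⟨csSup_le hne hub, D.opNorm_le_of_unit_norm
    (mul_nonneg hl0.le (gradNorm_nonneg u hg p)) fun q hq ↦ ?_⟩
  have key : ∀ q : V, ‖q‖ = 1 → D q ≤ l * gradNorm 𝓘(ℝ, V) g u p := by
    intro q hq
    have e := coord_coordVec' hp (l⁻¹ • q)
    set v : TangentSpace 𝓘(ℝ, V) p := coordVec 𝓘(ℝ, V) c (extChartAt 𝓘(ℝ, V) c p) (l⁻¹ • q)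
    have h1 : differential 𝓘(ℝ, V) u p v ≤ gradNorm 𝓘(ℝ, V) g u p := by
      refine le_csSup ⟨_, hub⟩ ⟨v, ?_, rfl⟩
      refine (h v).1.trans (le_of_eq ?_)
      rw [e, norm_smul, hq, Real.norm_of_nonneg (inv_nonneg.2 hl0.le)]
      field_simp
    rw [differential_eq_fderiv u hp, e, map_smul, smul_eq_mul, inv_mul_le_iff₀ hl0] at h1
    exact h1
  rw [Real.norm_eq_abs, abs_le']
  refine ⟨key q hq, ?_⟩
  rw [← map_neg]
  exact key (-q) (by rwa [norm_neg])

end Gradient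
end STIMCF
end

noncomputable section
namespace STIMCF
set_option linter.unusedSectionVars false

section Rigidity

variable {V : Type*} [NormedAddCommGroup V] [NormedSpace ℝ V] [FiniteDimensional ℝ V]
  [MeasurableSpace V] [BorelSpace V]
  {M : Type*} [TopologicalSpace M] [ChartedSpace V M] [IsManifold 𝓘(ℝ, V) ∞ M]
  [MeasurableSpace M] [BorelSpace M] [T2Space M] [SecondCountableTopology M]
  {g : TensorField 𝓘(ℝ, V) M} {u : M → ℝ}

/-- Near every point the function `u` is Lipschitz in the preferred chart. -/
def ChartLipschitz (V : Type*) [NormedAddCommGroup V] [NormedSpace ℝ V] {M : Type*}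
    [TopologicalSpace M] [ChartedSpace V M] (u : M → ℝ) : Prop :=
  ∀ x : M, ∃ (C : ℝ≥0) (R : ℝ), 0 < R ∧
    Metric.closedBall (extChartAt 𝓘(ℝ, V) x x) R ⊆ (extChartAt 𝓘(ℝ, V) x).target ∧
    LipschitzOnWith C (u ∘ (extChartAt 𝓘(ℝ, V) x).symm)
      (Metric.ball (extChartAt 𝓘(ℝ, V) x x) R)

/-- The gradient of a function vanishes almost everywhere on its level sets. -/
lemma ae_gradNorm_eq_zero (hg : C1Metric g) (hu : Continuous u) (t : ℝ) :
    ∀ᵐ x ∂(vol 𝓘(ℝ, V) g), u x = t → gradNorm 𝓘(ℝ, V) g u x = 0 := by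
  have h : vol 𝓘(ℝ, V) g {x | u x = t ∧ gradNorm 𝓘(ℝ, V) g u x ≠ 0} = 0 := by
    refine measure_null_of_locally_null _ fun c _ ↦ ?_
    set N : Set M := (extChartAt 𝓘(ℝ, V) c).source ∩ extChartAt 𝓘(ℝ, V) c ⁻¹'
      {y | fderiv ℝ (u ∘ (extChartAt 𝓘(ℝ, V) c).symm) y ≠ 0} ∩ {x | u x = t} with hN
    have hNm : MeasurableSet N := (measurableSet_source_inter_preimage c
      ((measurable_fderiv ℝ _) (measurableSet_singleton 0).compl)).inter
        (hu.measurable (measurableSet_singleton t))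
    have hN0 : vol 𝓘(ℝ, V) g N = 0 := by
      rw [vol_eq_zero_iff_chartSet hg hNm fun x hx ↦ hx.1.1]
      refine measure_mono_null (fun y hy ↦ ?_) (measure_level_fderiv_ne_zero
        (Module.finBasis ℝ V).addHaar (w := u ∘ (extChartAt 𝓘(ℝ, V) c).symm)
        (measurableSet_chartSet c (hu.measurable (measurableSet_singleton t)))
        (t := t) fun y hy ↦ hy.2)
      refine ⟨⟨hy.1, hy.2.2⟩, ?_⟩
      have h1 := hy.2.1.2
      rwa [mem_preimage, (extChartAt 𝓘(ℝ, V) c).right_inv hy.1] at h1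
    refine ⟨_, inter_mem_nhdsWithin _ (extChartAt_source_mem_nhds (I := 𝓘(ℝ, V)) c),
      measure_mono_null (t := N) (fun x hx ↦ ?_) hN0⟩
    refine ⟨⟨hx.2, fun h0 ↦ hx.1.2 ?_⟩, hx.1.1⟩
    obtain ⟨l, hl, hb⟩ := hg.exists_bounds c (isCompact_singleton (x := extChartAt 𝓘(ℝ, V) c x))
      (singleton_subset_iff.2 ((extChartAt 𝓘(ℝ, V) c).map_source hx.2))
    have h1 := (gradNorm_bounds u hg hx.2 hl (hb x hx.2 rfl)).1
    rw [h0, norm_zero, mul_zero] at h1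
    exact le_antisymm h1 (gradNorm_nonneg u hg x)
  filter_upwards [measure_eq_zero_iff_ae_notMem.1 h] with x hx hxt
  by_contra hc
  exact hx ⟨hxt, hc⟩

lemma ChartLipschitz.eventually_gradNorm_le (hg : C1Metric g) (hu : ChartLipschitz V u) (x : M) :
    ∃ C : ℝ, ∀ᶠ y in 𝓝 x, gradNorm 𝓘(ℝ, V) g u y ≤ C := by
  obtain ⟨C, R, hR, hRt, hL⟩ := hu x
  obtain ⟨l, hl, hb⟩ := hg.exists_bounds x (isCompact_closedBall _ R) hRt
  refine ⟨l * C, ?_⟩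
  filter_upwards [extChartAt_source_mem_nhds (I := 𝓘(ℝ, V)) x,
    (continuousAt_extChartAt (I := 𝓘(ℝ, V)) x).preimage_mem_nhds (Metric.ball_mem_nhds _ hR)] with y hy hyB
  refine (gradNorm_bounds u hg hy hl (hb y hy (Metric.ball_subset_closedBall hyB))).1.trans ?_
  have := norm_fderiv_le_of_lipschitzOn ℝ (Metric.isOpen_ball.mem_nhds hyB) hL
  gcongr

/-- If `∫_W √(|∇u|² + P²) ≤ ∫_W |P| < ∞` then `u` is locally constant in `W`. -/
theorem ChartLipschitz.mem_interior_level (hg : C1Metric g) (hu : ChartLipschitz V u) {P : M → ℝ}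
    {W : Set M} (hW : IsOpen W) (hfin : ∫⁻ x in W, ENNReal.ofReal |P x| ∂(vol 𝓘(ℝ, V) g) ≠ ⊤)
    (hle : ∫⁻ x in W, ENNReal.ofReal √(gradNorm 𝓘(ℝ, V) g u x ^ 2 + P x ^ 2) ∂(vol 𝓘(ℝ, V) g) ≤
      ∫⁻ x in W, ENNReal.ofReal |P x| ∂(vol 𝓘(ℝ, V) g)) {x : M} (hx : x ∈ W) :
    x ∈ interior {y | u y = u x} := by
  set f : M → ℝ≥0∞ := fun x ↦ ENNReal.ofReal √(gradNorm 𝓘(ℝ, V) g u x ^ 2 + P x ^ 2) with hf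
  set φ := extChartAt 𝓘(ℝ, V) x with hφ
  set w := u ∘ φ.symm with hw
  obtain ⟨C, R₀, hR₀, hRt₀, hL₀⟩ := hu x
  obtain ⟨R₁, hR₁, hRW⟩ := Metric.isOpen_iff.1 (isOpen_chartSet (V := V) x hW) (φ x)
    ⟨mem_extChartAt_target x, by simpa [hφ, extChartAt_to_inv x] using hx⟩
  set R := min R₀ R₁
  have hR : 0 < R := lt_min hR₀ hR₁
  have hRt : Metric.closedBall (φ x) R ⊆ φ.target :=
    (Metric.closedBall_subset_closedBall (min_le_left _ _)).trans hRt₀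
  have hL := hL₀.mono (Metric.ball_subset_ball (min_le_left R₀ R₁))
  have hRW' : Metric.ball (φ x) R ⊆ chartSet x W :=
    (Metric.ball_subset_ball (min_le_right _ _)).trans hRW
  obtain ⟨l, hl, hb⟩ := hg.exists_bounds x (isCompact_closedBall (φ x) R) hRt
  have hl0 : 0 < l := by linarith
  set N : Set M := φ.source ∩ φ ⁻¹' Metric.ball (φ x) R with hN
  have hNo : IsOpen N := (continuousOn_extChartAt x).isOpen_inter_preimage
    (isOpen_extChartAt_source x) Metric.isOpen_ball
  have hNm := hNo.measurableSet
  have hNW : N ⊆ W := fun y hy ↦ by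
    have h1 := (hRW' hy.2).2
    rwa [mem_preimage, φ.left_inv hy.1] at h1
  have hxN : x ∈ N := ⟨mem_extChartAt_source x, Metric.mem_ball_self hR⟩
  obtain ⟨h, hhm, hhp, hhe⟩ := exists_measurable_le_lintegral_eq
    (μ := (vol 𝓘(ℝ, V) g).restrict W) fun x ↦ ENNReal.ofReal |P x|
  have hhf : ∀ y, h y ≤ f y := fun y ↦ (hhp y).trans (ENNReal.ofReal_le_ofReal
    (Real.abs_le_sqrt (le_add_of_nonneg_left (sq_nonneg _))))
  have htop : ∀ y, h y ≠ ⊤ := fun y ↦ ((hhp y).trans_lt ENNReal.ofReal_lt_top).ne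
  have hPt : ∀ y, (h y).toReal ≤ |P y| := fun y ↦ ENNReal.toReal_le_of_le_ofReal (abs_nonneg _) (hhp y)
  have hleN : ∫⁻ y in N, f y ∂(vol 𝓘(ℝ, V) g) ≤ ∫⁻ y in N, h y ∂(vol 𝓘(ℝ, V) g) := by
    have e := fun q : M → ℝ≥0∞ ↦ lintegral_inter_add_sdiff (μ := vol 𝓘(ℝ, V) g) (A := W) q hNm
    have h1 : ∫⁻ y in W \ N, f y ∂(vol 𝓘(ℝ, V) g) ≠ ⊤ :=
      (((lintegral_mono_set sdiff_subset).trans hle).trans_lt hfin.lt_top).ne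
    rw [hhe, ← e f, ← e h, inter_eq_right.2 hNW] at hle
    exact (ENNReal.add_le_add_iff_right h1).1
      (hle.trans (add_le_add le_rfl (lintegral_mono hhf)))
  set H : M → ℝ≥0∞ := fun y ↦ ENNReal.ofReal √((‖fderiv ℝ w (φ y)‖ / l) ^ 2 + (h y).toReal ^ 2)
  have hHm : AEMeasurable H ((vol 𝓘(ℝ, V) g).restrict N) := by
    have h1 : AEMeasurable φ ((vol 𝓘(ℝ, V) g).restrict N) :=
      ((continuousOn_extChartAt x).mono inter_subset_left).aemeasurable hNm
    have h2 := ((measurable_fderiv ℝ w).norm.comp_aemeasurable h1)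
    exact ((((h2.div_const l).pow_const 2).add
      (hhm.ennreal_toReal.aemeasurable.pow_const 2)).sqrt).ennreal_ofReal
  have hHf : ∀ y ∈ N, H y ≤ f y := fun y hy ↦ by
    have h1 := (gradNorm_bounds u hg hy.1 hl (hb y hy.1 (Metric.ball_subset_closedBall hy.2))).2
    refine ENNReal.ofReal_le_ofReal (Real.sqrt_le_sqrt (add_le_add ?_ ?_))
    · refine pow_le_pow_left₀ (by positivity) ?_ 2
      rwa [div_le_iff₀' hl0]
    · rw [← sq_abs (P y)]
      exact pow_le_pow_left₀ ENNReal.toReal_nonneg (hPt y) 2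
  have hae := ae_eq_of_ae_le_of_lintegral_le (μ := (vol 𝓘(ℝ, V) g).restrict N) (f := h) (g := H)
    (Eventually.of_forall fun y ↦ by
      rw [← ENNReal.ofReal_toReal (htop y)]
      exact ENNReal.ofReal_le_ofReal ((le_abs_self _).trans
        (Real.abs_le_sqrt (le_add_of_nonneg_left (sq_nonneg _)))))
    ((((lintegral_mono_set hNW).trans_eq hhe.symm).trans_lt hfin.lt_top).ne) hHm
    ((setLIntegral_mono' hNm hHf).trans hleN)
  rw [Filter.EventuallyEq, ae_restrict_iff' hNm] at hae
  set Z : Set M := φ.source ∩ φ ⁻¹' (Metric.ball (φ x) R ∩ {y | fderiv ℝ w y ≠ 0}) with hZ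
  have hZm : MeasurableSet Z := measurableSet_source_inter_preimage x
    (Metric.isOpen_ball.measurableSet.inter
      ((measurable_fderiv ℝ w) (measurableSet_singleton 0).compl))
  have hZ0 : vol 𝓘(ℝ, V) g Z = 0 := by
    refine measure_mono_null (fun y hy ↦ ?_) (ae_iff.1 hae)
    simp only [mem_ofPred_eq, Classical.not_imp]
    refine ⟨⟨hy.1, hy.2.1⟩, fun he ↦ hy.2.2 ?_⟩
    have h1 := congrArg ENNReal.toReal he
    rw [ENNReal.toReal_ofReal (Real.sqrt_nonneg _)] at h1
    have h2 : (h y).toReal ^ 2 = (‖fderiv ℝ w (φ y)‖ / l) ^ 2 + (h y).toReal ^ 2 := by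
      conv_lhs => rw [h1]
      exact Real.sq_sqrt (by positivity)
    have h3 : ‖fderiv ℝ w (φ y)‖ / l = 0 := pow_eq_zero_iff (two_ne_zero) |>.1 (by linarith)
    rcases div_eq_zero_iff.1 h3 with h4 | h4
    · exact norm_eq_zero.1 h4
    · exact absurd h4 hl0.ne'
  rw [vol_eq_zero_iff_chartSet hg hZm inter_subset_left] at hZ0
  have hconst := fun y hy ↦ eq_of_fderiv_ae_eq_zero (Module.finBasis ℝ V).addHaar hL (by
    filter_upwards [measure_eq_zero_iff_ae_notMem.1 hZ0] with y hy hyB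
    by_contra hc
    have hyt := hRt (Metric.ball_subset_closedBall hyB)
    refine hy ⟨hyt, φ.map_target hyt, ?_⟩
    rw [mem_preimage, φ.right_inv hyt]
    exact ⟨hyB, hc⟩) (y := y) hy
  refine mem_interior.2 ⟨N, fun y hy ↦ ?_, hNo, hxN⟩
  have h1 := hconst (φ y) hy.2
  have e1 : φ.symm (φ y) = y := φ.left_inv hy.1
  have e2 : φ.symm (φ x) = x := φ.left_inv hxN.1
  simp only [Function.comp_apply] at h1
  rw [← hφ, e1, e2] at h1
  exact h1

end Rigidity
end STIMCF
end

noncomputable section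
namespace STIMCF
set_option linter.unusedSectionVars false

section Density

variable {V : Type*} [NormedAddCommGroup V] [NormedSpace ℝ V] [FiniteDimensional ℝ V]
  [MeasurableSpace V] [BorelSpace V]
  {M : Type*} [EMetricSpace M] [ChartedSpace V M] [IsManifold 𝓘(ℝ, V) ∞ M]
  [MeasurableSpace M] [BorelSpace M] [SecondCountableTopology M]
  {g : TensorField 𝓘(ℝ, V) M}

/-- Near every point the distance to it is comparable to the distance in the preferred chart. -/
def ChartComparable (V : Type*) [NormedAddCommGroup V] [NormedSpace ℝ V] (M : Type*)
    [EMetricSpace M] [ChartedSpace V M] : Prop :=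
  ∀ x : M, ∃ C : ℝ, 0 < C ∧ ∀ᶠ y in 𝓝 x,
    edist x y ≤ ENNReal.ofReal (C * ‖extChartAt 𝓘(ℝ, V) x y - extChartAt 𝓘(ℝ, V) x x‖) ∧
    ENNReal.ofReal ‖extChartAt 𝓘(ℝ, V) x y - extChartAt 𝓘(ℝ, V) x x‖ ≤
      ENNReal.ofReal C * edist x y

lemma exists_norm_chart_sub_le {c c' x : M} (hx : x ∈ (extChartAt 𝓘(ℝ, V) c).source)
    (hx' : x ∈ (extChartAt 𝓘(ℝ, V) c').source) : ∃ L : ℝ, 0 < L ∧ ∀ᶠ y in 𝓝 x,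
      ‖extChartAt 𝓘(ℝ, V) c' y - extChartAt 𝓘(ℝ, V) c' x‖ ≤
        L * ‖extChartAt 𝓘(ℝ, V) c y - extChartAt 𝓘(ℝ, V) c x‖ := by
  have hd : DifferentiableAt ℝ (transition (V := V) c c') (extChartAt 𝓘(ℝ, V) c x) :=
    (contDiffAt_transition ((extChartAt 𝓘(ℝ, V) c).map_source hx)
      (by rwa [(extChartAt 𝓘(ℝ, V) c).left_inv hx])).differentiableAt (by simp)
  obtain ⟨L, hL, hb⟩ := hd.isBigO_sub.exists_pos
  refine ⟨L, hL, ?_⟩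
  filter_upwards [(continuousAt_extChartAt' hx).eventually hb.bound,
    (isOpen_extChartAt_source (I := 𝓘(ℝ, V)) c).mem_nhds hx] with y hy hyc
  simpa only [transition, Function.comp_apply, (extChartAt 𝓘(ℝ, V) c).left_inv hx,
    (extChartAt 𝓘(ℝ, V) c).left_inv hyc] using hy

lemma ChartComparable.exists_eball (h : ChartComparable V M) {c x : M}
    (hx : x ∈ (extChartAt 𝓘(ℝ, V) c).source) : ∃ L : ℝ, 0 < L ∧ ∀ᶠ r in 𝓝[>] (0 : ℝ),
      Metric.closedBall (extChartAt 𝓘(ℝ, V) c x) (r / L) ⊆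
        chartSet c (Metric.eball x (ENNReal.ofReal r)) ∧
      chartSet c (Metric.eball x (ENNReal.ofReal r)) ⊆
        Metric.closedBall (extChartAt 𝓘(ℝ, V) c x) (L * r) ∧
      Metric.eball x (ENNReal.ofReal r) ⊆ (extChartAt 𝓘(ℝ, V) c).source := by
  obtain ⟨C, hC, hcomp⟩ := h x
  obtain ⟨L₁, hL₁, h1⟩ := exists_norm_chart_sub_le (V := V) hx (mem_extChartAt_source (I := 𝓘(ℝ, V)) x)
  obtain ⟨L₂, hL₂, h2⟩ := exists_norm_chart_sub_le (V := V) (mem_extChartAt_source (I := 𝓘(ℝ, V)) x) hx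
  set φ := extChartAt 𝓘(ℝ, V) c with hφ
  set L := 2 * (C * L₁) + L₂ * C with hL
  have hL0 : 0 < L := by positivity
  have hU := (hcomp.and (h1.and h2)).and ((isOpen_extChartAt_source (I := 𝓘(ℝ, V)) c).mem_nhds hx)
  obtain ⟨ε, hε, hεU⟩ := EMetric.mem_nhds_iff.1 hU
  have hs := (continuousAt_extChartAt_symm' hx).preimage_mem_nhds
    (by rw [(extChartAt 𝓘(ℝ, V) c).left_inv hx]; exact hU)
  obtain ⟨δ, hδ, hδs⟩ := Metric.mem_nhds_iff.1 (inter_mem hs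
    ((isOpen_extChartAt_target (I := 𝓘(ℝ, V)) c).mem_nhds (φ.map_source hx)))
  have hev : Tendsto ENNReal.ofReal (𝓝[>] 0) (𝓝 0) := by
    simpa using (ENNReal.continuous_ofReal.tendsto 0).mono_left nhdsWithin_le_nhds
  refine ⟨L, hL0, ?_⟩
  filter_upwards [hev.eventually (gt_mem_nhds hε), Ioo_mem_nhdsGT (mul_pos hδ hL0),
    self_mem_nhdsWithin] with r hr hrδ hr0
  have hr0' : 0 < r := hr0
  have hsub : Metric.eball x (ENNReal.ofReal r) ⊆ Metric.eball x ε :=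
    Metric.eball_subset_eball hr.le
  refine ⟨fun y hy ↦ ?_, fun y hy ↦ ?_, fun y hy ↦ (hεU (hsub hy)).2⟩
  · have hyδ : y ∈ Metric.ball (φ x) δ :=
      Metric.closedBall_subset_ball ((div_lt_iff₀ hL0).2 hrδ.2) hy
    obtain ⟨hy1, hyt⟩ := hδs hyδ
    refine ⟨hyt, ?_⟩
    have h3 := hy1.1.1.1
    have h4 := hy1.1.2.1
    rw [← hφ, φ.right_inv hyt] at h4
    rw [mem_preimage, Metric.mem_eball']
    refine h3.trans_lt ((ENNReal.ofReal_lt_ofReal_iff hr0').2 ?_)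
    have h5 : ‖y - φ x‖ ≤ r / L := by simpa [dist_eq_norm] using hy
    calc _ ≤ C * (L₁ * (r / L)) := by
          refine mul_le_mul_of_nonneg_left (h4.trans ?_) hC.le
          gcongr
      _ = (C * L₁) * r / L := by ring
      _ < r := by
          rw [div_lt_iff₀ hL0, mul_comm]
          refine mul_lt_mul_of_pos_left ?_ hr0'
          have := mul_pos hC hL₁
          have := mul_pos hL₂ hC
          linarith
  · obtain ⟨hyt, hy⟩ := hy
    have hyU := hεU (hsub hy)
    have h3 := hyU.1.1.2
    have h4 := hyU.1.2.2
    rw [φ.right_inv hyt] at h4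
    rw [mem_preimage, Metric.mem_eball'] at hy
    have h5 : ‖extChartAt 𝓘(ℝ, V) x (φ.symm y) - extChartAt 𝓘(ℝ, V) x x‖ ≤ C * r := by
      rw [← ENNReal.ofReal_le_ofReal_iff (by positivity), ENNReal.ofReal_mul hC.le]
      exact h3.trans (by gcongr)
    rw [Metric.mem_closedBall, dist_eq_norm]
    calc _ ≤ L₂ * (C * r) := h4.trans (by gcongr)
      _ = (L₂ * C) * r := by ring
      _ ≤ L * r := by
          refine mul_le_mul_of_nonneg_right ?_ hr0'.le
          have := mul_pos hC hL₁
          linarith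

lemma exists_vol_bounds (hg : C1Metric g) {c x : M} (hx : x ∈ (extChartAt 𝓘(ℝ, V) c).source) :
    ∃ a b : ℝ≥0∞, a ≠ ⊤ ∧ b ≠ ⊤ ∧ ∃ δ > 0, ∀ A : Set M, MeasurableSet A →
      A ⊆ (extChartAt 𝓘(ℝ, V) c).source →
      chartSet c A ⊆ Metric.closedBall (extChartAt 𝓘(ℝ, V) c x) δ →
      (Module.finBasis ℝ V).addHaar (chartSet c A) ≤ a * vol 𝓘(ℝ, V) g A ∧
        vol 𝓘(ℝ, V) g A ≤ b * (Module.finBasis ℝ V).addHaar (chartSet c A) := by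
  set φ := extChartAt 𝓘(ℝ, V) c
  have hxt := φ.map_source hx
  have hs := sqrtDet_pos hg hxt
  have hc := (contDiffOn_sqrtDet hg c).continuousOn.continuousAt
    ((isOpen_extChartAt_target (I := 𝓘(ℝ, V)) c).mem_nhds hxt)
  set s := sqrtDet 𝓘(ℝ, V) g c (φ x)
  obtain ⟨δ, hδ, hδs⟩ := Metric.nhds_basis_closedBall.mem_iff.1
    (hc.preimage_mem_nhds (Icc_mem_nhds (show s / 2 < s by linarith) (show s < 2 * s by linarith)))
  refine ⟨ENNReal.ofReal (s / 2)⁻¹, ENNReal.ofReal (2 * s), ENNReal.ofReal_ne_top, ENNReal.ofReal_ne_top,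
    δ, hδ, fun A hA hAs hAc ↦ ?_⟩
  have e : vol 𝓘(ℝ, V) g A = ∫⁻ y in chartSet c A, ENNReal.ofReal (sqrtDet 𝓘(ℝ, V) g c y)
      ∂(Module.finBasis ℝ V).addHaar := by
    rw [vol_apply_of_subset hg c hA hAs, chartMeasure_apply c hA]; rfl
  have hm := measurableSet_chartSet (V := V) c hA
  have h1 : ENNReal.ofReal (s / 2) * (Module.finBasis ℝ V).addHaar (chartSet c A) ≤
      vol 𝓘(ℝ, V) g A := by
    rw [e, ← setLIntegral_const]
    exact setLIntegral_mono' hm fun y hy ↦ ENNReal.ofReal_le_ofReal (hδs (hAc hy)).1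
  constructor
  · refine le_trans (le_of_eq ?_) (mul_le_mul_right h1 (ENNReal.ofReal (s / 2)⁻¹))
    rw [← mul_assoc, ← ENNReal.ofReal_mul (by positivity), inv_mul_cancel₀ (by positivity),
      ENNReal.ofReal_one, one_mul]
  · rw [e, ← setLIntegral_const]
    exact setLIntegral_mono' hm fun y hy ↦ ENNReal.ofReal_le_ofReal (hδs (hAc hy)).2

lemma ChartComparable.mem_lebesguePoints (h : ChartComparable V M) (hg : C1Metric g) {c x : M}
    (hx : x ∈ (extChartAt 𝓘(ℝ, V) c).source) {S : Set M} (hS : MeasurableSet S)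
    (hT : Tendsto (fun ρ ↦ (Module.finBasis ℝ V).addHaar (chartSet c S ∩
      Metric.closedBall (extChartAt 𝓘(ℝ, V) c x) ρ) / (Module.finBasis ℝ V).addHaar
        (Metric.closedBall (extChartAt 𝓘(ℝ, V) c x) ρ)) (𝓝[>] 0) (𝓝 1)) :
    x ∈ lebesguePoints (vol 𝓘(ℝ, V) g) S := by
  obtain ⟨L, hL, hev⟩ := h.exists_eball hx
  obtain ⟨a, b, ha, hb, δ, hδ, hab⟩ := exists_vol_bounds hg hx
  set m := (Module.finBasis ℝ V).addHaar
  set φ := extChartAt 𝓘(ℝ, V) c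
  set S' := chartSet (V := V) c S
  have hSm : MeasurableSet S' := measurableSet_chartSet c hS
  set D : ℝ → ℝ≥0∞ := fun ρ ↦ 1 - m (S' ∩ Metric.closedBall (φ x) ρ) / m (Metric.closedBall (φ x) ρ)
  have hpos : ∀ ρ, 0 < ρ → m (Metric.closedBall (φ x) ρ) ≠ 0 := fun ρ hρ ↦
    (Metric.measure_closedBall_pos m _ hρ).ne'
  have hfin : ∀ ρ, m (Metric.closedBall (φ x) ρ) ≠ ⊤ := fun ρ ↦
    (isCompact_closedBall _ _).measure_lt_top.ne
  have hD : ∀ ρ, 0 < ρ → m (Metric.closedBall (φ x) ρ \ S') = D ρ * m (Metric.closedBall (φ x) ρ) := by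
    intro ρ hρ
    rw [ENNReal.sub_mul (fun _ _ ↦ hfin ρ), one_mul, ENNReal.div_mul_cancel (hpos ρ hρ) (hfin ρ),
      ← sdiff_inter_self_eq_sdiff, measure_sdiff inter_subset_right
        (hSm.inter Metric.isClosed_closedBall.measurableSet).nullMeasurableSet
        (measure_ne_top_of_subset inter_subset_right (hfin ρ))]
  have hD0 : Tendsto D (𝓝[>] 0) (𝓝 0) := by
    simpa using ENNReal.Tendsto.sub (tendsto_const_nhds (x := (1 : ℝ≥0∞))) hT (Or.inl ENNReal.one_ne_top)
  have hmulT : Tendsto (fun r ↦ L * r) (𝓝[>] 0) (𝓝[>] 0) := by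
    refine tendsto_nhdsWithin_iff.2 ⟨?_, ?_⟩
    · simpa using ((continuous_const_mul L).tendsto 0).mono_left nhdsWithin_le_nhds
    · filter_upwards [self_mem_nhdsWithin] with r hr using mul_pos hL hr
  set K : ℝ≥0∞ := ENNReal.ofReal ((L ^ 2) ^ Module.finrank ℝ V)
  have hK : ∀ r, 0 < r → m (Metric.closedBall (φ x) (L * r)) = K * m (Metric.closedBall (φ x) (r / L)) := by
    intro r hr
    rw [Measure.addHaar_closedBall _ _ (by positivity), Measure.addHaar_closedBall _ _ (by positivity),
      ← mul_assoc, ← ENNReal.ofReal_mul (by positivity), ← mul_pow]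
    congr 3
    field_simp
  have hC : b * K * a ≠ ⊤ := ENNReal.mul_ne_top (ENNReal.mul_ne_top hb ENNReal.ofReal_ne_top) ha
  have hlim : Tendsto (fun r ↦ 1 - b * K * a * D (L * r)) (𝓝[>] 0) (𝓝 1) := by
    have h1 := ENNReal.Tendsto.const_mul (hD0.comp hmulT) (Or.inr hC)
    simpa using ENNReal.Tendsto.sub (tendsto_const_nhds (x := (1 : ℝ≥0∞))) h1
      (Or.inl ENNReal.one_ne_top)
  refine tendsto_of_tendsto_of_tendsto_of_le_of_le' hlim tendsto_const_nhds ?_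
    (Eventually.of_forall fun r ↦ ENNReal.div_le_of_le_mul
      (by rw [one_mul]; exact measure_mono inter_subset_right))
  filter_upwards [hev, self_mem_nhdsWithin, Ioo_mem_nhdsGT (show 0 < δ / L by positivity)]
    with r hr hr0 hrδ
  have hr0' : 0 < r := hr0
  set B := Metric.eball x (ENNReal.ofReal r)
  have hBm : MeasurableSet B := Metric.isOpen_eball.measurableSet
  have hsubδ : Metric.closedBall (φ x) (L * r) ⊆ Metric.closedBall (φ x) δ :=
    Metric.closedBall_subset_closedBall (by
      have := (lt_div_iff₀ hL).1 hrδ.2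
      linarith)
  have hB := hab B hBm hr.2.2 (hr.2.1.trans hsubδ)
  have hBS := hab (B \ S) (hBm.diff hS) (sdiff_subset.trans hr.2.2)
    (Subset.trans (fun y hy ↦ hr.2.1 ⟨hy.1, hy.2.1⟩) hsubδ)
  have h1 : m (Metric.closedBall (φ x) (r / L)) ≤ a * vol 𝓘(ℝ, V) g B :=
    (measure_mono hr.1).trans hB.1
  have hB0 : vol 𝓘(ℝ, V) g B ≠ 0 := fun h0 ↦ hpos (r / L) (by positivity) (by
    rw [h0, mul_zero] at h1
    exact nonpos_iff_eq_zero.1 h1)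
  have hBt : vol 𝓘(ℝ, V) g B ≠ ⊤ := (hB.2.trans_lt (ENNReal.mul_lt_top hb.lt_top
    ((measure_mono hr.2.1).trans_lt (hfin _).lt_top))).ne
  have h2 : vol 𝓘(ℝ, V) g (B \ S) ≤ b * K * a * D (L * r) * vol 𝓘(ℝ, V) g B := by
    calc _ ≤ b * m (chartSet c (B \ S)) := hBS.2
      _ ≤ b * m (Metric.closedBall (φ x) (L * r) \ S') := by
          gcongr
          exact fun y hy ↦ ⟨hr.2.1 ⟨hy.1, hy.2.1⟩, fun hyS ↦ hy.2.2 hyS.2⟩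
      _ = b * (D (L * r) * (K * m (Metric.closedBall (φ x) (r / L)))) := by
          rw [hD _ (by positivity), hK r hr0']
      _ ≤ b * (D (L * r) * (K * (a * vol 𝓘(ℝ, V) g B))) := by gcongr
      _ = _ := by ring
  rw [tsub_le_iff_right]
  calc (1 : ℝ≥0∞) = vol 𝓘(ℝ, V) g B / vol 𝓘(ℝ, V) g B := (ENNReal.div_self hB0 hBt).symm
    _ ≤ (vol 𝓘(ℝ, V) g (S ∩ B) + vol 𝓘(ℝ, V) g (B \ S)) / vol 𝓘(ℝ, V) g B := by
        refine ENNReal.div_le_div_right ?_ _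
        rw [inter_comm, measure_inter_add_sdiff _ hS]
    _ ≤ _ := by
        rw [ENNReal.add_div]
        exact add_le_add le_rfl (ENNReal.div_le_of_le_mul h2)

/-- Lebesgue's density theorem. -/
theorem ChartComparable.vol_sdiff_lebesguePoints (h : ChartComparable V M) (hg : C1Metric g)
    {S : Set M} (hS : MeasurableSet S) :
    vol 𝓘(ℝ, V) g (S \ lebesguePoints (vol 𝓘(ℝ, V) g) S) = 0 := by
  refine measure_null_of_locally_null _ fun c _ ↦ ?_
  have hae := Besicovitch.ae_tendsto_measure_inter_div (Module.finBasis ℝ V).addHaar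
    (chartSet (V := V) c S)
  rw [ae_restrict_iff' (measurableSet_chartSet c hS)] at hae
  obtain ⟨Z, hZ, hZm, hZ0⟩ := exists_measurable_superset_of_null (ae_iff.1 hae)
  have hNm := measurableSet_source_inter_preimage c hZm
  have hN : vol 𝓘(ℝ, V) g ((extChartAt 𝓘(ℝ, V) c).source ∩ extChartAt 𝓘(ℝ, V) c ⁻¹' Z) = 0 := by
    rw [vol_eq_zero_iff_chartSet hg hNm inter_subset_left]
    refine measure_mono_null (fun y hy ↦ ?_) hZ0
    have h1 := hy.2.2
    rwa [mem_preimage, (extChartAt 𝓘(ℝ, V) c).right_inv hy.1] at h1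
  refine ⟨_, inter_mem_nhdsWithin _ (extChartAt_source_mem_nhds (I := 𝓘(ℝ, V)) c),
    measure_mono_null (t := (extChartAt 𝓘(ℝ, V) c).source ∩ extChartAt 𝓘(ℝ, V) c ⁻¹' Z)
      (fun x hx ↦ ⟨hx.2, hZ ?_⟩) hN⟩
  simp only [mem_ofPred_eq, Classical.not_imp]
  refine ⟨⟨(extChartAt 𝓘(ℝ, V) c).map_source hx.2, ?_⟩, fun hT ↦
    hx.1.2 (h.mem_lebesguePoints hg hx.2 hS hT)⟩
  rw [mem_preimage, (extChartAt 𝓘(ℝ, V) c).left_inv hx.2]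
  exact hx.1.1

end Density
end STIMCF
end

noncomputable section
namespace STIMCF
set_option linter.unusedSectionVars false

section CoordinateFields

variable {V : Type*} [NormedAddCommGroup V] [NormedSpace ℝ V]
  {M : Type*} [TopologicalSpace M] [ChartedSpace V M] [IsManifold 𝓘(ℝ, V) ∞ M]

/-- The vector field whose components in the chart at `c` are those of `v`. -/
def coordField (c : M) (v : V) (x : M) : TangentSpace 𝓘(ℝ, V) x :=
  (coordVec 𝓘(ℝ, V) c (extChartAt 𝓘(ℝ, V) c x) v : V)

lemma coordField_symm {c : M} {y : V} (hy : y ∈ (extChartAt 𝓘(ℝ, V) c).target) (v : V) :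
    coordField c v ((extChartAt 𝓘(ℝ, V) c).symm y) = coordVec 𝓘(ℝ, V) c y v := by
  unfold coordField
  rw [(extChartAt 𝓘(ℝ, V) c).right_inv hy]

lemma contMDiffAt_coordField {c x : M} (hx : x ∈ (extChartAt 𝓘(ℝ, V) c).source) (v : V) :
    ContMDiffAt 𝓘(ℝ, V) 𝓘(ℝ, V).tangent 1
      (fun x ↦ (⟨x, coordField c v x⟩ : TangentBundle 𝓘(ℝ, V) M)) x := by
  rw [contMDiffAt_field_iff hx]
  refine (contMDiffAt_const (c := v)).congr_of_eventuallyEq ?_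
  filter_upwards [(isOpen_extChartAt_source (I := 𝓘(ℝ, V)) c).mem_nhds hx] with z hz
  exact coord_coordVec' hz v

lemma contDiffOn_tensor_coordVec {k : TensorField 𝓘(ℝ, V) M}
    (h : ∀ c (x : M) (v w : V), x ∈ (extChartAt 𝓘(ℝ, V) c).source →
      ContMDiffAt 𝓘(ℝ, V) 𝓘(ℝ, ℝ) 1 (fun z ↦ k z (coordField c v z) (coordField c w z)) x)
    (c : M) (v w : V) : ContDiffOn ℝ 1 (fun y ↦ k ((extChartAt 𝓘(ℝ, V) c).symm y)
      (coordVec 𝓘(ℝ, V) c y v) (coordVec 𝓘(ℝ, V) c y w)) (extChartAt 𝓘(ℝ, V) c).target := by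
  intro y hy
  have h1 := (contMDiffAt_comp_chart_iff (n := 1) hy).2
    (h c _ v w ((extChartAt 𝓘(ℝ, V) c).map_target hy))
  refine (h1.congr_of_eventuallyEq ?_).contDiffWithinAt
  filter_upwards [(isOpen_extChartAt_target (I := 𝓘(ℝ, V)) c).mem_nhds hy] with z hz
  simp only [Function.comp_apply, coordField_symm hz]

end CoordinateFields

section Riemannian

variable {V : Type*} [NormedAddCommGroup V] [NormedSpace ℝ V]
  {M : Type*} [EMetricSpace M] [ChartedSpace V M] [IsManifold 𝓘(ℝ, V) ∞ M]
  [RiemannianBundle (fun x : M ↦ TangentSpace 𝓘(ℝ, V) x)]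

section

variable [IsContMDiffRiemannianBundle 𝓘(ℝ, V) ∞ V (fun x : M ↦ TangentSpace 𝓘(ℝ, V) x)]

lemma c1Metric_metricTensor : C1Metric (metricTensor 𝓘(ℝ, V) : TensorField 𝓘(ℝ, V) M) where
  add_left x v v' w := inner_add_left v v' w
  smul_left x a v w := real_inner_smul_left v w a
  symm x v w := real_inner_comm w v
  pos x v hv := real_inner_self_pos.2 hv
  contDiffOn := contDiffOn_tensor_coordVec fun c x v w hx ↦ by
    have := isManifold_two (V := V) (M := M)
    have : IsContMDiffRiemannianBundle 𝓘(ℝ, V) 1 V (fun x : M ↦ TangentSpace 𝓘(ℝ, V) x) :=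
      IsContMDiffRiemannianBundle.of_le (n := ∞) (by norm_cast)
    exact ContMDiffAt.inner_bundle (contMDiffAt_coordField hx v) (contMDiffAt_coordField hx w)

end

lemma enorm_eq_ofReal_sqrt {x : M} (v : TangentSpace 𝓘(ℝ, V) x) :
    ‖v‖ₑ = ENNReal.ofReal √(metricTensor 𝓘(ℝ, V) x v v) := by
  rw [← ofReal_norm, metricTensor, real_inner_self_eq_norm_sq, Real.sqrt_sq (norm_nonneg v)]

lemma riemannianEDist_chart_symm_le {c : M} {l : ℝ} (hl : 0 ≤ l) {T : Set V} (hT : Convex ℝ T)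
    (hTt : T ⊆ (extChartAt 𝓘(ℝ, V) c).target)
    (h : ∀ y ∈ T, ∀ q, metricTensor 𝓘(ℝ, V) _ (coordVec 𝓘(ℝ, V) c y q) (coordVec 𝓘(ℝ, V) c y q) ≤
      l ^ 2 * ‖q‖ ^ 2) {a b : V} (ha : a ∈ T) (hb : b ∈ T) :
    riemannianEDist 𝓘(ℝ, V) ((extChartAt 𝓘(ℝ, V) c).symm a) ((extChartAt 𝓘(ℝ, V) c).symm b) ≤
      ENNReal.ofReal (l * ‖b - a‖) := by
  set η : ℝ → V := fun t ↦ a + t • (b - a) with hη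
  have hηT : ∀ t ∈ Icc (0 : ℝ) 1, η t ∈ T := fun t ht ↦ hT.add_smul_sub_mem ha hb ht
  have hη' : ∀ t, HasDerivAt η (b - a) t := fun t ↦ by
    have h1 := ((hasDerivAt_id t).smul_const (b - a)).const_add a
    rwa [one_smul] at h1
  have hηc : ContDiff ℝ 1 η := by fun_prop
  refine (riemannianEDist_le_pathELength (γ := (extChartAt 𝓘(ℝ, V) c).symm ∘ η) (a := 0) (b := 1)
    ?_ (by simp [hη]) (by simp [hη]) zero_le_one).trans ?_
  · have := IsManifold.of_le (I := 𝓘(ℝ, V)) (M := M) (m := 1) (n := ∞) (by norm_cast)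
    exact (contMDiffOn_extChartAt_symm c).comp hηc.contMDiff.contMDiffOn fun t ht ↦ hTt (hηT t ht)
  · rw [pathELength_eq_lintegral_mfderiv_Icc]
    refine (setLIntegral_mono' measurableSet_Icc (g := fun _ ↦ ENNReal.ofReal (l * ‖b - a‖))
      fun t ht ↦ ?_).trans (by simp)
    have h1 := (mdifferentiableAt_symm (hTt (hηT t ht))).hasMFDerivAt.comp t
      (hη' t).hasFDerivAt.hasMFDerivAt
    have h2 : mfderiv 𝓘(ℝ, ℝ) 𝓘(ℝ, V) ((extChartAt 𝓘(ℝ, V) c).symm ∘ η) t 1 =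
        coordVec 𝓘(ℝ, V) c (η t) (b - a) := by
      rw [h1.mfderiv]
      exact congrArg (fun q ↦ mfderiv 𝓘(ℝ, V) 𝓘(ℝ, V) (extChartAt 𝓘(ℝ, V) c).symm (η t) q)
        (one_smul ℝ (b - a))
    rw [h2, enorm_eq_ofReal_sqrt]
    refine ENNReal.ofReal_le_ofReal (Real.sqrt_le_iff.2 ⟨by positivity, ?_⟩)
    rw [mul_pow]
    exact h _ (hηT t ht) _

lemma norm_chart_sub_le {c x : M} {l : ℝ} (hl : 0 ≤ l) {S : Set M}
    (hS : S ⊆ (extChartAt 𝓘(ℝ, V) c).source)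
    (h : ∀ y ∈ S, ∀ v, ‖coord 𝓘(ℝ, V) c y v‖ ^ 2 ≤ l ^ 2 * metricTensor 𝓘(ℝ, V) y v v) {ρ : ℝ≥0∞}
    (hρ : ∀ y, riemannianEDist 𝓘(ℝ, V) x y < ρ → y ∈ S) {y : M}
    (hy : riemannianEDist 𝓘(ℝ, V) x y < ρ) :
    ENNReal.ofReal ‖extChartAt 𝓘(ℝ, V) c y - extChartAt 𝓘(ℝ, V) c x‖ ≤
      ENNReal.ofReal l * riemannianEDist 𝓘(ℝ, V) x y := by
  have hC1 := IsManifold.of_le (I := 𝓘(ℝ, V)) (M := M) (m := 1) (n := ∞) (by norm_cast)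
  have key : ∀ r, riemannianEDist 𝓘(ℝ, V) x y < r → r < ρ →
      ENNReal.ofReal ‖extChartAt 𝓘(ℝ, V) c y - extChartAt 𝓘(ℝ, V) c x‖ ≤ ENNReal.ofReal l * r := by
    intro r hr hrρ
    obtain ⟨γ, hγ0, hγ1, hγ, hlen, -⟩ := exists_lt_locally_constant_of_riemannianEDist_lt hr zero_lt_one
    have hγS : ∀ t ∈ Icc (0 : ℝ) 1, γ t ∈ S := fun t ht ↦ hρ _ (lt_of_le_of_lt
      ((riemannianEDist_le_pathELength hγ.contMDiffOn hγ0 rfl ht.1).trans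
        (pathELength_mono le_rfl ht.2)) (hlen.trans hrρ))
    set f := extChartAt 𝓘(ℝ, V) c ∘ γ with hf
    have hfc : ContDiffOn ℝ 1 f (Icc 0 1) := by
      rw [← contMDiffOn_iff_contDiffOn]
      exact (contMDiffOn_extChartAt (n := 1)).comp (t := (chartAt V c).source) hγ.contMDiffOn
        fun t ht ↦ by simpa using hS (hγS t ht)
    have h1 := enorm_sub_le_lintegral_deriv_of_contDiffOn_Icc hfc zero_le_one
    rw [hf, Function.comp_apply, Function.comp_apply, hγ0, hγ1, ← hf, ← ofReal_norm] at h1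
    refine h1.trans ((setLIntegral_mono' measurableSet_Icc
      (g := fun t ↦ ENNReal.ofReal l * ‖mfderiv 𝓘(ℝ, ℝ) 𝓘(ℝ, V) γ t 1‖ₑ) fun t ht ↦ ?_).trans ?_)
    · have hd := hasMFDerivAt_iff_hasFDerivAt.1
        ((mdifferentiableAt_extChartAt (I := 𝓘(ℝ, V)) (x := c) (y := γ t)
          (by simpa using hS (hγS t ht))).hasMFDerivAt.comp t
          ((hγ.mdifferentiable one_ne_zero) t).hasMFDerivAt)
      have hd2 : deriv f t = coord 𝓘(ℝ, V) c (γ t) (mfderiv 𝓘(ℝ, ℝ) 𝓘(ℝ, V) γ t 1) :=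
        congrArg (fun A : ℝ →L[ℝ] V ↦ A 1) (HasFDerivAt.fderiv (E := ℝ) (F := V) hd)
      rw [hd2, enorm_eq_ofReal_sqrt, ← ENNReal.ofReal_mul hl, ← ofReal_norm]
      refine ENNReal.ofReal_le_ofReal ?_
      have h3 := Real.le_sqrt_of_sq_le (h _ (hγS t ht) (mfderiv 𝓘(ℝ, ℝ) 𝓘(ℝ, V) γ t 1))
      rwa [Real.sqrt_mul (sq_nonneg l), Real.sqrt_sq hl] at h3
    · rw [lintegral_const_mul' _ _ ENNReal.ofReal_ne_top, ← pathELength_eq_lintegral_mfderiv_Icc]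
      gcongr
  have hne : (𝓝[>] (riemannianEDist 𝓘(ℝ, V) x y)).NeBot := nhdsGT_neBot_of_exists_gt ⟨ρ, hy⟩
  have hlim : Tendsto (fun r ↦ ENNReal.ofReal l * r) (𝓝[>] (riemannianEDist 𝓘(ℝ, V) x y))
      (𝓝 (ENNReal.ofReal l * riemannianEDist 𝓘(ℝ, V) x y)) :=
    (ENNReal.Tendsto.const_mul tendsto_id (Or.inr ENNReal.ofReal_ne_top)).mono_left
      nhdsWithin_le_nhds
  exact ge_of_tendsto hlim (by
    filter_upwards [self_mem_nhdsWithin, Ioo_mem_nhdsGT hy] with r hr hr' using key r hr hr'.2)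

end Riemannian
end STIMCF
end

noncomputable section
namespace STIMCF
set_option linter.unusedSectionVars false

section Riemannian

variable {V : Type*} [NormedAddCommGroup V] [NormedSpace ℝ V] [FiniteDimensional ℝ V]
  [MeasurableSpace V] [BorelSpace V]
  {M : Type*} [EMetricSpace M] [ChartedSpace V M] [IsManifold 𝓘(ℝ, V) ∞ M]
  [MeasurableSpace M] [BorelSpace M] [SecondCountableTopology M]
  [RiemannianBundle (fun x : M ↦ TangentSpace 𝓘(ℝ, V) x)]
  [IsContMDiffRiemannianBundle 𝓘(ℝ, V) ∞ V (fun x : M ↦ TangentSpace 𝓘(ℝ, V) x)]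

lemma exists_riemannian_bounds (x : M) {U : Set M} (hU : U ∈ 𝓝 x) : ∃ l R : ℝ, 1 ≤ l ∧ 0 < R ∧
    Metric.closedBall (extChartAt 𝓘(ℝ, V) x x) R ⊆ (extChartAt 𝓘(ℝ, V) x).target ∧
    (∀ y ∈ Metric.closedBall (extChartAt 𝓘(ℝ, V) x x) R, (extChartAt 𝓘(ℝ, V) x).symm y ∈ U) ∧
    (∀ y ∈ (extChartAt 𝓘(ℝ, V) x).source,
      extChartAt 𝓘(ℝ, V) x y ∈ Metric.closedBall (extChartAt 𝓘(ℝ, V) x x) R → ∀ v,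
        ‖coord 𝓘(ℝ, V) x y v‖ ^ 2 ≤ l ^ 2 * metricTensor 𝓘(ℝ, V) y v v) ∧
    ∀ a ∈ Metric.closedBall (extChartAt 𝓘(ℝ, V) x x) R,
      ∀ b ∈ Metric.closedBall (extChartAt 𝓘(ℝ, V) x x) R,
      riemannianEDist 𝓘(ℝ, V) ((extChartAt 𝓘(ℝ, V) x).symm a) ((extChartAt 𝓘(ℝ, V) x).symm b) ≤
        ENNReal.ofReal (l * ‖b - a‖) := by
  set φ := extChartAt 𝓘(ℝ, V) x
  obtain ⟨R, hR, hRs⟩ := Metric.nhds_basis_closedBall.mem_iff.1 (inter_mem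
    ((isOpen_extChartAt_target (I := 𝓘(ℝ, V)) x).mem_nhds (mem_extChartAt_target x))
    ((continuousAt_extChartAt_symm (I := 𝓘(ℝ, V)) x).preimage_mem_nhds
      (by rwa [extChartAt_to_inv x])))
  have hRt := hRs.trans inter_subset_left
  have hg : C1Metric (metricTensor 𝓘(ℝ, V) : TensorField 𝓘(ℝ, V) M) := c1Metric_metricTensor
  obtain ⟨l, hl, hb⟩ := hg.exists_bounds x (isCompact_closedBall (φ x) R) hRt
  refine ⟨l, R, hl, hR, hRt, fun y hy ↦ (hRs hy).2, fun y hy hyR v ↦ (hb y hy hyR v).2,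
    fun a ha b hb' ↦ riemannianEDist_chart_symm_le (by linarith)
      (convex_closedBall (φ x) R) hRt (fun y hy q ↦ ?_) ha hb'⟩
  have hyt := hRt hy
  refine (hb _ (φ.map_target hyt) (by rwa [φ.right_inv hyt]) _).1.trans_eq ?_
  rw [coord_coordVec hyt]

variable [IsRiemannianManifold 𝓘(ℝ, V) M]

lemma chartLipschitz_of_locallyLipschitz {u : M → ℝ} (hu : LocallyLipschitz u) :
    ChartLipschitz V u := by
  intro x
  obtain ⟨K, s, hs, hK⟩ := hu x
  obtain ⟨l, R, hl, hR, hRt, hRs, -, hd⟩ := exists_riemannian_bounds (V := V) x hs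
  refine ⟨K * l.toNNReal, R, hR, hRt, fun a ha b hb ↦ ?_⟩
  have ha' := Metric.ball_subset_closedBall ha
  have hb' := Metric.ball_subset_closedBall hb
  refine (hK (hRs a ha') (hRs b hb')).trans ?_
  rw [ENNReal.coe_mul, mul_assoc]
  gcongr
  rw [IsRiemannianManifold.out (I := 𝓘(ℝ, V))]
  refine (hd a ha' b hb').trans_eq ?_
  rw [ENNReal.ofReal_mul (by linarith), edist_comm, edist_dist, dist_eq_norm]
  rfl

variable (V M) in
lemma chartComparable : ChartComparable V M := by
  intro x
  obtain ⟨l, R, hl, hR, hRt, -, hc, hd⟩ := exists_riemannian_bounds (V := V) x univ_mem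
  have := IsManifold.of_le (I := 𝓘(ℝ, V)) (M := M) (m := 1) (n := ∞) (by norm_cast)
  have : IsContinuousRiemannianBundle V (fun x : M ↦ TangentSpace 𝓘(ℝ, V) x) := by
    obtain ⟨b, hb, h⟩ := IsContMDiffRiemannianBundle.exists_contMDiff (IB := 𝓘(ℝ, V)) (n := ∞)
      (F := V) (E := fun x : M ↦ TangentSpace 𝓘(ℝ, V) x)
    exact ⟨b, hb.continuous, h⟩
  set φ := extChartAt 𝓘(ℝ, V) x
  have hS : φ.source ∩ φ ⁻¹' Metric.closedBall (φ x) R ∈ 𝓝 x :=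
    inter_mem (extChartAt_source_mem_nhds x)
      ((continuousAt_extChartAt x).preimage_mem_nhds (Metric.closedBall_mem_nhds _ hR))
  obtain ⟨ρ, hρ, hρS⟩ := setOfPred_riemannianEDist_lt_subset_nhds 𝓘(ℝ, V) hS
  refine ⟨l, by linarith, ?_⟩
  filter_upwards [hS, Metric.eball_mem_nhds x (show (0 : ℝ≥0∞) < ρ by exact_mod_cast hρ)]
    with y hy hyρ
  rw [Metric.mem_eball'] at hyρ
  rw [IsRiemannianManifold.out (I := 𝓘(ℝ, V))] at hyρ ⊢
  constructor
  · have h1 := hd _ (Metric.mem_closedBall_self hR.le) _ hy.2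
    rwa [φ.left_inv hy.1, φ.left_inv (mem_extChartAt_source x)] at h1
  · exact norm_chart_sub_le (by linarith) inter_subset_left (fun z hz v ↦ hc z hz.1 hz.2 v)
      (fun z hz ↦ hρS hz) hyρ

end Riemannian

section Bounds

variable {V : Type*} [NormedAddCommGroup V] [NormedSpace ℝ V] [FiniteDimensional ℝ V]
  [MeasurableSpace V] [BorelSpace V]
  {M : Type*} [TopologicalSpace M] [ChartedSpace V M] [IsManifold 𝓘(ℝ, V) ∞ M]
  [MeasurableSpace M] [BorelSpace M] [T2Space M] [SecondCountableTopology M]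
  {g k : TensorField 𝓘(ℝ, V) M} {B : M → LinearMap.BilinForm ℝ V}

lemma trace_eq_chart (hg : C1Metric g) (hB : ∀ (x : M) (v w : V), k x v w = B x v w) {c x : M}
    (hx : x ∈ (extChartAt 𝓘(ℝ, V) c).source) :
    trace 𝓘(ℝ, V) g k x = ∑ i, ∑ j,
      (LinearMap.BilinForm.toMatrix (Module.finBasis ℝ V)
        (gramForm hg c (extChartAt 𝓘(ℝ, V) c x)))⁻¹ i j *
      k ((extChartAt 𝓘(ℝ, V) c).symm (extChartAt 𝓘(ℝ, V) c x))
        (coordVec 𝓘(ℝ, V) c (extChartAt 𝓘(ℝ, V) c x) (Module.finBasis ℝ V i))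
        (coordVec 𝓘(ℝ, V) c (extChartAt 𝓘(ℝ, V) c x) (Module.finBasis ℝ V j)) := by
  set b := Module.finBasis ℝ V
  set y := extChartAt 𝓘(ℝ, V) c x
  let e : V ≃ₗ[ℝ] V :=
    { toFun := fun v ↦ (coordVec 𝓘(ℝ, V) c y v : V)
      map_add' := coordVec_add c y
      map_smul' := coordVec_smul c y
      invFun := fun v ↦ coord 𝓘(ℝ, V) c x v
      left_inv := fun v ↦ coord_coordVec' hx v
      right_inv := fun v ↦ coordVec_coord hx v }
  rw [trace_eq_formTrace g k x (G := hg.form x) (fun _ _ ↦ rfl) (hB x),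
    formTrace_basis (b.map e) b]
  have hl := (extChartAt 𝓘(ℝ, V) c).left_inv hx
  have h1 : LinearMap.BilinForm.toMatrix (b.map e) (hg.form x) =
      LinearMap.BilinForm.toMatrix b (gramForm hg c y) := by
    ext i j
    rw [LinearMap.BilinForm.toMatrix_apply, LinearMap.BilinForm.toMatrix_apply, gramForm_apply, hl]
    rfl
  unfold formTrace
  rw [h1]
  refine Finset.sum_congr rfl fun i _ ↦ Finset.sum_congr rfl fun j _ ↦ ?_
  rw [← hB, hl]
  rfl

lemma exists_trace_le (hg : C1Metric g) (hB : ∀ (x : M) (v w : V), k x v w = B x v w)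
    (hk : ∀ c v w, ContinuousOn (fun y ↦ k ((extChartAt 𝓘(ℝ, V) c).symm y)
      (coordVec 𝓘(ℝ, V) c y v) (coordVec 𝓘(ℝ, V) c y w)) (extChartAt 𝓘(ℝ, V) c).target) (x : M) :
    ∃ C : ℝ, ∀ᶠ z in 𝓝 x, |trace 𝓘(ℝ, V) g k z| ≤ C := by
  set b := Module.finBasis ℝ V
  set φ := extChartAt 𝓘(ℝ, V) x
  set τ : V → ℝ := fun y ↦ ∑ i, ∑ j, (LinearMap.BilinForm.toMatrix b (gramForm hg x y))⁻¹ i j *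
    k (φ.symm y) (coordVec 𝓘(ℝ, V) x y (b i)) (coordVec 𝓘(ℝ, V) x y (b j))
  have hτ : ContinuousOn τ φ.target := by
    refine continuousOn_finsetSum _ fun i _ ↦ continuousOn_finsetSum _ fun j _ ↦
      ContinuousOn.mul ?_ (hk x _ _)
    have hm : ContinuousOn (fun y ↦ LinearMap.BilinForm.toMatrix b (gramForm hg x y)) φ.target := by
      refine continuousOn_pi.2 fun i ↦ continuousOn_pi.2 fun j ↦ ?_
      simp only [LinearMap.BilinForm.toMatrix_apply, gramForm_apply]
      exact (hg.contDiffOn x (b i) (b j)).continuousOn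
    have hi : ContinuousOn (fun y ↦ (LinearMap.BilinForm.toMatrix b (gramForm hg x y))⁻¹) φ.target := by
      simp only [Matrix.inv_def, Ring.inverse_eq_inv']
      refine ContinuousOn.smul (ContinuousOn.inv₀ (Continuous.comp_continuousOn
        (continuous_id.matrix_det) hm) fun y hy ↦ (det_gramForm_pos hg hy _).ne') ?_
      exact (continuous_id.matrix_adjugate).comp_continuousOn hm
    exact (continuous_apply_apply i j).comp_continuousOn hi
  have hx := mem_extChartAt_source (I := 𝓘(ℝ, V)) x
  have hc : ContinuousAt (fun z ↦ |τ (φ z)|) x := by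
    refine ContinuousAt.abs (ContinuousAt.comp (g := τ) (f := φ) ?_ (continuousAt_extChartAt x))
    exact hτ.continuousAt ((isOpen_extChartAt_target (I := 𝓘(ℝ, V)) x).mem_nhds (φ.map_source hx))
  refine ⟨|τ (φ x)| + 1, ?_⟩
  filter_upwards [hc.eventually (gt_mem_nhds (lt_add_one _)), extChartAt_source_mem_nhds (I := 𝓘(ℝ, V)) x]
    with z hz hzs
  rw [trace_eq_chart hg hB hzs]
  exact hz.le

lemma exists_quadratic_le (hg : C1Metric g) (hB : ∀ (x : M) (v w : V), k x v w = B x v w)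
    (hk : ∀ c v w, ContinuousOn (fun y ↦ k ((extChartAt 𝓘(ℝ, V) c).symm y)
      (coordVec 𝓘(ℝ, V) c y v) (coordVec 𝓘(ℝ, V) c y w)) (extChartAt 𝓘(ℝ, V) c).target) (x : M) :
    ∃ C : ℝ, ∀ᶠ z in 𝓝 x, ∀ v : TangentSpace 𝓘(ℝ, V) z, g z v v ≤ 1 → |k z v v| ≤ C := by
  set b := Module.finBasis ℝ V
  set φ := extChartAt 𝓘(ℝ, V) x
  set κ : V × V → ℝ := fun p ↦ ∑ i, ∑ j, b.coord i p.2 * (b.coord j p.2 *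
    k (φ.symm p.1) (coordVec 𝓘(ℝ, V) x p.1 (b i)) (coordVec 𝓘(ℝ, V) x p.1 (b j)))
  have hc : ∀ i, Continuous fun p : V × V ↦ b.coord i p.2 := fun i ↦
    (LinearMap.continuous_of_finiteDimensional (b.coord i)).comp continuous_snd
  have hκ : ContinuousOn κ (φ.target ×ˢ univ) :=
    continuousOn_finsetSum _ fun i _ ↦ continuousOn_finsetSum _ fun j _ ↦
      (hc i).continuousOn.mul ((hc j).continuousOn.mul
        ((hk x (b i) (b j)).comp continuousOn_fst fun p hp ↦ hp.1))
  obtain ⟨R, hR, hRt⟩ := Metric.nhds_basis_closedBall.mem_iff.1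
    ((isOpen_extChartAt_target (I := 𝓘(ℝ, V)) x).mem_nhds (mem_extChartAt_target x))
  obtain ⟨l, hl, hb⟩ := hg.exists_bounds x (isCompact_closedBall (φ x) R) hRt
  obtain ⟨C, hC⟩ := ((isCompact_closedBall (φ x) R).prod
    (isCompact_closedBall (0 : V) l)).exists_bound_of_continuousOn
      (hκ.mono (prod_mono hRt (subset_univ _)))
  refine ⟨C, ?_⟩
  filter_upwards [extChartAt_source_mem_nhds (I := 𝓘(ℝ, V)) x,
    (continuousAt_extChartAt (I := 𝓘(ℝ, V)) x).preimage_mem_nhds (Metric.closedBall_mem_nhds _ hR)]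
    with z hz hzR v hv
  have hn : ‖coord 𝓘(ℝ, V) x z v‖ ≤ l := by
    refine le_of_sq_le_sq ?_ (by linarith)
    nlinarith [(hb z hz hzR v).2, sq_nonneg l]
  have h1 := hC (φ z, coord 𝓘(ℝ, V) x z v) ⟨hzR, by simpa using hn⟩
  refine (le_of_eq ?_).trans h1
  rw [Real.norm_eq_abs]
  congr 1
  set q := coord 𝓘(ℝ, V) x z v
  set A : LinearMap.BilinForm ℝ V := LinearMap.mk₂ ℝ
    (fun p q ↦ B (φ.symm (φ z)) (coordVec 𝓘(ℝ, V) x (φ z) p : V) (coordVec 𝓘(ℝ, V) x (φ z) q : V))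
    (fun p p' q ↦ by rw [coordVec_add]; exact LinearMap.BilinForm.add_left _ _ _)
    (fun a p q ↦ by rw [coordVec_smul]; exact LinearMap.BilinForm.smul_left _ _ _)
    (fun p q q' ↦ by rw [coordVec_add]; exact LinearMap.BilinForm.add_right _ _ _)
    (fun a p q ↦ by rw [coordVec_smul]; exact LinearMap.BilinForm.smul_right _ _ _)
  have h2 := LinearMap.BilinForm.sum_repr_mul_repr_mul b (B := A) q q
  have h3 : A q q = k z v v := by
    have e1 : (coordVec 𝓘(ℝ, V) x (φ z) q : V) = v := coordVec_coord hz v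
    have e2 : φ.symm (φ z) = z := φ.left_inv hz
    rw [hB z v v]
    change B (φ.symm (φ z)) (coordVec 𝓘(ℝ, V) x (φ z) q : V) (coordVec 𝓘(ℝ, V) x (φ z) q : V) = _
    rw [e2]
    exact congrArg₂ (fun p q : V ↦ B z p q) e1 e1
  rw [← h3, ← h2, Finsupp.sum_fintype _ _ (by simp)]
  refine Finset.sum_congr rfl fun i _ ↦ ?_
  rw [Finsupp.sum_fintype _ _ (by simp)]
  refine Finset.sum_congr rfl fun j _ ↦ ?_
  have h4 : A (b i) (b j) = k (φ.symm (φ z)) (coordVec 𝓘(ℝ, V) x (φ z) (b i))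
    (coordVec 𝓘(ℝ, V) x (φ z) (b j)) := (hB _ _ _).symm
  rw [← h4]
  rfl

end Bounds
end STIMCF
end

noncomputable section
namespace STIMCF
set_option linter.unusedSectionVars false

section Bounds

variable {V : Type*} [NormedAddCommGroup V] [NormedSpace ℝ V] [FiniteDimensional ℝ V]
  [MeasurableSpace V] [BorelSpace V]
  {M : Type*} [TopologicalSpace M] [ChartedSpace V M] [IsManifold 𝓘(ℝ, V) ∞ M]
  [MeasurableSpace M] [BorelSpace M] [T2Space M] [SecondCountableTopology M]
  {g k : TensorField 𝓘(ℝ, V) M} {B : M → LinearMap.BilinForm ℝ V}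

lemma contDiffOn_clm_coordVec
    {K : ∀ x : M, TangentSpace 𝓘(ℝ, V) x →L[ℝ] TangentSpace 𝓘(ℝ, V) x →L[ℝ] ℝ}
    (hK : ContMDiff 𝓘(ℝ, V) (𝓘(ℝ, V).prod 𝓘(ℝ, V →L[ℝ] V →L[ℝ] ℝ)) 1
      (fun x ↦ TotalSpace.mk' (V →L[ℝ] V →L[ℝ] ℝ) x (K x))) (c : M) (v w : V) :
    ContDiffOn ℝ 1 (fun y ↦ K ((extChartAt 𝓘(ℝ, V) c).symm y)
      (coordVec 𝓘(ℝ, V) c y v) (coordVec 𝓘(ℝ, V) c y w)) (extChartAt 𝓘(ℝ, V) c).target := by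
  refine contDiffOn_tensor_coordVec (k := fun x v w ↦ K x v w) (fun c x v w hx ↦ ?_) c v w
  have := isManifold_two (V := V) (M := M)
  have h := ContMDiffAt.clm_bundle_apply₂ (F₁ := V) (F₂ := V) (F₃ := ℝ)
    (E₁ := fun x : M ↦ TangentSpace 𝓘(ℝ, V) x) (E₂ := fun x : M ↦ TangentSpace 𝓘(ℝ, V) x)
    (E₃ := Bundle.Trivial M ℝ) (b := fun x : M ↦ x) (ψ := K) (hK x) (contMDiffAt_coordField hx v)
    (contMDiffAt_coordField hx w)
  simp only [contMDiffAt_totalSpace] at h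
  exact h.2

lemma exists_energy_le (hg : C1Metric g) (hB : ∀ (x : M) (v w : V), k x v w = B x v w)
    (hk : ∀ c v w, ContinuousOn (fun y ↦ k ((extChartAt 𝓘(ℝ, V) c).symm y)
      (coordVec 𝓘(ℝ, V) c y v) (coordVec 𝓘(ℝ, V) c y w)) (extChartAt 𝓘(ℝ, V) c).target)
    {u : M → ℝ} (hu : ChartLipschitz V u) {ν : ∀ x : M, TangentSpace 𝓘(ℝ, V) x} {S A : Set M}
    (hν : ∀ x ∈ S, g x (ν x) (ν x) ≤ 1) (hA : IsCompact A) (hAS : A ⊆ S) :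
    ∃ C : ℝ≥0, ∀ x ∈ A, ENNReal.ofReal
      √(gradNorm 𝓘(ℝ, V) g u x ^ 2 + expansion 𝓘(ℝ, V) g k ν x ^ 2) ≤ C := by
  refine hA.induction_on (p := fun T ↦ ∃ C : ℝ≥0, ∀ x ∈ T, ENNReal.ofReal
      √(gradNorm 𝓘(ℝ, V) g u x ^ 2 + expansion 𝓘(ℝ, V) g k ν x ^ 2) ≤ C) ⟨0, by simp⟩ ?_ ?_ ?_
  · rintro s t hst ⟨C, hC⟩
    exact ⟨C, fun x hx ↦ hC x (hst hx)⟩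
  · rintro s t ⟨C, hC⟩ ⟨D, hD⟩
    refine ⟨max C D, fun x hx ↦ ?_⟩
    rcases hx with hx | hx
    · exact (hC x hx).trans (by exact_mod_cast le_max_left C D)
    · exact (hD x hx).trans (by exact_mod_cast le_max_right C D)
  · intro x _
    obtain ⟨C₁, h1⟩ := hu.eventually_gradNorm_le hg x
    obtain ⟨C₂, h2⟩ := exists_trace_le hg hB hk x
    obtain ⟨C₃, h3⟩ := exists_quadratic_le hg hB hk x
    refine ⟨_, inter_mem_nhdsWithin A (h1.and (h2.and h3)),
      (√(C₁ ^ 2 + (C₂ + C₃) ^ 2)).toNNReal, fun y hy ↦ ?_⟩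
    obtain ⟨hyA, hy1, hy2, hy3⟩ := hy
    refine ENNReal.ofReal_le_ofReal (Real.sqrt_le_sqrt (add_le_add ?_ ?_))
    · exact pow_le_pow_left₀ (gradNorm_nonneg u hg y) hy1 2
    · refine sq_le_sq' ?_ ?_
      all_goals
        have h4 := abs_le.1 hy2
        have h5 := abs_le.1 (hy3 (ν y) (hν y (hAS hyA)))
        unfold expansion
        linarith [h4.1, h4.2, h5.1, h5.2]

end Bounds
end STIMCF
end

noncomputable section
namespace STIMCF
set_option linter.unusedSectionVars false

section WeakSolution

variable {V : Type*} [NormedAddCommGroup V] [InnerProductSpace ℝ V] [FiniteDimensional ℝ V]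
  [MeasurableSpace V] [BorelSpace V]
  {M : Type*} [EMetricSpace M] [SecondCountableTopology M] [ChartedSpace V M]
  [IsManifold 𝓘(ℝ, V) ∞ M]
  [RiemannianBundle (fun x : M ↦ TangentSpace 𝓘(ℝ, V) x)]
  [IsContMDiffRiemannianBundle 𝓘(ℝ, V) ∞ V (fun x : M ↦ TangentSpace 𝓘(ℝ, V) x)]
  [IsRiemannianManifold 𝓘(ℝ, V) M] [MeasurableSpace M] [BorelSpace M]
  {K : ∀ x : M, TangentSpace 𝓘(ℝ, V) x →L[ℝ] TangentSpace 𝓘(ℝ, V) x →L[ℝ] ℝ}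
  {E₀ : Set M} {U : M × ℝ → ℝ} {ν : ∀ X : M × ℝ, TangentSpace (𝓘(ℝ, V).prod 𝓘(ℝ, ℝ)) X}

lemma IsWeakSolution.locallyLipschitz_slice
    (hU : IsWeakSolution 𝓘(ℝ, V) (fun x v w ↦ K x v w) E₀ U ν) : LocallyLipschitz (slice U) :=
  hU.locallyLipschitz.comp (LipschitzWith.of_edist_le
    (fun x y ↦ by simp [Prod.edist_eq]) : LipschitzWith 1 fun y : M ↦ (y, (0 : ℝ))).locallyLipschitz

/-- The slices of a weak solution minimize the energy on the base manifold. -/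
theorem IsWeakSolution.levelSetFlow
    (hK : ContMDiff 𝓘(ℝ, V) (𝓘(ℝ, V).prod 𝓘(ℝ, V →L[ℝ] V →L[ℝ] ℝ)) 1
      (fun x ↦ TotalSpace.mk' (V →L[ℝ] V →L[ℝ] ℝ) x (K x)))
    (hU : IsWeakSolution 𝓘(ℝ, V) (fun x v w ↦ K x v w) E₀ U ν)
    (hpre : ∀ t : ℝ, 0 < t → IsCompact (closure {x | slice U x < t})) :
    LevelSetFlow (metricTensor 𝓘(ℝ, V))
      (fun x : M ↦ ENNReal.ofReal √(gradNorm 𝓘(ℝ, V) (metricTensor 𝓘(ℝ, V)) (slice U) x ^ 2 +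
        expansion 𝓘(ℝ, V) (metricTensor 𝓘(ℝ, V)) (fun x v w ↦ K x v w)
          (projField 𝓘(ℝ, V) ν) x ^ 2))
      (fun x ↦ ENNReal.ofReal |expansion 𝓘(ℝ, V) (metricTensor 𝓘(ℝ, V)) (fun x v w ↦ K x v w)
        (projField 𝓘(ℝ, V) ν) x|) E₀ (slice U) := by
  have hg := c1Metric_metricTensor (V := V) (M := M)
  have hlip := hU.locallyLipschitz_slice
  have hinv : ∀ X : M × ℝ, U X = slice U X.1 := fun X ↦ hU.invariant X.1 X.2
  have hmin : ∀ t : ℝ, 0 < t → Minimizes 𝓘(ℝ, V) (metricTensor 𝓘(ℝ, V)) (fun x v w ↦ K x v w)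
      (slice U) (projField 𝓘(ℝ, V) ν) E₀ᶜ {x | slice U x < t} := fun t ht ↦ by
    have hset : {X : M × ℝ | U X < t} = {x | slice U x < t} ×ˢ univ := by
      ext X
      simp [hinv X]
    refine minimizes_of_cylinder hg (fun x ↦ ⟨LinearMap.mk₂ ℝ (fun v w : V ↦ K x v w)
      (fun a b c ↦ ?_) (fun r a b ↦ ?_) (fun a b c ↦ ?_) (fun r a b ↦ ?_), fun _ _ ↦ rfl⟩) hinv
      (fun X hX ↦ ?_) (isOpen_lt hlip.continuous continuous_const).measurableSet
      (hset ▸ hU.minimizes t ht)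
    · exact congrArg (fun T : TangentSpace 𝓘(ℝ, V) x →L[ℝ] ℝ ↦ T c) ((K x).map_add a b)
    · exact congrArg (fun T : TangentSpace 𝓘(ℝ, V) x →L[ℝ] ℝ ↦ T b) ((K x).map_smul r a)
    · exact (K x a).map_add b c
    · exact (K x a).map_smul r b
    · have h : ∀ a : ℝ, a = X.2 → (ν (X.1, a) : V × ℝ) = (ν (X.1, 0) : V × ℝ) →
        (ν X : V × ℝ) = (ν (X.1, 0) : V × ℝ) := by
        rintro a rfl h
        exact h
      exact h _ (zero_add X.2) (hU.field_invariant X.1 0 X.2 hX)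
  refine ⟨hg, hlip.continuous, fun x ↦ ⟨fun h ↦ ?_, hU.neg x⟩, hpre, fun x ↦ ?_, fun A hA hAE ↦ ?_,
    fun t _ ↦ ?_, fun t ht A hA hAE ↦ (hmin t ht).1.2 A hA hAE,
    fun t ht F A hF hA hAE hFA ↦ (hmin t ht).2 F A hF hA hAE hFA⟩
  · by_contra h0
    exact absurd (hU.nonneg x h0) (not_le.2 h)
  · exact ENNReal.ofReal_le_ofReal (Real.abs_le_sqrt (le_add_of_nonneg_left (sq_nonneg _)))
  · refine exists_energy_le hg (B := fun x ↦ LinearMap.mk₂ ℝ (fun v w : V ↦ K x v w)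
      (fun a b c ↦ ?_) (fun r a b ↦ ?_) (fun a b c ↦ ?_) (fun r a b ↦ ?_)) (fun _ _ _ ↦ rfl)
      (fun c v w ↦ (contDiffOn_clm_coordVec hK c v w).continuousOn)
      (chartLipschitz_of_locallyLipschitz hlip) (fun x hx ↦ ?_) hA hAE
    · exact congrArg (fun T : TangentSpace 𝓘(ℝ, V) x →L[ℝ] ℝ ↦ T c) ((K x).map_add a b)
    · exact congrArg (fun T : TangentSpace 𝓘(ℝ, V) x →L[ℝ] ℝ ↦ T b) ((K x).map_smul r a)
    · exact (K x a).map_add b c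
    · exact (K x a).map_smul r b
    · have h1 := hU.unit (x, 0) ⟨hx, mem_univ _⟩
      exact (le_add_of_nonneg_right (mul_self_nonneg _)).trans_eq h1
  · filter_upwards [ae_gradNorm_eq_zero hg hlip.continuous t] with x hx hxt
    simp [hx hxt, Real.sqrt_sq_eq_abs]

end WeakSolution

end STIMCF
end

theorem theorem8p1 (n : ℕ) (hn : 2 ≤ n)
    {M : Type*} [EMetricSpace M] [SecondCountableTopology M]
    [ChartedSpace (EuclideanSpace ℝ (Fin (n + 1))) M] [IsManifold (𝓡 (n + 1)) ∞ M]
    [RiemannianBundle (fun x : M ↦ TangentSpace (𝓡 (n + 1)) x)]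
    [IsContMDiffRiemannianBundle (𝓡 (n + 1)) ∞ (EuclideanSpace ℝ (Fin (n + 1)))
      (fun x : M ↦ TangentSpace (𝓡 (n + 1)) x)]
    [IsRiemannianManifold (𝓡 (n + 1)) M]
    [MeasurableSpace M] [BorelSpace M]
    (K : ∀ x : M, TangentSpace (𝓡 (n + 1)) x →L[ℝ] TangentSpace (𝓡 (n + 1)) x →L[ℝ] ℝ)
    (hK_smooth : ContMDiff (𝓡 (n + 1))
      ((𝓡 (n + 1)).prod 𝓘(ℝ, EuclideanSpace ℝ (Fin (n + 1)) →L[ℝ]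
        EuclideanSpace ℝ (Fin (n + 1)) →L[ℝ] ℝ)) 1
      (fun x ↦ TotalSpace.mk' (EuclideanSpace ℝ (Fin (n + 1)) →L[ℝ]
        EuclideanSpace ℝ (Fin (n + 1)) →L[ℝ] ℝ) x (K x)))
    (hK_symm : ∀ (x : M) (v w : TangentSpace (𝓡 (n + 1)) x), K x v w = K x w v)
    (hM : ∀ x : M, ¬ IsCompact (connectedComponent x))
    (E₀ : Set M) (U : M × ℝ → ℝ)
    (ν : ∀ X : M × ℝ, TangentSpace ((𝓡 (n + 1)).prod 𝓘(ℝ, ℝ)) X)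
    (hU : STIMCF.IsWeakSolution (𝓡 (n + 1)) (fun x v w ↦ K x v w) E₀ U ν)
    (u : M → ℝ) (hu : u = STIMCF.slice U)
    (νM : ∀ x : M, TangentSpace (𝓡 (n + 1)) x) (hνM : νM = STIMCF.projField (𝓡 (n + 1)) ν)
    (g : STIMCF.TensorField (𝓡 (n + 1)) M) (hg : g = STIMCF.metricTensor (𝓡 (n + 1)))
    (k : STIMCF.TensorField (𝓡 (n + 1)) M) (hk : k = fun x v w ↦ K x v w)
    (hpre : ∀ t : ℝ, 0 < t → IsCompact (closure {x | u x < t})) :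
    (∀ t : ℝ, 0 < t → STIMCF.OutwardOptimizing (𝓡 (n + 1)) g k νM univ {x | u x < t}) ∧
    (∀ t : ℝ, 0 ≤ t → STIMCF.OutwardOptimizing (𝓡 (n + 1)) g k νM univ {x | u x ≤ t}) ∧
    (∀ t : ℝ, 0 ≤ t → ∀ Ω : Set M, IsOpen Ω → {x | u x ≤ t} ⊆ Ω →
      (∀ t' : ℝ, t < t' → Disjoint Ω (STIMCF.jumpRegion u t')) →
        STIMCF.StrictlyOutwardOptimizing (𝓡 (n + 1)) g k νM Ω {x | u x ≤ t} ∧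
        STIMCF.hull (𝓡 (n + 1)) g k νM Ω {x | u x < t}
          =ᵐ[STIMCF.vol (𝓡 (n + 1)) g] {x | u x ≤ t}) ∧
    (∀ t : ℝ, 0 ≤ t → STIMCF.perimeter (𝓡 (n + 1)) g {x | u x ≤ t} univ < ⊤) ∧
    (∀ t : ℝ, 0 < t → STIMCF.perimeter (𝓡 (n + 1)) g {x | u x ≤ t} univ =
      STIMCF.perimeter (𝓡 (n + 1)) g {x | u x < t} univ +
        STIMCF.bulkP (𝓡 (n + 1)) g k νM ({x | u x ≤ t} \ {x | u x < t})) ∧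
    (STIMCF.OutwardOptimizing (𝓡 (n + 1)) g k νM univ E₀ ↔
      STIMCF.perimeter (𝓡 (n + 1)) g {x | u x ≤ 0} univ =
        STIMCF.perimeter (𝓡 (n + 1)) g E₀ univ +
          STIMCF.bulkP (𝓡 (n + 1)) g k νM ({x | u x ≤ 0} \ E₀)) := by
  subst hu hνM hg hk
  have h := hU.levelSetFlow hK_smooth hpre
  have hstrict : ∀ t : ℝ, 0 ≤ t → ∀ Ω : Set M, (∀ t' : ℝ, t < t' →
      Disjoint Ω (STIMCF.jumpRegion (STIMCF.slice U) t')) → STIMCF.StrictlyOutwardOptimizing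
        (𝓡 (n + 1)) (STIMCF.metricTensor (𝓡 (n + 1))) (fun x v w ↦ K x v w)
        (STIMCF.projField (𝓡 (n + 1)) ν) Ω {x | STIMCF.slice U x ≤ t} := fun t ht Ω hΩ ↦
    h.strictlyOutwardOptimizing_le (by rw [finrank_euclideanSpace_fin]; omega)
      (fun W hW _ hfin hle x hx ↦ (STIMCF.chartLipschitz_of_locallyLipschitz
        hU.locallyLipschitz_slice).mem_interior_level h.metric hW hfin hle hx) ht hΩ
  refine ⟨fun t ht ↦ h.outwardOptimizing_lt ht, fun t ht ↦ h.outwardOptimizing_le ht univ,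
    fun t ht Ω hΩ hsub hdisj ↦ ⟨hstrict t ht Ω hdisj, h.hull_lt_ae_eq ht hΩ hsub
      (hstrict t ht Ω hdisj) ((STIMCF.chartComparable _ M).vol_sdiff_lebesguePoints h.metric
        (h.isClosed_le t).measurableSet)⟩,
    fun t ht ↦ h.perimeter_le_lt_top ht univ, fun t ht ↦ h.perimeter_le_eq ht,
    h.outwardOptimizing_iff⟩
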